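/- For $f:\mathbb R\to\mathbb C$ write $f\in H^{1,1}(\mathbb R)$ if $f,\ xf(x),\ f'\in L^2(\mathbb R)$, where $f'$ is the weak derivative and $f$ denotes its continuous representative. Let $n\ge 0$, let $\rho_1,\rho_2\in H^{1,1}(\mathbb R)$, let $z_1,\dots,z_n$ be distinct points of the open upper half plane $\mathbb C^+$, and let $\mathbf C_i=(C_{i,1},C_{i,2})^T\in\mathbb C^2$ for $1\le i\le n$. Let $\gamma_i$ be the circle of radius $r_i>0$ around $z_i$, the closed discs bounded by the $\gamma_i$ being contained in $\mathbb C^+$ and pairwise disjoint, let $\gamma_i^*$ be the complex conjugate circle around $\bar z_i$, and let $\Gamma=\mathbb R\cup\bigcup_i(\gamma_i\cup\gamma_i^*)$, with $\mathbb R$ oriented from left to right, $\gamma_i$ clockwise and $\gamma_i^*$ counterclockwise; the $+$ side is on the left (above $\mathbb R$, outside $\gamma_i$, inside $\gamma_i^*$). Let $\sigma=\operatorname{diag}(-1,1,1)$ and, on $\Gamma$, $$V(\lambda)=\begin{pmatrix}1+|\rho_1(\lambda)|^2+|\rho_2(\lambda)|^2&\overline{\rho_1(\lambda)}&\overline{\rho_2(\lambda)}\\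 \rho_1(\lambda)&1&0\\ \rho_2(\lambda)&0&1\end{pmatrix}\ (\lambda\in\mathbb R),$$ $$V(\lambda)=\begin{pmatrix}1&0&0\\ \frac{C_{i,1}}{\lambda-z_i}&1&0\\ \frac{C_{i,2}}{\lambda-z_i}&0&1\end{pmatrix}\ (\lambda\in\gamma_i),\qquad V(\lambda)=\begin{pmatrix}1&\frac{\overline{C_{i,1}}}{\lambda-\bar z_i}&\frac{\overline{C_{i,2}}}{\lambda-\bar z_i}\\ 0&1&0\\ 0&0&1\end{pmatrix}\ (\lambda\in\gamma_i^*).$$ For $x\in\mathbb R$ consider the Riemann–Hilbert problem of finding a $3\times3$ matrix function $M(x,\cdot)$, analytic on $\mathbb C\setminus\Gamma$, such that 1. $M(x,z)\to I$ as $z\to\infty$ in $\mathbb C\setminus\Gamma$, and $M(x,z)=I+O(z^{-1})$ as $z\to\infty$ in every cone $\{c\,|\operatorname{Re}z|\le|\operatorname{Im}z|\}$, $c>0$; 2. $M(x,\cdot)$ has continuous boundary values $M_\pm(x,\lambda)$ from the $\pm$ sides at every $\lambda\in\Gamma$, and $M_+(x,\lambda)=M_-(x,\lambda)\,e^{i\lambda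 x\sigma}V(\lambda)e^{-i\lambda x\sigma}$. Then this problem has a solution for every $x\in\mathbb R$; for every solution $M(x,\cdot)$ the limits $$u(x)=-2i\lim_{z\to\infty}zM(x,z)_{21},\qquad v(x)=-2i\lim_{z\to\infty}zM(x,z)_{31}$$ exist as $z\to\infty$ in each of the above cones, and they do not depend on the solution or on the cone; and the functions $u,v$ so defined on $\mathbb R$ belong to $H^{1,1}(\mathbb R)$. -/

import Mathlib

noncomputable section

namespace AKNS

open Filter Topology MeasureTheory Bornology Complex
open scoped ComplexConjugate

/-- The weighted Sobolev space of functions `f` on the line with `f'` and `x f` in `L²`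
(and `f` in `L²`). As functions are used pointwise below, membership refers to the locally absolutely
continuous representative: `g` is the (weak) derivative of `f`, and it lies in `L²`. -/
def MemH11 (f : ℝ → ℂ) : Prop :=
  MemLp f 2 volume ∧ MemLp (fun x : ℝ => (x : ℂ) * f x) 2 volume ∧
    ∃ g : ℝ → ℂ, MemLp g 2 volume ∧ ∀ a b : ℝ, f b - f a = ∫ t in a..b, g t

/-- Complex `3 × 3` matrices. -/
abbrev Mat3 : Type := Matrix (Fin 3) (Fin 3) ℂ

/-- The diagonal of `σ = diag(-1, 1, 1)`. -/
def sigma : Fin 3 → ℂ := ![-1, 1, 1]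

/-- `e^{i s x ad σ} B = e^{i s x σ} B e^{-i s x σ}`, written entry by entry. -/
def phaseConj (x : ℝ) (s : ℂ) (B : Mat3) : Mat3 :=
  Matrix.of fun j k => Complex.exp (I * s * (x : ℂ) * (sigma j - sigma k)) * B j k

/-- The jump matrix on the real line (focusing case, `ε = 1`). -/
def jumpReal (ρ₁ ρ₂ : ℝ → ℂ) (s : ℝ) : Mat3 :=
  !![1 + ((‖ρ₁ s‖ ^ 2 : ℝ) : ℂ) + ((‖ρ₂ s‖ ^ 2 : ℝ) : ℂ), conj (ρ₁ s), conj (ρ₂ s);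
     ρ₁ s, 1, 0;
     ρ₂ s, 0, 1]

/-- The jump matrix on the circle around an eigenvalue `w` in the upper half plane. -/
def jumpUpper (w : ℂ) (c : ℂ × ℂ) (s : ℂ) : Mat3 :=
  !![1, 0, 0;
     c.1 / (s - w), 1, 0;
     c.2 / (s - w), 0, 1]

/-- The jump matrix on the circle around the conjugate of an eigenvalue `w`. -/
def jumpLower (w : ℂ) (c : ℂ × ℂ) (s : ℂ) : Mat3 :=
  !![1, conj c.1 / (s - conj w), conj c.2 / (s - conj w);
     0, 1, 0;
     0, 0, 1]

/-- The radii are positive and small: the closed discs around the eigenvalues lie in the open upper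
half plane and are pairwise disjoint. -/
def AdmissibleRadii {n : ℕ} (z : Fin n → ℂ) (r : Fin n → ℝ) : Prop :=
  (∀ i, 0 < r i) ∧ (∀ i, r i < (z i).im) ∧ ∀ i j, i ≠ j → r i + r j < dist (z i) (z j)

/-- The real line together with the circles around the eigenvalues and around their conjugates. -/
def contour {n : ℕ} (z : Fin n → ℂ) (r : Fin n → ℝ) : Set ℂ :=
  {s : ℂ | s.im = 0} ∪ ⋃ i, (Metric.sphere (z i) (r i) ∪ Metric.sphere (conj (z i)) (r i))

/-- At the contour point `s`, with plus side `P` and minus side `N`, the matrix function `M` has the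
boundary values `Mp s` and `Mm s`, related by `Mp = Mm e^{i s x ad σ} V`. -/
def JumpAt (x : ℝ) (M Mp Mm : ℂ → Mat3) (s : ℂ) (P N : Set ℂ) (V : Mat3) : Prop :=
  Tendsto M (𝓝[P] s) (𝓝 (Mp s)) ∧ Tendsto M (𝓝[N] s) (𝓝 (Mm s)) ∧
    Mp s = Mm s * phaseConj x s V

/-- The non-tangential approach to infinity in the double cone `c |Re z| ≤ |Im z|`. -/
def coneAtInfty (c : ℝ) : Filter ℂ :=
  cobounded ℂ ⊓ 𝓟 {s : ℂ | c * |s.re| ≤ |s.im|}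

/-- `M` solves the Riemann-Hilbert problem at the point `x`. The line is oriented from left to right
(plus side above), the circles in the upper half plane clockwise (plus side outside), those in the
lower half plane counterclockwise (plus side inside). The values of `M` on the contour itself are
irrelevant. -/
structure IsRHSolution {n : ℕ} (ρ₁ ρ₂ : ℝ → ℂ) (z : Fin n → ℂ) (C : Fin n → ℂ × ℂ)
    (r : Fin n → ℝ) (x : ℝ) (M : ℂ → Mat3) : Prop where
  analytic : ∀ j k, DifferentiableOn ℂ (fun s => M s j k) (contour z r)ᶜ
  tendsto_one : Tendsto M (cobounded ℂ ⊓ 𝓟 (contour z r)ᶜ) (𝓝 1)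
  isBigO : ∀ c : ℝ, 0 < c → ∀ j k,
    (fun s => M s j k - (1 : Mat3) j k) =O[coneAtInfty c] fun s => s⁻¹
  jump : ∃ Mp Mm : ℂ → Mat3,
    ContinuousOn Mp (contour z r) ∧ ContinuousOn Mm (contour z r) ∧
    (∀ s : ℝ, JumpAt x M Mp Mm (s : ℂ) {w | 0 < w.im} {w | w.im < 0} (jumpReal ρ₁ ρ₂ s)) ∧
    (∀ i, ∀ s ∈ Metric.sphere (z i) (r i),
      JumpAt x M Mp Mm s (Metric.closedBall (z i) (r i))ᶜ (Metric.ball (z i) (r i))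
        (jumpUpper (z i) (C i) s)) ∧
    (∀ i, ∀ s ∈ Metric.sphere (conj (z i)) (r i),
      JumpAt x M Mp Mm s (Metric.ball (conj (z i)) (r i)) (Metric.closedBall (conj (z i)) (r i))ᶜ
        (jumpLower (z i) (C i) s))

/-- The reconstruction formula `(p, q) = -2 i lim (s M₂₁(s), s M₃₁(s))` as `s → ∞`
non-tangentially. -/
def Reconstructs (M : ℂ → Mat3) (p q : ℂ) : Prop :=
  ∀ c : ℝ, 0 < c →
    Tendsto (fun s => -2 * I * (s * M s 1 0)) (coneAtInfty c) (𝓝 p) ∧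
    Tendsto (fun s => -2 * I * (s * M s 2 0)) (coneAtInfty c) (𝓝 q)

end AKNS

end

noncomputable section

namespace AKNS

open Filter Topology MeasureTheory Bornology Complex
open scoped ComplexConjugate


section

/-! ### Removing singularities on lines and circles -/

/-! Uniqueness is Liouville's theorem. All jump matrices have determinant one, so for two solutions
the product of `M` with the adjugate of `M'` has no jump; it is entire and tends to the identity
(`IsRHSolution.mul_adjugate_eq_one`). It remains to construct one solution for each x and to show
that the potentials read off from it lie in `H^{1,1}`.

The construction reduces to a factorization on the line. The circle entry `e^{2iwx}/(w - z_i)` is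
the difference of a pure pole with frozen exponent, used outside the disc, and an entire function,
used inside. This removes the circles and replaces the reflection coefficients by `r_k = ρ_k
e^{2isx} - ∑ C_{ik} e^{2i z_i x}/(s - z_i)`. Let L(r) be the unipotent matrix with first column (1,
r). If `L(r)ᴴ L(r) = Nᴴ N` with N and its inverse holomorphic in the upper half plane (`IsFactor`),
a solution is N times a unipotent pole factor above the line, and the adjoint of its inverse at the
conjugate point below (`IsFactor.exists_solution`).

For x ≥ 0 put τ = 2x. The part of `r_k` that continues to the lower half plane has amplitude G_k(τ +
y), y > 0, with G_k in `H^{1,1}`; the poles contribute decaying exponentials to G_k. Cancelling the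
unwanted half plane components of N and of its inverse is a Marchenko system in L² of the half-line
with operator 1 + L_τ, where L_τ = ∑_k ∫_τ^∞ |g_k(t)⟩⟨g_k(t)| dt and g_k(t) = G_k(t + ·). Since L_τ
is positive, 1 + L_τ has an inverse of norm at most one, with no smallness assumption
(`exists_marchenko_row`, `exists_isFactor`). The potential is a multiple of G_j(τ) - ⟨h_τ, (1 +
L_τ)⁻¹ g_j(τ)⟩. The first term is in `H^{1,1}` because the Fourier transform preserves this space
(`MemH11.fourier`). In the second term h_τ and g_j(τ) are both O(1/(1+τ)), and increments over [a,
b] are O((b - a)/(1+a)), which is enough (`HankelFamily.memH11_coeff`).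

For x ≤ 0 the exponentials `e^{2i z_i x}` grow, and the problem is converted into one of the same
kind at -x ≥ 0, with poles at `-conj z_i`. This needs a holomorphic E with `E (1 + ρρᴴ) Eᴴ = 1` on
the line and `E(z_i) C_i = 0`, built from scalar outer functions, one application of the
factorization theorem in size two, and Blaschke–Potapov factors (`exists_leftFactor`). A holomorphic
matrix of determinant one then connects the two factorizations (`LeftFactor.isFactor_of_reflected`).
The potentials found for x ≥ 0 and x ≤ 0 agree at 0 by uniqueness and glue within `H^{1,1}`. -/

lemma differentiableOn_of_im_ne_zero {f : ℂ → ℂ} {U : Set ℂ} (hU : IsOpen U)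
    (hc : ContinuousOn f U) (hd : DifferentiableOn ℂ f (U ∩ {z | z.im ≠ 0})) :
    DifferentiableOn ℂ f U := by
  rw [← isConservativeOn_and_continuousOn_iff_isDifferentiableOn hU]
  refine ⟨?_, hc⟩
  -- Morera's theorem: Cauchy's theorem needs only continuity on the boundary, so it covers
  -- rectangles whose interior misses the real line. The others are cut along the line.
  have key : ∀ z w : ℂ, (Set.uIcc z.re w.re ×ℂ Set.uIcc z.im w.im) ⊆ U →
      (0 ∉ Set.Ioo (min z.im w.im) (max z.im w.im)) →
      (∫ x : ℝ in z.re..w.re, f (x + z.im * I)) - (∫ x : ℝ in z.re..w.re, f (x + w.im * I)) +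
      I • (∫ y : ℝ in z.im..w.im, f (re w + y * I)) -
      I • (∫ y : ℝ in z.im..w.im, f (re z + y * I)) = 0 := by
    intro z w hzw h0
    apply integral_boundary_rect_eq_zero_of_continuousOn_of_differentiableOn f z w (hc.mono hzw)
    refine hd.mono fun x hx => ⟨hzw ?_, fun h => h0 ?_⟩
    · rw [mem_reProdIm] at hx ⊢
      exact ⟨Set.Ioo_subset_Icc_self hx.1, Set.Ioo_subset_Icc_self hx.2⟩
    · rw [mem_reProdIm] at hx
      rw [← h]; exact hx.2
  intro z w hzw
  rw [← add_eq_zero_iff_eq_neg, wedgeIntegral_add_wedgeIntegral_eq]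
  by_cases h0 : (0 : ℝ) ∈ Set.Ioo (min z.im w.im) (max z.im w.im)
  · have h0' : (0 : ℝ) ∈ Set.uIcc z.im w.im := Set.Ioo_subset_Icc_self h0
    have h1 := key z w.re (by
      refine Set.Subset.trans (reProdIm_subset_iff'.2 ?_) hzw
      left
      simp only [ofReal_re, ofReal_im]
      exact ⟨subset_rfl, Set.uIcc_subset_uIcc_left h0'⟩) (by
        intro h; simp only [ofReal_im, Set.mem_Ioo] at h
        rcases le_total z.im 0 with h' | h'
        · rw [max_eq_right h'] at h; exact lt_irrefl _ h.2
        · rw [min_eq_right h'] at h; exact lt_irrefl _ h.1)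
    have h2 := key z.re w (by
      refine Set.Subset.trans (reProdIm_subset_iff'.2 ?_) hzw
      left
      simp only [ofReal_re, ofReal_im]
      exact ⟨subset_rfl, Set.uIcc_subset_uIcc_right h0'⟩) (by
        intro h; simp only [ofReal_im, Set.mem_Ioo] at h
        rcases le_total w.im 0 with h' | h'
        · rw [max_eq_left h'] at h; exact lt_irrefl _ h.2
        · rw [min_eq_left h'] at h; exact lt_irrefl _ h.1)
    simp only [ofReal_re, ofReal_im] at h1 h2
    have hv : ∀ t : ℝ, t ∈ Set.uIcc z.re w.re → ∀ a b : ℝ, Set.uIcc a b ⊆ Set.uIcc z.im w.im →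
        IntervalIntegrable (fun y : ℝ => f (t + y * I)) volume a b := by
      intro t ht a b hab
      apply ContinuousOn.intervalIntegrable
      refine hc.comp (by fun_prop) fun y hy => hzw ?_
      rw [Rectangle, mem_reProdIm]
      simpa using ⟨ht, hab hy⟩
    rw [← intervalIntegral.integral_add_adjacent_intervals (b := 0)
        (hv w.re Set.right_mem_uIcc _ _ (Set.uIcc_subset_uIcc_left h0'))
        (hv w.re Set.right_mem_uIcc _ _ (Set.uIcc_subset_uIcc_right h0')),
      ← intervalIntegral.integral_add_adjacent_intervals (b := 0)
        (hv z.re Set.left_mem_uIcc _ _ (Set.uIcc_subset_uIcc_left h0'))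
        (hv z.re Set.left_mem_uIcc _ _ (Set.uIcc_subset_uIcc_right h0'))]
    rw [smul_add, smul_add]
    linear_combination h1 + h2
  · exact key z w hzw h0

/-- A continuous function that is holomorphic off a circle is holomorphic across the circle. -/
lemma differentiableAt_of_off_sphere {f : ℂ → ℂ} {U : Set ℂ} (hU : IsOpen U) {c : ℂ} {r : ℝ}
    (hr : 0 < r) (hc : ContinuousOn f U)
    (hd : DifferentiableOn ℂ f (U ∩ (Metric.sphere c r)ᶜ)) {s : ℂ} (hsU : s ∈ U)
    (hs : s ∈ Metric.sphere c r) : DifferentiableAt ℂ f s := by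
  have hs' : ‖s - c‖ = r := by simpa [dist_eq_norm] using hs
  have hsc : s - c ≠ 0 := by
    intro h; rw [h, norm_zero] at hs'; exact hr.ne hs'
  -- This map wraps the real line onto the circle and sends 0 to s, so the result for the line
  -- applies to `f ∘ φ`. The logarithm `ψ` below is a local inverse.
  set φ : ℂ → ℂ := fun w => c + (s - c) * Complex.exp (I * w) with hφ
  have hφd : Differentiable ℂ φ := by fun_prop
  have hV : IsOpen (φ ⁻¹' U) := hU.preimage hφd.continuous
  have hg : DifferentiableOn ℂ (f ∘ φ) (φ ⁻¹' U) := by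
    apply differentiableOn_of_im_ne_zero hV (hc.comp hφd.continuous.continuousOn fun x hx => hx)
    intro w hw
    have hUo : IsOpen (U ∩ (Metric.sphere c r)ᶜ) := hU.inter Metric.isClosed_sphere.isOpen_compl
    have hmem : φ w ∈ U ∩ (Metric.sphere c r)ᶜ := by
      refine ⟨hw.1, fun h => hw.2 ?_⟩
      have : ‖(s - c) * Complex.exp (I * w)‖ = r := by
        simpa [hφ, dist_eq_norm] using h
      rw [norm_mul, hs', Complex.norm_exp] at this
      have h1 : Real.exp (I * w).re = 1 := by
        field_simp at this; exact this
      have h2 : (I * w).re = -w.im := by simp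
      rw [h2, Real.exp_eq_one_iff] at h1
      linarith
    exact ((hd.differentiableAt (hUo.mem_nhds hmem)).comp w
      hφd.differentiableAt).differentiableWithinAt
  set ψ : ℂ → ℂ := fun z => -I * Complex.log ((z - c) / (s - c)) with hψ
  have hψs : ψ s = 0 := by simp [hψ, div_self hsc]
  have hψd : DifferentiableAt ℂ ψ s := by
    apply DifferentiableAt.const_mul
    apply DifferentiableAt.clog (by fun_prop)
    rw [div_self hsc]; simp
  have h0 : (0 : ℂ) ∈ φ ⁻¹' U := by simpa [hφ] using hsU
  have h3 : DifferentiableAt ℂ (f ∘ φ ∘ ψ) s := by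
    have := hg.differentiableAt (hV.mem_nhds h0)
    rw [← hψs] at this
    exact this.comp s hψd
  refine h3.congr_of_eventuallyEq ?_
  have hne : ∀ᶠ z in 𝓝 s, z - c ≠ 0 :=
    (continuousAt_id.sub continuousAt_const).eventually_ne hsc
  filter_upwards [hne] with z hz
  simp only [Function.comp, hφ, hψ]
  rw [show I * (-I * Complex.log ((z - c) / (s - c))) = Complex.log ((z - c) / (s - c)) by
    rw [← mul_assoc, mul_neg, I_mul_I, neg_neg, one_mul],
    Complex.exp_log (div_ne_zero hz hsc), mul_div_cancel₀ _ hsc]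
  simp

/-- Liouville's theorem in the form used below. -/
lemma eq_const_of_differentiable_of_tendsto {f : ℂ → ℂ} {c : ℂ} (hd : Differentiable ℂ f)
    (hlim : Tendsto f (cobounded ℂ) (𝓝 c)) (z : ℂ) : f z = c := by
  rw [Metric.cobounded_eq_cocompact] at hlim
  exact hd.apply_eq_of_tendsto_cocompact z hlim

end

section

/-! ### Uniqueness for the Riemann-Hilbert problem -/

/-- Circles are removed one at a time: each is crossed inside the open complement of the line and of
the remaining circles. No disjointness is needed, since continuity is known everywhere. -/
lemma differentiable_of_off_spheres {ι : Type*} (t : Finset ι) (c : ι → ℂ) (r : ι → ℝ)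
    (hr : ∀ i, 0 < r i) {f : ℂ → ℂ} (hc : Continuous f)
    (hd : DifferentiableOn ℂ f ({s : ℂ | s.im = 0} ∪ ⋃ i ∈ t, Metric.sphere (c i) (r i))ᶜ) :
    Differentiable ℂ f := by
  classical
  induction t using Finset.induction_on with
  | empty =>
    rw [← differentiableOn_univ]
    refine differentiableOn_of_im_ne_zero isOpen_univ hc.continuousOn (hd.mono ?_)
    intro z hz
    simpa using hz.2
  | insert i t _ ih =>
    apply ih
    have hS : IsOpen ({s : ℂ | s.im = 0} ∪ ⋃ i ∈ t, Metric.sphere (c i) (r i))ᶜ := by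
      rw [isOpen_compl_iff]
      refine (isClosed_eq continuous_im continuous_const).union ?_
      exact t.finite_toSet.isClosed_biUnion fun i _ => Metric.isClosed_sphere
    rw [Finset.set_biUnion_insert] at hd
    intro z hz
    by_cases hzi : z ∈ Metric.sphere (c i) (r i)
    · refine (differentiableAt_of_off_sphere hS (hr i) hc.continuousOn (hd.mono ?_) hz
        hzi).differentiableWithinAt
      rintro w ⟨hw1, hw2⟩
      simp only [Set.mem_compl_iff, Set.mem_union, not_or] at hw1 ⊢
      exact ⟨hw1.1, hw2, hw1.2⟩
    · refine (hd.differentiableAt (IsOpen.mem_nhds ?_ ?_)).differentiableWithinAt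
      · rw [Set.union_left_comm, Set.compl_union]
        exact Metric.isClosed_sphere.isOpen_compl.inter hS
      · simp only [Set.mem_compl_iff, Set.mem_union, not_or] at hz ⊢
        exact ⟨hz.1, hzi, hz.2⟩

lemma contour_eq {n : ℕ} (z : Fin n → ℂ) (r : Fin n → ℝ) :
    contour z r = {s : ℂ | s.im = 0} ∪ ⋃ i ∈ (Finset.univ : Finset (Fin n ⊕ Fin n)),
      Metric.sphere (Sum.elim z (fun i => conj (z i)) i) (Sum.elim r r i) := by
  ext s
  simp only [contour, Set.mem_union, Set.mem_iUnion, Finset.mem_univ, Set.iUnion_true, Sum.exists,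
    Sum.elim_inl, Sum.elim_inr, exists_or]

lemma isClosed_contour {n : ℕ} (z : Fin n → ℂ) (r : Fin n → ℝ) : IsClosed (contour z r) := by
  rw [contour_eq]
  refine (isClosed_eq continuous_im continuous_const).union ?_
  exact Set.Finite.isClosed_biUnion (Finset.finite_toSet _) fun i _ => Metric.isClosed_sphere

lemma dense_compl_contour {n : ℕ} (z : Fin n → ℂ) (r : Fin n → ℝ) (hr : ∀ i, 0 < r i) :
    Dense (contour z r)ᶜ := by
  rw [contour_eq, Set.compl_union, Set.compl_iUnion₂]
  apply Dense.inter_of_isOpen_left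
  · have : {s : ℂ | s.im = 0}ᶜ = im ⁻¹' {0}ᶜ := by ext; simp
    rw [this, dense_iff_closure_eq, closure_preimage_im, (dense_compl_singleton (0 : ℝ)).closure_eq,
      Set.preimage_univ]
  · simp only [Finset.mem_univ, Set.iInter_true]
    apply dense_iInter_of_isOpen
    · intro i; exact Metric.isClosed_sphere.isOpen_compl
    · intro i
      rw [← interior_eq_empty_iff_dense_compl]
      apply interior_sphere
      rcases i with i | i
      · exact (hr i).ne'
      · exact (hr i).ne'
  · exact (isClosed_eq continuous_im continuous_const).isOpen_compl

/-- The normalization of the problem only concerns approach off the contour; by density a continuous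
function has the same limit along the contour. -/
lemma tendsto_cobounded_of_dense {f : ℂ → ℂ} (hf : Continuous f) {S : Set ℂ} (hS : Dense S) {c : ℂ}
    (h : Tendsto f (cobounded ℂ ⊓ 𝓟 S) (𝓝 c)) : Tendsto f (cobounded ℂ) (𝓝 c) := by
  rw [(closed_nhds_basis c).tendsto_right_iff]
  rintro V ⟨hV, hVc⟩
  have h1 := h hV
  rw [mem_map, mem_inf_principal, (Metric.hasBasis_cobounded_compl_closedBall (0 : ℂ)).mem_iff] at h1
  obtain ⟨R, -, hR⟩ := h1
  rw [(Metric.hasBasis_cobounded_compl_closedBall (0 : ℂ)).eventually_iff]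
  refine ⟨R, trivial, fun x hx => ?_⟩
  have h2 : x ∈ closure ((Metric.closedBall (0 : ℂ) R)ᶜ ∩ S) :=
    (hS.open_subset_closure_inter Metric.isClosed_closedBall.isOpen_compl) hx
  have h3 := map_mem_closure hf h2 (t := V) fun y hy => hR hy.1 hy.2
  rwa [hVc.closure_eq] at h3

/-- A point of the contour is approached from the plus side, from the minus side or along the
contour itself. The side sets are intersected with the complement of `Γ` because they may meet other
components of it. -/
lemma continuousAt_glue {E : Type*} [TopologicalSpace E] {Γ P N : Set ℂ} [DecidablePred (· ∈ Γ)]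
    {F B : ℂ → E} (hB : ContinuousOn B Γ) {s : ℂ} (hs : s ∈ Γ) (hPN : P ∪ N ∪ Γ = Set.univ)
    (hP : Tendsto F (𝓝[P] s) (𝓝 (B s))) (hN : Tendsto F (𝓝[N] s) (𝓝 (B s))) :
    ContinuousAt (fun z => if z ∈ Γ then B z else F z) s := by
  have hcov : 𝓝 s ≤ 𝓝[P ∩ Γᶜ] s ⊔ 𝓝[N ∩ Γᶜ] s ⊔ 𝓝[Γ] s := by
    rw [← nhdsWithin_union, ← nhdsWithin_union, ← nhdsWithin_univ]
    apply nhdsWithin_mono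
    intro z _
    by_cases hz : z ∈ Γ
    · exact Or.inr hz
    · have : z ∈ P ∪ N ∪ Γ := by rw [hPN]; trivial
      rcases this with (h | h) | h
      · exact Or.inl (Or.inl ⟨h, hz⟩)
      · exact Or.inl (Or.inr ⟨h, hz⟩)
      · exact absurd h hz
  rw [ContinuousAt, if_pos hs]
  refine Tendsto.mono_left ?_ hcov
  refine Tendsto.sup (Tendsto.sup ?_ ?_) ?_
  · refine (hP.mono_left (nhdsWithin_mono _ Set.inter_subset_left)).congr' ?_
    filter_upwards [self_mem_nhdsWithin] with z hz
    rw [if_neg hz.2]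
  · refine (hN.mono_left (nhdsWithin_mono _ Set.inter_subset_left)).congr' ?_
    filter_upwards [self_mem_nhdsWithin] with z hz
    rw [if_neg hz.2]
  · refine (hB s hs).tendsto.congr' ?_
    filter_upwards [self_mem_nhdsWithin] with z hz
    rw [if_pos hz]

lemma det_phaseConj (x : ℝ) (s : ℂ) (B : Mat3) : (phaseConj x s B).det = B.det := by
  have h : phaseConj x s B = Matrix.diagonal (fun j => Complex.exp (I * s * x * sigma j)) * B *
      Matrix.diagonal (fun j => Complex.exp (-(I * s * x * sigma j))) := by
    ext j k
    rw [Matrix.mul_diagonal, Matrix.diagonal_mul, phaseConj, Matrix.of_apply, mul_sub, sub_eq_add_neg,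
      Complex.exp_add]
    ring
  rw [h, Matrix.det_mul, Matrix.det_mul, mul_right_comm, ← Matrix.det_mul,
    Matrix.diagonal_mul_diagonal]
  simp [← Complex.exp_add]

lemma det_jumpReal (ρ₁ ρ₂ : ℝ → ℂ) (s : ℝ) : (jumpReal ρ₁ ρ₂ s).det = 1 := by
  have h : ∀ w : ℂ, ((‖w‖ ^ 2 : ℝ) : ℂ) = w * conj w := fun w => by
    rw [mul_conj, normSq_eq_norm_sq]
  rw [jumpReal, Matrix.det_fin_three]
  simp only [h, Matrix.of_apply, Matrix.cons_val', Matrix.cons_val_zero, Matrix.cons_val_one,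
    Matrix.cons_val, Matrix.cons_val_fin_one]
  ring

lemma det_jumpUpper (w : ℂ) (c : ℂ × ℂ) (s : ℂ) : (jumpUpper w c s).det = 1 := by
  rw [jumpUpper, Matrix.det_fin_three]; simp

lemma det_jumpLower (w : ℂ) (c : ℂ × ℂ) (s : ℂ) : (jumpLower w c s).det = 1 := by
  rw [jumpLower, Matrix.det_fin_three]; simp

/-- The adjugate stands in for the inverse, so that invertibility of solutions need not be known
beforehand. -/
lemma mul_adjugate_jump {A A' B B' W : Mat3} (hW : W.det = 1) (hA : A = A' * W) (hB : B = B' * W) :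
    A * B.adjugate = A' * B'.adjugate := by
  rw [hA, hB, Matrix.adjugate_mul_distrib, Matrix.mul_assoc, ← Matrix.mul_assoc W,
    Matrix.mul_adjugate, hW, one_smul, Matrix.one_mul]

lemma tendsto_mul_adjugate {α : Type*} {l : Filter α} {f g : α → Mat3} {a b : Mat3}
    (hf : Tendsto f l (𝓝 a)) (hg : Tendsto g l (𝓝 b)) :
    Tendsto (fun z => f z * (g z).adjugate) l (𝓝 (a * b.adjugate)) := by
  have hc : Continuous fun p : Mat3 × Mat3 => p.1 * p.2.adjugate :=
    continuous_fst.matrix_mul continuous_snd.matrix_adjugate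
  have := (hc.tendsto (a, b)).comp (hf.prodMk_nhds hg)
  exact this

lemma differentiableOn_adjugate {M : ℂ → Mat3} {U : Set ℂ}
    (hM : ∀ j k, DifferentiableOn ℂ (fun s => M s j k) U) (j k : Fin 3) :
    DifferentiableOn ℂ (fun s => (M s).adjugate j k) U := by
  simp only [Matrix.adjugate_apply, Matrix.det_fin_three]
  have h : ∀ a b, DifferentiableOn ℂ (fun s => (M s).updateRow k (Pi.single j 1) a b) U := by
    intro a b
    by_cases hak : a = k
    · subst hak
      simp only [Matrix.updateRow_self]
      exact differentiableOn_const _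
    · simp only [Matrix.updateRow_ne hak]
      exact hM a b
  fun_prop

/-- Liouville's theorem for the quotient of two solutions: the jumps cancel, hence the quotient
extends continuously and then holomorphically across the contour, with limit 1 at infinity. -/
lemma IsRHSolution.mul_adjugate_eq_one {n : ℕ} {ρ₁ ρ₂ : ℝ → ℂ} {z : Fin n → ℂ} {C : Fin n → ℂ × ℂ}
    {r : Fin n → ℝ} {x : ℝ} (hr : ∀ i, 0 < r i) {M M' : ℂ → Mat3}
    (hM : IsRHSolution ρ₁ ρ₂ z C r x M) (hM' : IsRHSolution ρ₁ ρ₂ z C r x M') {s : ℂ}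
    (hs : s ∈ (contour z r)ᶜ) : M s * (M' s).adjugate = 1 := by
  classical
  obtain ⟨Mp, Mm, hMp, -, hR, hU, hL⟩ := hM.jump
  obtain ⟨Mp', Mm', hMp', -, hR', hU', hL'⟩ := hM'.jump
  set Γ := contour z r with hΓ
  set F : ℂ → Mat3 := fun w => if w ∈ Γ then Mp w * (Mp' w).adjugate else M w * (M' w).adjugate
    with hF
  have hBc : ContinuousOn (fun w => Mp w * (Mp' w).adjugate) Γ :=
    fun w hw => tendsto_mul_adjugate (hMp w hw) (hMp' w hw)
  have hjump : ∀ s P N V, V.det = 1 → s ∈ Γ → P ∪ N ∪ Γ = Set.univ → JumpAt x M Mp Mm s P N V →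
      JumpAt x M' Mp' Mm' s P N V → ContinuousAt F s := by
    intro s P N V hV hsΓ hPN h h'
    have h1 := mul_adjugate_jump (W := phaseConj x s V) (by rw [det_phaseConj, hV]) h.2.2 h'.2.2
    have h2 := tendsto_mul_adjugate h.2.1 h'.2.1
    rw [← h1] at h2
    exact continuousAt_glue (F := fun w => M w * (M' w).adjugate)
      (B := fun w => Mp w * (Mp' w).adjugate) hBc hsΓ hPN (tendsto_mul_adjugate h.1 h'.1) h2
  have hopen : IsOpen Γᶜ := (isClosed_contour z r).isOpen_compl
  have hFd : ∀ j k, DifferentiableOn ℂ (fun w => F w j k) Γᶜ := by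
    intro j k
    have h1 : DifferentiableOn ℂ (fun w => (M w * (M' w).adjugate) j k) Γᶜ := by
      simp only [Matrix.mul_apply]
      exact DifferentiableOn.fun_sum fun l _ =>
        (hM.analytic j l).mul (differentiableOn_adjugate hM'.analytic l k)
    refine h1.congr fun w hw => ?_
    simp only [hF]
    rw [if_neg hw]
  have hFc : ∀ j k, Continuous fun w => F w j k := by
    intro j k
    rw [continuous_iff_continuousAt]
    intro w
    by_cases hw : w ∈ Γ
    · have : ContinuousAt F w := by
        have hw' := hw
        rw [hΓ, contour, Set.mem_union, Set.mem_iUnion] at hw'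
        rcases hw' with hw' | ⟨i, hw' | hw'⟩
        · obtain ⟨t, rfl⟩ : ∃ t : ℝ, (t : ℂ) = w := ⟨w.re, Complex.ext rfl (by simpa using hw'.symm)⟩
          refine hjump t _ _ (jumpReal ρ₁ ρ₂ t) (det_jumpReal ρ₁ ρ₂ t) hw ?_ (hR t) (hR' t)
          rw [Set.eq_univ_iff_forall]
          intro y
          rcases lt_trichotomy y.im 0 with h | h | h
          · exact Or.inl (Or.inr h)
          · exact Or.inr (Or.inl h)
          · exact Or.inl (Or.inl h)
        · refine hjump w _ _ (jumpUpper (z i) (C i) w) (det_jumpUpper _ _ _) hw ?_ (hU i w hw') (hU' i w hw')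
          rw [Set.eq_univ_iff_forall]
          intro y
          rcases lt_trichotomy (dist y (z i)) (r i) with h | h | h
          · exact Or.inl (Or.inr h)
          · exact Or.inr (Or.inr (Set.mem_iUnion.2 ⟨i, Or.inl h⟩))
          · exact Or.inl (Or.inl (by simpa using h))
        · refine hjump w _ _ (jumpLower (z i) (C i) w) (det_jumpLower _ _ _) hw ?_ (hL i w hw') (hL' i w hw')
          rw [Set.eq_univ_iff_forall]
          intro y
          rcases lt_trichotomy (dist y (conj (z i))) (r i) with h | h | h
          · exact Or.inl (Or.inl h)
          · exact Or.inr (Or.inr (Set.mem_iUnion.2 ⟨i, Or.inr h⟩))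
          · exact Or.inl (Or.inr (by simpa using h))
      exact ((continuous_apply_apply j k).tendsto _).comp this
    · exact ((hFd j k).differentiableAt (hopen.mem_nhds hw)).continuousAt
  have hlim : ∀ j k, Tendsto (fun w => F w j k) (cobounded ℂ) (𝓝 ((1 : Mat3) j k)) := by
    intro j k
    apply tendsto_cobounded_of_dense (hFc j k) (dense_compl_contour z r hr)
    have h1 := tendsto_mul_adjugate hM.tendsto_one hM'.tendsto_one
    rw [Matrix.adjugate_one, Matrix.mul_one] at h1
    have h2 : Tendsto (fun w => (M w * (M' w).adjugate) j k) (cobounded ℂ ⊓ 𝓟 Γᶜ)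
        (𝓝 ((1 : Mat3) j k)) := ((continuous_apply_apply j k).tendsto _).comp h1
    refine h2.congr' ?_
    filter_upwards [mem_inf_of_right (mem_principal_self _)] with w hw
    simp only [hF]
    rw [if_neg hw]
  ext j k
  have hd : Differentiable ℂ (fun w => F w j k) := by
    have := hFd j k
    rw [hΓ, contour_eq] at this
    exact differentiable_of_off_spheres _ _ _ (by rintro (i | i) <;> exact hr i) (hFc j k) this
  have := eq_const_of_differentiable_of_tendsto hd (hlim j k) s
  simp only [hF] at this
  rwa [if_neg hs] at this

theorem IsRHSolution.unique {n : ℕ} {ρ₁ ρ₂ : ℝ → ℂ} {z : Fin n → ℂ} {C : Fin n → ℂ × ℂ}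
    {r : Fin n → ℝ} {x : ℝ} (hr : ∀ i, 0 < r i) {M M' : ℂ → Mat3}
    (hM : IsRHSolution ρ₁ ρ₂ z C r x M) (hM' : IsRHSolution ρ₁ ρ₂ z C r x M') {s : ℂ}
    (hs : s ∈ (contour z r)ᶜ) : M s = M' s := by
  have h1 := hM.mul_adjugate_eq_one hr hM' hs
  -- The quotient of `M'` by itself shows that the adjugate of `M'` is its inverse.
  have h2 := mul_eq_one_comm.1 (hM'.mul_adjugate_eq_one hr hM' hs)
  calc M s = M s * ((M' s).adjugate * M' s) := by rw [h2, Matrix.mul_one]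
    _ = M' s := by rw [← Matrix.mul_assoc, h1, Matrix.one_mul]

end

section

/-! ### Functions with square integrable weak derivative -/

/-- Locally absolutely continuous functions whose derivative is square integrable. -/
def HasL2Deriv (f : ℝ → ℂ) : Prop :=
  ∃ g : ℝ → ℂ, MemLp g 2 volume ∧ ∀ a b : ℝ, f b - f a = ∫ t in a..b, g t

lemma intervalIntegrable_of_memLp_two {E : Type*} [NormedAddCommGroup E] {g : ℝ → E}
    (hg : MemLp g 2 volume) (a b : ℝ) : IntervalIntegrable g volume a b :=
  intervalIntegrable_iff.2 <| ((hg.locallyIntegrable (by norm_num)).integrableOn_isCompact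
    isCompact_uIcc).mono_set Set.uIoc_subset_uIcc

lemma HasL2Deriv.exists_dominating {f : ℝ → ℂ} (hf : HasL2Deriv f) :
    ∃ κ : ℝ → ℝ, (∀ t, 0 ≤ κ t) ∧ MemLp κ 2 volume ∧
      ∀ a b, a ≤ b → ‖f b - f a‖ ≤ ∫ t in a..b, κ t := by
  obtain ⟨g, hg, h⟩ := hf
  refine ⟨fun t => ‖g t‖, fun t => norm_nonneg _, hg.norm, fun a b hab => ?_⟩
  rw [h]
  exact intervalIntegral.norm_integral_le_integral_norm hab

/-- The increments of f are bounded by those of a primitive K of κ. Hence f inherits absolute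
continuity from K, and comparing difference quotients bounds its derivative by that of K almost
everywhere. -/
lemma exists_real_deriv_of_dominated {f : ℝ → ℝ} {κ : ℝ → ℝ} (hκ : MemLp κ 2 volume)
    (h : ∀ a b, a ≤ b → |f b - f a| ≤ ∫ t in a..b, κ t) :
    MemLp (deriv f) 2 volume ∧ ∀ a b : ℝ, f b - f a = ∫ t in a..b, deriv f t := by
  have hint := intervalIntegrable_of_memLp_two hκ
  set K : ℝ → ℝ := fun x => ∫ t in (0 : ℝ)..x, κ t with hK
  have hKsub : ∀ a b, K b - K a = ∫ t in a..b, κ t := fun a b => by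
    rw [hK]
    exact intervalIntegral.integral_interval_sub_left (hint _ _) (hint _ _)
  have hdist : ∀ a b, dist (f a) (f b) ≤ dist (K a) (K b) := by
    intro a b
    rcases le_total a b with hab | hab
    · rw [dist_comm, dist_comm (K a), Real.dist_eq, Real.dist_eq]
      refine (h a b hab).trans ?_
      rw [← hKsub]; exact le_abs_self _
    · rw [Real.dist_eq, Real.dist_eq]
      refine (h b a hab).trans ?_
      rw [← hKsub]; exact le_abs_self _
  have hKac : ∀ a b, AbsolutelyContinuousOnInterval K a b := by
    intro a b
    have h1 : AbsolutelyContinuousOnInterval K (-(|a| + |b|)) (|a| + |b|) := by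
      apply (hint _ _).absolutelyContinuousOnInterval_intervalIntegral
      have : 0 ≤ |a| + |b| := by positivity
      rw [Set.uIcc_of_le (by linarith)]
      constructor <;> linarith
    refine h1.mono (Set.uIcc_subset_uIcc ?_ ?_) <;>
    · rw [Set.uIcc_of_le (by linarith [abs_nonneg a, abs_nonneg b])]
      constructor <;> linarith [neg_abs_le a, neg_abs_le b, le_abs_self a, le_abs_self b,
        abs_nonneg a, abs_nonneg b]
  have hac : ∀ a b, AbsolutelyContinuousOnInterval f a b := by
    intro a b
    refine squeeze_zero' ?_ ?_ (hKac a b)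
    · exact Eventually.of_forall fun E => Finset.sum_nonneg fun _ _ => dist_nonneg
    · exact Eventually.of_forall fun E => Finset.sum_le_sum fun _ _ => hdist _ _
  have hdiff : ∀ᵐ x : ℝ, DifferentiableAt ℝ f x := by
    have h1 : ∀ n : ℕ, ∀ᵐ x : ℝ, x ∈ Set.uIcc (-(n : ℝ)) n → DifferentiableAt ℝ f x :=
      fun n => (hac _ _).ae_differentiableAt
    filter_upwards [ae_all_iff.2 h1] with x hx
    obtain ⟨n, hn⟩ := exists_nat_ge |x|
    apply hx n
    rw [Set.uIcc_of_le (by simp)]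
    exact abs_le.1 hn
  have hKd : ∀ᵐ x : ℝ, HasDerivAt K (κ x) x := by
    filter_upwards [LocallyIntegrable.ae_hasDerivAt_integral (hκ.locallyIntegrable (by norm_num))] with x hx
    exact hx 0
  refine ⟨hκ.mono (stronglyMeasurable_deriv f).aestronglyMeasurable ?_, fun a b =>
    ((hac a b).integral_deriv_eq_sub).symm⟩
  filter_upwards [hdiff, hKd] with x hx hKx
  have h1 := (hasDerivAt_iff_tendsto_slope.1 hx.hasDerivAt).norm
  have h2 := (hasDerivAt_iff_tendsto_slope.1 hKx).norm
  refine le_of_tendsto_of_tendsto h1 h2 ?_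
  filter_upwards [self_mem_nhdsWithin] with y hy
  rw [slope_def_field, slope_def_field, norm_div, norm_div]
  have := hdist y x
  rw [dist_eq_norm, dist_eq_norm] at this
  gcongr

/-- Converse of `HasL2Deriv.exists_dominating`. Together they reduce closure of the class under
algebraic operations to inequalities between increments. -/
lemma hasL2Deriv_of_dominated {f : ℝ → ℂ} {κ : ℝ → ℝ} (hκ : MemLp κ 2 volume)
    (h : ∀ a b, a ≤ b → ‖f b - f a‖ ≤ ∫ t in a..b, κ t) : HasL2Deriv f := by
  obtain ⟨h1, h2⟩ := exists_real_deriv_of_dominated (f := fun t => (f t).re) hκ fun a b hab => by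
    rw [← sub_re]; exact (abs_re_le_norm _).trans (h a b hab)
  obtain ⟨h3, h4⟩ := exists_real_deriv_of_dominated (f := fun t => (f t).im) hκ fun a b hab => by
    rw [← sub_im]; exact (abs_im_le_norm _).trans (h a b hab)
  set u := deriv fun t => (f t).re
  set v := deriv fun t => (f t).im
  have m1 : MemLp (fun t => (u t : ℂ)) 2 volume := h1.ofReal
  have m2 : MemLp (fun t => (v t : ℂ) * I) 2 volume := (MemLp.ofReal (K := ℂ) h3).mul_const I
  refine ⟨fun t => (u t : ℂ) + (v t : ℂ) * I, m1.add m2, fun a b => ?_⟩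
  rw [intervalIntegral.integral_add (intervalIntegrable_of_memLp_two m1 a b)
    (intervalIntegrable_of_memLp_two m2 a b), intervalIntegral.integral_mul_const,
    intervalIntegral.integral_ofReal, intervalIntegral.integral_ofReal, ← h2, ← h4]
  apply Complex.ext <;> simp

lemma HasL2Deriv.continuous {f : ℝ → ℂ} (hf : HasL2Deriv f) : Continuous f := by
  obtain ⟨g, hg, h⟩ := hf
  have : f = fun x => f 0 + ∫ t in (0 : ℝ)..x, g t := by
    ext x; rw [← h]; ring
  rw [this]
  exact continuous_const.add (intervalIntegral.continuous_primitive
    (intervalIntegrable_of_memLp_two hg) 0)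

lemma HasL2Deriv.of_le {f F : ℝ → ℂ} {C : ℝ} (hf : HasL2Deriv f)
    (h : ∀ a b, ‖F b - F a‖ ≤ C * ‖f b - f a‖) : HasL2Deriv F := by
  obtain ⟨κ, h0, hκ, hle⟩ := hf.exists_dominating
  refine hasL2Deriv_of_dominated (hκ.const_mul |C|) fun a b hab => ?_
  rw [intervalIntegral.integral_const_mul]
  calc ‖F b - F a‖ ≤ C * ‖f b - f a‖ := h a b
    _ ≤ |C| * ‖f b - f a‖ := by gcongr; exact le_abs_self C
    _ ≤ _ := by gcongr; exact hle a b hab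

lemma HasL2Deriv.of_le₂ {f₁ f₂ F : ℝ → ℂ} {C : ℝ} (hf₁ : HasL2Deriv f₁) (hf₂ : HasL2Deriv f₂)
    (h : ∀ a b, ‖F b - F a‖ ≤ C * (‖f₁ b - f₁ a‖ + ‖f₂ b - f₂ a‖)) : HasL2Deriv F := by
  obtain ⟨κ₁, -, hκ₁, hle₁⟩ := hf₁.exists_dominating
  obtain ⟨κ₂, -, hκ₂, hle₂⟩ := hf₂.exists_dominating
  refine hasL2Deriv_of_dominated ((hκ₁.add hκ₂).const_mul |C|) fun a b hab => ?_
  simp only [Pi.add_apply]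
  rw [intervalIntegral.integral_const_mul, intervalIntegral.integral_add
    (intervalIntegrable_of_memLp_two hκ₁ _ _) (intervalIntegrable_of_memLp_two hκ₂ _ _)]
  calc ‖F b - F a‖ ≤ C * (‖f₁ b - f₁ a‖ + ‖f₂ b - f₂ a‖) := h a b
    _ ≤ |C| * (‖f₁ b - f₁ a‖ + ‖f₂ b - f₂ a‖) := by gcongr; exact le_abs_self C
    _ ≤ _ := by gcongr; exacts [hle₁ a b hab, hle₂ a b hab]

lemma hasL2Deriv_const (c : ℂ) : HasL2Deriv fun _ => c :=
  ⟨0, MemLp.zero, fun a b => by simp⟩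

lemma HasL2Deriv.add {f g : ℝ → ℂ} (hf : HasL2Deriv f) (hg : HasL2Deriv g) :
    HasL2Deriv fun t => f t + g t :=
  hf.of_le₂ (C := 1) hg fun a b => by
    rw [one_mul, add_sub_add_comm]; exact norm_add_le _ _

lemma HasL2Deriv.mul {f g : ℝ → ℂ} (hf : HasL2Deriv f) (hg : HasL2Deriv g) {A B : ℝ}
    (hA : ∀ t, ‖f t‖ ≤ A) (hB : ∀ t, ‖g t‖ ≤ B) : HasL2Deriv fun t => f t * g t :=
  hf.of_le₂ (C := A + B) hg fun a b => by
    have hA0 : 0 ≤ A := (norm_nonneg _).trans (hA 0)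
    have hB0 : 0 ≤ B := (norm_nonneg _).trans (hB 0)
    calc ‖f b * g b - f a * g a‖ = ‖(f b - f a) * g b + f a * (g b - g a)‖ := by ring_nf
      _ ≤ ‖f b - f a‖ * ‖g b‖ + ‖f a‖ * ‖g b - g a‖ := by
        refine (norm_add_le _ _).trans ?_
        rw [norm_mul, norm_mul]
      _ ≤ ‖f b - f a‖ * B + A * ‖g b - g a‖ := by gcongr; exacts [hB b, hA a]
      _ ≤ _ := by nlinarith [norm_nonneg (f b - f a), norm_nonneg (g b - g a)]

lemma HasL2Deriv.const_mul {f : ℝ → ℂ} (hf : HasL2Deriv f) (c : ℂ) :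
    HasL2Deriv fun t => c * f t :=
  hf.of_le (C := ‖c‖) fun a b => by rw [← mul_sub, norm_mul]

lemma HasL2Deriv.star {f : ℝ → ℂ} (hf : HasL2Deriv f) : HasL2Deriv fun t => conj (f t) :=
  hf.of_le (C := 1) fun a b => by rw [← map_sub, RCLike.norm_conj, one_mul]

lemma HasL2Deriv.inv {f : ℝ → ℂ} (hf : HasL2Deriv f) {δ : ℝ} (hδ : 0 < δ)
    (h : ∀ t, δ ≤ ‖f t‖) : HasL2Deriv fun t => (f t)⁻¹ :=
  hf.of_le (C := (δ * δ)⁻¹) fun a b => by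
    have h0 : ∀ t, f t ≠ 0 := fun t => norm_pos_iff.1 (hδ.trans_le (h t))
    rw [inv_sub_inv (h0 b) (h0 a), norm_div, norm_mul, norm_sub_rev, div_eq_inv_mul]
    gcongr
    · exact h b
    · exact h a

lemma HasL2Deriv.comp_neg {f : ℝ → ℂ} (hf : HasL2Deriv f) : HasL2Deriv fun t => f (-t) := by
  obtain ⟨g, hg, h⟩ := hf
  refine ⟨fun t => - g (-t), (hg.comp_measurePreserving (Measure.measurePreserving_neg _)).neg,
    fun a b => ?_⟩
  rw [intervalIntegral.integral_neg, intervalIntegral.integral_comp_neg (fun t => g t), h,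
    intervalIntegral.integral_symm]

lemma memLp_comp_mul_left {g : ℝ → ℂ} (hg : MemLp g 2 volume) {c : ℝ} (hc : c ≠ 0) :
    MemLp (fun t => g (c * t)) 2 volume := by
  have : MemLp g 2 (Measure.map (fun t => c * t) volume) := by
    rw [Real.map_volume_mul_left hc]
    exact hg.smul_measure (by simp)
  exact (memLp_map_measure_iff this.1 (by fun_prop)).1 this

lemma HasL2Deriv.comp_mul_left {f : ℝ → ℂ} (hf : HasL2Deriv f) {c : ℝ} (hc : c ≠ 0) :
    HasL2Deriv fun t => f (c * t) := by
  obtain ⟨g, hg, h⟩ := hf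
  refine ⟨fun t => (c : ℂ) * g (c * t), (memLp_comp_mul_left hg hc).const_mul _, fun a b => ?_⟩
  rw [intervalIntegral.integral_const_mul, intervalIntegral.integral_comp_mul_left g hc, h,
    Complex.real_smul, ← mul_assoc]
  simp [hc]

lemma HasL2Deriv.comp_add_left {f : ℝ → ℂ} (hf : HasL2Deriv f) (c : ℝ) :
    HasL2Deriv fun t => f (c + t) := by
  obtain ⟨g, hg, h⟩ := hf
  refine ⟨fun t => g (c + t), hg.comp_measurePreserving (measurePreserving_add_left volume c),
    fun a b => ?_⟩
  rw [intervalIntegral.integral_comp_add_left (fun t => g t), h]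

lemma hasL2Deriv_of_hasDerivAt {f f' : ℝ → ℂ} (h : ∀ t, HasDerivAt f (f' t) t)
    (hf' : MemLp f' 2 volume) : HasL2Deriv f :=
  ⟨f', hf', fun a b => (intervalIntegral.integral_eq_sub_of_hasDerivAt (fun t _ => h t)
    (intervalIntegrable_of_memLp_two hf' a b)).symm⟩

/-- Gluing at the origin. -/
lemma HasL2Deriv.glue {f₁ f₂ f : ℝ → ℂ} (hf₁ : HasL2Deriv f₁) (hf₂ : HasL2Deriv f₂)
    (h₁ : ∀ t, 0 ≤ t → f t = f₁ t) (h₂ : ∀ t, t ≤ 0 → f t = f₂ t) : HasL2Deriv f := by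
  obtain ⟨κ₁, p₁, hκ₁, hle₁⟩ := hf₁.exists_dominating
  obtain ⟨κ₂, p₂, hκ₂, hle₂⟩ := hf₂.exists_dominating
  have i₁ := intervalIntegrable_of_memLp_two hκ₁
  have i₂ := intervalIntegrable_of_memLp_two hκ₂
  refine hasL2Deriv_of_dominated (hκ₁.add hκ₂) fun a b hab => ?_
  simp only [Pi.add_apply]
  rw [intervalIntegral.integral_add (i₁ _ _) (i₂ _ _)]
  have n₁ : ∀ a b, a ≤ b → 0 ≤ ∫ t in a..b, κ₁ t := fun a b hab =>
    intervalIntegral.integral_nonneg hab fun t _ => p₁ t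
  have n₂ : ∀ a b, a ≤ b → 0 ≤ ∫ t in a..b, κ₂ t := fun a b hab =>
    intervalIntegral.integral_nonneg hab fun t _ => p₂ t
  rcases le_total 0 a with ha | ha
  · rw [h₁ a ha, h₁ b (ha.trans hab)]
    linarith [hle₁ a b hab, n₂ a b hab]
  rcases le_total b 0 with hb | hb
  · rw [h₂ a ha, h₂ b hb]
    linarith [hle₂ a b hab, n₁ a b hab]
  · have e1 := hle₂ a 0 ha
    have e2 := hle₁ 0 b hb
    rw [← h₁ 0 le_rfl, ← h₁ b hb] at e2
    rw [← h₂ 0 le_rfl, ← h₂ a ha] at e1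
    have e3 := intervalIntegral.integral_add_adjacent_intervals (i₁ a 0) (i₁ 0 b)
    have e4 := intervalIntegral.integral_add_adjacent_intervals (i₂ a 0) (i₂ 0 b)
    have e5 : ‖f b - f a‖ ≤ ‖f b - f 0‖ + ‖f 0 - f a‖ := by
      simpa using norm_add_le (f b - f 0) (f 0 - f a)
    linarith [n₁ a 0 ha, n₂ 0 b hb]

end

section

/-! ### The class `H^{1,1}` -/

lemma MemH11.hasL2Deriv {f : ℝ → ℂ} (hf : MemH11 f) : HasL2Deriv f := hf.2.2

lemma setIntegral_norm_le_sq {f : ℝ → ℂ} (hf : MemLp f 2 volume) (b : ℝ) :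
    ∫ t in b..b + 1, ‖f t‖ ≤ 1 + ∫ t, ‖f t‖ ^ 2 := by
  have hsq : Integrable (fun t => ‖f t‖ ^ 2) := (memLp_two_iff_integrable_sq_norm hf.1).1 hf
  have h1 : ∫ t in b..b + 1, ‖f t‖ ≤ ∫ t in b..b + 1, (1 + ‖f t‖ ^ 2) := by
    apply intervalIntegral.integral_mono_on (by linarith)
    · exact (intervalIntegrable_of_memLp_two hf _ _).norm
    · exact (continuous_const.intervalIntegrable _ _).add hsq.intervalIntegrable
    · intro t _
      nlinarith [sq_nonneg (‖f t‖ - 1), norm_nonneg (f t)]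
  rw [intervalIntegral.integral_add (continuous_const.intervalIntegrable _ _)
    hsq.intervalIntegrable] at h1
  refine h1.trans ?_
  simp only [intervalIntegral.integral_const, add_sub_cancel_left, smul_eq_mul, mul_one]
  gcongr
  rw [intervalIntegral.integral_of_le (by linarith)]
  exact setIntegral_le_integral hsq (Eventually.of_forall fun t => by positivity)

/-- On [b, b+1] the function differs from its value at b by at most the integral of ‖g‖. Averaging
over the interval and using `u ≤ 1 + u²` bounds everything by L² norms. -/
lemma HasL2Deriv.exists_bound {f : ℝ → ℂ} (h : MemLp f 2 volume) (hd : HasL2Deriv f) :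
    ∃ B, ∀ t, ‖f t‖ ≤ B := by
  obtain ⟨g, hg, hfg⟩ := hd
  refine ⟨(1 + ∫ t, ‖f t‖ ^ 2) + (1 + ∫ t, ‖g t‖ ^ 2), fun b => ?_⟩
  have h1 : ∀ t ∈ Set.Icc b (b + 1), ‖f b‖ ≤ ‖f t‖ + ∫ t in b..b + 1, ‖g t‖ := by
    intro t ht
    have h2 : ‖f t - f b‖ ≤ ∫ t in b..b + 1, ‖g t‖ := by
      rw [hfg]
      refine (intervalIntegral.norm_integral_le_integral_norm ht.1).trans ?_
      apply intervalIntegral.integral_mono_interval le_rfl ht.1 ht.2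
      · exact Eventually.of_forall fun t => norm_nonneg _
      · exact (intervalIntegrable_of_memLp_two hg _ _).norm
    have h3 : ‖f b‖ ≤ ‖f t‖ + ‖f t - f b‖ := by
      have := norm_sub_le (f t) (f t - f b)
      simpa using this
    linarith
  have h4 := intervalIntegral.integral_mono_on (show b ≤ b + 1 by linarith)
    (continuous_const.intervalIntegrable (μ := volume) _ _)
    (((intervalIntegrable_of_memLp_two h b (b + 1)).norm).add
      (continuous_const.intervalIntegrable _ _)) h1
  rw [intervalIntegral.integral_add (intervalIntegrable_of_memLp_two h b (b + 1)).norm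
      (continuous_const.intervalIntegrable _ _)] at h4
  simp only [intervalIntegral.integral_const, add_sub_cancel_left, smul_eq_mul, one_mul] at h4
  linarith [setIntegral_norm_le_sq h b, setIntegral_norm_le_sq hg b]

lemma MemH11.exists_bound {f : ℝ → ℂ} (hf : MemH11 f) : ∃ B, ∀ t, ‖f t‖ ≤ B :=
  hf.hasL2Deriv.exists_bound hf.1

lemma MemH11.continuous {f : ℝ → ℂ} (hf : MemH11 f) : Continuous f := hf.hasL2Deriv.continuous

lemma memLp_two_one_add_abs_inv : MemLp (fun x : ℝ => (1 + |x|)⁻¹) 2 volume := by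
  have h1 : Continuous fun x : ℝ => (1 + |x|)⁻¹ :=
    (continuous_const.add continuous_abs).inv₀ fun x =>
      (by positivity : (0 : ℝ) < 1 + |x|).ne'
  rw [memLp_two_iff_integrable_sq h1.aestronglyMeasurable]
  refine integrable_inv_one_add_sq.mono' (h1.pow 2).aestronglyMeasurable (Eventually.of_forall
    fun x => ?_)
  rw [Real.norm_of_nonneg (by positivity), inv_pow]
  gcongr
  nlinarith [abs_nonneg x, sq_abs x]

lemma MemH11.memLp_weight {f : ℝ → ℂ} (hf : MemH11 f) :
    MemLp (fun x : ℝ => (1 + |x|) * ‖f x‖) 2 volume := by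
  have h := hf.1.norm.add hf.2.1.norm
  refine h.congr_norm ?_ ?_
  · exact ((continuous_const.add continuous_abs).mul hf.continuous.norm).aestronglyMeasurable
  · refine Eventually.of_forall fun x => ?_
    simp only [Pi.add_apply, norm_mul, Complex.norm_real, Real.norm_eq_abs]
    rw [abs_norm, abs_of_nonneg (by positivity : 0 ≤ ‖f x‖ + |x| * ‖f x‖),
      abs_of_nonneg (by positivity : 0 ≤ 1 + |x|)]
    ring

/-- Cauchy–Schwarz: the weighted function and `(1 + |x|)⁻¹` are both square integrable. -/
lemma MemH11.integrable {f : ℝ → ℂ} (hf : MemH11 f) : Integrable f := by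
  have h := hf.memLp_weight.integrable_mul memLp_two_one_add_abs_inv
  refine h.mono' hf.continuous.aestronglyMeasurable (Eventually.of_forall fun x => ?_)
  have : (1 + |x|) ≠ 0 := by positivity
  simp only [Pi.mul_apply]
  rw [mul_right_comm, mul_inv_cancel₀ this, one_mul]

/-- Pointwise domination transfers both integrability conditions; the derivative is the only
condition to be checked separately. -/
lemma MemH11.of_bound_mul {f g : ℝ → ℂ} {B : ℝ} (hf : MemH11 f) (hg : HasL2Deriv g)
    (h : ∀ t, ‖g t‖ ≤ B * ‖f t‖) : MemH11 g := by
  have hc := hg.continuous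
  refine ⟨hf.1.of_le_mul (c := B) hc.aestronglyMeasurable (Eventually.of_forall h),
    hf.2.1.of_le_mul (c := B) (by fun_prop) (Eventually.of_forall fun t => ?_), hg⟩
  rw [norm_mul, norm_mul, mul_left_comm]
  gcongr
  exact h t

lemma MemH11.mul_left {f φ : ℝ → ℂ} {B : ℝ} (hf : MemH11 f) (hφ : HasL2Deriv φ)
    (hB : ∀ t, ‖φ t‖ ≤ B) : MemH11 fun t => φ t * f t := by
  obtain ⟨A, hA⟩ := hf.exists_bound
  refine hf.of_bound_mul (B := B) (hφ.mul hf.hasL2Deriv hB hA) fun t => ?_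
  rw [norm_mul]
  gcongr
  exact hB t

lemma MemH11.add {f g : ℝ → ℂ} (hf : MemH11 f) (hg : MemH11 g) : MemH11 fun t => f t + g t :=
  ⟨hf.1.add hg.1, by simp only [mul_add]; exact hf.2.1.add hg.2.1, hf.hasL2Deriv.add hg.hasL2Deriv⟩

lemma MemH11.const_mul {f : ℝ → ℂ} (hf : MemH11 f) (c : ℂ) : MemH11 fun t => c * f t :=
  hf.of_bound_mul (B := ‖c‖) (hf.hasL2Deriv.const_mul c) fun _ => (norm_mul _ _).le

lemma MemH11.zero : MemH11 fun _ => 0 := by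
  refine ⟨MemLp.zero, ?_, hasL2Deriv_const 0⟩
  simp only [mul_zero]
  exact MemLp.zero

lemma MemH11.sum {ι : Type*} (s : Finset ι) {f : ι → ℝ → ℂ} (hf : ∀ i ∈ s, MemH11 (f i)) :
    MemH11 fun t => ∑ i ∈ s, f i t := by
  classical
  induction s using Finset.induction_on with
  | empty => simpa using MemH11.zero
  | insert i s hi ih =>
    simp only [Finset.sum_insert hi]
    exact (hf i (by simp)).add (ih fun j hj => hf j (by simp [hj]))

lemma MemH11.star {f : ℝ → ℂ} (hf : MemH11 f) : MemH11 fun t => conj (f t) :=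
  hf.of_bound_mul (B := 1) hf.hasL2Deriv.star fun t => by rw [RCLike.norm_conj, one_mul]

lemma MemH11.comp_mul_left {f : ℝ → ℂ} (hf : MemH11 f) {c : ℝ} (hc : c ≠ 0) :
    MemH11 fun t => f (c * t) := by
  refine ⟨memLp_comp_mul_left hf.1 hc, ?_, hf.hasL2Deriv.comp_mul_left hc⟩
  have := (memLp_comp_mul_left hf.2.1 hc).const_mul (c : ℂ)⁻¹
  refine this.congr_norm ?_ (Eventually.of_forall fun t => ?_)
  · have := hf.continuous; fun_prop
  · have : (c : ℂ) ≠ 0 := by exact_mod_cast hc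
    rw [ofReal_mul, mul_assoc, ← mul_assoc (c : ℂ)⁻¹, inv_mul_cancel₀ this, one_mul]

lemma MemH11.comp_neg {f : ℝ → ℂ} (hf : MemH11 f) : MemH11 fun t => f (-t) := by
  simpa using hf.comp_mul_left (c := -1) (by norm_num)

lemma MemH11.comp_add_left {f : ℝ → ℂ} (hf : MemH11 f) (c : ℝ) : MemH11 fun t => f (c + t) := by
  have hm := measurePreserving_add_left (volume : Measure ℝ) c
  have h1 := hf.1.comp_measurePreserving hm
  have h2 := hf.2.1.comp_measurePreserving hm
  refine ⟨h1, ?_, hf.hasL2Deriv.comp_add_left c⟩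
  have := h2.sub (h1.const_mul (c : ℂ))
  refine this.congr_norm ?_ (Eventually.of_forall fun t => ?_)
  · have := hf.continuous; fun_prop
  · simp only [Pi.sub_apply, Function.comp]
    congr 1
    push_cast
    ring

/-- Gluing at the origin. -/
lemma MemH11.glue {f₁ f₂ f : ℝ → ℂ} (hf₁ : MemH11 f₁) (hf₂ : MemH11 f₂)
    (h₁ : ∀ t, 0 ≤ t → f t = f₁ t) (h₂ : ∀ t, t ≤ 0 → f t = f₂ t) : MemH11 f := by
  have hd := hf₁.hasL2Deriv.glue hf₂.hasL2Deriv h₁ h₂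
  have hc := hd.continuous
  have hle : ∀ t, ‖f t‖ ≤ ‖f₁ t‖ + ‖f₂ t‖ := fun t => by
    rcases le_total 0 t with h | h
    · rw [h₁ t h]; linarith [norm_nonneg (f₂ t)]
    · rw [h₂ t h]; linarith [norm_nonneg (f₁ t)]
  refine ⟨(hf₁.1.norm.add hf₂.1.norm).mono hc.aestronglyMeasurable (Eventually.of_forall fun t => ?_),
    (hf₁.2.1.norm.add hf₂.2.1.norm).mono (by fun_prop) (Eventually.of_forall fun t => ?_), hd⟩
  · exact (hle t).trans (le_abs_self _)
  · refine le_trans ?_ (le_abs_self _)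
    simp only [Pi.add_apply, norm_mul]
    rw [← mul_add]
    gcongr
    exact hle t

end

section

/-! ### Functions on the closed upper half plane -/

lemma norm_inv_sub_le {w : ℂ} (hw : w.im ≠ 0) (t : ℝ) : ‖((t : ℂ) - w)⁻¹‖ ≤ |w.im|⁻¹ := by
  rw [norm_inv]
  have h1 : |w.im| ≤ ‖(t : ℂ) - w‖ := by simpa using abs_im_le_norm ((t : ℂ) - w)
  have h2 : 0 < |w.im| := abs_pos.2 hw
  gcongr

lemma memLp_two_inv_sub {w : ℂ} (hw : w.im ≠ 0) :
    MemLp (fun t : ℝ => ((t : ℂ) - w)⁻¹) 2 volume := by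
  have hne : ∀ t : ℝ, (t : ℂ) - w ≠ 0 := fun t h => hw (by simpa using congrArg im h)
  have hc : Continuous fun t : ℝ => ((t : ℂ) - w)⁻¹ := Continuous.inv₀ (by fun_prop) hne
  rw [memLp_two_iff_integrable_sq_norm hc.aestronglyMeasurable]
  have h1 := ((integrable_inv_one_add_sq.comp_div hw).comp_sub_right w.re).const_mul (w.im ^ 2)⁻¹
  refine h1.congr (Eventually.of_forall fun t => ?_)
  have h2 : ‖(t : ℂ) - w‖ ^ 2 = (t - w.re) ^ 2 + w.im ^ 2 := by
    rw [← normSq_eq_norm_sq, normSq_apply]; simp; ring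
  beta_reduce
  rw [norm_inv, inv_pow, h2, ← mul_inv]
  congr 1
  field_simp
  ring

lemma hasL2Deriv_inv_sub {w : ℂ} (hw : w.im ≠ 0) : HasL2Deriv fun t : ℝ => ((t : ℂ) - w)⁻¹ := by
  have hne : ∀ t : ℝ, (t : ℂ) - w ≠ 0 := fun t h => hw (by simpa using congrArg im h)
  have hm := memLp_two_inv_sub hw
  refine hasL2Deriv_of_hasDerivAt (f' := fun t => -1 / ((t : ℂ) - w) ^ 2) (fun t => ?_) ?_
  · exact ((hasDerivAt_id (t : ℂ)).comp_ofReal.sub_const w).inv (hne t)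
  · refine hm.of_le_mul (c := |w.im|⁻¹) ?_ (Eventually.of_forall fun t => ?_)
    · refine Continuous.aestronglyMeasurable ?_
      exact continuous_const.div (by fun_prop) fun t => pow_ne_zero 2 (hne t)
    · rw [neg_div, norm_neg, one_div, ← inv_pow, norm_pow, pow_two]
      gcongr
      exact norm_inv_sub_le hw t


/-- Approach to infinity in the closed upper half plane. -/
def upperInfty : Filter ℂ := cobounded ℂ ⊓ 𝓟 {z : ℂ | 0 ≤ z.im}

/-- Approach to infinity in the cone `κ |Re z| ≤ Im z`. -/
def upperCone (κ : ℝ) : Filter ℂ := cobounded ℂ ⊓ 𝓟 {z : ℂ | κ * |z.re| ≤ z.im}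

lemma upperCone_le {κ : ℝ} (hκ : 0 < κ) : upperCone κ ≤ upperInfty :=
  inf_le_inf_left _ (principal_mono.2 fun _ hz => (by positivity : 0 ≤ κ * |_|).trans hz)

/-- Functions holomorphic in the upper half plane, continuous up to the boundary, with limit `c` at
infinity and nontangential expansion `c + l / z + o(1 / z)`, and with square integrable derivative
on the real line. -/
structure UpperNice (f : ℂ → ℂ) (c l : ℂ) : Prop where
  diff : DifferentiableOn ℂ f {z | 0 < z.im}
  cont : ContinuousOn f {z | 0 ≤ z.im}
  lim : Tendsto f upperInfty (𝓝 c)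
  cone : ∀ κ : ℝ, 0 < κ → Tendsto (fun z => z * (f z - c)) (upperCone κ) (𝓝 l)
  deriv : HasL2Deriv fun s : ℝ => f s

namespace UpperNice

variable {f g : ℂ → ℂ} {c d l k : ℂ}

lemma isOpen_upper : IsOpen {z : ℂ | 0 < z.im} := isOpen_lt continuous_const continuous_im

lemma isClosed_upper : IsClosed {z : ℂ | 0 ≤ z.im} := isClosed_le continuous_const continuous_im

lemma congr (hf : UpperNice f c l) (h : ∀ z : ℂ, 0 ≤ z.im → g z = f z) : UpperNice g c l where
  diff := hf.diff.congr fun z hz => h z (le_of_lt hz)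
  cont := hf.cont.congr fun z hz => h z hz
  lim := hf.lim.congr' (by
    filter_upwards [mem_inf_of_right (mem_principal_self _)] with z hz
    exact (h z hz).symm)
  cone κ hκ := (hf.cone κ hκ).congr' (by
    filter_upwards [upperCone_le hκ (mem_inf_of_right (mem_principal_self _))] with z hz
    rw [h z hz])
  deriv := by
    have : (fun s : ℝ => g s) = fun s : ℝ => f s := by
      ext s; exact h s (by simp)
    rw [this]; exact hf.deriv

lemma exists_bound (hf : UpperNice f c l) : ∃ B, ∀ z : ℂ, 0 ≤ z.im → ‖f z‖ ≤ B := by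
  have h1 : ∀ᶠ z in upperInfty, ‖f z‖ < ‖c‖ + 1 :=
    hf.lim.norm.eventually_lt_const (by linarith)
  rw [upperInfty, eventually_inf_principal,
    (Metric.hasBasis_cobounded_compl_closedBall (0 : ℂ)).eventually_iff] at h1
  obtain ⟨R, -, hR⟩ := h1
  obtain ⟨B, hB⟩ := ((isCompact_closedBall (0 : ℂ) R).inter_right isClosed_upper).exists_bound_of_continuousOn
    (hf.cont.mono Set.inter_subset_right)
  refine ⟨max B (‖c‖ + 1), fun z hz => ?_⟩
  by_cases hzR : z ∈ Metric.closedBall (0 : ℂ) R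
  · exact (hB z ⟨hzR, hz⟩).trans (le_max_left _ _)
  · exact (hR hzR hz).le.trans (le_max_right _ _)

lemma exists_bound_real (hf : UpperNice f c l) : ∃ B, ∀ s : ℝ, ‖f s‖ ≤ B := by
  obtain ⟨B, hB⟩ := hf.exists_bound
  exact ⟨B, fun s => hB s (by simp)⟩

lemma const (c : ℂ) : UpperNice (fun _ => c) c 0 where
  diff := differentiableOn_const _
  cont := continuousOn_const
  lim := tendsto_const_nhds
  cone κ hκ := by simpa using tendsto_const_nhds
  deriv := hasL2Deriv_const c

lemma add (hf : UpperNice f c l) (hg : UpperNice g d k) :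
    UpperNice (fun z => f z + g z) (c + d) (l + k) where
  diff := hf.diff.add hg.diff
  cont := hf.cont.add hg.cont
  lim := hf.lim.add hg.lim
  cone κ hκ := by
    refine ((hf.cone κ hκ).add (hg.cone κ hκ)).congr fun z => ?_
    ring
  deriv := hf.deriv.add hg.deriv

lemma mul (hf : UpperNice f c l) (hg : UpperNice g d k) :
    UpperNice (fun z => f z * g z) (c * d) (l * d + c * k) where
  diff := hf.diff.mul hg.diff
  cont := hf.cont.mul hg.cont
  lim := hf.lim.mul hg.lim
  cone κ hκ := by
    have h1 := (hf.cone κ hκ).mul (hg.lim.mono_left (upperCone_le hκ))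
    refine (h1.add ((hg.cone κ hκ).const_mul c)).congr fun z => ?_
    ring
  deriv := by
    obtain ⟨A, hA⟩ := hf.exists_bound_real
    obtain ⟨B, hB⟩ := hg.exists_bound_real
    exact hf.deriv.mul hg.deriv hA hB

lemma const_mul (hf : UpperNice f c l) (a : ℂ) : UpperNice (fun z => a * f z) (a * c) (a * l) := by
  simpa using (const a).mul hf

lemma neg (hf : UpperNice f c l) : UpperNice (fun z => - f z) (-c) (-l) := by
  simpa using hf.const_mul (-1)

lemma sub (hf : UpperNice f c l) (hg : UpperNice g d k) :
    UpperNice (fun z => f z - g z) (c - d) (l - k) := by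
  simpa [sub_eq_add_neg] using hf.add hg.neg

lemma sum {ι : Type*} (s : Finset ι) {f : ι → ℂ → ℂ} {c l : ι → ℂ}
    (hf : ∀ i ∈ s, UpperNice (f i) (c i) (l i)) :
    UpperNice (fun z => ∑ i ∈ s, f i z) (∑ i ∈ s, c i) (∑ i ∈ s, l i) := by
  classical
  induction s using Finset.induction_on with
  | empty => simpa using const 0
  | insert i s hi ih =>
    simp only [Finset.sum_insert hi]
    exact (hf i (by simp)).add (ih fun j hj => hf j (by simp [hj]))

lemma inv (hf : UpperNice f c l) (hc : c ≠ 0) (h : ∀ z : ℂ, 0 ≤ z.im → f z ≠ 0) :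
    UpperNice (fun z => (f z)⁻¹) c⁻¹ (-l / c ^ 2) where
  diff := hf.diff.inv fun z hz => h z (le_of_lt hz)
  cont := hf.cont.inv₀ h
  lim := hf.lim.inv₀ hc
  cone κ hκ := by
    have h1 := (hf.lim.mono_left (upperCone_le hκ)).inv₀ hc
    have h2 := ((hf.cone κ hκ).neg.mul h1).mul_const c⁻¹
    have e : -l / c ^ 2 = -l * c⁻¹ * c⁻¹ := by field_simp
    rw [e]
    refine h2.congr' ?_
    filter_upwards [upperCone_le hκ (mem_inf_of_right (mem_principal_self _))] with z hz
    have := h z hz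
    field_simp
    ring
  deriv := by
    have h1 : ∀ᶠ z in upperInfty, ‖c‖ / 2 < ‖f z‖ :=
      hf.lim.norm.eventually_const_lt (half_lt_self (norm_pos_iff.2 hc))
    rw [upperInfty, eventually_inf_principal,
      (Metric.hasBasis_cobounded_compl_closedBall (0 : ℂ)).eventually_iff] at h1
    obtain ⟨R, -, hR⟩ := h1
    obtain ⟨B, hB⟩ := ((isCompact_closedBall (0 : ℂ) R).inter_right
      isClosed_upper).exists_bound_of_continuousOn
      ((hf.cont.inv₀ h).mono Set.inter_subset_right)
    have hc' := norm_pos_iff.2 hc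
    -- A lower bound for |f| on the line: half the limit near infinity, and on the remaining compact
    -- set the reciprocal of a bound for 1/f. The term `|B| + 1` keeps it positive.
    refine hf.deriv.inv (δ := min (|B| + 1)⁻¹ (‖c‖ / 2)) (by positivity) fun t => ?_
    by_cases ht : (t : ℂ) ∈ Metric.closedBall (0 : ℂ) R
    · refine (min_le_left _ _).trans ?_
      have h2 := hB t ⟨ht, by simp⟩
      rw [Pi.inv_apply, norm_inv] at h2
      have h3 : 0 < ‖f t‖ := norm_pos_iff.2 (h t (by simp))
      rw [inv_le_comm₀ (by positivity) h3]
      linarith [le_abs_self B]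
    · exact (min_le_right _ _).trans (hR ht (by simp)).le

lemma prod {ι : Type*} (s : Finset ι) {f : ι → ℂ → ℂ}
    (hf : ∀ i ∈ s, ∃ l, UpperNice (f i) 1 l) :
    ∃ l, UpperNice (fun z => ∏ i ∈ s, f i z) 1 l := by
  classical
  induction s using Finset.induction_on with
  | empty => exact ⟨0, by simpa using const 1⟩
  | insert i s hi ih =>
    obtain ⟨l, hl⟩ := hf i (by simp)
    obtain ⟨k, hk⟩ := ih fun j hj => hf j (by simp [hj])
    refine ⟨l * 1 + 1 * k, ?_⟩
    simp only [Finset.prod_insert hi]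
    simpa using hl.mul hk

lemma exp (hf : UpperNice f 0 l) : UpperNice (fun z => Complex.exp (f z)) 1 l where
  diff := hf.diff.cexp
  cont := hf.cont.cexp
  lim := by simpa using hf.lim.cexp
  cone κ hκ := by
    -- `exp f - 1` is f times a difference quotient of exp at 0, which tends to 1 because f tends to
    -- 0.
    have hc : Tendsto (dslope Complex.exp 0) (𝓝 0) (𝓝 1) := by
      have h1 : ContinuousAt (dslope Complex.exp 0) 0 :=
        continuousAt_dslope_same.2 Complex.differentiableAt_exp
      have h2 := h1.tendsto
      rwa [dslope_same, Complex.deriv_exp, Complex.exp_zero] at h2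
    have h3 := (hf.cone κ hκ).mul (hc.comp (hf.lim.mono_left (upperCone_le hκ)))
    rw [mul_one] at h3
    refine h3.congr fun z => ?_
    have h4 := sub_smul_dslope Complex.exp 0 (f z)
    simp only [sub_zero, smul_eq_mul, Complex.exp_zero] at h4
    simp only [Function.comp, sub_zero]
    rw [mul_assoc, h4]
  deriv := by
    obtain ⟨B, hB⟩ := hf.exists_bound_real
    have hlip : LipschitzOnWith (Real.toNNReal (Real.exp B)) Complex.exp (Metric.closedBall 0 B) := by
      refine (convex_closedBall (0 : ℂ) B).lipschitzOnWith_of_nnnorm_deriv_le (𝕜 := ℂ)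
        (fun x _ => Complex.differentiableAt_exp) fun x hx => ?_
      rw [Complex.deriv_exp, ← NNReal.coe_le_coe, coe_nnnorm, Real.coe_toNNReal _ (Real.exp_pos _).le]
      refine (Complex.norm_exp_le_exp_norm x).trans (Real.exp_le_exp.2 (by simpa using hx))
    refine hf.deriv.of_le (C := Real.exp B) fun a b => ?_
    have := hlip.dist_le_mul (f b) (by simpa using hB b) (f a) (by simpa using hB a)
    rwa [dist_eq_norm, dist_eq_norm, Real.coe_toNNReal _ (Real.exp_pos _).le] at this

lemma tendsto_neg_conj_cobounded :
    Tendsto (fun z : ℂ => -conj z) (cobounded ℂ) (cobounded ℂ) := by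
  rw [← tendsto_norm_atTop_iff_cobounded]
  simpa using tendsto_norm_cobounded_atTop

/-- The reflection `z ↦ conj (f (-conj z))`. -/
lemma reflect (hf : UpperNice f c l) :
    UpperNice (fun z => conj (f (-conj z))) (conj c) (-conj l) where
  diff := by
    intro z hz
    have h1 : DifferentiableAt ℂ f (-conj z) :=
      hf.diff.differentiableAt (isOpen_upper.mem_nhds (by simpa using hz))
    have h2 : DifferentiableAt ℂ (fun w => f (-w)) (conj z) := by
      apply DifferentiableAt.comp (conj z) (g := f) h1; fun_prop
    have h3 := h2.conj_conj
    rw [Complex.conj_conj] at h3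
    exact h3.differentiableWithinAt
  cont := by
    refine continuous_conj.comp_continuousOn (hf.cont.comp (by fun_prop) fun z hz => ?_)
    simpa using hz
  lim := by
    refine (continuous_conj.tendsto c).comp (hf.lim.comp ?_)
    refine tendsto_inf.2 ⟨tendsto_neg_conj_cobounded.mono_left inf_le_left, ?_⟩
    refine tendsto_principal.2 ?_
    filter_upwards [mem_inf_of_right (mem_principal_self _)] with z hz
    simpa using hz
  cone κ hκ := by
    have h1 : Tendsto (fun z : ℂ => -conj z) (upperCone κ) (upperCone κ) := by
      refine tendsto_inf.2 ⟨tendsto_neg_conj_cobounded.mono_left inf_le_left, ?_⟩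
      refine tendsto_principal.2 ?_
      filter_upwards [mem_inf_of_right (mem_principal_self _)] with z hz
      simpa using hz
    have h2 := ((continuous_conj.tendsto l).comp ((hf.cone κ hκ).comp h1)).neg
    refine h2.congr fun z => ?_
    simp
  deriv := by
    have := hf.deriv.star.comp_neg
    simpa using this

/-- Dividing out a zero in the upper half plane. -/
lemma dslope (hf : UpperNice f c l) {w : ℂ} (hw : 0 < w.im) (h0 : f w = 0) :
    UpperNice (dslope f w) 0 c := by
  have hne : ∀ᶠ z in cobounded ℂ, z ≠ w := by
    have : ({w} : Set ℂ)ᶜ ∈ cobounded ℂ := isBounded_def.1 (isBounded_singleton)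
    exact this
  have heq : ∀ z, z ≠ w → _root_.dslope f w z = (z - w)⁻¹ * f z := fun z hz => by
    rw [dslope_of_ne _ hz, slope_def_field, h0, sub_zero, div_eq_inv_mul]
  have hinv : Tendsto (fun z : ℂ => (z - w)⁻¹) (cobounded ℂ) (𝓝 0) :=
    tendsto_inv₀_cobounded.comp (tendsto_sub_const_cobounded w)
  have hzw : Tendsto (fun z : ℂ => z * (z - w)⁻¹) (cobounded ℂ) (𝓝 1) := by
    have h1 := (hinv.const_mul w).const_add 1
    rw [mul_zero, add_zero] at h1
    refine h1.congr' ?_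
    filter_upwards [hne] with z hz
    have : z - w ≠ 0 := sub_ne_zero.2 hz
    field_simp
    ring
  have hnb : {z : ℂ | 0 < z.im} ∈ 𝓝 w := isOpen_upper.mem_nhds hw
  refine ⟨(differentiableOn_dslope hnb).2 hf.diff, ?_, ?_, ?_, ?_⟩
  · have hnb' : {z : ℂ | 0 ≤ z.im} ∈ 𝓝 w :=
      mem_of_superset hnb fun z (hz : 0 < z.im) => hz.le
    exact (continuousOn_dslope hnb').2 ⟨hf.cont, hf.diff.differentiableAt hnb⟩
  · have h1 := (hinv.mono_left (inf_le_left (b := 𝓟 {z : ℂ | 0 ≤ z.im}))).mul hf.lim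
    rw [zero_mul] at h1
    refine h1.congr' ?_
    filter_upwards [inf_le_left (a := cobounded ℂ) hne] with z hz
    rw [heq z hz]
  · intro κ hκ
    have h1 := (hzw.mono_left (inf_le_left (b := 𝓟 {z : ℂ | κ * |z.re| ≤ z.im}))).mul
      (hf.lim.mono_left (upperCone_le hκ))
    rw [one_mul] at h1
    refine h1.congr' ?_
    filter_upwards [inf_le_left (a := cobounded ℂ) hne] with z hz
    rw [heq z hz, sub_zero, mul_assoc]
  · have h1 : (fun s : ℝ => _root_.dslope f w s) = fun s : ℝ => ((s : ℂ) - w)⁻¹ * f s := by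
      ext s
      refine heq s fun h => ?_
      rw [← h] at hw
      simp at hw
    rw [h1]
    obtain ⟨B, hB⟩ := hf.exists_bound_real
    exact (hasL2Deriv_inv_sub hw.ne').mul hf.deriv (norm_inv_sub_le hw.ne') hB

end UpperNice

end

section

open scoped FourierTransform ContDiff

/-! ### The Fourier transform on `H^{1,1}` -/

lemma integral_fourier_mul_flip {f g : ℝ → ℂ} (hf : Integrable f) (hg : Integrable g) :
    ∫ ξ, 𝓕 f ξ • g ξ = ∫ x, f x • 𝓕 g x := by
  simpa using! (VectorFourier.integral_fourierIntegral_smul_eq_flip (L := innerₗ ℝ)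
    Real.continuous_fourierChar continuous_inner hf hg)

lemma continuous_fourier {f : ℝ → ℂ} (hf : Integrable f) : Continuous (𝓕 f) :=
  VectorFourier.fourierIntegral_continuous Real.continuous_fourierChar
    (by exact continuous_inner) hf

/-- Both sides define the same distribution: against a test function the transform moves to the
other factor, by `integral_fourier_mul_flip` on one side and by duality of the L² transform on the
other. -/
lemma fourier_toLp_ae {f : ℝ → ℂ} (h1 : Integrable f) (h2 : MemLp f 2 volume) :
    ((𝓕 (h2.toLp f) : Lp ℂ 2 (volume : Measure ℝ)) : ℝ → ℂ) =ᵐ[volume] 𝓕 f := by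
  apply ae_eq_of_integral_contDiff_smul_eq
  · exact (Lp.memLp _).locallyIntegrable (by norm_num)
  · exact (continuous_fourier h1).locallyIntegrable
  · intro g hg hgc
    have hg₁ : HasCompactSupport (Complex.ofRealCLM ∘ g) := hgc.comp_left rfl
    have hg₂ : ContDiff ℝ ∞ (Complex.ofRealCLM ∘ g) := by fun_prop
    set φ := hg₁.toSchwartzMap hg₂ with hφ
    have hφg : ∀ x, φ x = (g x : ℂ) := fun x => rfl
    have e1 := congrArg (fun T => T φ) (Lp.fourier_toTemperedDistribution_eq (h2.toLp f))
    simp only [TemperedDistribution.fourier_apply, Lp.toTemperedDistribution_apply] at e1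
    have e2 : ∫ x, (𝓕 φ) x • (h2.toLp f) x = ∫ x, 𝓕 (φ : ℝ → ℂ) x • f x := by
      apply integral_congr_ae
      filter_upwards [h2.coeFn_toLp] with x hx
      rw [hx, SchwartzMap.fourier_coe]
    rw [e2, integral_fourier_mul_flip φ.integrable h1] at e1
    simp only [hφg, Complex.coe_smul] at e1
    exact e1.symm

lemma fourierInv_toLp_ae {f : ℝ → ℂ} (h1 : Integrable f) (h2 : MemLp f 2 volume) :
    ((𝓕⁻ (h2.toLp f) : Lp ℂ 2 (volume : Measure ℝ)) : ℝ → ℂ) =ᵐ[volume] 𝓕⁻ f := by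
  have hinv : ∀ h : ℝ → ℂ, 𝓕⁻ h = fun x => 𝓕 h (-x) := fun h => by
    ext x; rw [Real.fourierInv_eq_fourier_neg]
  apply ae_eq_of_integral_contDiff_smul_eq
  · exact (Lp.memLp _).locallyIntegrable (by norm_num)
  · rw [hinv]
    exact ((continuous_fourier h1).comp continuous_neg).locallyIntegrable
  · intro g hg hgc
    have hg₁ : HasCompactSupport (Complex.ofRealCLM ∘ g) := hgc.comp_left rfl
    have hg₂ : ContDiff ℝ ∞ (Complex.ofRealCLM ∘ g) := by fun_prop
    set φ := hg₁.toSchwartzMap hg₂ with hφ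
    have hφg : ∀ x, φ x = (g x : ℂ) := fun x => rfl
    have e1 := congrArg (fun T => T φ) (Lp.fourierInv_toTemperedDistribution_eq (h2.toLp f))
    simp only [TemperedDistribution.fourierInv_apply, Lp.toTemperedDistribution_apply] at e1
    have e2 : ∫ x, (𝓕⁻ φ) x • (h2.toLp f) x = ∫ x, 𝓕 (φ : ℝ → ℂ) (-x) • f x := by
      apply integral_congr_ae
      filter_upwards [h2.coeFn_toLp] with x hx
      rw [hx, SchwartzMap.fourierInv_coe, hinv]
    have e3 : ∫ x, 𝓕 (φ : ℝ → ℂ) (-x) • f x = ∫ x, φ x • 𝓕 f (-x) := by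
      have e4 := integral_fourier_mul_flip h1 φ.integrable.comp_neg
      have e5 : ∀ x, 𝓕 (fun y => φ (-y)) x = 𝓕 (φ : ℝ → ℂ) (-x) := fun x => by
        rw [← Real.fourierInv_eq_fourier_neg, Real.fourierInv_eq_fourier_comp_neg]
      simp only [e5] at e4
      calc _ = ∫ x, f x • 𝓕 (φ : ℝ → ℂ) (-x) := by simp only [smul_eq_mul, mul_comm]
        _ = ∫ x, 𝓕 f x • φ (-x) := e4.symm
        _ = ∫ x, 𝓕 f (-x) • φ (- -x) := by
          rw [← integral_neg_eq_self (fun x => 𝓕 f x • φ (-x))]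
        _ = _ := by simp only [smul_eq_mul, mul_comm, neg_neg]
    rw [e2, e3] at e1
    simp only [hφg, Complex.coe_smul] at e1
    rw [hinv]
    exact e1.symm

lemma eLpNorm_fourier {f : ℝ → ℂ} (h1 : Integrable f) (h2 : MemLp f 2 volume) :
    eLpNorm (𝓕 f) 2 volume = eLpNorm f 2 volume := by
  rw [← eLpNorm_congr_ae (fourier_toLp_ae h1 h2), ← eLpNorm_congr_ae h2.coeFn_toLp,
    ← ENNReal.toReal_eq_toReal_iff' (Lp.eLpNorm_ne_top _) (Lp.eLpNorm_ne_top _),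
    ← Lp.norm_def, ← Lp.norm_def, Lp.norm_fourier_eq]

lemma memLp_fourier {f : ℝ → ℂ} (h1 : Integrable f) (h2 : MemLp f 2 volume) :
    MemLp (𝓕 f) 2 volume :=
  ⟨(continuous_fourier h1).aestronglyMeasurable, by rw [eLpNorm_fourier h1 h2]; exact h2.2⟩

/-- The Fourier transform of an integrable function with square integrable first moment has a
square integrable derivative. -/
lemma hasL2Deriv_fourier {f : ℝ → ℂ} (h1 : Integrable f)
    (h2 : MemLp (fun x : ℝ => (x : ℂ) * f x) 2 volume) : HasL2Deriv (𝓕 f) := by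
  have hk : MemLp (fun x : ℝ => (-2 * Real.pi * I : ℂ) * ((x : ℂ) * f x)) 2 volume := h2.const_mul _
  set k : Lp ℂ 2 (volume : Measure ℝ) := hk.toLp _ with hkdef
  refine ⟨(𝓕 k : Lp ℂ 2 (volume : Measure ℝ)), Lp.memLp _, ?_⟩
  -- The function x f(x) need not be integrable, so one cannot differentiate under the integral.
  -- Instead the integral over (a, b] of the L² transform of -2πi x f is an inner product with an
  -- indicator. Plancherel moves the transform onto the indicator, where the factor x cancels.
  have key : ∀ a b : ℝ, a ≤ b → 𝓕 f b - 𝓕 f a =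
      ∫ t in a..b, ((𝓕 k : Lp ℂ 2 (volume : Measure ℝ)) : ℝ → ℂ) t := by
    intro a b hab
    have hs : MeasurableSet (Set.Ioc a b) := measurableSet_Ioc
    have hsf : volume (Set.Ioc a b) ≠ ⊤ := by simp
    set χ : Lp ℂ 2 (volume : Measure ℝ) := indicatorConstLp 2 hs hsf (1 : ℂ) with hχ
    have e1 : ∫ t in a..b, ((𝓕 k : Lp ℂ 2 (volume : Measure ℝ)) : ℝ → ℂ) t = inner ℂ χ (𝓕 k) := by
      rw [intervalIntegral.integral_of_le hab, hχ, L2.inner_indicatorConstLp_one]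
    have e2 : inner ℂ χ (𝓕 k) = inner ℂ (𝓕⁻ χ) k := by
      rw [← Lp.inner_fourier_eq (𝓕⁻ χ) k, FourierTransform.fourier_fourierInv_eq]
    set χ₀ : ℝ → ℂ := Set.indicator (Set.Ioc a b) fun _ => 1 with hχ₀
    have hχi : Integrable χ₀ := (integrable_indicator_iff hs).2 (by simp)
    have hχ2 : MemLp χ₀ 2 volume := memLp_indicator_const 2 hs 1 (Or.inr hsf)
    have e3 : ((𝓕⁻ χ : Lp ℂ 2 (volume : Measure ℝ)) : ℝ → ℂ) =ᵐ[volume] 𝓕⁻ χ₀ :=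
      fourierInv_toLp_ae hχi hχ2
    have e4 : ∀ x : ℝ, conj (𝓕⁻ χ₀ x) * ((-2 * Real.pi * I : ℂ) * ((x : ℂ) * f x)) =
        Complex.exp ((-2 * Real.pi * x * b : ℝ) * I) * f x - Complex.exp ((-2 * Real.pi * x * a : ℝ) * I) * f x := by
      intro x
      have e5 : 𝓕⁻ χ₀ x = ∫ t in a..b, Complex.exp ((2 * Real.pi * x * I) * t) := by
        rw [Real.fourierInv_eq', intervalIntegral.integral_of_le hab, ← integral_indicator hs]
        congr 1
        ext t
        by_cases ht : t ∈ Set.Ioc a b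
        · simp only [hχ₀, Set.indicator_of_mem ht, smul_eq_mul, mul_one]
          congr 1
          simp
          ring
        · simp only [hχ₀, Set.indicator_of_notMem ht, smul_zero]
      by_cases hx : x = 0
      · subst hx; simp
      · have hc : (2 * Real.pi * x * I : ℂ) ≠ 0 := by simp [hx, Real.pi_ne_zero]
        rw [e5, integral_exp_mul_complex hc, map_div₀, map_sub, ← Complex.exp_conj, ← Complex.exp_conj]
        simp only [map_mul, conj_ofReal, conj_I, map_ofNat]
        have hc2 : (2 * Real.pi * x * -I : ℂ) ≠ 0 := by simp [hx, Real.pi_ne_zero]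
        rw [div_mul_eq_mul_div, div_eq_iff hc2]
        push_cast
        ring_nf
    have hexp : ∀ c : ℝ, Integrable fun x : ℝ => Complex.exp ((-2 * Real.pi * x * c : ℝ) * I) * f x := by
      intro c
      refine h1.bdd_mul (c := 1) (by fun_prop) (Eventually.of_forall fun x => ?_)
      rw [Complex.norm_exp_ofReal_mul_I]
    have hF : ∀ c : ℝ, 𝓕 f c = ∫ x : ℝ, Complex.exp ((-2 * Real.pi * x * c : ℝ) * I) * f x := by
      intro c
      rw [Real.fourier_real_eq_integral_exp_smul]
      rfl
    rw [e1, e2, L2.inner_def, hF, hF, ← integral_sub (hexp b) (hexp a)]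
    apply integral_congr_ae
    filter_upwards [e3, hk.coeFn_toLp] with x hx hx2
    rw [hx, hkdef, hx2, ← e4 x, RCLike.inner_apply, mul_comm]
  intro a b
  rcases le_total a b with hab | hab
  · exact key a b hab
  · rw [intervalIntegral.integral_symm, ← key b a hab]; ring

/-- Young's inequality for an L¹ and an L² factor: Cauchy–Schwarz for the measure c dt, then Tonelli
and translation invariance. -/
lemma lintegral_sq_translate_le {c k : ℝ → ENNReal} (hc : Measurable c) (hk : Measurable k) :
    ∫⁻ x, (∫⁻ t, c t * k (x + t)) ^ 2 ≤ (∫⁻ t, c t) ^ 2 * ∫⁻ y, k y ^ 2 := by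
  have hcs : ∀ x, (∫⁻ t, c t * k (x + t)) ^ 2 ≤ (∫⁻ t, c t) * ∫⁻ t, c t * k (x + t) ^ 2 := by
    intro x
    have hkx : Measurable fun t => k (x + t) := hk.comp (measurable_const_add x)
    have h1 := ENNReal.lintegral_mul_le_Lp_mul_Lq (volume.withDensity c)
      Real.HolderConjugate.two_two (f := fun _ => 1) (g := fun t => k (x + t)) (by fun_prop)
      hkx.aemeasurable
    simp only [Pi.mul_apply, one_mul, ENNReal.one_rpow] at h1
    rw [lintegral_withDensity_eq_lintegral_mul _ hc hkx,
      lintegral_withDensity_eq_lintegral_mul _ hc measurable_const,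
      lintegral_withDensity_eq_lintegral_mul _ hc (by fun_prop)] at h1
    simp only [Pi.mul_apply, mul_one, ENNReal.rpow_ofNat] at h1
    calc _ ≤ ((∫⁻ t, c t) ^ (1 / 2 : ℝ) * (∫⁻ t, c t * k (x + t) ^ 2) ^ (1 / 2 : ℝ)) ^ 2 := by
          gcongr
      _ = _ := by
        rw [mul_pow, ← ENNReal.rpow_natCast, ← ENNReal.rpow_mul, ← ENNReal.rpow_natCast,
          ← ENNReal.rpow_mul]
        norm_num
  calc _ ≤ ∫⁻ x, (∫⁻ t, c t) * ∫⁻ t, c t * k (x + t) ^ 2 := lintegral_mono hcs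
    _ = (∫⁻ t, c t) * ∫⁻ x, ∫⁻ t, c t * k (x + t) ^ 2 :=
        lintegral_const_mul _ (Measurable.lintegral_prod_right (by fun_prop))
    _ = (∫⁻ t, c t) * ∫⁻ t, ∫⁻ x, c t * k (x + t) ^ 2 := by
        rw [lintegral_lintegral_swap (by fun_prop)]
    _ = (∫⁻ t, c t) * ∫⁻ t, c t * ∫⁻ y, k y ^ 2 := by
        congr 1
        refine lintegral_congr fun t => ?_
        rw [lintegral_const_mul _ (by fun_prop), lintegral_add_right_eq_self (fun x => k x ^ 2) t]
    _ = _ := by rw [lintegral_mul_const _ hc, pow_two, mul_assoc]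

lemma eLpNorm_two_sq {E : Type*} [NormedAddCommGroup E] (f : ℝ → E) (μ : Measure ℝ) :
    eLpNorm f 2 μ ^ 2 = ∫⁻ x, ‖f x‖ₑ ^ 2 ∂μ := by
  have := eLpNorm_nnreal_pow_eq_lintegral (f := f) (μ := μ) (p := 2) (by norm_num)
  simpa using this

/-- The increment over a step h is the correlation of g with the indicator of (0, h], which has mass
h. -/
lemma eLpNorm_translate_sub_le {f g : ℝ → ℂ} (hg : MemLp g 2 volume)
    (hfg : ∀ a b : ℝ, f b - f a = ∫ t in a..b, g t) {h : ℝ} (hh : 0 ≤ h) :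
    eLpNorm (fun x => f (x + h) - f x) 2 volume ≤ ENNReal.ofReal h * eLpNorm g 2 volume := by
  obtain ⟨G, hG, hgG⟩ := hg.1
  have h1 : ∀ x, ‖f (x + h) - f x‖ₑ ≤ ∫⁻ t, (Set.Ioc 0 h).indicator (fun _ => 1) t * ‖G (x + t)‖ₑ := by
    intro x
    rw [hfg, intervalIntegral.integral_congr_ae (g := G) (by filter_upwards [hgG] with t ht _ using ht)]
    have e1 : ∫ t in x..x + h, G t = ∫ t in (0 : ℝ)..h, G (x + t) := by
      rw [intervalIntegral.integral_comp_add_left (fun t => G t), add_zero]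
    rw [e1, intervalIntegral.integral_of_le hh]
    refine (enorm_integral_le_lintegral_enorm _).trans ?_
    rw [← lintegral_indicator measurableSet_Ioc]
    refine lintegral_mono fun t => ?_
    by_cases ht : t ∈ Set.Ioc 0 h <;> simp [ht]
  have h2 := lintegral_sq_translate_le (c := (Set.Ioc 0 h).indicator (fun _ => 1))
    (k := fun y => ‖G y‖ₑ) (measurable_const.indicator measurableSet_Ioc) hG.measurable.enorm
  rw [lintegral_indicator measurableSet_Ioc] at h2
  simp only [lintegral_const, Measure.restrict_apply MeasurableSet.univ, Set.univ_inter,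
    Real.volume_Ioc, sub_zero, one_mul] at h2
  rw [← ENNReal.pow_le_pow_left_iff two_ne_zero, mul_pow, eLpNorm_congr_ae hgG, eLpNorm_two_sq,
    eLpNorm_two_sq]
  refine le_trans (lintegral_mono fun x => ?_) h2
  gcongr
  exact h1 x

lemma MemH11.fourier {f : ℝ → ℂ} (hf : MemH11 f) : MemH11 (𝓕 f) := by
  have h1 := hf.integrable
  refine ⟨memLp_fourier h1 hf.1, ?_, hasL2Deriv_fourier h1 hf.2.1⟩
  obtain ⟨g, hg, hfg⟩ := hf.2.2
  have hc := continuous_fourier h1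
  refine ⟨by fun_prop, ?_⟩
  -- Transforms of difference quotients with step 1/(n+1). Their L² norms are at most that of g by
  -- Plancherel, they converge pointwise to `2πiξ 𝓕 f ξ`, and Fatou's lemma bounds the limit.
  set F : ℕ → ℝ → ℂ := fun n ξ =>
    ((n : ℂ) + 1) * 𝓕 (fun x => f (x + ((n : ℝ) + 1)⁻¹) - f x) ξ with hF
  have hn0 : ∀ n : ℕ, (0 : ℝ) < ((n : ℝ) + 1)⁻¹ := fun n => by positivity
  have hfi : ∀ h : ℝ, Integrable fun x => f (x + h) := fun h => h1.comp_add_right h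
  have hf2 : ∀ h : ℝ, MemLp (fun x => f (x + h)) 2 volume := fun h =>
    hf.1.comp_measurePreserving (measurePreserving_add_right volume h)
  have hshift : ∀ (h ξ : ℝ), 𝓕 (fun x => f (x + h) - f x) ξ =
      (Complex.exp (2 * Real.pi * ξ * I * h) - 1) * 𝓕 f ξ := by
    intro h ξ
    rw [sub_mul, one_mul]
    have e1 : 𝓕 (fun x => f (x + h)) ξ = Complex.exp (2 * Real.pi * ξ * I * h) * 𝓕 f ξ := by
      have := congrFun (VectorFourier.fourierIntegral_comp_add_right Real.fourierChar volume
        (innerₗ ℝ) f h) ξ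
      rw [Circle.smul_def, Real.fourierChar_apply, smul_eq_mul] at this
      simp only [innerₗ_apply_apply, RCLike.inner_apply, conj_trivial] at this
      rw [show (2 * Real.pi * ξ * I * h : ℂ) = ((2 * Real.pi * (ξ * h) : ℝ) : ℂ) * I by
        push_cast; ring]
      exact this
    rw [← e1, Real.fourier_eq, Real.fourier_eq, Real.fourier_eq, ← integral_sub
      ((Real.fourierIntegral_convergent_iff ξ).2 (hfi h))
      ((Real.fourierIntegral_convergent_iff ξ).2 h1)]
    simp only [smul_sub]
  have hlim : ∀ ξ : ℝ, Tendsto (fun n => F n ξ) atTop (𝓝 (2 * Real.pi * I * (ξ * 𝓕 f ξ))) := by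
    intro ξ
    have hd : HasDerivAt (fun h : ℝ => Complex.exp (2 * Real.pi * ξ * I * h))
        (2 * Real.pi * ξ * I) 0 := by
      have h2 : HasDerivAt (fun h : ℂ => Complex.exp (2 * Real.pi * ξ * I * h))
          (Complex.exp (2 * Real.pi * ξ * I * ((0 : ℝ) : ℂ)) * (2 * Real.pi * ξ * I * 1)) ((0 : ℝ) : ℂ) :=
        ((hasDerivAt_id _).const_mul _).cexp
      simpa using h2.comp_ofReal
    have h2 := hasDerivAt_iff_tendsto_slope_zero.1 hd
    have h3 : Tendsto (fun n : ℕ => ((n : ℝ) + 1)⁻¹) atTop (𝓝[≠] 0) := by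
      refine tendsto_nhdsWithin_iff.2 ⟨?_, Eventually.of_forall fun n => (hn0 n).ne'⟩
      simpa using tendsto_one_div_add_atTop_nhds_zero_nat (𝕜 := ℝ)
    have h4 := (h2.comp h3).mul_const (𝓕 f ξ)
    rw [show (2 * Real.pi * I * (ξ * 𝓕 f ξ) : ℂ) = 2 * Real.pi * ξ * I * 𝓕 f ξ by ring]
    refine h4.congr fun n => ?_
    simp only [Function.comp, hF, hshift]
    simp [mul_assoc]
  have hle : ∀ n, eLpNorm (F n) 2 volume ≤ eLpNorm g 2 volume := by
    intro n
    have e1 : eLpNorm (F n) 2 volume = ‖((n : ℂ) + 1)‖ₑ * eLpNorm (𝓕 fun x => f (x + ((n : ℝ) + 1)⁻¹) - f x) 2 volume :=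
      eLpNorm_const_smul ((n : ℂ) + 1) _ _ _
    rw [e1, eLpNorm_fourier (f := fun x => f (x + ((n : ℝ) + 1)⁻¹) - f x) ((hfi _).sub h1)
      ((hf2 _).sub hf.1)]
    refine (mul_le_mul_right (eLpNorm_translate_sub_le hg hfg (hn0 n).le) _).trans (le_of_eq ?_)
    have e2 : ‖((n : ℂ) + 1)‖ₑ = ENNReal.ofReal ((n : ℝ) + 1) := by
      rw [← ofReal_norm]
      congr 1
      rw [show ((n : ℂ) + 1) = (((n : ℝ) + 1 : ℝ) : ℂ) by push_cast; rfl, Complex.norm_real,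
        Real.norm_of_nonneg (by positivity)]
    rw [e2, ← mul_assoc, ← ENNReal.ofReal_mul (by positivity), mul_inv_cancel₀ (by positivity),
      ENNReal.ofReal_one, one_mul]
  have h3 : eLpNorm (fun ξ : ℝ => 2 * Real.pi * I * (ξ * 𝓕 f ξ)) 2 volume ≤ eLpNorm g 2 volume := by
    refine (Lp.eLpNorm_lim_le_liminf_eLpNorm (f := F) (fun n => ?_) _
      (Eventually.of_forall hlim)).trans ?_
    · exact (continuous_const.mul (continuous_fourier ((hfi _).sub h1))).aestronglyMeasurable
    · refine (liminf_le_liminf (Eventually.of_forall hle)).trans ?_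
      simp
  have h4 : eLpNorm (fun ξ : ℝ => 2 * Real.pi * I * (ξ * 𝓕 f ξ)) 2 volume =
      ‖(2 * Real.pi * I : ℂ)‖ₑ * eLpNorm (fun ξ : ℝ => (ξ : ℂ) * 𝓕 f ξ) 2 volume :=
    eLpNorm_const_smul (2 * Real.pi * I : ℂ) _ _ _
  have h5 : ‖(2 * Real.pi * I : ℂ)‖ₑ ≠ 0 := by simp [Real.pi_ne_zero]
  rw [h4] at h3
  by_contra h6
  rw [not_lt, top_le_iff] at h6
  rw [h6, ENNReal.mul_top h5, top_le_iff] at h3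
  exact hg.2.ne h3

end

/-! ### Fourier transforms of half-line amplitudes -/

section

open scoped FourierTransform ContDiff

/-- Amplitudes on the half-line `(0, ∞)`: continuous, bounded and integrable, with square integrable
first moment. Values at negative arguments are irrelevant. -/
structure HalfNice (a : ℝ → ℂ) : Prop where
  cont : Continuous a
  bound : ∃ B, ∀ y, 0 ≤ y → ‖a y‖ ≤ B
  int : IntegrableOn a (Set.Ioi 0)
  wt : MemLp (fun y : ℝ => (y : ℂ) * a y) 2 (volume.restrict (Set.Ioi 0))

/-- The Fourier transform of an amplitude on the half-line. -/
def halfFT (a : ℝ → ℂ) (z : ℂ) : ℂ := ∫ y in Set.Ioi (0 : ℝ), a y * exp (I * z * y)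

lemma norm_exp_I_mul_mul (z : ℂ) (y : ℝ) : ‖exp (I * z * y)‖ = Real.exp (-(z.im * y)) := by
  rw [norm_exp]; simp

lemma norm_exp_I_mul_mul_le {z : ℂ} (hz : 0 ≤ z.im) {y : ℝ} (hy : 0 ≤ y) :
    ‖exp (I * z * y)‖ ≤ 1 := by
  rw [norm_exp_I_mul_mul]
  exact Real.exp_le_one_iff.2 (by have := mul_nonneg hz hy; linarith)

lemma halfFT_eq_fourier (a : ℝ → ℂ) (s : ℝ) :
    halfFT a s = 𝓕 ((Set.Ioi (0 : ℝ)).indicator a) (-(2 * Real.pi)⁻¹ * s) := by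
  rw [halfFT, Real.fourier_eq', ← integral_indicator measurableSet_Ioi]
  refine integral_congr_ae (.of_forall fun y => ?_)
  by_cases hy : y ∈ Set.Ioi (0 : ℝ)
  · simp only [Set.indicator_of_mem hy, smul_eq_mul]
    rw [mul_comm]
    congr 2
    have : (Real.pi : ℂ) ≠ 0 := by exact_mod_cast Real.pi_ne_zero
    simp
    field_simp
  · simp [Set.indicator_of_notMem hy]

namespace HalfNice

variable {a : ℝ → ℂ}

lemma indicator_integrable (ha : HalfNice a) : Integrable ((Set.Ioi (0 : ℝ)).indicator a) :=
  ha.int.integrable_indicator measurableSet_Ioi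

lemma norm_halfFT_le {a : ℝ → ℂ} (ha : IntegrableOn a (Set.Ioi 0)) {z : ℂ} (hz : 0 ≤ z.im) :
    ‖halfFT a z‖ ≤ ∫ y in Set.Ioi (0 : ℝ), ‖a y‖ := by
  refine norm_integral_le_of_norm_le ha.norm ?_
  refine (ae_restrict_iff' measurableSet_Ioi).2 (.of_forall fun y hy => ?_)
  rw [norm_mul]
  exact mul_le_of_le_one_right (norm_nonneg _) (norm_exp_I_mul_mul_le hz (le_of_lt hy))

lemma integrableOn_mul_exp {a : ℝ → ℂ} (ha : IntegrableOn a (Set.Ioi 0)) {z : ℂ} (hz : 0 ≤ z.im) :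
    IntegrableOn (fun y : ℝ => a y * exp (I * z * y)) (Set.Ioi 0) := by
  refine Integrable.mono ha (ha.aestronglyMeasurable.mul
    (show Continuous fun y : ℝ => exp (I * z * y) by fun_prop).aestronglyMeasurable) ?_
  refine (ae_restrict_iff' measurableSet_Ioi).2 (.of_forall fun y hy => ?_)
  rw [norm_mul]
  exact mul_le_of_le_one_right (norm_nonneg _) (norm_exp_I_mul_mul_le hz (le_of_lt hy))

lemma halfFT_sub {a b : ℝ → ℂ} (ha : IntegrableOn a (Set.Ioi 0)) (hb : IntegrableOn b (Set.Ioi 0))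
    {z : ℂ} (hz : 0 ≤ z.im) : halfFT (fun y => a y - b y) z = halfFT a z - halfFT b z := by
  simp only [halfFT, sub_mul]
  exact integral_sub (integrableOn_mul_exp ha hz) (integrableOn_mul_exp hb hz)

/-- One integration by parts, with boundary term b(0), gives the bound O(1/|z|) uniformly in the
closed upper half plane. -/
lemma halfFT_tendsto_zero_of_smooth {b : ℝ → ℂ} (hb : HasCompactSupport b) (hs : ContDiff ℝ ∞ b) :
    Tendsto (halfFT b) upperInfty (𝓝 0) := by
  have hs1 : ContDiff ℝ 1 b := hs.of_le (by exact_mod_cast le_top)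
  have hbi : IntegrableOn b (Set.Ioi 0) :=
    (hs.continuous.integrable_of_hasCompactSupport hb).integrableOn
  have hdi : IntegrableOn (deriv b) (Set.Ioi 0) :=
    ((hs1.continuous_deriv le_rfl).integrable_of_hasCompactSupport hb.deriv).integrableOn
  set M := ‖b 0‖ + ∫ y in Set.Ioi (0 : ℝ), ‖deriv b y‖ with hM
  have key : ∀ z : ℂ, 0 ≤ z.im → z ≠ 0 → ‖halfFT b z‖ ≤ M * ‖z‖⁻¹ := by
    intro z hz hz0
    have hE : ContDiff ℝ 1 fun y : ℝ => exp (I * z * y) := by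
      have : ContDiff ℝ 1 fun y : ℝ => (y : ℂ) := ofRealCLM.contDiff
      fun_prop
    have hder : ∀ y : ℝ, HasDerivAt (fun y : ℝ => exp (I * z * y)) (exp (I * z * y) * (I * z)) y := by
      intro y
      refine HasDerivAt.cexp ?_
      simpa using (hasDerivAt_id y).ofReal_comp.const_mul (I * z)
    have h1 := (hb.mul_right (f' := fun y : ℝ => exp (I * z * y))).integral_Ioi_deriv_eq
      (hs1.mul hE) 0
    have h2 : deriv (fun y : ℝ => b y * exp (I * z * y)) =
        fun y => deriv b y * exp (I * z * y) + (I * z) * (b y * exp (I * z * y)) := by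
      ext y
      rw [((hs1.differentiable one_ne_zero y).hasDerivAt.fun_mul (hder y)).deriv]
      ring
    rw [h2, integral_add (integrableOn_mul_exp hdi hz) ((integrableOn_mul_exp hbi hz).const_mul _),
      integral_const_mul] at h1
    change halfFT (deriv b) z + I * z * halfFT b z = _ at h1
    simp only [ofReal_zero, mul_zero, exp_zero, mul_one] at h1
    have h3 : ‖z‖ * ‖halfFT b z‖ ≤ M := by
      have : ‖z‖ * ‖halfFT b z‖ = ‖-b 0 - halfFT (deriv b) z‖ := by
        rw [← norm_mul, ← h1, add_sub_cancel_left, mul_assoc, norm_mul I, norm_I, one_mul]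
      rw [this]
      refine (norm_sub_le _ _).trans ?_
      rw [norm_neg, hM]
      gcongr
      exact norm_halfFT_le hdi hz
    rwa [← div_eq_mul_inv, le_div_iff₀ (norm_pos_iff.2 hz0), mul_comm]
  have h0 : Tendsto (fun z : ℂ => M * ‖z‖⁻¹) upperInfty (𝓝 0) := by
    have := (tendsto_norm_cobounded_atTop (E := ℂ)).inv_tendsto_atTop.const_mul M
    rw [mul_zero] at this
    exact this.mono_left inf_le_left
  refine squeeze_zero_norm' ?_ h0
  have hup : ∀ᶠ z : ℂ in upperInfty, 0 ≤ z.im := mem_inf_of_right (mem_principal_self _)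
  have hne : ∀ᶠ z : ℂ in upperInfty, z ≠ 0 := mem_inf_of_left (eventually_ne_cobounded (0 : ℂ))
  filter_upwards [hup, hne] with z h1 h2 using key z h1 h2

/-- The Riemann–Lebesgue lemma, uniformly in the closed upper half plane: since |e^{izy}| ≤ 1 there,
approximating the amplitude in L¹ by a smooth one costs no more than the L¹ error. -/
lemma tendsto_zero (ha : HalfNice a) : Tendsto (halfFT a) upperInfty (𝓝 0) := by
  rw [Metric.tendsto_nhds]
  intro ε hε
  obtain ⟨b, hb, hs, hab⟩ := MemLp.exist_eLpNorm_sub_le (p := 1) (by simp) le_rfl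
    (memLp_one_iff_integrable.2 ha.indicator_integrable) (half_pos hε)
  have hbi : Integrable b := hs.continuous.integrable_of_hasCompactSupport hb
  have h := Metric.tendsto_nhds.1 (halfFT_tendsto_zero_of_smooth hb hs) _ (half_pos hε)
  have hup : ∀ᶠ z : ℂ in upperInfty, 0 ≤ z.im := mem_inf_of_right (mem_principal_self _)
  filter_upwards [h, hup] with z hz hz0
  rw [dist_zero_right] at hz ⊢
  have e1 : ∫ y in Set.Ioi (0 : ℝ), ‖a y - b y‖ ≤ ε / 2 := by
    have h1 : Integrable ((Set.Ioi (0 : ℝ)).indicator a - b) := ha.indicator_integrable.sub hbi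
    have h2 : ∫ y, ‖((Set.Ioi (0 : ℝ)).indicator a - b) y‖ ≤ ε / 2 := by
      rw [integral_norm_eq_lintegral_enorm h1.1, ← eLpNorm_one_eq_lintegral_enorm]
      exact ENNReal.toReal_le_of_le_ofReal (by positivity) hab
    refine le_trans (le_trans (le_of_eq ?_) (setIntegral_le_integral (s := Set.Ioi (0 : ℝ)) h1.norm
      (.of_forall fun _ => norm_nonneg _))) h2
    refine setIntegral_congr_fun measurableSet_Ioi fun y hy => ?_
    simp only [Pi.sub_apply, Set.indicator_of_mem hy]
  have e2 := (norm_halfFT_le (ha.int.sub hbi.integrableOn) hz0).trans e1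
  have e3 := halfFT_sub ha.int hbi.integrableOn hz0
  calc ‖halfFT a z‖ = ‖halfFT (fun y => a y - b y) z + halfFT b z‖ := by rw [e3]; ring_nf
    _ ≤ _ := norm_add_le _ _
    _ < ε := by simp only [Pi.sub_def] at e2; linarith

lemma continuousOn (ha : HalfNice a) : ContinuousOn (halfFT a) {z | 0 ≤ z.im} := by
  refine continuousOn_of_dominated (bound := fun y => ‖a y‖) ?_ ?_ ha.int.norm ?_
  · intro z _
    exact ha.int.aestronglyMeasurable.mul (by fun_prop)
  · intro z hz
    refine (ae_restrict_iff' measurableSet_Ioi).2 (.of_forall fun y hy => ?_)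
    rw [norm_mul]
    exact mul_le_of_le_one_right (norm_nonneg _) (norm_exp_I_mul_mul_le hz (le_of_lt hy))
  · exact .of_forall fun y => by fun_prop

lemma differentiableOn (ha : HalfNice a) : DifferentiableOn ℂ (halfFT a) {z | 0 < z.im} := by
  intro z hz
  have hz : 0 < z.im := hz
  obtain ⟨B, hB⟩ := ha.bound
  have hs : {w : ℂ | z.im / 2 < w.im} ∈ 𝓝 z :=
    (isOpen_lt continuous_const continuous_im).mem_nhds (half_lt_self hz)
  -- For Im w > Im z / 2 the bound `y e^{-y Im w} ≤ 2 / Im z` follows from `1 + u ≤ e^u`, so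
  -- integrability of a is enough to differentiate under the integral.
  have hint : IntegrableOn (fun y : ℝ => ‖a y‖ * (2 / z.im)) (Set.Ioi 0) := ha.int.norm.mul_const _
  refine (hasDerivAt_integral_of_dominated_loc_of_deriv_le
    (F := fun w (y : ℝ) => a y * exp (I * w * y)) (F' := fun w (y : ℝ) => a y * (exp (I * w * y) * (I * y)))
    hs (.of_forall fun w => ha.int.aestronglyMeasurable.mul (by fun_prop))
    (integrableOn_mul_exp ha.int hz.le) (ha.int.aestronglyMeasurable.mul (by fun_prop)) ?_ hint
    ?_).2.differentiableAt.differentiableWithinAt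
  · refine (ae_restrict_iff' measurableSet_Ioi).2 (.of_forall fun y hy w hw => ?_)
    have hw : z.im / 2 < w.im := hw
    have hy : 0 < y := hy
    rw [norm_mul]
    gcongr
    rw [norm_mul, norm_exp_I_mul_mul]
    simp only [norm_mul, norm_I, one_mul, norm_real, Real.norm_eq_abs, abs_of_pos hy]
    rw [Real.exp_neg, inv_mul_le_iff₀ (Real.exp_pos _)]
    have h1 := Real.add_one_le_exp (w.im * y)
    have h2 : y ≤ (w.im * y) * (2 / z.im) := by
      rw [mul_div_assoc', le_div_iff₀ hz]; nlinarith
    refine h2.trans ?_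
    gcongr
    linarith
  · refine .of_forall fun y w _ => ?_
    refine HasDerivAt.const_mul _ (HasDerivAt.cexp ?_)
    simpa using ((hasDerivAt_id w).const_mul I).mul_const (y : ℂ)

lemma hasL2Deriv_halfFT (ha : HalfNice a) : HasL2Deriv fun s : ℝ => halfFT a s := by
  simp only [halfFT_eq_fourier]
  refine HasL2Deriv.comp_mul_left (f := 𝓕 ((Set.Ioi (0 : ℝ)).indicator a))
    (hasL2Deriv_fourier ha.indicator_integrable ?_) (by simp [Real.pi_ne_zero])
  have h := (memLp_indicator_iff_restrict (μ := (volume : Measure ℝ))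
    (measurableSet_Ioi (a := (0 : ℝ)))).2 ha.wt
  refine h.ae_eq (.of_forall fun y => ?_)
  by_cases hy : y ∈ Set.Ioi (0 : ℝ)
  · simp only [Set.indicator_of_mem hy]
  · simp only [Set.indicator_of_notMem hy, mul_zero]

/-- As ∫ e^{izy} dy = i/z over (0, ∞), the coefficient of 1/z is `I * a 0` up to the error z ∫ (a(y)
- a(0)) e^{izy} dy. In a cone |e^{izy}| ≤ e^{-c|z|y}; the substitution y = t/|z| and dominated
convergence at the continuity point 0 make the error vanish. -/
lemma upperNice (ha : HalfNice a) : UpperNice (halfFT a) 0 (I * a 0) where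
  diff := ha.differentiableOn
  cont := ha.continuousOn
  lim := ha.tendsto_zero
  deriv := ha.hasL2Deriv_halfFT
  cone := by
    intro κ hκ
    obtain ⟨B, hB⟩ := ha.bound
    -- In the cone |z| ≤ |Re z| + Im z ≤ (1/κ + 1) Im z.
    set c : ℝ := (1 / κ + 1)⁻¹ with hc
    have hcpos : 0 < c := by positivity
    have him : ∀ z : ℂ, κ * |z.re| ≤ z.im → c * ‖z‖ ≤ z.im := by
      intro z hz
      have h1 : |z.re| ≤ z.im / κ := by rw [le_div_iff₀ hκ]; linarith
      have h0 : 0 ≤ z.im := le_trans (by positivity) hz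
      have h2 := Complex.norm_le_abs_re_add_abs_im z
      rw [abs_of_nonneg h0] at h2
      rw [hc, inv_mul_le_iff₀ (by positivity)]
      calc ‖z‖ ≤ z.im / κ + z.im := by linarith
        _ = _ := by ring
    have hei : IntegrableOn (fun t : ℝ => Real.exp (-c * t)) (Set.Ioi 0) :=
      exp_neg_integrableOn_Ioi 0 hcpos
    have hΦ : Tendsto (fun R : ℝ => ∫ t in Set.Ioi (0 : ℝ), ‖a (t / R) - a 0‖ * Real.exp (-c * t))
        atTop (𝓝 (∫ t in Set.Ioi (0 : ℝ), 0)) := by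
      refine tendsto_integral_filter_of_dominated_convergence
        (fun t => (B + B) * Real.exp (-c * t)) ?_ ?_ (hei.const_mul _) ?_
      · refine .of_forall fun R => Continuous.aestronglyMeasurable ?_
        have := ha.cont
        fun_prop
      · filter_upwards [eventually_gt_atTop 0] with R hR
        refine (ae_restrict_iff' measurableSet_Ioi).2 (.of_forall fun t ht => ?_)
        have ht : 0 < t := ht
        rw [Real.norm_eq_abs, abs_of_nonneg (by positivity)]
        gcongr
        exact (norm_sub_le _ _).trans (add_le_add (hB _ (by positivity)) (hB _ le_rfl))
      · refine .of_forall fun t => ?_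
        have h1 : Tendsto (fun R : ℝ => a (t / R)) atTop (𝓝 (a 0)) :=
          (ha.cont.tendsto 0).comp (tendsto_const_nhds.div_atTop tendsto_id)
        have h2 := ((h1.sub_const (a 0)).norm).mul_const (Real.exp (-c * t))
        simpa using h2
    simp only [integral_zero] at hΦ
    have hΦ2 : Tendsto (fun z : ℂ => ∫ t in Set.Ioi (0 : ℝ), ‖a (t / ‖z‖) - a 0‖ * Real.exp (-c * t))
        (upperCone κ) (𝓝 0) :=
      hΦ.comp (tendsto_norm_cobounded_atTop.mono_left inf_le_left)
    have hcone : ∀ᶠ z : ℂ in upperCone κ, κ * |z.re| ≤ z.im :=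
      mem_inf_of_right (mem_principal_self _)
    have hne : ∀ᶠ z : ℂ in upperCone κ, z ≠ 0 :=
      mem_inf_of_left (by
        have := (eventually_ne_cobounded (0 : ℂ)); exact this)
    rw [tendsto_iff_norm_sub_tendsto_zero]
    refine squeeze_zero' (.of_forall fun _ => norm_nonneg _) ?_ hΦ2
    filter_upwards [hcone, hne] with z hz hz0
    have hn : 0 < ‖z‖ := norm_pos_iff.2 hz0
    have hi := him z hz
    have hipos : 0 < z.im := lt_of_lt_of_le (by positivity) hi
    have hre : (I * z).re < 0 := by simpa using hipos
    have hc0 : IntegrableOn (fun y : ℝ => a 0 * exp (I * z * y)) (Set.Ioi 0) :=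
      (integrableOn_exp_mul_complex_Ioi hre 0).const_mul _
    have e1 : z * (halfFT a z - 0) - I * a 0 =
        z * ∫ y in Set.Ioi (0 : ℝ), (a y - a 0) * exp (I * z * y) := by
      have : ∫ y in Set.Ioi (0 : ℝ), (a y - a 0) * exp (I * z * y) =
          halfFT a z - a 0 * (-exp (I * z * (0 : ℝ)) / (I * z)) := by
        rw [← integral_exp_mul_complex_Ioi hre 0, ← integral_const_mul]
        simp only [sub_mul]
        exact integral_sub (integrableOn_mul_exp ha.int hipos.le) hc0
      rw [this]
      simp only [ofReal_zero, mul_zero, exp_zero]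
      field_simp
      linear_combination (-a 0) * I_sq
    rw [e1, norm_mul]
    have e2 : ∫ t in Set.Ioi (0 : ℝ), ‖a (t / ‖z‖) - a 0‖ * Real.exp (-c * t) =
        ‖z‖ * ∫ y in Set.Ioi (0 : ℝ), ‖a y - a 0‖ * Real.exp (-c * (‖z‖ * y)) := by
      have := integral_comp_mul_left_Ioi
        (fun t : ℝ => ‖a (t / ‖z‖) - a 0‖ * Real.exp (-c * t)) 0 hn
      rw [mul_zero] at this
      simp only [mul_div_cancel_left₀ _ hn.ne'] at this
      rw [this, smul_eq_mul, mul_inv_cancel_left₀ hn.ne']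
    rw [e2]
    gcongr
    refine norm_integral_le_of_norm_le ?_ ?_
    · have : IntegrableOn (fun y : ℝ => (B + B) * Real.exp (-(c * ‖z‖) * y)) (Set.Ioi 0) :=
        (exp_neg_integrableOn_Ioi 0 (by positivity)).const_mul _
      refine Integrable.mono' this (Continuous.aestronglyMeasurable (by have := ha.cont; fun_prop)) ?_
      refine (ae_restrict_iff' measurableSet_Ioi).2 (.of_forall fun t ht => ?_)
      have ht : 0 < t := ht
      rw [Real.norm_eq_abs, abs_of_nonneg (by positivity), show -c * (‖z‖ * t) = -(c * ‖z‖) * t by ring]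
      gcongr
      exact (norm_sub_le _ _).trans (add_le_add (hB _ ht.le) (hB _ le_rfl))
    · refine (ae_restrict_iff' measurableSet_Ioi).2 (.of_forall fun t ht => ?_)
      have ht : 0 < t := ht
      rw [norm_mul, norm_exp_I_mul_mul]
      gcongr
      nlinarith

end HalfNice

lemma MemH11.halfNice {G : ℝ → ℂ} (hG : MemH11 G) : HalfNice G where
  cont := hG.continuous
  bound := let ⟨B, hB⟩ := hG.exists_bound; ⟨B, fun y _ => hB y⟩
  int := hG.integrable.integrableOn
  wt := hG.2.1.restrict _

end

/-! ### Correlations and the splitting of products of half-line transforms -/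

section

open scoped FourierTransform ContDiff

/-- The correlation of two amplitudes on the half-line. -/
def corr (b g : ℝ → ℂ) (y : ℝ) : ℂ :=
  ∫ t in Set.Ioi (0 : ℝ), b t * (Set.Ioi (0 : ℝ)).indicator g (y + t)

lemma corr_eq (b g : ℝ → ℂ) (y : ℝ) : corr b g y =
    ∫ t, (Set.Ioi (0 : ℝ)).indicator b t * (Set.Ioi (0 : ℝ)).indicator g (y + t) := by
  rw [corr, ← integral_indicator measurableSet_Ioi]
  refine integral_congr_ae (.of_forall fun t => ?_)
  by_cases ht : t ∈ Set.Ioi (0 : ℝ)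
  · simp only [Set.indicator_of_mem ht]
  · simp only [Set.indicator_of_notMem ht, zero_mul]

lemma integrable_correlation {b g : ℝ → ℂ} (hb : Integrable b) (hg : Integrable g) :
    Integrable (fun y => ∫ t, b t * g (y + t)) ∧
      ∫ y, ∫ t, b t * g (y + t) = (∫ t, b t) * ∫ t, g t := by
  have h1 : Integrable fun t => b (-t) := hb.comp_neg
  have e : (fun y => ∫ t, b t * g (y + t)) =
      MeasureTheory.convolution (fun t => b (-t)) g (ContinuousLinearMap.mul ℂ ℂ) volume := by
    ext y
    rw [MeasureTheory.convolution, ← integral_neg_eq_self]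
    simp [sub_eq_add_neg]
  constructor
  · rw [e]
    exact h1.integrable_convolution _ hg
  · have := integral_convolution (L := ContinuousLinearMap.mul ℂ ℂ) h1 hg
    rw [← e] at this
    rw [this, ContinuousLinearMap.mul_apply', integral_neg_eq_self]

/-- Writing y = (y + t) - t puts the weight on one factor or the other, and each of the two terms is
a correlation of an L¹ with an L² function. -/
lemma memLp_mul_correlation {b g : ℝ → ℂ} (hbm : Measurable b) (hgm : Measurable g)
    (hb : Integrable b) (hg : Integrable g)
    (hb2 : MemLp (fun y : ℝ => (y : ℂ) * b y) 2 volume)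
    (hg2 : MemLp (fun y : ℝ => (y : ℂ) * g y) 2 volume) :
    MemLp (fun y : ℝ => (y : ℂ) * ∫ t, b t * g (y + t)) 2 volume := by
  refine ⟨(by fun_prop : Continuous fun y : ℝ => (y : ℂ)).aestronglyMeasurable.mul
    (integrable_correlation hb hg).1.aestronglyMeasurable, ?_⟩
  set P : ℝ → ENNReal := fun y => ∫⁻ t : ℝ, ‖(t : ℂ) * b t‖ₑ * ‖g (y + t)‖ₑ with hP
  set Q : ℝ → ENNReal := fun y => ∫⁻ t : ℝ, ‖b t‖ₑ * ‖((y + t : ℝ) : ℂ) * g (y + t)‖ₑ with hQ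
  have hQ2 : ∫⁻ y, Q y ^ 2 < ⊤ := by
    refine (lintegral_sq_translate_le (c := fun t => ‖b t‖ₑ) (k := fun t => ‖(t : ℂ) * g t‖ₑ)
      (by fun_prop) (by fun_prop)).trans_lt ?_
    rw [← eLpNorm_two_sq (fun t : ℝ => (t : ℂ) * g t)]
    exact ENNReal.mul_lt_top (ENNReal.pow_lt_top hb.2) (ENNReal.pow_lt_top hg2.2)
  have hP2 : ∫⁻ y, P y ^ 2 < ⊤ := by
    have e : ∀ y, P y = ∫⁻ t, ‖g (-t)‖ₑ * ‖((-(y + t) : ℝ) : ℂ) * b (-(y + t))‖ₑ := by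
      intro y
      refine (lintegral_sub_left_eq_self (fun t : ℝ => ‖(t : ℂ) * b t‖ₑ * ‖g (y + t)‖ₑ)
        (-y)).symm.trans (lintegral_congr fun t => ?_)
      rw [mul_comm, show -y - t = -(y + t) by ring, show y + -(y + t) = -t by ring]
    simp only [e]
    refine (lintegral_sq_translate_le (c := fun t => ‖g (-t)‖ₑ)
      (k := fun t => ‖((-t : ℝ) : ℂ) * b (-t)‖ₑ) (by fun_prop) (by fun_prop)).trans_lt ?_
    have h2 : ∫⁻ t : ℝ, ‖((-t : ℝ) : ℂ) * b (-t)‖ₑ ^ 2 = ∫⁻ t : ℝ, ‖(t : ℂ) * b t‖ₑ ^ 2 :=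
      lintegral_neg_eq_self (fun t : ℝ => ‖(t : ℂ) * b t‖ₑ ^ 2)
    rw [h2, ← eLpNorm_two_sq (fun t : ℝ => (t : ℂ) * b t)]
    exact ENNReal.mul_lt_top (ENNReal.pow_lt_top hg.comp_neg.2) (ENNReal.pow_lt_top hb2.2)
  have hPm : Measurable P := Measurable.lintegral_prod_right (by fun_prop)
  have hle : ∀ y : ℝ, ‖(y : ℂ) * ∫ t, b t * g (y + t)‖ₑ ^ 2 ≤ 4 * (P y ^ 2 + Q y ^ 2) := by
    intro y
    have h1 : ‖(y : ℂ) * ∫ t, b t * g (y + t)‖ₑ ≤ P y + Q y := by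
      rw [← integral_const_mul, hP, hQ, ← lintegral_add_left
        (f := fun t : ℝ => ‖(t : ℂ) * b t‖ₑ * ‖g (y + t)‖ₑ) (by fun_prop)]
      refine (enorm_integral_le_lintegral_enorm _).trans (lintegral_mono fun t => ?_)
      rw [← enorm_mul, ← enorm_mul, show (y : ℂ) * (b t * g (y + t)) =
        b t * (((y + t : ℝ) : ℂ) * g (y + t)) - (t : ℂ) * b t * g (y + t) by push_cast; ring]
      exact enorm_sub_le.trans_eq (add_comm _ _)
    calc _ ≤ (P y + Q y) ^ 2 := by gcongr
      _ ≤ (2 * max (P y) (Q y)) ^ 2 := by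
        gcongr; rw [two_mul]; exact add_le_add (le_max_left _ _) (le_max_right _ _)
      _ = 4 * (max (P y) (Q y)) ^ 2 := by rw [mul_pow]; norm_num
      _ ≤ _ := by
        gcongr
        rcases max_choice (P y) (Q y) with h | h <;> rw [h]
        · exact le_self_add
        · exact le_add_self
  have h4 : eLpNorm (fun y : ℝ => (y : ℂ) * ∫ t, b t * g (y + t)) 2 volume ^ 2 < ⊤ := by
    rw [eLpNorm_two_sq]
    refine (lintegral_mono hle).trans_lt ?_
    rw [lintegral_const_mul' _ _ (by norm_num), lintegral_add_left (hPm.pow_const 2)]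
    exact ENNReal.mul_lt_top (by norm_num) (ENNReal.add_lt_top.2 ⟨hP2, hQ2⟩)
  exact (ENNReal.pow_lt_top_iff.1 h4).resolve_right (by norm_num)

namespace HalfNice

variable {b g : ℝ → ℂ}

lemma indicator_wt (hb : HalfNice b) :
    MemLp (fun y : ℝ => (y : ℂ) * (Set.Ioi (0 : ℝ)).indicator b y) 2 volume := by
  have h := (memLp_indicator_iff_restrict (μ := (volume : Measure ℝ))
    (measurableSet_Ioi (a := (0 : ℝ)))).2 hb.wt
  refine h.ae_eq (.of_forall fun y => ?_)
  by_cases hy : y ∈ Set.Ioi (0 : ℝ)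
  · simp only [Set.indicator_of_mem hy]
  · simp only [Set.indicator_of_notMem hy, mul_zero]

lemma norm_indicator_le {B : ℝ} (hB : ∀ y, 0 ≤ y → ‖b y‖ ≤ B) (t : ℝ) :
    ‖(Set.Ioi (0 : ℝ)).indicator b t‖ ≤ B := by
  by_cases hy : t ∈ Set.Ioi (0 : ℝ)
  · rw [Set.indicator_of_mem hy]; exact hB _ (le_of_lt hy)
  · rw [Set.indicator_of_notMem hy, norm_zero]; exact (norm_nonneg _).trans (hB 0 le_rfl)

lemma corr_integrable (hb : IntegrableOn b (Set.Ioi 0)) (hg : HalfNice g) :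
    Integrable (corr b g) := by
  have := (integrable_correlation (hb.integrable_indicator measurableSet_Ioi)
    hg.indicator_integrable).1
  exact this.congr (.of_forall fun y => (corr_eq b g y).symm)

lemma corr_wt (hb : HalfNice b) (hg : HalfNice g) :
    MemLp (fun y : ℝ => (y : ℂ) * corr b g y) 2 volume := by
  simp only [corr_eq]
  exact memLp_mul_correlation (hb.cont.measurable.indicator measurableSet_Ioi)
    (hg.cont.measurable.indicator measurableSet_Ioi) hb.indicator_integrable
    hg.indicator_integrable hb.indicator_wt hg.indicator_wt

/-- The truncation of g jumps only at the origin, that is at the single point t = -y, which is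
negligible in the dominated convergence argument. -/
lemma corr_continuous (hb : IntegrableOn b (Set.Ioi 0)) (hg : HalfNice g) : Continuous (corr b g) := by
  obtain ⟨B, hB⟩ := hg.bound
  refine continuous_iff_continuousAt.2 fun y => ?_
  have hgm : Measurable ((Set.Ioi (0 : ℝ)).indicator g) :=
    hg.cont.measurable.indicator measurableSet_Ioi
  refine continuousAt_of_dominated (bound := fun t => ‖b t‖ * B) ?_ ?_ (hb.norm.mul_const B) ?_
  · refine .of_forall fun y => hb.aestronglyMeasurable.mul ?_
    exact (hgm.comp (measurable_const_add y)).aestronglyMeasurable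
  · refine .of_forall fun y => .of_forall fun t => ?_
    rw [norm_mul]
    gcongr
    exact norm_indicator_le hB _
  · have h0 : ∀ᵐ t : ℝ ∂(volume.restrict (Set.Ioi 0)), t ≠ -y :=
      ae_restrict_of_ae (by simp [ae_iff, measure_singleton])
    filter_upwards [h0] with t ht
    refine ContinuousAt.mul continuousAt_const ?_
    have h1 : ContinuousAt ((Set.Ioi (0 : ℝ)).indicator g) (y + t) := by
      rcases lt_or_gt_of_ne (show y + t ≠ 0 from fun h => ht (by linarith)) with h | h
      · have : (Set.Ioi (0 : ℝ)).indicator g =ᶠ[𝓝 (y + t)] fun _ => 0 := by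
          filter_upwards [Iio_mem_nhds h] with w hw
          exact Set.indicator_of_notMem (not_lt.2 (le_of_lt hw)) _
        exact this.continuousAt
      · have : (Set.Ioi (0 : ℝ)).indicator g =ᶠ[𝓝 (y + t)] g := by
          filter_upwards [Ioi_mem_nhds h] with w hw
          exact Set.indicator_of_mem hw _
        exact hg.cont.continuousAt.congr this.symm
    exact ContinuousAt.comp (f := fun y => y + t) h1 (by fun_prop)

lemma norm_corr_le {B : ℝ} (hb : IntegrableOn b (Set.Ioi 0)) (hB : ∀ y, 0 ≤ y → ‖g y‖ ≤ B) (y : ℝ) :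
    ‖corr b g y‖ ≤ ∫ t in Set.Ioi (0 : ℝ), ‖b t‖ * B := by
  refine norm_integral_le_of_norm_le (hb.norm.mul_const B) (.of_forall fun t => ?_)
  rw [norm_mul]
  gcongr
  exact norm_indicator_le hB _

/-- On the positive half-line the correlation inherits its moments from the second factor. -/
lemma corr_halfNice (hbc : Continuous b) (hb : IntegrableOn b (Set.Ioi 0)) (hg : HalfNice g) :
    HalfNice (corr b g) where
  cont := corr_continuous hb hg
  bound := let ⟨_, hB⟩ := hg.bound; ⟨_, fun y _ => norm_corr_le hb hB y⟩
  int := (corr_integrable hb hg).integrableOn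
  wt := by
    refine ⟨(continuous_ofReal.mul (corr_continuous hb hg)).aestronglyMeasurable, ?_⟩
    set bh := (Set.Ioi (0 : ℝ)).indicator b with hbh
    set gh := (Set.Ioi (0 : ℝ)).indicator g with hgh
    have hbm : Measurable bh := hbc.measurable.indicator measurableSet_Ioi
    have hgm : Measurable gh := hg.cont.measurable.indicator measurableSet_Ioi
    -- For positive y and t one has y ≤ y + t, so the whole weight can be put on g and integrability
    -- of b suffices.
    have hle : ∀ y ∈ Set.Ioi (0 : ℝ), ‖(y : ℂ) * corr b g y‖ₑ ^ 2 ≤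
        (∫⁻ t, ‖bh t‖ₑ * ‖((y + t : ℝ) : ℂ) * gh (y + t)‖ₑ) ^ 2 := by
      intro y hy
      have hy : 0 < y := hy
      gcongr
      rw [corr_eq, ← integral_const_mul]
      refine (enorm_integral_le_lintegral_enorm _).trans (lintegral_mono fun t => ?_)
      by_cases ht : t ∈ Set.Ioi (0 : ℝ)
      · have ht : 0 < t := ht
        rw [← mul_assoc, mul_comm (y : ℂ), mul_assoc, enorm_mul]
        gcongr
        rw [enorm_mul, enorm_mul]
        gcongr
        rw [enorm_le_iff_norm_le, norm_real, norm_real, Real.norm_of_nonneg hy.le,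
          Real.norm_of_nonneg (by positivity)]
        linarith
      · simp [Set.indicator_of_notMem ht]
    have h4 : eLpNorm (fun y : ℝ => (y : ℂ) * corr b g y) 2 (volume.restrict (Set.Ioi 0)) ^ 2 < ⊤ := by
      rw [eLpNorm_two_sq]
      refine (setLIntegral_mono' measurableSet_Ioi hle).trans_lt ?_
      refine (setLIntegral_le_lintegral _ _).trans_lt ?_
      refine (lintegral_sq_translate_le (c := fun t => ‖bh t‖ₑ) (k := fun t => ‖(t : ℂ) * gh t‖ₑ)
        (by fun_prop) (by fun_prop)).trans_lt ?_
      rw [← eLpNorm_two_sq (fun t : ℝ => (t : ℂ) * gh t)]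
      exact ENNReal.mul_lt_top (ENNReal.pow_lt_top (hb.integrable_indicator measurableSet_Ioi).2)
        (ENNReal.pow_lt_top hg.indicator_wt.2)
    exact (ENNReal.pow_lt_top_iff.1 h4).resolve_right (by norm_num)

/-- At negative arguments the weight cannot be absorbed by g alone, so both factors need a first
moment. -/
lemma corr_neg_halfNice (hb : HalfNice b) (hg : HalfNice g) :
    HalfNice fun y => corr b g (-y) where
  cont := (corr_continuous hb.int hg).comp continuous_neg
  bound := let ⟨_, hB⟩ := hg.bound; ⟨_, fun y _ => norm_corr_le hb.int hB (-y)⟩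
  int := (corr_integrable hb.int hg).comp_neg.integrableOn
  wt := by
    have h := ((hb.corr_wt hg).comp_measurePreserving (Measure.measurePreserving_neg volume)).neg
    refine (h.ae_eq (.of_forall fun y => ?_)).restrict _
    simp

lemma add (hb : HalfNice b) (hg : HalfNice g) : HalfNice fun y => b y + g y where
  cont := hb.cont.add hg.cont
  bound := by
    obtain ⟨B, hB⟩ := hb.bound
    obtain ⟨D, hD⟩ := hg.bound
    exact ⟨B + D, fun y hy => (norm_add_le _ _).trans (add_le_add (hB y hy) (hD y hy))⟩
  int := hb.int.add hg.int
  wt := (hb.wt.add hg.wt).ae_eq (.of_forall fun y => by simp [mul_add])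

lemma const_mul (hb : HalfNice b) (c : ℂ) : HalfNice fun y => c * b y where
  cont := hb.cont.const_mul c
  bound := by
    obtain ⟨B, hB⟩ := hb.bound
    exact ⟨‖c‖ * B, fun y hy => by rw [norm_mul]; gcongr; exact hB y hy⟩
  int := hb.int.const_mul c
  wt := (hb.wt.const_mul c).ae_eq (.of_forall fun y => by ring)

lemma neg (hb : HalfNice b) : HalfNice fun y => - b y := by
  simpa using hb.const_mul (-1)

lemma zero : HalfNice fun _ => 0 := MemH11.zero.halfNice

lemma sum {ι : Type*} (s : Finset ι) {f : ι → ℝ → ℂ} (hf : ∀ i ∈ s, HalfNice (f i)) :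
    HalfNice fun y => ∑ i ∈ s, f i y := by
  classical
  induction s using Finset.induction_on with
  | empty => simpa using zero
  | insert i s hi ih =>
    simp only [Finset.sum_insert hi]
    exact (hf i (Finset.mem_insert_self i s)).add
      (ih fun k hk => hf k (Finset.mem_insert_of_mem hk))

lemma star (hb : HalfNice b) : HalfNice fun y => conj (b y) where
  cont := continuous_conj.comp hb.cont
  bound := by simpa using hb.bound
  int := by
    refine Integrable.mono hb.int (continuous_conj.comp hb.cont).aestronglyMeasurable
      (.of_forall fun y => ?_)
    simp
  wt := by
    refine hb.wt.mono (continuous_ofReal.mul (continuous_conj.comp hb.cont)).aestronglyMeasurable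
      (.of_forall fun y => ?_)
    simp

end HalfNice

lemma integral_mul_exp_neg_eq {f : ℝ → ℂ} (hf : Integrable f) (s : ℝ) :
    ∫ y, f y * exp (-(I * s * y)) = halfFT f (-s) + halfFT (fun y => f (-y)) s := by
  have hi : Integrable fun y : ℝ => f y * exp (-(I * s * y)) := by
    refine hf.mono (hf.aestronglyMeasurable.mul
      (show Continuous fun y : ℝ => exp (-(I * s * y)) by fun_prop).aestronglyMeasurable)
      (.of_forall fun y => ?_)
    rw [norm_mul, norm_exp]
    simp
  rw [← intervalIntegral.integral_Iic_add_Ioi (b := 0) hi.integrableOn hi.integrableOn, add_comm]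
  congr 1
  · simp only [halfFT]
    refine integral_congr_ae (.of_forall fun y => ?_)
    simp only
    congr 2
    ring
  · rw [halfFT]
    have := integral_comp_neg_Ioi (0 : ℝ) fun y : ℝ => f y * exp (-(I * s * y))
    rw [neg_zero] at this
    rw [← this]
    refine integral_congr_ae (.of_forall fun y => ?_)
    simp only
    congr 2
    push_cast
    ring

/-- The product of an upper and a lower half-line transform splits by correlation. -/
lemma HalfNice.halfFT_mul_halfFT_neg {b g : ℝ → ℂ} (hb : HalfNice b) (hg : HalfNice g) (s : ℝ) :
    halfFT b s * halfFT g (-s) = halfFT (corr b g) (-s) + halfFT (fun y => corr b g (-y)) s := by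
  rw [← integral_mul_exp_neg_eq (HalfNice.corr_integrable hb.int hg)]
  have e1 : halfFT b s = ∫ t : ℝ, (Set.Ioi (0 : ℝ)).indicator b t * exp (I * s * t) := by
    rw [halfFT, ← integral_indicator measurableSet_Ioi]
    simp only [Set.indicator_mul_left]
  have e2 : halfFT g (-s) = ∫ t : ℝ, (Set.Ioi (0 : ℝ)).indicator g t * exp (-(I * s * t)) := by
    rw [halfFT, ← integral_indicator measurableSet_Ioi]
    simp only [Set.indicator_mul_left]
    congr! 4
    ring
  have hi : ∀ {f : ℝ → ℂ} (w : ℝ), Integrable f → Integrable fun t : ℝ => f t * exp (I * w * t) := by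
    intro f w hf
    refine hf.mono (hf.aestronglyMeasurable.mul
      (show Continuous fun y : ℝ => exp (I * w * y) by fun_prop).aestronglyMeasurable)
      (.of_forall fun y => ?_)
    rw [norm_mul, norm_exp]
    simp
  have h1 := hi s hb.indicator_integrable
  have h2 := hi (-s) hg.indicator_integrable
  simp only [ofReal_neg, mul_neg, neg_mul] at h2
  rw [e1, e2, ← (integrable_correlation h1 h2).2]
  refine integral_congr_ae (.of_forall fun y => ?_)
  simp only [corr_eq, ← integral_mul_const]
  refine integral_congr_ae (.of_forall fun t => ?_)
  simp only
  rw [mul_mul_mul_comm, ← exp_add]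
  congr 2
  push_cast
  ring

/-- Fourier inversion, rescaled to the kernel e^{-isy} and cut at y = 0. Positive y gives the part
that continues to the lower half plane, negative y the part that continues to the upper one. -/
lemma MemH11.exists_fourier_amplitude {ρ : ℝ → ℂ} (hρ : MemH11 ρ) :
    ∃ F : ℝ → ℂ, MemH11 F ∧ ∀ s : ℝ, ρ s = halfFT F (-s) + halfFT (fun y => F (-y)) s := by
  have hpi : (0 : ℝ) < (2 * Real.pi)⁻¹ := by positivity
  have hF : MemH11 fun y => ((2 * Real.pi)⁻¹ : ℂ) * 𝓕 ρ (-(2 * Real.pi)⁻¹ * y) :=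
    (hρ.fourier.comp_mul_left (c := -(2 * Real.pi)⁻¹) (by linarith)).const_mul _
  refine ⟨_, hF, fun s => ?_⟩
  rw [← integral_mul_exp_neg_eq hF.integrable]
  have hinv : 𝓕⁻ (𝓕 ρ) = ρ := hρ.continuous.fourierInv_fourier_eq hρ.integrable hρ.fourier.integrable
  conv_lhs => rw [← hinv]
  rw [Real.fourierInv_eq']
  have h := Measure.integral_comp_mul_left
    (fun ξ : ℝ => ((2 * Real.pi)⁻¹ : ℂ) * 𝓕 ρ ξ * exp (2 * Real.pi * I * ξ * s)) (-(2 * Real.pi)⁻¹)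
  have hpi0 : (Real.pi : ℂ) ≠ 0 := by exact_mod_cast Real.pi_ne_zero
  have e : ∀ y : ℝ, ((2 * Real.pi)⁻¹ : ℂ) * 𝓕 ρ (-(2 * Real.pi)⁻¹ * y) * exp (-(I * s * y)) =
      ((2 * Real.pi)⁻¹ : ℂ) * 𝓕 ρ (-(2 * Real.pi)⁻¹ * y) *
        exp (2 * Real.pi * I * ((-(2 * Real.pi)⁻¹ * y : ℝ) : ℂ) * s) := by
    intro y
    congr 2
    push_cast
    field_simp
  simp only [e]
  rw [h, ← integral_smul]
  refine integral_congr_ae (.of_forall fun ξ => ?_)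
  simp only [smul_eq_mul, real_smul, inv_neg, inv_inv, abs_neg, abs_of_pos (show 0 < 2 * Real.pi by positivity)]
  rw [mul_comm (exp _), mul_assoc ((2 * Real.pi)⁻¹ : ℂ), ← mul_assoc _ ((2 * Real.pi)⁻¹ : ℂ)]
  push_cast
  rw [mul_inv_cancel₀ (by simp), one_mul]
  congr 2
  simp
  ring

end

/-! ### Positive Hankel-type operators and their matrix elements -/

section

open InnerProductSpace

set_option linter.unusedSectionVars false

/-- A family of curves in a Hilbert space, with scalar weights, from which a Hankel-type operator is
built: decay like `1 / t`, Lipschitz dependence on the parameter, and integrable bounded weights. -/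
structure HankelFamily {ι H : Type*} [NormedAddCommGroup H] (g : ι → ℝ → H) (G : ι → ℝ → ℂ)
    (C : ℝ) : Prop where
  nonneg : 0 ≤ C
  bound : ∀ k t, 0 ≤ t → ‖g k t‖ ≤ C / (1 + t)
  lip : ∀ k a b, a ≤ b → ‖g k b - g k a‖ ≤ C * (b - a)
  contG : ∀ k, Continuous (G k)
  boundG : ∀ k t, ‖G k t‖ ≤ C
  intG : ∀ k, Integrable (G k)

section

variable {ι H : Type*} [Fintype ι] [NormedAddCommGroup H] [InnerProductSpace ℂ H]

/-- The integrand of the Hankel operator. -/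
def hankelKernel (g : ι → ℝ → H) (t : ℝ) : H →L[ℂ] H := ∑ k, rankOne ℂ (g k t) (g k t)

/-- The integrand of the inhomogeneous term. -/
def hankelVec (g : ι → ℝ → H) (G : ι → ℝ → ℂ) (t : ℝ) : H := ∑ k, conj (G k t) • g k t

/-- The operator `∑ ∫_τ^∞ |g_k⟩⟨g_k|`. -/
def hankelOp (g : ι → ℝ → H) (τ : ℝ) : H →L[ℂ] H := ∫ t in Set.Ioi τ, hankelKernel g t

/-- The vector `∑ ∫_τ^∞ conj G_k • g_k`. -/
def hankelSource (g : ι → ℝ → H) (G : ι → ℝ → ℂ) (τ : ℝ) : H := ∫ t in Set.Ioi τ, hankelVec g G t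

/-- The resolvent `(1 + L_τ)⁻¹`. -/
def hankelResolvent (g : ι → ℝ → H) (τ : ℝ) : H →L[ℂ] H := Ring.inverse (1 + hankelOp g τ)

/-- The matrix element `⟨h_τ, (1 + L_τ)⁻¹ g_j⟩`. -/
def hankelCoeff (g : ι → ℝ → H) (G : ι → ℝ → ℂ) (j : ι) (τ : ℝ) : ℂ :=
  inner ℂ (hankelSource g G τ) (hankelResolvent g τ (g j τ))

namespace HankelFamily

variable {g : ι → ℝ → H} {G : ι → ℝ → ℂ} {C : ℝ}

lemma continuous (hF : HankelFamily g G C) (k : ι) : Continuous (g k) := by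
  have : LipschitzWith (Real.toNNReal C) (g k) := by
    refine LipschitzWith.of_dist_le_mul fun a b => ?_
    rw [Real.coe_toNNReal _ hF.nonneg]
    rcases le_total a b with h | h
    · rw [dist_comm, dist_comm a, dist_eq_norm, Real.dist_eq, abs_of_nonneg (sub_nonneg.2 h)]
      exact hF.lip k a b h
    · rw [dist_eq_norm, Real.dist_eq, abs_of_nonneg (sub_nonneg.2 h)]
      exact hF.lip k b a h
  exact this.continuous

lemma bound' (hF : HankelFamily g G C) (k : ι) {t : ℝ} (ht : 0 ≤ t) : ‖g k t‖ ≤ C :=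
  (hF.bound k t ht).trans (div_le_self hF.nonneg (by linarith))

lemma continuous_kernel (hF : HankelFamily g G C) : Continuous (hankelKernel g) := by
  have h := hF.continuous
  unfold hankelKernel
  refine continuous_finsetSum _ fun k _ => ?_
  have h1 : Continuous fun t => ContinuousLinearMap.toSpanSingleton ℂ (g k t) :=
    (ContinuousLinearMap.toSpanSingletonLIE ℂ H).continuous.comp (h k)
  have h2 : Continuous fun t => innerSL ℂ (g k t) := (innerSL ℂ).continuous.comp (h k)
  exact h1.clm_comp h2

lemma continuous_vec (hF : HankelFamily g G C) : Continuous (hankelVec g G) := by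
  have h := hF.continuous
  have h2 := hF.contG
  unfold hankelVec
  exact continuous_finsetSum _ fun k _ => (continuous_conj.comp (h2 k)).smul (h k)

lemma norm_kernel_le (hF : HankelFamily g G C) {t : ℝ} (ht : 0 ≤ t) :
    ‖hankelKernel g t‖ ≤ Fintype.card ι * (C / (1 + t)) ^ 2 := by
  refine (norm_sum_le _ _).trans ((Finset.sum_le_card_nsmul _ _ ((C / (1 + t)) ^ 2) ?_).trans_eq ?_)
  · intro k _
    rw [norm_rankOne, pow_two]
    have := hF.bound k t ht
    exact mul_le_mul this this (norm_nonneg _) ((norm_nonneg _).trans this)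
  · simp

lemma norm_kernel_le' (hF : HankelFamily g G C) {t : ℝ} (ht : 0 ≤ t) :
    ‖hankelKernel g t‖ ≤ Fintype.card ι * C ^ 2 := by
  have := hF.nonneg
  refine (hF.norm_kernel_le ht).trans ?_
  gcongr
  exact div_le_self hF.nonneg (by linarith)

lemma norm_vec_le (hF : HankelFamily g G C) {t : ℝ} (ht : 0 ≤ t) :
    ‖hankelVec g G t‖ ≤ C / (1 + t) * ∑ k, ‖G k t‖ := by
  rw [Finset.mul_sum]
  refine (norm_sum_le _ _).trans (Finset.sum_le_sum fun k _ => ?_)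
  rw [norm_smul, RCLike.norm_conj, mul_comm]
  gcongr
  exact hF.bound k t ht

lemma norm_vec_le' (hF : HankelFamily g G C) {t : ℝ} (ht : 0 ≤ t) :
    ‖hankelVec g G t‖ ≤ Fintype.card ι * C ^ 2 := by
  have h0 := hF.nonneg
  refine (hF.norm_vec_le ht).trans ?_
  have h1 : ∑ k, ‖G k t‖ ≤ Fintype.card ι * C :=
    (Finset.sum_le_card_nsmul _ _ C fun k _ => hF.boundG k t).trans_eq (by simp)
  calc C / (1 + t) * ∑ k, ‖G k t‖ ≤ C * (Fintype.card ι * C) := by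
        gcongr
        exact div_le_self h0 (by linarith)
    _ = _ := by ring

lemma integrableOn_inv_sq : IntegrableOn (fun t : ℝ => (1 / (1 + t)) ^ 2) (Set.Ioi 0) := by
  have h : Integrable fun x : ℝ => (1 + |x|)⁻¹ ^ 2 := memLp_two_one_add_abs_inv.integrable_sq
  refine h.integrableOn.congr_fun (fun t ht => ?_) measurableSet_Ioi
  simp only [one_div, abs_of_pos (Set.mem_Ioi.1 ht)]

lemma integrableOn_kernel (hF : HankelFamily g G C) {τ : ℝ} (hτ : 0 ≤ τ) :
    IntegrableOn (hankelKernel g) (Set.Ioi τ) := by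
  refine IntegrableOn.mono_set ?_ (Set.Ioi_subset_Ioi hτ)
  refine Integrable.mono' (integrableOn_inv_sq.const_mul (Fintype.card ι * C ^ 2))
    hF.continuous_kernel.aestronglyMeasurable ?_
  refine (ae_restrict_iff' measurableSet_Ioi).2 (.of_forall fun t ht => ?_)
  refine (hF.norm_kernel_le (le_of_lt ht)).trans_eq ?_
  ring

lemma integrableOn_sum (hF : HankelFamily g G C) (τ : ℝ) :
    IntegrableOn (fun t => ∑ k, ‖G k t‖) (Set.Ioi τ) :=
  integrable_finsetSum _ fun k _ => (hF.intG k).norm.integrableOn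

lemma integrableOn_vec (hF : HankelFamily g G C) {τ : ℝ} (hτ : 0 ≤ τ) :
    IntegrableOn (hankelVec g G) (Set.Ioi τ) := by
  refine Integrable.mono' ((hF.integrableOn_sum τ).const_mul C)
    hF.continuous_vec.aestronglyMeasurable ?_
  refine (ae_restrict_iff' measurableSet_Ioi).2 (.of_forall fun t ht => ?_)
  have ht0 : 0 ≤ t := hτ.trans (le_of_lt ht)
  refine (hF.norm_vec_le ht0).trans ?_
  gcongr
  exact div_le_self hF.nonneg (by linarith)

variable [CompleteSpace H]

lemma hankelOp_apply (hF : HankelFamily g G C) {τ : ℝ} (hτ : 0 ≤ τ) (f : H) :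
    hankelOp g τ f = ∫ t in Set.Ioi τ, ∑ k, inner ℂ (g k t) f • g k t := by
  rw [hankelOp, ContinuousLinearMap.integral_apply (hF.integrableOn_kernel hτ)]
  simp [hankelKernel]

lemma integrableOn_kernel_apply (hF : HankelFamily g G C) {τ : ℝ} (hτ : 0 ≤ τ) (f : H) :
    IntegrableOn (fun t => ∑ k, inner ℂ (g k t) f • g k t) (Set.Ioi τ) := by
  have := (hF.integrableOn_kernel hτ).apply_continuousLinearMap f
  refine this.congr (.of_forall fun t => ?_)
  simp [hankelKernel]

lemma inner_hankelOp (hF : HankelFamily g G C) {τ : ℝ} (hτ : 0 ≤ τ) (f f' : H) :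
    inner ℂ f' (hankelOp g τ f) =
      ∫ t in Set.Ioi τ, ∑ k, inner ℂ (g k t) f * inner ℂ f' (g k t) := by
  rw [hF.hankelOp_apply hτ, ← integral_inner (hF.integrableOn_kernel_apply hτ f)]
  simp [inner_sum, inner_smul_right]

lemma inner_hankelSource (hF : HankelFamily g G C) {τ : ℝ} (hτ : 0 ≤ τ) (f : H) :
    inner ℂ f (hankelSource g G τ) =
      ∫ t in Set.Ioi τ, ∑ k, conj (G k t) * inner ℂ f (g k t) := by
  rw [hankelSource, ← integral_inner (hF.integrableOn_vec hτ)]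
  simp [hankelVec, inner_sum, inner_smul_right]

lemma hankelOp_symm (hF : HankelFamily g G C) {τ : ℝ} (hτ : 0 ≤ τ) (f f' : H) :
    inner ℂ (hankelOp g τ f) f' = inner ℂ f (hankelOp g τ f') := by
  rw [← inner_conj_symm, hF.inner_hankelOp hτ, hF.inner_hankelOp hτ, ← integral_conj]
  refine integral_congr_ae (.of_forall fun t => ?_)
  simp only [map_sum, map_mul, inner_conj_symm]
  exact Finset.sum_congr rfl fun k _ => mul_comm _ _

lemma re_inner_hankelOp_nonneg (hF : HankelFamily g G C) {τ : ℝ} (hτ : 0 ≤ τ) (f : H) :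
    0 ≤ (inner ℂ f (hankelOp g τ f)).re := by
  have e : inner ℂ f (hankelOp g τ f) =
      ((∫ t in Set.Ioi τ, ∑ k, ‖inner ℂ (g k t) f‖ ^ 2 : ℝ) : ℂ) := by
    rw [hF.inner_hankelOp hτ, ← integral_complex_ofReal]
    refine integral_congr_ae (.of_forall fun t => ?_)
    push_cast
    refine Finset.sum_congr rfl fun k _ => ?_
    rw [← inner_conj_symm f, RCLike.mul_conj]
    norm_cast
  rw [e, ofReal_re]
  exact integral_nonneg fun t => by positivity

lemma le_re_inner (hF : HankelFamily g G C) {τ : ℝ} (hτ : 0 ≤ τ) (f : H) :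
    ‖f‖ ^ 2 ≤ (inner ℂ f ((1 + hankelOp g τ) f)).re := by
  have h := hF.re_inner_hankelOp_nonneg hτ f
  have h2 : (inner ℂ f f).re = ‖f‖ ^ 2 := by
    rw [inner_self_eq_norm_sq_to_K]; norm_cast
  simp only [add_apply, one_apply_eq_self, inner_add_right, add_re,
    h2]
  linarith

/-- Positivity of the operator makes the identity plus it coercive, so the inverse exists for every
τ ≥ 0, whatever the size of the data. -/
lemma isUnit (hF : HankelFamily g G C) {τ : ℝ} (hτ : 0 ≤ τ) : IsUnit (1 + hankelOp g τ) := by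
  refine ContinuousLinearMap.isUnit_of_forall_le_norm_inner_map _ (c := 1) one_pos fun f => ?_
  rw [NNReal.coe_one, mul_one, norm_inner_symm]
  exact (hF.le_re_inner hτ f).trans (re_le_norm _)

lemma add_resolvent (hF : HankelFamily g G C) {τ : ℝ} (hτ : 0 ≤ τ) (f : H) :
    hankelResolvent g τ f + hankelOp g τ (hankelResolvent g τ f) = f := by
  have := congrArg (fun T : H →L[ℂ] H => T f) (Ring.mul_inverse_cancel _ (hF.isUnit hτ))
  simpa [hankelResolvent] using this

lemma resolvent_add (hF : HankelFamily g G C) {τ : ℝ} (hτ : 0 ≤ τ) (f : H) :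
    hankelResolvent g τ (f + hankelOp g τ f) = f := by
  have := congrArg (fun T : H →L[ℂ] H => T f) (Ring.inverse_mul_cancel _ (hF.isUnit hτ))
  simpa [hankelResolvent] using this

lemma norm_resolvent_le (hF : HankelFamily g G C) {τ : ℝ} (hτ : 0 ≤ τ) (f : H) :
    ‖hankelResolvent g τ f‖ ≤ ‖f‖ := by
  set φ := hankelResolvent g τ f with hφ
  have h1 := hF.le_re_inner hτ φ
  have h2 : (1 + hankelOp g τ) φ = f := by simpa using hF.add_resolvent hτ f
  rw [h2] at h1
  have h3 := (h1.trans (re_le_norm _)).trans (norm_inner_le_norm φ f)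
  rcases (norm_nonneg φ).eq_or_lt with h | h
  · rw [← h]; exact norm_nonneg _
  · rw [pow_two] at h3
    exact le_of_mul_le_mul_left h3 h

lemma resolvent_symm (hF : HankelFamily g G C) {τ : ℝ} (hτ : 0 ≤ τ) (f f' : H) :
    inner ℂ (hankelResolvent g τ f) f' = inner ℂ f (hankelResolvent g τ f') := by
  conv_lhs => rw [← hF.add_resolvent hτ f']
  conv_rhs => rw [← hF.add_resolvent hτ f]
  rw [inner_add_right, inner_add_left, hF.hankelOp_symm hτ]

lemma norm_source_le (hF : HankelFamily g G C) {τ : ℝ} (hτ : 0 ≤ τ) :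
    ‖hankelSource g G τ‖ ≤ C / (1 + τ) * ∫ t, ∑ k, ‖G k t‖ := by
  have h0 := hF.nonneg
  have hI : Integrable fun t => ∑ k, ‖G k t‖ := integrable_finsetSum _ fun k _ => (hF.intG k).norm
  have h1 : ‖hankelSource g G τ‖ ≤ ∫ t in Set.Ioi τ, C / (1 + τ) * ∑ k, ‖G k t‖ := by
    refine norm_integral_le_of_norm_le ((hF.integrableOn_sum τ).const_mul _) ?_
    refine (ae_restrict_iff' measurableSet_Ioi).2 (.of_forall fun t ht => ?_)
    have ht : τ < t := ht
    refine (hF.norm_vec_le (hτ.trans ht.le)).trans ?_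
    gcongr
  refine h1.trans ?_
  rw [integral_const_mul]
  gcongr
  · exact .of_forall fun t => by positivity
  · exact Measure.restrict_le_self

lemma norm_source_sub_le (hF : HankelFamily g G C) {a b : ℝ} (ha : 0 ≤ a) (hab : a ≤ b) :
    ‖hankelSource g G b - hankelSource g G a‖ ≤ Fintype.card ι * C ^ 2 * (b - a) := by
  rw [norm_sub_rev, hankelSource, hankelSource, intervalIntegral.integral_Ioi_sub_Ioi
    (hF.integrableOn_vec ha) hab]
  refine (intervalIntegral.norm_integral_le_of_norm_le_const fun t ht => ?_).trans_eq
    (by rw [abs_of_nonneg (sub_nonneg.2 hab)])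
  rw [Set.uIoc_of_le hab] at ht
  exact hF.norm_vec_le' (ha.trans ht.1.le)

lemma norm_op_sub_le (hF : HankelFamily g G C) {a b : ℝ} (ha : 0 ≤ a) (hab : a ≤ b) :
    ‖hankelOp g a - hankelOp g b‖ ≤ Fintype.card ι * C ^ 2 * (b - a) := by
  rw [hankelOp, hankelOp, intervalIntegral.integral_Ioi_sub_Ioi
    (hF.integrableOn_kernel ha) hab]
  refine (intervalIntegral.norm_integral_le_of_norm_le_const fun t ht => ?_).trans_eq
    (by rw [abs_of_nonneg (sub_nonneg.2 hab)])
  rw [Set.uIoc_of_le hab] at ht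
  exact hF.norm_kernel_le' (ha.trans ht.1.le)

/-- The resolvent identity `R_b - R_a = R_b (L_a - L_b) R_a`, with both resolvents of norm at most
one. -/
lemma norm_resolvent_sub_le (hF : HankelFamily g G C) {a b : ℝ} (ha : 0 ≤ a) (hab : a ≤ b) (f : H) :
    ‖hankelResolvent g b f - hankelResolvent g a f‖ ≤ Fintype.card ι * C ^ 2 * (b - a) * ‖f‖ := by
  have hb := ha.trans hab
  set φ := hankelResolvent g a f with hφ
  have h1 : hankelResolvent g b f - φ = hankelResolvent g b ((hankelOp g a - hankelOp g b) φ) := by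
    have e1 := hF.add_resolvent ha f
    have e2 := hF.resolvent_add hb φ
    rw [← hφ] at e1
    conv_lhs => rw [← e2]
    rw [← map_sub]
    congr 1
    rw [← e1, sub_apply]
    abel
  rw [h1]
  refine (hF.norm_resolvent_le hb _).trans ((ContinuousLinearMap.le_opNorm _ _).trans ?_)
  have := hF.norm_resolvent_le ha f
  have h0 : 0 ≤ b - a := sub_nonneg.2 hab
  exact mul_le_mul (hF.norm_op_sub_le ha hab) this (norm_nonneg _) (by positivity)

/-- Each of the two vectors in the matrix element contributes a factor 1/(1+τ): the source because
only t > τ enters and the weights are integrable, the other by the decay hypothesis. -/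
lemma norm_coeff_le (hF : HankelFamily g G C) (j : ι) {τ : ℝ} (hτ : 0 ≤ τ) :
    ‖hankelCoeff g G j τ‖ ≤ C ^ 2 * (∫ t, ∑ k, ‖G k t‖) * ((1 + τ)⁻¹) ^ 2 := by
  have h0 := hF.nonneg
  have h1 := hF.norm_source_le hτ
  have h2 := (hF.norm_resolvent_le hτ (g j τ)).trans (hF.bound j τ hτ)
  refine (norm_inner_le_norm _ _).trans ((mul_le_mul h1 h2 (norm_nonneg _)
    ((norm_nonneg _).trans h1)).trans_eq ?_)
  ring

/-- The difference telescopes over the source, the resolvent and the vector; each term keeps an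
undifferenced factor that decays like 1/(1+a). -/
lemma norm_coeff_sub_le (hF : HankelFamily g G C) (j : ι) :
    ∃ D, 0 ≤ D ∧ ∀ a b, 0 ≤ a → a ≤ b →
      ‖hankelCoeff g G j b - hankelCoeff g G j a‖ ≤ D * (b - a) * (1 + a)⁻¹ := by
  have h0 := hF.nonneg
  set J := ∫ t, ∑ k, ‖G k t‖ with hJ
  have hJ0 : 0 ≤ J := integral_nonneg fun t => by positivity
  set n : ℝ := Fintype.card ι * C ^ 2 with hn
  have hn0 : 0 ≤ n := by positivity
  refine ⟨n * C + C * J * (n * C) + C * J * C, by positivity, fun a b ha hab => ?_⟩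
  have hb := ha.trans hab
  have hba : 0 ≤ b - a := sub_nonneg.2 hab
  have e : hankelCoeff g G j b - hankelCoeff g G j a =
      inner ℂ (hankelSource g G b - hankelSource g G a) (hankelResolvent g b (g j b)) +
      inner ℂ (hankelSource g G a) (hankelResolvent g b (g j b) - hankelResolvent g a (g j b)) +
      inner ℂ (hankelSource g G a) (hankelResolvent g a (g j b - g j a)) := by
    simp only [hankelCoeff, inner_sub_left, inner_sub_right, map_sub]
    ring
  have t1 : ‖inner ℂ (hankelSource g G b - hankelSource g G a) (hankelResolvent g b (g j b))‖ ≤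
      (n * (b - a)) * (C / (1 + a)) := by
    refine (norm_inner_le_norm _ _).trans (mul_le_mul (hF.norm_source_sub_le ha hab) ?_
      (norm_nonneg _) (by positivity))
    refine (hF.norm_resolvent_le hb _).trans ((hF.bound j b hb).trans ?_)
    gcongr
  have t2 : ‖inner ℂ (hankelSource g G a)
      (hankelResolvent g b (g j b) - hankelResolvent g a (g j b))‖ ≤
      (C / (1 + a) * J) * (n * (b - a) * C) := by
    refine (norm_inner_le_norm _ _).trans (mul_le_mul (hF.norm_source_le ha) ?_
      (norm_nonneg _) (by positivity))
    refine (hF.norm_resolvent_sub_le ha hab _).trans ?_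
    gcongr
    exact hF.bound' j hb
  have t3 : ‖inner ℂ (hankelSource g G a) (hankelResolvent g a (g j b - g j a))‖ ≤
      (C / (1 + a) * J) * (C * (b - a)) := by
    refine (norm_inner_le_norm _ _).trans (mul_le_mul (hF.norm_source_le ha) ?_
      (norm_nonneg _) (by positivity))
    exact (hF.norm_resolvent_le ha _).trans (hF.lip j a b hab)
  rw [e]
  refine (norm_add₃_le).trans ((add_le_add_three t1 t2 t3).trans_eq ?_)
  ring

end HankelFamily

end

/-- A function on the half-line with decay `(1 + t)⁻²` and local Lipschitz constant `(1 + t)⁻¹`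
extends evenly to the weighted Sobolev space. -/
lemma memH11_even_of_bounds {w : ℝ → ℂ} {D E : ℝ} (hD : 0 ≤ D) (hE : 0 ≤ E)
    (h1 : ∀ t, 0 ≤ t → ‖w t‖ ≤ E * ((1 + t)⁻¹) ^ 2)
    (h2 : ∀ a b, 0 ≤ a → a ≤ b → ‖w b - w a‖ ≤ D * (b - a) * (1 + a)⁻¹) :
    MemH11 fun t => w |t| := by
  -- A majorant for the derivative. Up to length one the Lipschitz bound is used, with 1 + t ≤ 2(1 +
  -- a) accounting for a factor 2. On longer intervals ‖w b‖ + ‖w a‖ ≤ 2E/(1+a) is already dominated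
  -- by the integral of κ over the first unit.
  set κ : ℝ → ℝ := fun t => (4 * E + 2 * D) * (1 + |t|)⁻¹ with hκ
  have hκ2 : MemLp κ 2 volume := memLp_two_one_add_abs_inv.const_mul _
  have hκc : Continuous κ := by
    have : ∀ t : ℝ, 1 + |t| ≠ 0 := fun t => by positivity
    fun_prop (disch := assumption)
  have hpos : ∀ a b, 0 ≤ a → a ≤ b → ‖w b - w a‖ ≤ ∫ t in a..b, κ t := by
    intro a b ha hab
    have hκ0 : ∀ t, 0 ≤ κ t := fun t => by positivity
    have hlow : ∀ c, a ≤ c → c ≤ a + 1 → (c - a) * ((2 * E + D) * (1 + a)⁻¹) ≤ ∫ t in a..c, κ t := by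
      intro c hac hc
      have e : (c - a) * ((2 * E + D) * (1 + a)⁻¹) = ∫ t in a..c, (2 * E + D) * (1 + a)⁻¹ := by
        rw [intervalIntegral.integral_const, smul_eq_mul]
      rw [e]
      refine intervalIntegral.integral_mono_on hac (by simp) (hκc.intervalIntegrable _ _) ?_
      intro t ht
      have ht0 : 0 ≤ t := ha.trans ht.1
      rw [hκ]
      simp only [abs_of_nonneg ht0]
      rw [show 4 * E + 2 * D = (2 * E + D) * 2 by ring, mul_assoc]
      gcongr
      rw [inv_le_iff_one_le_mul₀ (by positivity)]
      rw [mul_assoc, ← div_eq_inv_mul, mul_div_assoc', le_div_iff₀ (by positivity)]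
      linarith [ht.2]
    rcases le_total b (a + 1) with hb | hb
    · refine (h2 a b ha hab).trans (le_trans ?_ (hlow b hab hb))
      have : 0 ≤ b - a := sub_nonneg.2 hab
      have h3 : 0 ≤ (1 + a)⁻¹ := by positivity
      nlinarith [mul_nonneg this h3, mul_nonneg (mul_nonneg this h3) hE]
    · have e3 : ‖w b - w a‖ ≤ 2 * E * (1 + a)⁻¹ := by
        have h4 : ((1 + b)⁻¹) ^ 2 ≤ (1 + a)⁻¹ := by
          have : (1 + b)⁻¹ ≤ (1 + a)⁻¹ := by gcongr
          have h5 : (1 + a)⁻¹ ≤ 1 := inv_le_one_of_one_le₀ (by linarith)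
          have h6 : 0 ≤ (1 + b)⁻¹ := by have := ha.trans hab; positivity
          nlinarith
        have h5 : ((1 + a)⁻¹) ^ 2 ≤ (1 + a)⁻¹ := by
          have h5 : (1 + a)⁻¹ ≤ 1 := inv_le_one_of_one_le₀ (by linarith)
          have h6 : 0 ≤ (1 + a)⁻¹ := by positivity
          nlinarith
        refine (norm_sub_le _ _).trans ((add_le_add (h1 b (ha.trans hab)) (h1 a ha)).trans ?_)
        nlinarith
      have e4 := hlow (a + 1) (by linarith) le_rfl
      have e5 : ∫ t in a..(a + 1), κ t ≤ ∫ t in a..b, κ t :=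
        intervalIntegral.integral_mono_interval le_rfl (by linarith) hb
          (.of_forall hκ0) (hκc.intervalIntegrable _ _)
      refine e3.trans (le_trans ?_ (e4.trans e5))
      have h3 : 0 ≤ (1 + a)⁻¹ := by positivity
      nlinarith [mul_nonneg hD h3]
  have hder : HasL2Deriv fun t => w |t| := by
    have heven : ∀ a b, a ≤ b → b ≤ 0 → ‖w |b| - w |a|‖ ≤ ∫ t in a..b, κ t := by
      intro a b hab hb
      have h := hpos (-b) (-a) (by linarith) (by linarith)
      rw [← intervalIntegral.integral_comp_neg, norm_sub_rev] at h
      rw [abs_of_nonpos hb, abs_of_nonpos (hab.trans hb)]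
      simpa [hκ] using h
    refine hasL2Deriv_of_dominated hκ2 fun a b hab => ?_
    rcases le_total 0 a with ha | ha
    · rw [abs_of_nonneg ha, abs_of_nonneg (ha.trans hab)]
      exact hpos a b ha hab
    rcases le_total b 0 with hb | hb
    · exact heven a b hab hb
    · have i1 := heven a 0 ha le_rfl
      have i2 := hpos 0 b le_rfl hb
      rw [← intervalIntegral.integral_add_adjacent_intervals (b := 0)
        (hκc.intervalIntegrable _ _) (hκc.intervalIntegrable _ _)]
      rw [abs_of_nonneg hb]
      rw [abs_zero] at i1
      calc ‖w b - w |a|‖ = ‖(w 0 - w |a|) + (w b - w 0)‖ := by congr 1; ring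
        _ ≤ _ := (norm_add_le _ _).trans (add_le_add i1 i2)
  have hw : ∀ t : ℝ, ‖(t : ℂ) * w |t|‖ ≤ ‖(fun x : ℝ => E * (1 + |x|)⁻¹) t‖ := by
    intro t
    simp only
    rw [norm_mul, norm_real, Real.norm_eq_abs, Real.norm_of_nonneg (show 0 ≤ E * (1 + |t|)⁻¹ by positivity)]
    calc |t| * ‖w |t|‖ ≤ (1 + |t|) * (E * ((1 + |t|)⁻¹) ^ 2) := by
          gcongr
          · linarith
          · exact h1 _ (abs_nonneg t)
      _ = _ := by field_simp
  have hw0 : ∀ t : ℝ, ‖w |t|‖ ≤ ‖(fun x : ℝ => E * (1 + |x|)⁻¹) t‖ := by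
    intro t
    simp only
    rw [Real.norm_of_nonneg (show 0 ≤ E * (1 + |t|)⁻¹ by positivity)]
    refine (h1 _ (abs_nonneg t)).trans ?_
    have h5 : (1 + |t|)⁻¹ ≤ 1 := inv_le_one_of_one_le₀ (by linarith [abs_nonneg t])
    have h6 : 0 ≤ (1 + |t|)⁻¹ := by positivity
    gcongr
    nlinarith
  have hm := hder.continuous
  have hE2 := memLp_two_one_add_abs_inv.const_mul E
  exact ⟨hE2.mono hm.aestronglyMeasurable (.of_forall hw0),
    hE2.mono (continuous_ofReal.mul hm).aestronglyMeasurable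
      (.of_forall hw), hder⟩

lemma HankelFamily.memH11_coeff {ι H : Type*} [Fintype ι] [NormedAddCommGroup H]
    [InnerProductSpace ℂ H] [CompleteSpace H] {g : ι → ℝ → H} {G : ι → ℝ → ℂ} {C : ℝ}
    (hF : HankelFamily g G C) (j : ι) : MemH11 fun t => hankelCoeff g G j |t| := by
  obtain ⟨D, hD, hD2⟩ := hF.norm_coeff_sub_le j
  exact memH11_even_of_bounds hD
    (mul_nonneg (sq_nonneg C) (integral_nonneg fun t => Finset.sum_nonneg fun k _ => norm_nonneg _))
    (fun t ht => hF.norm_coeff_le j ht) hD2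

end

/-! ### Translates in L² of the half-line -/

section

/-- The space of square integrable functions on the half-line. -/
abbrev HalfL2 : Type := Lp ℂ 2 ((volume : Measure ℝ).restrict (Set.Ioi 0))

lemma integral_norm_mul_le {α : Type*} [MeasurableSpace α] {μ : Measure α} {f g : α → ℂ}
    (hf : MemLp f 2 μ) (hg : MemLp g 2 μ) :
    ∫ x, ‖f x‖ * ‖g x‖ ∂μ ≤ ‖hf.toLp f‖ * ‖hg.toLp g‖ := by
  have h := real_inner_le_norm (hg.norm.toLp _) (hf.norm.toLp _)
  rw [L2.inner_def] at h
  simp only [Lp.norm_toLp, eLpNorm_norm] at h ⊢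
  rw [mul_comm] at h
  refine (le_of_eq (integral_congr_ae ?_)).trans h
  filter_upwards [hf.norm.coeFn_toLp, hg.norm.coeFn_toLp] with x h1 h2
  rw [h1, h2]
  simp

namespace MemH11

variable {G : ℝ → ℂ}

lemma memLp_shift (hG : MemH11 G) (t : ℝ) :
    MemLp (fun y => G (t + y)) 2 (volume.restrict (Set.Ioi 0)) := (hG.comp_add_left t).1.restrict _

/-- The restriction of the translate `G(t + ·)` to the half-line. -/
def shiftLp (hG : MemH11 G) (t : ℝ) : HalfL2 := (hG.memLp_shift t).toLp _

lemma inner_shiftLp (hG : MemH11 G) (t : ℝ) (f : HalfL2) :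
    inner ℂ (hG.shiftLp t) f = ∫ y in Set.Ioi (0 : ℝ), conj (G (t + y)) * f y := by
  rw [L2.inner_def]
  refine integral_congr_ae ?_
  filter_upwards [(hG.memLp_shift t).coeFn_toLp] with y hy
  rw [shiftLp, hy, RCLike.inner_apply, mul_comm]

/-- For t, y ≥ 0 one has 1 + t ≤ 1 + t + y, so the factor 1 + t is absorbed by the weight available
for `H^{1,1}` functions. -/
lemma exists_norm_shiftLp_le (hG : MemH11 G) :
    ∃ C, 0 ≤ C ∧ ∀ t, 0 ≤ t → ‖hG.shiftLp t‖ ≤ C / (1 + t) := by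
  have hW := hG.memLp_weight
  refine ⟨(eLpNorm (fun x : ℝ => (1 + |x|) * ‖G x‖) 2 volume).toReal, ENNReal.toReal_nonneg,
    fun t ht => ?_⟩
  rw [le_div_iff₀ (by positivity), mul_comm, shiftLp, Lp.norm_toLp,
    ← ENNReal.toReal_ofReal (show 0 ≤ 1 + t by positivity), ← ENNReal.toReal_mul]
  refine ENNReal.toReal_mono hW.2.ne ?_
  have e1 : ENNReal.ofReal (1 + t) * eLpNorm (fun y => G (t + y)) 2 (volume.restrict (Set.Ioi 0)) =
      eLpNorm (fun y => ((1 + t : ℝ) : ℂ) * G (t + y)) 2 (volume.restrict (Set.Ioi 0)) := by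
    have := eLpNorm_const_smul ((1 + t : ℝ) : ℂ) (fun y => G (t + y)) 2 (volume.restrict (Set.Ioi 0))
    simp only [Pi.smul_def, smul_eq_mul] at this
    rw [this]
    congr 1
    rw [← ofReal_norm, norm_real, Real.norm_of_nonneg (by positivity)]
  rw [e1]
  have e2 : eLpNorm (fun y : ℝ => (1 + |t + y|) * ‖G (t + y)‖) 2 volume =
      eLpNorm (fun x : ℝ => (1 + |x|) * ‖G x‖) 2 volume :=
    eLpNorm_comp_measurePreserving (g := fun x : ℝ => (1 + |x|) * ‖G x‖) hW.1
      (measurePreserving_add_left volume t)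
  rw [← e2]
  refine le_trans (eLpNorm_mono_ae ?_) (eLpNorm_mono_measure _ Measure.restrict_le_self)
  refine (ae_restrict_iff' measurableSet_Ioi).2 (.of_forall fun y hy => ?_)
  have hy : 0 < y := hy
  rw [norm_mul, norm_real, Real.norm_of_nonneg (by positivity), Real.norm_of_nonneg (by positivity),
    abs_of_nonneg (by positivity)]
  gcongr
  linarith

lemma exists_norm_shiftLp_sub_le (hG : MemH11 G) :
    ∃ C, 0 ≤ C ∧ ∀ a b, a ≤ b → ‖hG.shiftLp b - hG.shiftLp a‖ ≤ C * (b - a) := by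
  obtain ⟨g, hg, hGg⟩ := hG.2.2
  refine ⟨(eLpNorm g 2 volume).toReal, ENNReal.toReal_nonneg, fun a b hab => ?_⟩
  have hba : 0 ≤ b - a := sub_nonneg.2 hab
  rw [shiftLp, shiftLp, ← MemLp.toLp_sub, Lp.norm_toLp, mul_comm,
    ← ENNReal.toReal_ofReal hba, ← ENNReal.toReal_mul]
  refine ENNReal.toReal_mono (ENNReal.mul_ne_top (by simp) hg.2.ne) ?_
  refine le_trans (eLpNorm_mono_measure _ Measure.restrict_le_self) ?_
  have h := eLpNorm_translate_sub_le hg hGg hba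
  have hc := hG.continuous
  have e2 : eLpNorm (fun y : ℝ => G ((a + y) + (b - a)) - G (a + y)) 2 volume =
      eLpNorm (fun x : ℝ => G (x + (b - a)) - G x) 2 volume :=
    eLpNorm_comp_measurePreserving (g := fun x : ℝ => G (x + (b - a)) - G x)
      (Continuous.aestronglyMeasurable (by fun_prop)) (measurePreserving_add_left volume a)
  rw [← e2] at h
  refine le_trans (le_of_eq ?_) h
  congr 1
  ext y
  simp only [Pi.sub_apply]
  congr 2
  ring

lemma hankelFamily {ι : Type*} [Fintype ι] {G : ι → ℝ → ℂ} (hG : ∀ k, MemH11 (G k)) :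
    ∃ C, HankelFamily (fun k t => (hG k).shiftLp t) G C := by
  choose C₁ h1 h1' using fun k => (hG k).exists_norm_shiftLp_le
  choose C₂ h2 h2' using fun k => (hG k).exists_norm_shiftLp_sub_le
  choose C₃ h3 using fun k => (hG k).exists_bound
  have h30 : ∀ k, 0 ≤ C₃ k := fun k => (norm_nonneg _).trans (h3 k 0)
  have hle : ∀ k, C₁ k + C₂ k + C₃ k ≤ ∑ k, (C₁ k + C₂ k + C₃ k) := fun k =>
    Finset.single_le_sum (f := fun k => C₁ k + C₂ k + C₃ k)
      (fun i _ => add_nonneg (add_nonneg (h1 i) (h2 i)) (h30 i)) (Finset.mem_univ k)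
  refine ⟨∑ k, (C₁ k + C₂ k + C₃ k), ?_, ?_, ?_, fun k => (hG k).continuous, ?_,
    fun k => (hG k).integrable⟩
  · exact Finset.sum_nonneg fun i _ => add_nonneg (add_nonneg (h1 i) (h2 i)) (h30 i)
  · intro k t ht
    refine (h1' k t ht).trans ?_
    gcongr
    linarith [hle k, h2 k, h30 k]
  · intro k a b hab
    refine (h2' k a b hab).trans ?_
    have : 0 ≤ b - a := sub_nonneg.2 hab
    gcongr
    linarith [hle k, h1 k, h30 k]
  · intro k t
    exact (h3 k t).trans (by linarith [hle k, h1 k, h2 k])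

end MemH11

/-- Integrability of a correlation when decay is traded between the two factors. -/
lemma integrableOn_corr_of_weight {b g : ℝ → ℂ} (hbc : Continuous b) (hgc : Continuous g)
    (hb : IntegrableOn (fun t : ℝ => (1 + |t|) ^ (-(1 / 4 : ℝ)) * ‖b t‖) (Set.Ioi 0))
    (hg : IntegrableOn (fun t : ℝ => (1 + |t|) ^ (1 / 4 : ℝ) * ‖g t‖) (Set.Ioi 0)) :
    IntegrableOn (corr b g) (Set.Ioi 0) := by
  have hbm : Measurable ((Set.Ioi (0 : ℝ)).indicator b) := hbc.measurable.indicator measurableSet_Ioi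
  have hgm : Measurable ((Set.Ioi (0 : ℝ)).indicator g) := hgc.measurable.indicator measurableSet_Ioi
  have hm : AEStronglyMeasurable (corr b g) (volume.restrict (Set.Ioi 0)) := by
    have e : corr b g = fun y => ∫ t, (Set.Ioi (0 : ℝ)).indicator b t *
        (Set.Ioi (0 : ℝ)).indicator g (y + t) := funext (corr_eq b g)
    rw [e]
    refine (StronglyMeasurable.integral_prod_right (ν := (volume : Measure ℝ))
      (f := fun y t => (Set.Ioi (0 : ℝ)).indicator b t *
        (Set.Ioi (0 : ℝ)).indicator g (y + t)) ?_).aestronglyMeasurable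
    exact Measurable.stronglyMeasurable (by fun_prop)
  refine ⟨hm, ?_⟩
  set bt : ℝ → ENNReal := fun t => (Set.Ioi (0 : ℝ)).indicator
    (fun t => ‖(1 + |t|) ^ (-(1 / 4 : ℝ)) * ‖b t‖‖ₑ) t with hbt
  set gt : ℝ → ENNReal := fun t => (Set.Ioi (0 : ℝ)).indicator
    (fun t => ‖(1 + |t|) ^ (1 / 4 : ℝ) * ‖g t‖‖ₑ) t with hgt
  have hbtm : Measurable bt := by
    have := hbc.measurable
    exact Measurable.indicator (by fun_prop) measurableSet_Ioi
  have hgtm : Measurable gt := by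
    have := hgc.measurable
    exact Measurable.indicator (by fun_prop) measurableSet_Ioi
  have hle : ∀ y ∈ Set.Ioi (0 : ℝ), ‖corr b g y‖ₑ ≤ ∫⁻ t, bt t * gt (y + t) := by
    intro y hy
    have hy : 0 < y := hy
    rw [corr_eq]
    refine (enorm_integral_le_lintegral_enorm _).trans (lintegral_mono fun t => ?_)
    by_cases ht : t ∈ Set.Ioi (0 : ℝ)
    · have ht' : 0 < t := ht
      have hyt : y + t ∈ Set.Ioi (0 : ℝ) := add_pos hy ht'
      have hyt' : 0 < y + t := hyt
      simp only [hbt, hgt, Set.indicator_of_mem ht, Set.indicator_of_mem hyt]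
      rw [← enorm_mul, enorm_le_iff_norm_le, norm_mul, Real.norm_of_nonneg (by positivity),
        abs_of_pos ht', abs_of_pos hyt', Real.rpow_neg (by positivity)]
      -- The weight moves from b to g because t ≤ y + t. The gain makes a first factor of size
      -- 1/(1+t) admissible although it is not integrable itself.
      have h1 : (1 + t) ^ (1 / 4 : ℝ) ≤ (1 + (y + t)) ^ (1 / 4 : ℝ) :=
        Real.rpow_le_rpow (by positivity) (by linarith) (by norm_num)
      have h2 : 0 < (1 + t) ^ (1 / 4 : ℝ) := by positivity
      calc ‖b t‖ * ‖g (y + t)‖ = ((1 + t) ^ (1 / 4 : ℝ))⁻¹ * ‖b t‖ *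
            ((1 + t) ^ (1 / 4 : ℝ) * ‖g (y + t)‖) := by field_simp
        _ ≤ _ := by gcongr
    · simp [Set.indicator_of_notMem ht]
  have hb1 : ∫⁻ t, bt t < ⊤ := by
    rw [hbt, lintegral_indicator measurableSet_Ioi]; exact hb.2
  have hg1 : ∫⁻ t, gt t < ⊤ := by
    rw [hgt, lintegral_indicator measurableSet_Ioi]; exact hg.2
  refine (setLIntegral_mono' measurableSet_Ioi hle).trans_lt ((setLIntegral_le_lintegral _ _).trans_lt ?_)
  rw [lintegral_lintegral_swap (by fun_prop)]
  have : ∀ t, ∫⁻ y, bt t * gt (y + t) = bt t * ∫⁻ y, gt y := fun t => by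
    rw [lintegral_const_mul _ (by fun_prop), lintegral_add_right_eq_self]
  simp only [this]
  rw [lintegral_mul_const _ hbtm]
  exact ENNReal.mul_lt_top hb1 hg1

/-- Cauchy–Schwarz with `(1 + |t|)^(-3/4)`, which is square integrable. Any exponent strictly
between 0 and 1/2 could replace 1/4: positive for `integrableOn_weight_inv`, below 1/2 here. -/
lemma MemH11.integrable_weight {G : ℝ → ℂ} (hG : MemH11 G) :
    Integrable fun t : ℝ => (1 + |t|) ^ (1 / 4 : ℝ) * ‖G t‖ := by
  have h1 : MemLp (fun t : ℝ => (1 + |t|) ^ (-(3 / 4) : ℝ)) 2 volume := by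
    have hm : AEStronglyMeasurable (fun t : ℝ => (1 + |t|) ^ (-(3 / 4) : ℝ)) volume :=
      Measurable.aestronglyMeasurable (by fun_prop)
    rw [memLp_two_iff_integrable_sq hm]
    have h := integrable_one_add_norm (E := ℝ) (μ := volume) (r := 3 / 2) (by norm_num)
    refine h.congr (.of_forall fun t => ?_)
    simp only [Real.norm_eq_abs]
    rw [← Real.rpow_natCast, ← Real.rpow_mul (by positivity)]
    norm_num
  have h2 := h1.integrable_mul hG.memLp_weight
  refine h2.congr (.of_forall fun t => ?_)
  simp only [Pi.mul_apply]
  rw [← mul_assoc]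
  congr 1
  nth_rewrite 2 [← Real.rpow_one (1 + |t|)]
  rw [← Real.rpow_add (by positivity)]
  norm_num

lemma MemH11.integrable_weight_shift {G : ℝ → ℂ} (hG : MemH11 G) (τ : ℝ) :
    Integrable fun t : ℝ => (1 + |t|) ^ (1 / 4 : ℝ) * ‖G (τ + t)‖ :=
  (hG.comp_add_left τ).integrable_weight

lemma integrableOn_weight_inv :
    IntegrableOn (fun t : ℝ => (1 + |t|) ^ (-(1 / 4 : ℝ)) * (1 + |t|)⁻¹) (Set.Ioi 0) := by
  have h := integrable_one_add_norm (E := ℝ) (μ := volume) (r := 5 / 4) (by norm_num)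
  refine (h.congr (.of_forall fun t => ?_)).integrableOn
  simp only [Real.norm_eq_abs]
  rw [← Real.rpow_neg_one (1 + |t|), ← Real.rpow_add (by positivity)]
  norm_num

end

/-! ### The Marchenko system -/

section

lemma setIntegral_Ioi_shift {E : Type*} [NormedAddCommGroup E] [NormedSpace ℝ E] (f : ℝ → E) (τ : ℝ) :
    ∫ u in Set.Ioi τ, f u = ∫ s in Set.Ioi (0 : ℝ), f (τ + s) := by
  have h := (measurePreserving_add_left (volume : Measure ℝ) τ).setIntegral_preimage_emb
    (MeasurableEquiv.addLeft τ).measurableEmbedding f (Set.Ioi τ)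
  rw [← h]
  simp

lemma corr_of_nonneg (b g : ℝ → ℂ) {y : ℝ} (hy : 0 ≤ y) :
    corr b g y = ∫ t in Set.Ioi (0 : ℝ), b t * g (y + t) := by
  refine setIntegral_congr_fun measurableSet_Ioi fun t ht => ?_
  have ht : 0 < t := ht
  simp only [Set.indicator_of_mem (show y + t ∈ Set.Ioi (0 : ℝ) from add_pos_of_nonneg_of_pos hy ht)]

lemma corr_congr_left {b b' g : ℝ → ℂ} (h : ∀ t, 0 < t → b t = b' t) : corr b g = corr b' g := by
  ext y
  refine setIntegral_congr_fun measurableSet_Ioi fun t ht => ?_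
  simp only [h t ht]

lemma inner_shiftLp_shiftLp {G G' : ℝ → ℂ} (hG : MemH11 G) (hG' : MemH11 G') (t u : ℝ) :
    inner ℂ (hG.shiftLp t) (hG'.shiftLp u) =
      ∫ y in Set.Ioi (0 : ℝ), conj (G (t + y)) * G' (u + y) := by
  rw [hG.inner_shiftLp]
  refine integral_congr_ae ?_
  filter_upwards [(hG'.memLp_shift u).coeFn_toLp] with y hy
  rw [MemH11.shiftLp, hy]

/-- Fubini's theorem; Cauchy–Schwarz in y together with `hi` makes the double integral absolutely
convergent. -/
lemma integral_mul_inner_shiftLp {G G' β : ℝ → ℂ} (hG : MemH11 G) (hG' : MemH11 G') (t τ : ℝ)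
    (hβ : Continuous β)
    (hi : IntegrableOn (fun s => ‖β s‖ * ‖hG'.shiftLp (τ + s)‖) (Set.Ioi 0)) :
    IntegrableOn (fun y => conj (G (t + y)) * corr β (fun y => G' (τ + y)) y) (Set.Ioi 0) ∧
    ∫ s in Set.Ioi (0 : ℝ), β s * inner ℂ (hG.shiftLp t) (hG'.shiftLp (τ + s)) =
      ∫ y in Set.Ioi (0 : ℝ), conj (G (t + y)) * corr β (fun y => G' (τ + y)) y := by
  have hc := hG.continuous
  have hc' := hG'.continuous
  set F : ℝ × ℝ → ℂ := fun p => β p.1 * (conj (G (t + p.2)) * G' (τ + p.1 + p.2)) with hF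
  have hFc : Continuous F := by
    have := continuous_conj
    fun_prop
  have hmem : ∀ s, Integrable (fun y => conj (G (t + y)) * G' (τ + s + y))
      (volume.restrict (Set.Ioi 0)) := fun s =>
    ((hG.star.memLp_shift t).integrable_mul (hG'.memLp_shift (τ + s)))
  have hint : Integrable F ((volume.restrict (Set.Ioi 0)).prod (volume.restrict (Set.Ioi 0))) := by
    rw [integrable_prod_iff hFc.aestronglyMeasurable]
    refine ⟨.of_forall fun s => (hmem s).const_mul (β s), ?_⟩
    refine Integrable.mono' (hi.const_mul ‖hG.shiftLp t‖) ?_ (.of_forall fun s => ?_)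
    · exact (hFc.norm.stronglyMeasurable.integral_prod_right' (ν := volume.restrict (Set.Ioi (0:ℝ)))).aestronglyMeasurable
    · rw [Real.norm_of_nonneg (integral_nonneg fun _ => norm_nonneg _)]
      simp only [hF, norm_mul, integral_const_mul]
      have := integral_norm_mul_le (hG.memLp_shift t) (hG'.memLp_shift (τ + s))
      simp only [RCLike.norm_conj]
      calc ‖β s‖ * ∫ y in Set.Ioi (0 : ℝ), ‖G (t + y)‖ * ‖G' (τ + s + y)‖
          ≤ ‖β s‖ * (‖hG.shiftLp t‖ * ‖hG'.shiftLp (τ + s)‖) := by gcongr; exact this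
        _ = _ := by ring
  have e : ∀ y ∈ Set.Ioi (0 : ℝ), ∫ s in Set.Ioi (0 : ℝ), F (s, y) =
      conj (G (t + y)) * corr β (fun y => G' (τ + y)) y := by
    intro y hy
    rw [corr_of_nonneg _ _ (le_of_lt hy), ← integral_const_mul]
    refine integral_congr_ae (.of_forall fun s => ?_)
    simp only [hF]
    rw [show τ + s + y = τ + (y + s) by ring]
    ring
  constructor
  · exact hint.integral_prod_right.congr ((ae_restrict_iff' measurableSet_Ioi).2 (.of_forall e))
  · have h1 := integral_integral_swap (f := fun s y => F (s, y)) hint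
    rw [setIntegral_congr_fun measurableSet_Ioi e] at h1
    rw [← h1]
    refine integral_congr_ae (.of_forall fun s => ?_)
    simp only [inner_shiftLp_shiftLp, hF, integral_const_mul]

/-- In the application (ε, η) is a row of the identity matrix, and A, b_k are the amplitudes of the
corresponding row of boundary values. Eliminating b from the two equations leaves (1 + L_τ) A = -(∑
η_k g_k(τ) + ε h_τ), which is solvable in L² by positivity. The rest is regularity: an L² solution
is not enough for pointwise values and first moments. -/
lemma exists_marchenko_row {ι : Type*} [Fintype ι] {G : ι → ℝ → ℂ} (hG : ∀ k, MemH11 (G k))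
    {τ : ℝ} (hτ : 0 ≤ τ) (ε : ℂ) (η : ι → ℂ) :
    ∃ (Af : HalfL2) (A : ℝ → ℂ) (b : ι → ℝ → ℂ),
      Af = -hankelResolvent (fun k t => (hG k).shiftLp t) τ
        (∑ k, η k • (hG k).shiftLp τ + ε • hankelSource (fun k t => (hG k).shiftLp t) G τ) ∧
      HalfNice A ∧ (∀ k, HalfNice (b k)) ∧
      (∀ y, A y = -∑ k, (η k * G k (τ + y) + corr (b k) (fun y => G k (τ + y)) y)) ∧
      (∀ k y, b k y = ε * conj (G k (τ + y)) +
        conj (corr (fun t => conj (A t)) (fun y => G k (τ + y)) y)) ∧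
      ∀ k y, 0 ≤ y → b k y = ε * conj (G k (τ + y)) + inner ℂ ((hG k).shiftLp (τ + y)) Af := by
  obtain ⟨C, hF⟩ := MemH11.hankelFamily hG
  set g : ι → ℝ → HalfL2 := fun k t => (hG k).shiftLp t with hg
  have hC := hF.nonneg
  set Af : HalfL2 := -hankelResolvent g τ
    (∑ k, η k • (hG k).shiftLp τ + ε • hankelSource g G τ) with hAf
  -- The second unknown computed from the L² solution. As an inner product it is defined and
  -- continuous at every point, but its second term is so far only known to be O(1/(1+s)).
  set β : ι → ℝ → ℂ := fun k s => ε * conj (G k (τ + s)) + inner ℂ (g k (τ + s)) Af with hβ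
  have hβc : ∀ k, Continuous (β k) := by
    intro k
    have h1 := (hG k).continuous
    have h2 := hF.continuous k
    have h3 := continuous_conj
    have h4 : Continuous fun s => inner ℂ (g k (τ + s)) Af :=
      (h2.comp (continuous_const_add τ)).inner continuous_const
    have h5 : Continuous fun s => conj (G k (τ + s)) := h3.comp (h1.comp (continuous_const_add τ))
    exact (continuous_const.mul h5).add h4
  have hβle : ∀ k s, 0 < s → ‖β k s‖ ≤ ‖ε‖ * ‖G k (τ + s)‖ + C * ‖Af‖ * (1 + |s|)⁻¹ := by
    intro k s hs
    refine (norm_add_le _ _).trans ?_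
    rw [norm_mul, RCLike.norm_conj]
    gcongr
    refine (norm_inner_le_norm _ _).trans ?_
    have h1 := hF.bound k (τ + s) (by positivity)
    rw [abs_of_pos hs]
    calc ‖g k (τ + s)‖ * ‖Af‖ ≤ C / (1 + (τ + s)) * ‖Af‖ := by gcongr
      _ ≤ C / (1 + s) * ‖Af‖ := by gcongr; linarith
      _ = _ := by ring
  -- the equation satisfied by `Af`
  have hkey : Af = -(∑ k, η k • g k τ + ∫ u in Set.Ioi τ,
      ∑ k, (ε * conj (G k u) + inner ℂ (g k u) Af) • g k u) := by
    have h1 := hF.add_resolvent hτ (∑ k, η k • (hG k).shiftLp τ + ε • hankelSource g G τ)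
    have h2 : Af + hankelOp g τ Af = -(∑ k, η k • g k τ + ε • hankelSource g G τ) := by
      rw [hAf, map_neg, ← neg_add, h1]
    rw [hF.hankelOp_apply hτ] at h2
    have h3 : ε • hankelSource g G τ = ∫ u in Set.Ioi τ, ∑ k, (ε * conj (G k u)) • g k u := by
      rw [hankelSource, ← integral_smul]
      refine integral_congr_ae (.of_forall fun u => ?_)
      simp only [hankelVec, Finset.smul_sum, smul_smul]
    have h4 : IntegrableOn (fun u => ∑ k, (ε * conj (G k u)) • g k u) (Set.Ioi τ) := by
      refine ((hF.integrableOn_vec hτ).smul ε).congr (.of_forall fun u => ?_)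
      simp only [hankelVec, Finset.smul_sum, smul_smul, Pi.smul_apply]
    simp only [add_smul, Finset.sum_add_distrib]
    rw [integral_add h4 (hF.integrableOn_kernel_apply hτ Af), ← h3]
    conv_lhs => rw [eq_sub_of_add_eq h2]
    abel
  have hGsq : ∀ k, IntegrableOn (fun s => ‖β k s‖ * ‖g k (τ + s)‖) (Set.Ioi 0) := by
    intro k
    have hm : Continuous fun s => ‖β k s‖ * ‖g k (τ + s)‖ :=
      (hβc k).norm.mul ((hF.continuous k).comp (continuous_const_add τ)).norm
    have h1 : IntegrableOn (fun s => ‖ε‖ * C * ‖G k (τ + s)‖ + C ^ 2 * ‖Af‖ * (1 / (1 + s)) ^ 2)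
        (Set.Ioi 0) :=
      (((hG k).comp_add_left τ).integrable.norm.integrableOn.const_mul _).add
        (HankelFamily.integrableOn_inv_sq.const_mul _)
    refine Integrable.mono' h1 hm.aestronglyMeasurable ?_
    refine (ae_restrict_iff' measurableSet_Ioi).2 (.of_forall fun s hs => ?_)
    have hs : 0 < s := hs
    rw [Real.norm_of_nonneg (by positivity)]
    have h2 := hF.bound k (τ + s) (by positivity)
    have h3 : ‖g k (τ + s)‖ ≤ C * (1 / (1 + s)) := by
      refine h2.trans ?_
      rw [mul_one_div]
      gcongr
      linarith
    have h4 : ‖g k (τ + s)‖ ≤ C := hF.bound' k (by positivity)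
    have h5 := hβle k s hs
    rw [abs_of_pos hs, ← one_div] at h5
    calc ‖β k s‖ * ‖g k (τ + s)‖
        ≤ (‖ε‖ * ‖G k (τ + s)‖ + C * ‖Af‖ * (1 / (1 + s))) * ‖g k (τ + s)‖ := by gcongr
      _ = ‖ε‖ * ‖G k (τ + s)‖ * ‖g k (τ + s)‖ + C * ‖Af‖ * (1 / (1 + s)) * ‖g k (τ + s)‖ := by ring
      _ ≤ ‖ε‖ * ‖G k (τ + s)‖ * C + C * ‖Af‖ * (1 / (1 + s)) * (C * (1 / (1 + s))) := by gcongr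
      _ = _ := by ring
  -- The right-hand side of the first equation supplies a representative defined pointwise; that it
  -- represents `Af` is used only through the inner products in `hinner`.
  set A : ℝ → ℂ := fun y => -∑ k, (η k * G k (τ + y) + corr (β k) (fun y => G k (τ + y)) y) with hA
  have hinner : ∀ k t, inner ℂ (g k t) Af = ∫ y in Set.Ioi (0 : ℝ), conj (G k (t + y)) * A y := by
    intro k t
    have hl := fun l => integral_mul_inner_shiftLp (hG k) (hG l) t τ (hβc l) (hGsq l)
    have i1 : ∀ l, IntegrableOn (fun y => conj (G k (t + y)) * (η l * G l (τ + y))) (Set.Ioi 0) := by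
      intro l
      have := (((hG k).star.memLp_shift t).integrable_mul ((hG l).memLp_shift τ)).const_mul (η l)
      refine this.congr (.of_forall fun y => ?_)
      simp only [Pi.mul_apply]
      ring
    have hsplit : ∫ y in Set.Ioi (0 : ℝ), conj (G k (t + y)) * A y =
        -∑ l, ((∫ y in Set.Ioi (0 : ℝ), conj (G k (t + y)) * (η l * G l (τ + y))) +
          ∫ y in Set.Ioi (0 : ℝ), conj (G k (t + y)) * corr (β l) (fun y => G l (τ + y)) y) := by
      simp only [← integral_add (i1 _) (hl _).1]
      have i2 : ∀ l, IntegrableOn (fun y => conj (G k (t + y)) * (η l * G l (τ + y)) +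
          conj (G k (t + y)) * corr (β l) (fun y => G l (τ + y)) y) (Set.Ioi 0) :=
        fun l => (i1 l).add (hl l).1
      rw [← integral_finsetSum _ fun l _ => i2 l, ← integral_neg]
      refine integral_congr_ae (.of_forall fun y => ?_)
      simp only [hA, mul_neg, Finset.mul_sum, mul_add]
    have hmt : Integrable (fun u => ∑ l, (ε * conj (G l u) + inner ℂ (g l u) Af) • g l u)
        (volume.restrict (Set.Ioi τ)) := by
      have h4 : IntegrableOn (fun u => ∑ k, (ε * conj (G k u)) • g k u) (Set.Ioi τ) := by
        refine ((hF.integrableOn_vec hτ).smul ε).congr (.of_forall fun u => ?_)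
        simp only [hankelVec, Finset.smul_sum, smul_smul, Pi.smul_apply]
      refine (h4.add (hF.integrableOn_kernel_apply hτ Af)).congr (.of_forall fun u => ?_)
      simp only [Pi.add_apply, add_smul, Finset.sum_add_distrib]
    have hgi : ∀ l, IntegrableOn (fun s => β l s * inner ℂ (g k t) (g l (τ + s))) (Set.Ioi 0) := by
      intro l
      have hm : Continuous fun s => β l s * inner ℂ (g k t) (g l (τ + s)) :=
        (hβc l).mul (continuous_const.inner ((hF.continuous l).comp (continuous_const_add τ)))
      refine Integrable.mono' ((hGsq l).const_mul ‖g k t‖) hm.aestronglyMeasurable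
        (.of_forall fun s => ?_)
      rw [norm_mul]
      calc _ ≤ ‖β l s‖ * (‖g k t‖ * ‖g l (τ + s)‖) := by gcongr; exact norm_inner_le_norm _ _
        _ = _ := by ring
    conv_lhs => rw [hkey]
    rw [inner_neg_right, inner_add_right, hsplit, inner_sum, ← integral_inner hmt,
      setIntegral_Ioi_shift, Finset.sum_add_distrib]
    simp only [inner_sum, inner_smul_right]
    have e3 : ∫ s in Set.Ioi (0 : ℝ), ∑ l, (ε * conj (G l (τ + s)) + inner ℂ (g l (τ + s)) Af) *
        inner ℂ (g k t) (g l (τ + s)) =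
        ∑ l, ∫ s in Set.Ioi (0 : ℝ), β l s * inner ℂ (g k t) (g l (τ + s)) :=
      integral_finsetSum _ fun l _ => hgi l
    rw [e3]
    congr 2
    · refine Finset.sum_congr rfl fun l _ => ?_
      rw [inner_shiftLp_shiftLp, ← integral_const_mul]
      refine integral_congr_ae (.of_forall fun y => ?_)
      simp only
      ring
    · exact Finset.sum_congr rfl fun l _ => (hl l).2
  have hGn : ∀ k, HalfNice fun y => G k (τ + y) := fun k => ((hG k).comp_add_left τ).halfNice
  -- `β k` is not known to be integrable at this stage, so a quarter power of decay is borrowed from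
  -- `G k`.
  have hAint : IntegrableOn A (Set.Ioi 0) := by
    refine Integrable.neg (integrable_finsetSum _ fun k _ => ((hGn k).int.const_mul (η k)).add ?_)
    refine integrableOn_corr_of_weight (hβc k) (hGn k).cont ?_
      ((hG k).integrable_weight_shift τ).integrableOn
    have hm : AEStronglyMeasurable (fun t : ℝ => (1 + |t|) ^ (-(1 / 4 : ℝ)) * ‖β k t‖)
        (volume.restrict (Set.Ioi 0)) := by
      have := (hβc k).measurable
      exact Measurable.aestronglyMeasurable (by fun_prop)
    have h1 : IntegrableOn (fun t : ℝ => ‖ε‖ * ‖G k (τ + t)‖ +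
        C * ‖Af‖ * ((1 + |t|) ^ (-(1 / 4 : ℝ)) * (1 + |t|)⁻¹)) (Set.Ioi 0) :=
      ((hGn k).int.norm.const_mul _).add (integrableOn_weight_inv.const_mul _)
    refine Integrable.mono' h1 hm ?_
    refine (ae_restrict_iff' measurableSet_Ioi).2 (.of_forall fun t ht => ?_)
    have ht : 0 < t := ht
    rw [Real.norm_of_nonneg (by positivity)]
    have h2 : (1 + |t|) ^ (-(1 / 4 : ℝ)) ≤ 1 :=
      Real.rpow_le_one_of_one_le_of_nonpos (by linarith [abs_nonneg t]) (by norm_num)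
    have h3 := hβle k t ht
    have h4 : 0 ≤ (1 + |t|) ^ (-(1 / 4 : ℝ)) := by positivity
    calc (1 + |t|) ^ (-(1 / 4 : ℝ)) * ‖β k t‖
        ≤ (1 + |t|) ^ (-(1 / 4 : ℝ)) * (‖ε‖ * ‖G k (τ + t)‖ + C * ‖Af‖ * (1 + |t|)⁻¹) := by gcongr
      _ = (1 + |t|) ^ (-(1 / 4 : ℝ)) * (‖ε‖ * ‖G k (τ + t)‖) +
          C * ‖Af‖ * ((1 + |t|) ^ (-(1 / 4 : ℝ)) * (1 + |t|)⁻¹) := by ring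
      _ ≤ _ := by
        exact add_le_add (mul_le_of_le_one_left (by positivity) h2) le_rfl
  -- With A integrable, this expression in A is integrable too. It agrees with `β k` on the
  -- half-line, and its integrability then gives A its first moment, which in turn gives b the full
  -- regularity.
  set b : ι → ℝ → ℂ := fun k y => ε * conj (G k (τ + y)) +
        conj (corr (fun t => conj (A t)) (fun y => G k (τ + y)) y) with hb
  have hbβ : ∀ k y, 0 ≤ y → b k y = β k y := by
    intro k y hy
    simp only [hb, hβ]
    rw [hinner k (τ + y), corr_of_nonneg _ _ hy, ← integral_conj]
    congr 1
    refine integral_congr_ae (.of_forall fun t => ?_)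
    simp only [map_mul, conj_conj]
    rw [mul_comm, add_assoc]
  have hAi : IntegrableOn (fun t => conj (A t)) (Set.Ioi 0) := by
    have := (LinearIsometryEquiv.integrable_comp_iff (μ := volume.restrict (Set.Ioi 0)) (φ := A) conjLIE).2 hAint
    exact this
  have hbc : ∀ k, Continuous (b k) := fun k =>
    (continuous_const.mul (continuous_conj.comp (hGn k).cont)).add
      (continuous_conj.comp (HalfNice.corr_continuous hAi (hGn k)))
  have hbint : ∀ k, IntegrableOn (b k) (Set.Ioi 0) := by
    intro k
    refine ((hGn k).star.int.const_mul ε).add ?_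
    have h := HalfNice.corr_integrable hAi (hGn k)
    have := (LinearIsometryEquiv.integrable_comp_iff (μ := volume.restrict (Set.Ioi 0)) conjLIE).2
      h.integrableOn
    exact this
  have hcorr : ∀ k, corr (b k) (fun y => G k (τ + y)) = corr (β k) (fun y => G k (τ + y)) :=
    fun k => corr_congr_left fun t ht => hbβ k t ht.le
  have hAn : HalfNice A := by
    simp only [hA, ← hcorr]
    exact (HalfNice.sum _ fun k _ => ((hGn k).const_mul (η k)).add
      (HalfNice.corr_halfNice (hbc k) (hbint k) (hGn k))).neg
  refine ⟨Af, A, b, rfl, hAn, fun k => ?_, fun y => ?_, fun k y => rfl, fun k y hy => hbβ k y hy⟩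
  · exact ((hGn k).star.const_mul ε).add
      (HalfNice.corr_halfNice hAn.star.cont hAn.star.int (hGn k)).star
  · simp only [hA, hcorr]

end

/-! ### Factorization of the jump matrix on the line -/

section

open scoped Matrix

instance upperCone_neBot (κ : ℝ) : (upperCone κ).NeBot := by
  have h : Tendsto (fun n : ℕ => (n : ℂ) * I) atTop (upperCone κ) := by
    refine tendsto_inf.2 ⟨?_, tendsto_principal.2 (.of_forall fun n => by simp)⟩
    rw [← tendsto_norm_atTop_iff_cobounded]
    simpa using tendsto_natCast_atTop_atTop (R := ℝ)
  exact h.neBot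

namespace UpperNice

variable {f g : ℂ → ℂ} {c d l k : ℂ}

lemma unique (hf : UpperNice f c l) (hg : UpperNice g d k) (h : ∀ z : ℂ, 0 ≤ z.im → f z = g z) :
    c = d ∧ l = k := by
  have hle := upperCone_le one_pos
  have hcd : c = d := by
    refine tendsto_nhds_unique (hf.lim.mono_left hle) ((hg.lim.mono_left hle).congr' ?_)
    filter_upwards [hle (mem_inf_of_right (mem_principal_self _))] with z hz using (h z hz).symm
  subst hcd
  refine ⟨rfl, tendsto_nhds_unique (hf.cone 1 one_pos) ((hg.cone 1 one_pos).congr' ?_)⟩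
  filter_upwards [hle (mem_inf_of_right (mem_principal_self _))] with z hz
  rw [h z hz]

/-- Two functions on the upper half plane with conjugate values on the real line are constant. -/
lemma eq_const_of_conj (hf : UpperNice f c l) (hg : UpperNice g (conj c) k)
    (h : ∀ s : ℝ, f s = conj (g s)) {z : ℂ} (hz : 0 ≤ z.im) : f z = c := by
  -- Schwarz reflection: the two functions match along the real line and form a bounded entire
  -- function.
  set F : ℂ → ℂ := fun z => if 0 ≤ z.im then f z else conj (g (conj z)) with hF
  have hcont : Continuous F := by
    refine continuous_if_le continuous_const continuous_im hf.cont ?_ ?_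
    · refine continuous_conj.comp_continuousOn (hg.cont.comp (by fun_prop) fun z hz => ?_)
      have hz : z.im ≤ 0 := hz
      simpa using hz
    · intro z hz
      have hz : 0 = z.im := hz
      have e : z = (z.re : ℂ) := Complex.ext (by simp) (by simp [← hz])
      rw [e, h]
      simp
  have hd : Differentiable ℂ F := by
    rw [← differentiableOn_univ]
    refine differentiableOn_of_im_ne_zero isOpen_univ hcont.continuousOn fun z hz => ?_
    rcases lt_or_gt_of_ne hz.2 with h0 | h0
    · have h1 : DifferentiableAt ℂ g (conj z) :=
        hg.diff.differentiableAt (isOpen_upper.mem_nhds (by simpa using h0))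
      have h2 := h1.conj_conj
      rw [Complex.conj_conj] at h2
      refine (h2.congr_of_eventuallyEq ?_).differentiableWithinAt
      filter_upwards [(isOpen_lt continuous_im continuous_const).mem_nhds h0] with w hw
      simp only [hF, if_neg (not_le.2 (show w.im < 0 from hw))]
      rfl
    · refine ((hf.diff.differentiableAt (isOpen_upper.mem_nhds h0)).congr_of_eventuallyEq
        ?_).differentiableWithinAt
      filter_upwards [isOpen_upper.mem_nhds h0] with w hw
      simp only [hF, if_pos (le_of_lt (show 0 < w.im from hw))]
  have hlim : Tendsto F (cobounded ℂ) (𝓝 c) := by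
    have hg' : Tendsto (fun z => conj (g (conj z))) (cobounded ℂ ⊓ 𝓟 {z : ℂ | ¬ 0 ≤ z.im}) (𝓝 c) := by
      have h1 : Tendsto (fun z : ℂ => conj z) (cobounded ℂ ⊓ 𝓟 {z : ℂ | ¬ 0 ≤ z.im}) upperInfty := by
        refine tendsto_inf.2 ⟨?_, tendsto_principal.2 ?_⟩
        · refine Tendsto.mono_left ?_ inf_le_left
          rw [← tendsto_norm_atTop_iff_cobounded]
          simpa using tendsto_norm_cobounded_atTop
        · filter_upwards [mem_inf_of_right (mem_principal_self _)] with z hz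
          have hz : ¬ 0 ≤ z.im := hz
          simp only [conj_im]
          linarith
      have h2 := (continuous_conj.tendsto _).comp (hg.lim.comp h1)
      rw [Complex.conj_conj] at h2
      exact h2
    exact Tendsto.if hf.lim hg'
  have := eq_const_of_differentiable_of_tendsto hd hlim z
  simpa only [hF, if_pos hz] using this

end UpperNice

variable {m : ℕ}

/-- The unipotent matrix with first column `(1, t)`. -/
def lowMat (t : Fin m → ℂ) : Matrix (Fin (m + 1)) (Fin (m + 1)) ℂ :=
  Matrix.of fun j k => Fin.cases (Fin.cases 1 (fun _ => 0) k)
    (fun j' => Fin.cases (t j') (fun k' => if j' = k' then 1 else 0) k) j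

@[simp] lemma lowMat_zero_zero (t : Fin m → ℂ) : lowMat t 0 0 = 1 := rfl

@[simp] lemma lowMat_zero_succ (t : Fin m → ℂ) (k : Fin m) : lowMat t 0 k.succ = 0 := rfl

@[simp] lemma lowMat_succ_zero (t : Fin m → ℂ) (j : Fin m) : lowMat t j.succ 0 = t j := rfl

@[simp] lemma lowMat_succ_succ (t : Fin m → ℂ) (j k : Fin m) :
    lowMat t j.succ k.succ = if j = k then 1 else 0 := rfl

lemma mul_lowMat_zero {κ : Type*} (N : Matrix κ (Fin (m + 1)) ℂ) (t : Fin m → ℂ) (j : κ) :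
    (N * lowMat t) j 0 = N j 0 + ∑ k, N j k.succ * t k := by
  simp [Matrix.mul_apply, Fin.sum_univ_succ]

lemma mul_lowMat_succ {κ : Type*} (N : Matrix κ (Fin (m + 1)) ℂ) (t : Fin m → ℂ) (j : κ)
    (k : Fin m) : (N * lowMat t) j k.succ = N j k.succ := by
  simp [Matrix.mul_apply, Fin.sum_univ_succ]

lemma lowMat_mul_zero {κ : Type*} (K : Matrix (Fin (m + 1)) κ ℂ) (t : Fin m → ℂ) (j : κ) :
    (lowMat t * K) 0 j = K 0 j := by
  simp [Matrix.mul_apply, Fin.sum_univ_succ]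

lemma lowMat_mul_succ {κ : Type*} (K : Matrix (Fin (m + 1)) κ ℂ) (t : Fin m → ℂ) (k : Fin m)
    (j : κ) : (lowMat t * K) k.succ j = t k * K 0 j + K k.succ j := by
  simp [Matrix.mul_apply, Fin.sum_univ_succ]

lemma lowMat_mul_lowMat (t t' : Fin m → ℂ) : lowMat t * lowMat t' = lowMat (t + t') := by
  ext j k
  refine Fin.cases ?_ (fun j => ?_) j <;> refine Fin.cases ?_ (fun k => ?_) k
  · simp [lowMat_mul_zero]
  · simp [lowMat_mul_zero]
  · simp [lowMat_mul_succ]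
  · simp [lowMat_mul_succ]

lemma lowMat_zero : lowMat (0 : Fin m → ℂ) = 1 := by
  ext j k
  refine Fin.cases ?_ (fun j => ?_) j <;> refine Fin.cases ?_ (fun k => ?_) k
  · simp
  · simp [(Fin.succ_ne_zero _).symm]
  · simp
  · simp [Matrix.one_apply]

lemma lowMat_mul_neg (t : Fin m → ℂ) : lowMat t * lowMat (-t) = 1 := by
  rw [lowMat_mul_lowMat, add_neg_cancel, lowMat_zero]

/-- A factorization `V = Nᴴ N` on the line of the jump matrix `V` with reflection coefficients `r`,
where `N` and its inverse `K` are holomorphic in the upper half plane. -/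
structure IsFactor (r : Fin m → ℝ → ℂ) (N K : ℂ → Matrix (Fin (m + 1)) (Fin (m + 1)) ℂ)
    (ℓ : Matrix (Fin (m + 1)) (Fin (m + 1)) ℂ) : Prop where
  nice : ∀ j k, UpperNice (fun z => N z j k) ((1 : Matrix (Fin (m + 1)) (Fin (m + 1)) ℂ) j k) (ℓ j k)
  nice_inv : ∀ j k,
    UpperNice (fun z => K z j k) ((1 : Matrix (Fin (m + 1)) (Fin (m + 1)) ℂ) j k) (-ℓ j k)
  mul_inv : ∀ z : ℂ, 0 ≤ z.im → N z * K z = 1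
  jump : ∀ s : ℝ, (N s)ᴴ * N s = (lowMat fun k => r k s)ᴴ * lowMat fun k => r k s

lemma UpperNice.matrix_mul {κ : Type*} [Fintype κ] [DecidableEq κ] {N K : ℂ → Matrix κ κ ℂ}
    {ℓ ℓ' : Matrix κ κ ℂ}
    (hN : ∀ j k, UpperNice (fun z => N z j k) ((1 : Matrix κ κ ℂ) j k) (ℓ j k))
    (hK : ∀ j k, UpperNice (fun z => K z j k) ((1 : Matrix κ κ ℂ) j k) (ℓ' j k)) (j k : κ) :
    UpperNice (fun z => (N z * K z) j k) ((1 : Matrix κ κ ℂ) j k) (ℓ j k + ℓ' j k) := by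
  have h := UpperNice.sum Finset.univ fun i (_ : i ∈ Finset.univ) => (hN j i).mul (hK i k)
  have e1 : ∑ i, (1 : Matrix κ κ ℂ) j i * (1 : Matrix κ κ ℂ) i k = (1 : Matrix κ κ ℂ) j k := by
    rw [← Matrix.mul_apply, one_mul]
  have e2 : ∑ i, (ℓ j i * (1 : Matrix κ κ ℂ) i k + (1 : Matrix κ κ ℂ) j i * ℓ' i k) =
      ℓ j k + ℓ' j k := by
    rw [Finset.sum_add_distrib, ← Matrix.mul_apply, ← Matrix.mul_apply, one_mul, mul_one]
  rw [e1, e2] at h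
  exact h.congr fun z _ => by simp only [Matrix.mul_apply]

lemma UpperNice.eq_neg_of_mul_eq_one {κ : Type*} [Fintype κ] [DecidableEq κ]
    {N K : ℂ → Matrix κ κ ℂ} {ℓ ℓ' : Matrix κ κ ℂ}
    (hN : ∀ j k, UpperNice (fun z => N z j k) ((1 : Matrix κ κ ℂ) j k) (ℓ j k))
    (hK : ∀ j k, UpperNice (fun z => K z j k) ((1 : Matrix κ κ ℂ) j k) (ℓ' j k))
    (h : ∀ z : ℂ, 0 ≤ z.im → N z * K z = 1) (j k : κ) : ℓ' j k = -ℓ j k := by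
  have h1 := ((UpperNice.matrix_mul hN hK j k).unique
    (UpperNice.const ((1 : Matrix κ κ ℂ) j k)) fun z hz => by rw [h z hz]).2
  linear_combination h1

/-- Liouville's theorem turns boundary data of the form `N = X L`, `K = L⁻¹ Xᴴ` into a
factorization. -/
lemma IsFactor.of_hermitian {r : Fin m → ℝ → ℂ}
    {N K : ℂ → Matrix (Fin (m + 1)) (Fin (m + 1)) ℂ} {X : ℝ → Matrix (Fin (m + 1)) (Fin (m + 1)) ℂ}
    {ℓ ℓ' : Matrix (Fin (m + 1)) (Fin (m + 1)) ℂ}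
    (hN : ∀ j k,
      UpperNice (fun z => N z j k) ((1 : Matrix (Fin (m + 1)) (Fin (m + 1)) ℂ) j k) (ℓ j k))
    (hK : ∀ j k,
      UpperNice (fun z => K z j k) ((1 : Matrix (Fin (m + 1)) (Fin (m + 1)) ℂ) j k) (ℓ' j k))
    (h1 : ∀ s : ℝ, N s = X s * lowMat fun k => r k s)
    (h2 : ∀ s : ℝ, K s = lowMat (-fun k => r k s) * (X s)ᴴ) : IsFactor r N K ℓ := by
  -- The unipotent factors cancel, so N K is Hermitian on the line. Its entries and the transposed
  -- ones are holomorphic above with conjugate boundary values, hence constant; N K = 1 then says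
  -- that X is unitary.
  have hprod : ∀ s : ℝ, N s * K s = X s * (X s)ᴴ := fun s => by
    rw [h1, h2, Matrix.mul_assoc, ← Matrix.mul_assoc (lowMat _) (lowMat _), lowMat_mul_neg,
      Matrix.one_mul]
  have hone : ∀ z : ℂ, 0 ≤ z.im → N z * K z = 1 := by
    intro z hz
    ext j k
    have hjk := UpperNice.matrix_mul hN hK j k
    have hkj := UpperNice.matrix_mul hN hK k j
    have e : (1 : Matrix (Fin (m + 1)) (Fin (m + 1)) ℂ) k j =
        conj ((1 : Matrix (Fin (m + 1)) (Fin (m + 1)) ℂ) j k) := by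
      simp only [Matrix.one_apply, eq_comm (a := k)]
      split_ifs <;> simp
    rw [e] at hkj
    refine hjk.eq_const_of_conj hkj (fun s => ?_) hz
    have h3 : (N s * K s)ᴴ = N s * K s := by
      rw [hprod, Matrix.conjTranspose_mul, Matrix.conjTranspose_conjTranspose]
    conv_lhs => rw [← h3]
    rfl
  refine ⟨hN, fun j k => ?_, hone, fun s => ?_⟩
  · rw [← UpperNice.eq_neg_of_mul_eq_one hN hK hone j k]
    exact hK j k
  · have h3 : (X s)ᴴ * X s = 1 := by
      have := hone s (by simp)
      rw [hprod] at this
      exact mul_eq_one_comm.1 this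
    rw [h1, Matrix.conjTranspose_mul, Matrix.mul_assoc, ← Matrix.mul_assoc _ (X s), h3,
      Matrix.one_mul]

section halfFT

variable {a b : ℝ → ℂ}

lemma HalfNice.halfFT_add (ha : HalfNice a) (hb : HalfNice b) {z : ℂ} (hz : 0 ≤ z.im) :
    halfFT (fun y => a y + b y) z = halfFT a z + halfFT b z := by
  simp only [halfFT, add_mul]
  exact integral_add (HalfNice.integrableOn_mul_exp ha.int hz)
    (HalfNice.integrableOn_mul_exp hb.int hz)

lemma halfFT_const_mul (a : ℝ → ℂ) (c z : ℂ) : halfFT (fun y => c * a y) z = c * halfFT a z := by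
  simp only [halfFT, mul_assoc]
  exact integral_const_mul _ _

lemma halfFT_neg (a : ℝ → ℂ) (z : ℂ) : halfFT (fun y => - a y) z = - halfFT a z := by
  simp only [halfFT, neg_mul]
  exact integral_neg _

lemma halfFT_sum {ι : Type*} (s : Finset ι) {a : ι → ℝ → ℂ} (ha : ∀ i ∈ s, HalfNice (a i)) {z : ℂ}
    (hz : 0 ≤ z.im) : halfFT (fun y => ∑ i ∈ s, a i y) z = ∑ i ∈ s, halfFT (a i) z := by
  simp only [halfFT, Finset.sum_mul]
  exact integral_finsetSum _ fun i hi => HalfNice.integrableOn_mul_exp (ha i hi).int hz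

lemma conj_halfFT (a : ℝ → ℂ) (z : ℂ) :
    conj (halfFT a z) = halfFT (fun y => conj (a y)) (-conj z) := by
  rw [halfFT, ← integral_conj, halfFT]
  refine integral_congr_ae (.of_forall fun y => ?_)
  simp [← exp_conj]

end halfFT

/-- The boundary matrix X is the identity plus half-line transforms, its first column continuing to
the lower half plane and the others to the upper one. In X L(r) and L(-r) Xᴴ the products of
transforms split by correlation. The first Marchenko equation says that the lower half plane part of
the first column of X L(r) cancels; the second says the same for the remaining rows of L(-r) Xᴴ. The
1/z coefficients are the amplitudes at 0. -/
theorem exists_isFactor {G : Fin m → ℝ → ℂ} (hG : ∀ k, MemH11 (G k)) {gneg : Fin m → ℝ → ℂ}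
    (hgneg : ∀ k, HalfNice (gneg k)) {τ : ℝ} (hτ : 0 ≤ τ) {r : Fin m → ℝ → ℂ}
    (hr : ∀ k (s : ℝ), r k s = halfFT (fun y => G k (τ + y)) (-s) + halfFT (gneg k) s) :
    ∃ N K ℓ, IsFactor r N K ℓ ∧
      (∀ j : Fin m, ℓ j.succ 0 =
        I * (gneg j 0 - hankelCoeff (fun k t => (hG k).shiftLp t) G j τ)) ∧
      ∀ j : Fin m, ℓ 0 j.succ =
        I * conj (G j τ - hankelCoeff (fun k t => (hG k).shiftLp t) G j τ) := by
  obtain ⟨C, hF⟩ := MemH11.hankelFamily hG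
  set g : Fin m → ℝ → HalfL2 := fun k t => (hG k).shiftLp t with hg
  set E : Matrix (Fin (m + 1)) (Fin (m + 1)) ℂ := 1 with hE
  choose Af A b hAf hA hb hAeq hbeq hbinner using fun j : Fin (m + 1) =>
    exists_marchenko_row hG hτ (E j 0) (fun k => E j k.succ)
  have hGn : ∀ k, HalfNice fun y => G k (τ + y) := fun k => ((hG k).comp_add_left τ).halfNice
  set cneg : Fin (m + 1) → Fin m → ℝ → ℂ := fun j k y => corr (b j k) (fun y => G k (τ + y)) (-y)
    with hcneg
  have hcn : ∀ j k, HalfNice (cneg j k) := fun j k => HalfNice.corr_neg_halfNice (hb j k) (hGn k)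
  set dneg : Fin (m + 1) → Fin m → ℝ → ℂ := fun j k y =>
    corr (fun t => conj (A j t)) (fun y => G k (τ + y)) (-y) with hdneg
  have hdn : ∀ j k, HalfNice (dneg j k) := fun j k => HalfNice.corr_neg_halfNice (hA j).star (hGn k)
  set μ : Fin (m + 1) → Fin m → ℂ → ℂ := fun j k z => E j k.succ + halfFT (b j k) z with hμ
  have hμn : ∀ j k, UpperNice (μ j k) (E j k.succ) (I * b j k 0) := fun j k => by
    simpa using (UpperNice.const (E j k.succ)).add (hb j k).upperNice
  set ν : Fin (m + 1) → ℂ → ℂ := fun j z => conj (E j 0) + halfFT (fun y => conj (A j y)) z with hν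
  have hνn : ∀ j, UpperNice (ν j) (conj (E j 0)) (I * conj (A j 0)) := fun j => by
    simpa using (UpperNice.const (conj (E j 0))).add (hA j).star.upperNice
  set N : ℂ → Matrix (Fin (m + 1)) (Fin (m + 1)) ℂ := fun z => Matrix.of fun j k =>
    Fin.cases (E j 0 + ∑ k, (halfFT (cneg j k) z + μ j k z * halfFT (gneg k) z)) (fun k => μ j k z) k
    with hN
  set K : ℂ → Matrix (Fin (m + 1)) (Fin (m + 1)) ℂ := fun z => Matrix.of fun k j =>
    Fin.cases (ν j z) (fun k => conj (E j k.succ) - halfFT (dneg j k) z - ν j z * halfFT (gneg k) z) k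
    with hK
  set ℓ : Matrix (Fin (m + 1)) (Fin (m + 1)) ℂ := Matrix.of fun j k =>
    Fin.cases (∑ k, (I * cneg j k 0 + E j k.succ * (I * gneg k 0))) (fun k => I * b j k 0) k with hℓ
  set ℓ' : Matrix (Fin (m + 1)) (Fin (m + 1)) ℂ := Matrix.of fun k j =>
    Fin.cases (I * conj (A j 0))
      (fun k => 0 - I * dneg j k 0 - conj (E j 0) * (I * gneg k 0)) k with hℓ'
  set X : ℝ → Matrix (Fin (m + 1)) (Fin (m + 1)) ℂ := fun s => Matrix.of fun j k =>
    Fin.cases (E j 0 + halfFT (A j) (-s)) (fun k => μ j k s) k with hX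
  have hEc : ∀ j k, conj (E j k) = E k j := fun j k => by
    simp only [hE, Matrix.one_apply, eq_comm (a := j)]
    split_ifs <;> simp
  have hfac : IsFactor r N K ℓ := by
    refine IsFactor.of_hermitian (X := X) (ℓ' := ℓ') (fun j k => ?_) (fun k j => ?_) (fun s => ?_)
      (fun s => ?_)
    · refine Fin.cases ?_ (fun k => ?_) k
      · have h := (UpperNice.const (E j 0)).add (UpperNice.sum Finset.univ fun k _ =>
          ((hcn j k).upperNice).add ((hμn j k).mul (hgneg k).upperNice))
        simpa [hN, hℓ] using h
      · exact hμn j k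
    · refine Fin.cases ?_ (fun k => ?_) k
      · have := hνn j
        rw [hEc] at this
        exact this
      · have h := ((UpperNice.const (conj (E j k.succ))).sub (hdn j k).upperNice).sub
          ((hνn j).mul (hgneg k).upperNice)
        rw [hEc j k.succ] at h
        simpa [hK, hℓ', hEc] using h
    · have hs : 0 ≤ (-(s : ℂ)).im := by simp
      ext j k
      refine Fin.cases ?_ (fun k => ?_) k
      · rw [mul_lowMat_zero]
        simp only [hN, hX, Matrix.of_apply, Fin.cases_zero, Fin.cases_succ]
        have e1 : halfFT (A j) (-s) = -∑ k, (E j k.succ * halfFT (fun y => G k (τ + y)) (-s) +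
            halfFT (corr (b j k) fun y => G k (τ + y)) (-s)) := by
          have hcn' : ∀ k, HalfNice (corr (b j k) fun y => G k (τ + y)) := fun k =>
            HalfNice.corr_halfNice (hb j k).cont (hb j k).int (hGn k)
          rw [funext (hAeq j), halfFT_neg, halfFT_sum _
            (fun k _ => ((hGn k).const_mul _).add (hcn' k)) hs]
          congr 1
          refine Finset.sum_congr rfl fun k _ => ?_
          rw [((hGn k).const_mul _).halfFT_add (hcn' k) hs, halfFT_const_mul]
        rw [e1, add_assoc, ← Finset.sum_neg_distrib, ← Finset.sum_add_distrib]
        congr 1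
        refine Finset.sum_congr rfl fun k _ => ?_
        have e2 := (hb j k).halfFT_mul_halfFT_neg (hGn k) s
        rw [hr]
        simp only [hμ, hcneg]
        linear_combination -e2
      · rw [mul_lowMat_succ]
        rfl
    · have hs : 0 ≤ (-(s : ℂ)).im := by simp
      have hX0 : ∀ j, conj (X s j 0) = ν j s := fun j => by
        simp only [hX, hν, Matrix.of_apply, Fin.cases_zero, map_add, conj_halfFT]
        simp
      ext k j
      refine Fin.cases ?_ (fun k => ?_) k
      · rw [lowMat_mul_zero, Matrix.conjTranspose_apply]
        exact (hX0 j).symm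
      · rw [lowMat_mul_succ, Matrix.conjTranspose_apply, Matrix.conjTranspose_apply]
        have e0 : star (X s j 0) = ν j s := hX0 j
        have e1 : star (X s j k.succ) = conj (E j k.succ) + (conj (E j 0) *
            halfFT (fun y => G k (τ + y)) (-s) +
            halfFT (corr (fun t => conj (A j t)) fun y => G k (τ + y)) (-s)) := by
          have hc' : HalfNice (corr (fun t => conj (A j t)) fun y => G k (τ + y)) :=
            HalfNice.corr_halfNice (hA j).star.cont (hA j).star.int (hGn k)
          change conj (E j k.succ + halfFT (b j k) s) = _
          rw [map_add, conj_halfFT, conj_ofReal, ← halfFT_const_mul,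
            ← ((hGn k).const_mul _).halfFT_add hc' hs]
          congr 2
          ext y
          rw [hbeq]
          simp
        rw [e0, e1]
        simp only [hK, Matrix.of_apply, Fin.cases_succ, Pi.neg_apply]
        have e2 := (hA j).star.halfFT_mul_halfFT_neg (hGn k) s
        rw [hr]
        simp only [hν, hdneg]
        linear_combination e2
  have hE00 : E 0 0 = 1 := Matrix.one_apply_eq _
  have hE0s : ∀ k : Fin m, E 0 k.succ = 0 := fun k => Matrix.one_apply_ne (Fin.succ_ne_zero _).symm
  have hEs0 : ∀ k : Fin m, E k.succ 0 = 0 := fun k => Matrix.one_apply_ne (Fin.succ_ne_zero _)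
  have hEss : ∀ j k : Fin m, E j.succ k.succ = if j = k then 1 else 0 := fun j k => by
    simp [hE, Matrix.one_apply]
  refine ⟨N, K, ℓ, hfac, fun j => ?_, fun j => ?_⟩
  · have hAf' : Af j.succ = -hankelResolvent g τ (g j τ) := by
      rw [hAf]
      simp [hEs0, hEss, hg]
    -- At argument 0 the correlations of `b` with the translates of G sum to the pairing of the
    -- source vector with `Af`.
    have e1 : ∑ k, cneg j.succ k 0 = -hankelCoeff g G j τ := by
      rw [hankelCoeff, ← inner_neg_right, ← hAf', ← inner_conj_symm, hF.inner_hankelSource hτ, ← integral_conj, setIntegral_Ioi_shift]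
      simp only [hcneg, neg_zero, corr_of_nonneg _ _ le_rfl, zero_add]
      rw [← integral_finsetSum]
      · refine setIntegral_congr_fun measurableSet_Ioi fun t ht => ?_
        have ht : 0 < t := ht
        simp only [map_sum, map_mul, conj_conj, inner_conj_symm]
        refine Finset.sum_congr rfl fun k _ => ?_
        rw [hbinner j.succ k t ht.le, hEs0, zero_mul, zero_add, mul_comm]
      · intro k _
        obtain ⟨B, hB⟩ := (hG k).exists_bound
        refine Integrable.mono' ((hb j.succ k).int.norm.mul_const B)
          ((hb j.succ k).cont.mul (hGn k).cont).aestronglyMeasurable (.of_forall fun t => ?_)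
        rw [norm_mul]
        gcongr
        exact hB _
    simp only [hℓ, Matrix.of_apply, Fin.cases_zero, hEss, Finset.sum_add_distrib, ← Finset.mul_sum,
      e1]
    simp
    ring
  · have hAf' : Af 0 = -hankelResolvent g τ (hankelSource g G τ) := by
      rw [hAf]
      simp [hE00, hE0s, hg]
    simp only [hℓ, Matrix.of_apply, Fin.cases_succ]
    congr 1
    rw [hbinner 0 j 0 le_rfl, hE00, one_mul, add_zero, hAf', inner_neg_right, map_sub, hankelCoeff,
      inner_conj_symm, hF.resolvent_symm hτ]
    rw [sub_eq_add_neg]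

end

/-! ### Pole terms and the conjugated jump matrices -/

section

open scoped Matrix

section pole

/-- The pole term with residue `e^{2 i a x}` at `a`. -/
def poleOut (a : ℂ) (x : ℝ) (w : ℂ) : ℂ := exp (2 * I * a * x) / (w - a)

/-- The holomorphic difference between the pole term and `e^{2 i w x} / (w - a)`. -/
def poleIn (a : ℂ) (x : ℝ) (w : ℂ) : ℂ := -dslope (fun s => exp (2 * I * s * x)) a w

open Classical in
/-- The pole term, regularized in the set `B`. -/
def poleReg (B : Set ℂ) (a : ℂ) (x : ℝ) (w : ℂ) : ℂ := if w ∈ B then poleIn a x w else poleOut a x w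

variable {a : ℂ} {x : ℝ} {ρ : ℝ}

lemma differentiable_poleIn (a : ℂ) (x : ℝ) : Differentiable ℂ (poleIn a x) := by
  have h : Differentiable ℂ fun s : ℂ => exp (2 * I * s * x) := by fun_prop
  have := (Complex.differentiableOn_dslope (c := a) univ_mem).2 h.differentiableOn
  exact (differentiableOn_univ.1 this).neg

lemma differentiableAt_poleOut {w : ℂ} (h : w ≠ a) : DifferentiableAt ℂ (poleOut a x) w := by
  have : w - a ≠ 0 := sub_ne_zero.2 h
  unfold poleOut
  fun_prop (disch := assumption)

/-- The jump on a circle is thus a difference of a term decaying at infinity, used outside, and an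
entire term, used inside; this is what removes the circles. -/
lemma poleOut_sub_poleIn {w : ℂ} (h : w ≠ a) :
    poleOut a x w - poleIn a x w = exp (2 * I * w * x) / (w - a) := by
  have : w - a ≠ 0 := sub_ne_zero.2 h
  rw [poleOut, poleIn, dslope_of_ne _ h, slope_def_field]
  field_simp
  ring

lemma poleReg_of_mem {B : Set ℂ} {w : ℂ} (h : w ∈ B) : poleReg B a x w = poleIn a x w := if_pos h

lemma poleReg_of_notMem {B : Set ℂ} {w : ℂ} (h : w ∉ B) : poleReg B a x w = poleOut a x w := if_neg h

open Classical in
lemma poleReg_eventuallyEq {w : ℂ} (h : w ∉ Metric.sphere a ρ) :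
    ∀ᶠ s in 𝓝 w, poleReg (Metric.ball a ρ) a x s = poleReg (Metric.closedBall a ρ) a x s ∧
      poleReg (Metric.ball a ρ) a x s = if w ∈ Metric.ball a ρ then poleIn a x s else poleOut a x s := by
  rcases lt_or_gt_of_ne (show dist w a ≠ ρ from h) with h | h
  · filter_upwards [Metric.isOpen_ball.mem_nhds (show w ∈ Metric.ball a ρ from h)] with s hs
    rw [poleReg_of_mem hs, poleReg_of_mem (Metric.ball_subset_closedBall hs),
      if_pos (show w ∈ Metric.ball a ρ from h)]
    exact ⟨rfl, rfl⟩
  · have h' : w ∉ Metric.closedBall a ρ := not_le.2 h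
    filter_upwards [Metric.isClosed_closedBall.isOpen_compl.mem_nhds h'] with s hs
    have hs' : s ∉ Metric.ball a ρ := fun h => hs (Metric.ball_subset_closedBall h)
    rw [poleReg_of_notMem hs, poleReg_of_notMem hs',
      if_neg fun h0 => h' (Metric.ball_subset_closedBall h0)]
    exact ⟨rfl, rfl⟩

lemma differentiableAt_poleReg (hρ : 0 < ρ) {w : ℂ} (h : w ∉ Metric.sphere a ρ) :
    DifferentiableAt ℂ (poleReg (Metric.ball a ρ) a x) w := by
  have he := (poleReg_eventuallyEq (x := x) h).mono fun s hs => hs.2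
  by_cases hw : w ∈ Metric.ball a ρ
  · simp only [if_pos hw] at he
    exact (differentiable_poleIn a x w).congr_of_eventuallyEq he
  · simp only [if_neg hw] at he
    refine (differentiableAt_poleOut ?_).congr_of_eventuallyEq he
    rintro rfl
    exact hw (Metric.mem_ball_self hρ)

lemma tendsto_poleReg_outside (hρ : 0 < ρ) {w : ℂ} (h : w ∈ Metric.sphere a ρ) :
    Tendsto (poleReg (Metric.ball a ρ) a x) (𝓝[(Metric.ball a ρ)ᶜ] w)
      (𝓝 (poleReg (Metric.ball a ρ) a x w)) := by
  have hw : w ∉ Metric.ball a ρ := fun h' => (show dist w a < ρ from h').ne h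
  have hne : w ≠ a := by rintro rfl; exact hw (Metric.mem_ball_self hρ)
  rw [poleReg_of_notMem hw]
  refine ((differentiableAt_poleOut (x := x) hne).continuousAt.mono_left nhdsWithin_le_nhds).congr' ?_
  filter_upwards [self_mem_nhdsWithin] with s hs using (poleReg_of_notMem hs).symm

lemma tendsto_poleReg_inside {w : ℂ} (h : w ∈ Metric.sphere a ρ) :
    Tendsto (poleReg (Metric.closedBall a ρ) a x) (𝓝[Metric.closedBall a ρ] w)
      (𝓝 (poleReg (Metric.closedBall a ρ) a x w)) := by
  rw [poleReg_of_mem (Metric.sphere_subset_closedBall h)]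
  refine ((differentiable_poleIn a x w).continuousAt.mono_left nhdsWithin_le_nhds).congr' ?_
  filter_upwards [self_mem_nhdsWithin] with s hs using (poleReg_of_mem hs).symm

lemma tendsto_mul_poleOut (a : ℂ) (x : ℝ) :
    Tendsto (fun w => w * poleOut a x w) (cobounded ℂ) (𝓝 (exp (2 * I * a * x))) := by
  have h1 : Tendsto (fun w : ℂ => (w - a)⁻¹) (cobounded ℂ) (𝓝 0) :=
    tendsto_inv₀_cobounded.comp (tendsto_sub_const_cobounded a)
  have h2 : Tendsto (fun w : ℂ => exp (2 * I * a * x) * (1 + a * (w - a)⁻¹)) (cobounded ℂ)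
      (𝓝 (exp (2 * I * a * x) * (1 + a * 0))) := ((h1.const_mul a).const_add 1).const_mul _
  rw [mul_zero, add_zero, mul_one] at h2
  refine h2.congr' ?_
  filter_upwards [eventually_ne_cobounded a] with w hw
  have : w - a ≠ 0 := sub_ne_zero.2 hw
  rw [poleOut]
  field_simp
  ring

end pole

lemma continuous_lowMat {m : ℕ} : Continuous (lowMat : (Fin m → ℂ) → _) := by
  refine continuous_pi fun j => continuous_pi fun k => ?_
  refine Fin.cases ?_ (fun j => ?_) j <;> refine Fin.cases ?_ (fun k => ?_) k
  · exact continuous_const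
  · exact continuous_const
  · exact continuous_apply j
  · exact continuous_const

/-- The reflection coefficients at position `x`, with the bound state poles absorbed. -/
def effReflection {n : ℕ} (ρ : Fin 2 → ℝ → ℂ) (z : Fin n → ℂ) (C : Fin n → Fin 2 → ℂ) (x : ℝ)
    (k : Fin 2) (s : ℝ) : ℂ :=
  ρ k s * exp (2 * I * s * x) - ∑ i, C i k * poleOut (z i) x s

lemma lowMat_three_01 (t : Fin 2 → ℂ) : lowMat t (0 : Fin 3) (1 : Fin 3) = 0 := rfl

lemma lowMat_three_02 (t : Fin 2 → ℂ) : lowMat t (0 : Fin 3) (2 : Fin 3) = 0 := rfl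

lemma lowMat_three_10 (t : Fin 2 → ℂ) : lowMat t (1 : Fin 3) (0 : Fin 3) = t 0 := rfl

lemma lowMat_three_11 (t : Fin 2 → ℂ) : lowMat t (1 : Fin 3) (1 : Fin 3) = 1 := rfl

lemma lowMat_three_12 (t : Fin 2 → ℂ) : lowMat t (1 : Fin 3) (2 : Fin 3) = 0 := rfl

lemma lowMat_three_20 (t : Fin 2 → ℂ) : lowMat t (2 : Fin 3) (0 : Fin 3) = t 1 := rfl

lemma lowMat_three_21 (t : Fin 2 → ℂ) : lowMat t (2 : Fin 3) (1 : Fin 3) = 0 := rfl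

lemma lowMat_three_22 (t : Fin 2 → ℂ) : lowMat t (2 : Fin 3) (2 : Fin 3) = 1 := rfl

/-- Entries of σ differ by 0 or ±2, so conjugation multiplies the lower part of the first column by
e^{2isx} and the rest of the first row by its conjugate, and fixes the other entries. -/
lemma phaseConj_jumpReal (ρ : Fin 2 → ℝ → ℂ) (x s : ℝ) :
    phaseConj x s (jumpReal (ρ 0) (ρ 1) s) =
      (lowMat fun k => ρ k s * exp (2 * I * s * x))ᴴ * lowMat fun k => ρ k s * exp (2 * I * s * x) := by
  have hE : conj (exp (2 * I * s * x)) = exp (-(2 * I * s * x)) := by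
    rw [← exp_conj]; congr 1; simp [conj_ofNat]
  have hEE : exp (-(2 * I * s * x)) * exp (2 * I * s * x) = 1 := by rw [← exp_add]; simp
  have hn : ∀ k, ((‖ρ k s‖ ^ 2 : ℝ) : ℂ) = conj (ρ k s) * ρ k s := fun k => by
    rw [mul_comm, mul_conj, normSq_eq_norm_sq]
  have e1 : exp (I * s * x * 2) = exp (2 * I * s * x) := by congr 1; ring
  have e2 : I * s * x * (-1 - 1) = -(2 * I * s * x) := by ring
  ext j k
  rw [Matrix.mul_apply, Fin.sum_univ_three]
  simp only [Matrix.conjTranspose_apply, phaseConj, Matrix.of_apply, hn, jumpReal]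
  set e := exp (2 * I * s * x)
  set e' := exp (-(2 * I * s * x))
  have hE' : star e = e' := hE
  fin_cases j <;> fin_cases k <;>
    simp [sigma, lowMat_three_01, lowMat_three_02, lowMat_three_10, lowMat_three_11, lowMat_three_12, lowMat_three_20, lowMat_three_21, lowMat_three_22, e2, hE'] <;>
    first
      | linear_combination (-(conj (ρ 0 s) * ρ 0 s) - conj (ρ 1 s) * ρ 1 s) * hEE
      | (norm_num; rw [e1, mul_comm])
      | rw [mul_comm]

lemma phaseConj_jumpUpper (C : Fin 2 → ℂ) (a s : ℂ) (x : ℝ) :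
    phaseConj x s (jumpUpper a (C 0, C 1) s) =
      lowMat fun k => C k * (exp (2 * I * s * x) / (s - a)) := by
  have e1 : exp (I * s * x * 2) = exp (2 * I * s * x) := by congr 1; ring
  ext j k
  simp only [phaseConj, Matrix.of_apply, jumpUpper]
  fin_cases j <;> fin_cases k <;>
    simp [sigma, lowMat_three_01, lowMat_three_02, lowMat_three_10, lowMat_three_11, lowMat_three_12, lowMat_three_20, lowMat_three_21, lowMat_three_22] <;>
    (norm_num; rw [e1]; ring)

lemma phaseConj_jumpLower (C : Fin 2 → ℂ) (a s : ℂ) (x : ℝ) :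
    phaseConj x s (jumpLower a (C 0, C 1) s) =
      (lowMat fun k => C k * (exp (2 * I * conj s * x) / (conj s - a)))ᴴ := by
  have hE : conj (exp (2 * I * conj s * x)) = exp (I * s * x * (-1 - 1)) := by
    rw [← exp_conj]
    congr 1
    simp [conj_ofNat]
    ring
  ext j k
  simp only [phaseConj, Matrix.of_apply, jumpLower, Matrix.conjTranspose_apply]
  fin_cases j <;> fin_cases k <;>
    simp [sigma, lowMat_three_01, lowMat_three_02, lowMat_three_10, lowMat_three_11, lowMat_three_12, lowMat_three_20, lowMat_three_21, lowMat_three_22, hE] <;>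
    ring

end

/-! ### Sums of regularized pole terms near the contour -/

section

open scoped Matrix

variable {n : ℕ}

/-- The sum of the pole terms, regularized in the sets `B i`. -/
def poleSum (B : Fin n → Set ℂ) (z : Fin n → ℂ) (C : Fin n → Fin 2 → ℂ) (x : ℝ) (w : ℂ) (k : Fin 2) : ℂ :=
  ∑ i, C i k * poleReg (B i) (z i) x w

section geometry

variable {z : Fin n → ℂ} {r : Fin n → ℝ}

lemma AdmissibleRadii.im_pos (hr : AdmissibleRadii z r) {i : Fin n} {w : ℂ}
    (hw : w ∈ Metric.closedBall (z i) (r i)) : 0 < w.im := by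
  have h1 : ‖w - z i‖ ≤ r i := by rw [← dist_eq_norm]; exact hw
  have h2 := (abs_im_le_norm (w - z i)).trans h1
  rw [sub_im, abs_le] at h2
  linarith [hr.2.1 i]

lemma AdmissibleRadii.notMem (hr : AdmissibleRadii z r) {i j : Fin n} (hij : i ≠ j) {w : ℂ}
    (hw : w ∈ Metric.closedBall (z i) (r i)) : w ∉ Metric.closedBall (z j) (r j) := by
  intro h
  have h1 : dist w (z i) ≤ r i := hw
  have h2 : dist w (z j) ≤ r j := h
  have h3 := dist_triangle_left (z i) (z j) w
  linarith [hr.2.2 i j hij]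

lemma conj_mem_sphere {a w : ℂ} {ρ : ℝ} :
    conj w ∈ Metric.sphere a ρ ↔ w ∈ Metric.sphere (conj a) ρ := by
  rw [mem_sphere_iff_norm, mem_sphere_iff_norm, ← norm_conj (w - conj a)]
  simp

lemma conj_mem_ball {a w : ℂ} {ρ : ℝ} :
    conj w ∈ Metric.ball a ρ ↔ w ∈ Metric.ball (conj a) ρ := by
  rw [mem_ball_iff_norm, mem_ball_iff_norm, ← norm_conj (w - conj a)]
  simp

lemma conj_mem_contour {w : ℂ} : conj w ∈ contour z r ↔ w ∈ contour z r := by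
  simp only [contour, Set.mem_union, Set.mem_ofPred_eq, Set.mem_iUnion, conj_im, neg_eq_zero,
    conj_mem_sphere, Complex.conj_conj]
  simp only [or_comm]

lemma tendsto_conj_contour (s : ℂ) :
    Tendsto (fun w => conj w) (𝓝[contour z r] s) (𝓝[contour z r] (conj s)) :=
  continuous_conj.continuousWithinAt.tendsto_nhdsWithin fun _ hw => conj_mem_contour.2 hw

lemma AdmissibleRadii.eventually_notMem (hr : AdmissibleRadii z r) {s : ℂ} (hs : s.im = 0) :
    ∀ᶠ w in 𝓝 s, ∀ i, w ∉ Metric.closedBall (z i) (r i) ∧ conj w ∉ Metric.closedBall (z i) (r i) := by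
  refine eventually_all.2 fun i => ?_
  have h1 : s ∉ Metric.closedBall (z i) (r i) := fun h => (hr.im_pos h).ne' hs
  have h2 : conj s ∉ Metric.closedBall (z i) (r i) := fun h => (hr.im_pos h).ne' (by simpa using hs)
  have e1 := Metric.isClosed_closedBall.isOpen_compl.mem_nhds h1
  have e2 := continuous_conj.continuousAt.preimage_mem_nhds
    (Metric.isClosed_closedBall.isOpen_compl.mem_nhds h2)
  filter_upwards [e1, e2] with w h1 h2 using ⟨h1, h2⟩

/-- The finitely many closed discs stay away from the line, so near a real point the contour
consists of the line only. -/
lemma AdmissibleRadii.eventually_contour_real (hr : AdmissibleRadii z r) {s : ℂ} (hs : s.im = 0) :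
    ∀ᶠ w in 𝓝[contour z r] s, w.im = 0 := by
  filter_upwards [self_mem_nhdsWithin, nhdsWithin_le_nhds (hr.eventually_notMem hs)] with w hw h
  rcases hw with hw | hw
  · exact hw
  · obtain ⟨i, hw | hw⟩ := Set.mem_iUnion.1 hw
    · exact absurd (Metric.sphere_subset_closedBall hw) (h i).1
    · exact absurd (Metric.sphere_subset_closedBall (conj_mem_sphere.2 hw)) (h i).2

lemma AdmissibleRadii.eventually_contour_sphere (hr : AdmissibleRadii z r) {s : ℂ} {i : Fin n}
    (hs : s ∈ Metric.sphere (z i) (r i)) :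
    ∀ᶠ w in 𝓝[contour z r] s, w ∈ Metric.sphere (z i) (r i) := by
  have hs' := Metric.sphere_subset_closedBall hs
  have h1 : ∀ᶠ w in 𝓝 s, ∀ j, j ≠ i → w ∉ Metric.closedBall (z j) (r j) := by
    refine eventually_all.2 fun j => ?_
    by_cases hj : j = i
    · exact .of_forall fun w h => absurd hj h
    · filter_upwards [Metric.isClosed_closedBall.isOpen_compl.mem_nhds (hr.notMem (Ne.symm hj) hs')]
        with w hw _ using hw
  have h2 : ∀ᶠ w : ℂ in 𝓝 s, 0 < w.im := UpperNice.isOpen_upper.mem_nhds (hr.im_pos hs')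
  filter_upwards [self_mem_nhdsWithin, nhdsWithin_le_nhds h1, nhdsWithin_le_nhds h2] with w hw h1 h2
  rcases hw with hw | hw
  · exact absurd hw h2.ne'
  · obtain ⟨j, hw | hw⟩ := Set.mem_iUnion.1 hw
    · by_cases hj : j = i
      · rwa [← hj]
      · exact absurd (Metric.sphere_subset_closedBall hw) (h1 j hj)
    · have := hr.im_pos (Metric.sphere_subset_closedBall (conj_mem_sphere.2 hw))
      simp only [conj_im] at this
      linarith

end geometry

section poleSum

variable {z : Fin n → ℂ} {r : Fin n → ℝ} {C : Fin n → Fin 2 → ℂ} {x : ℝ}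

lemma tendsto_poleSum {B : Fin n → Set ℂ} {F : Filter ℂ} {v : Fin n → ℂ}
    (h : ∀ i, Tendsto (poleReg (B i) (z i) x) F (𝓝 (v i))) :
    Tendsto (poleSum B z C x) F (𝓝 fun k => ∑ i, C i k * v i) :=
  tendsto_pi_nhds.2 fun _ => tendsto_finsetSum _ fun i _ => (h i).const_mul _

lemma poleSum_real (hr : AdmissibleRadii z r) {B : Fin n → Set ℂ}
    (hB : ∀ i, B i ⊆ Metric.closedBall (z i) (r i)) {w : ℂ} (hw : w.im ≤ 0) :
    poleSum B z C x w = fun k => ∑ i, C i k * poleOut (z i) x w := by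
  ext k
  refine Finset.sum_congr rfl fun i _ => ?_
  rw [poleReg_of_notMem fun h => (hr.im_pos (hB i h)).not_ge hw]

/-- By disjointness of the closed discs only the i-th term notices on its circle whether the open or
the closed disc is used. -/
lemma poleSum_sub (hr : AdmissibleRadii z r) {s : ℂ} {i : Fin n}
    (hs : s ∈ Metric.sphere (z i) (r i)) :
    poleSum (fun i => Metric.ball (z i) (r i)) z C x s -
      poleSum (fun i => Metric.closedBall (z i) (r i)) z C x s =
      fun k => C i k * (exp (2 * I * s * x) / (s - z i)) := by
  ext k
  have hsb : s ∉ Metric.ball (z i) (r i) := fun h' => (show dist s (z i) < r i from h').ne hs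
  have hne : s ≠ z i := by rintro h; rw [h] at hsb; exact hsb (Metric.mem_ball_self (hr.1 i))
  rw [Pi.sub_apply, poleSum, poleSum, ← Finset.sum_sub_distrib, Finset.sum_eq_single i]
  · rw [poleReg_of_notMem hsb, poleReg_of_mem (Metric.sphere_subset_closedBall hs), ← mul_sub,
      poleOut_sub_poleIn hne]
  · intro j _ hj
    have h1 := hr.notMem (Ne.symm hj) (Metric.sphere_subset_closedBall hs)
    rw [poleReg_of_notMem h1, poleReg_of_notMem fun h => h1 (Metric.ball_subset_closedBall h), sub_self]
  · simp

/-- Away from the circles the two regularizations agree and are continuous. -/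
lemma tendsto_poleSum_off (hr : AdmissibleRadii z r) {s : ℂ}
    (hs : ∀ i, s ∉ Metric.sphere (z i) (r i)) :
    Tendsto (poleSum (fun i => Metric.ball (z i) (r i)) z C x) (𝓝 s)
      (𝓝 (poleSum (fun i => Metric.ball (z i) (r i)) z C x s)) :=
  tendsto_poleSum fun i => (differentiableAt_poleReg (hr.1 i) (hs i)).continuousAt

lemma tendsto_poleReg_closedBall (hr : AdmissibleRadii z r) {s : ℂ} {j : Fin n}
    (hs : s ∉ Metric.sphere (z j) (r j)) :
    Tendsto (poleReg (Metric.closedBall (z j) (r j)) (z j) x) (𝓝 s)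
      (𝓝 (poleReg (Metric.closedBall (z j) (r j)) (z j) x s)) := by
  have h := poleReg_eventuallyEq (a := z j) (x := x) hs
  rw [← h.self_of_nhds.1]
  exact (differentiableAt_poleReg (hr.1 j) hs).continuousAt.tendsto.congr' (h.mono fun w hw => hw.1)

lemma tendsto_poleSum_outside (hr : AdmissibleRadii z r) {s : ℂ} {i : Fin n}
    (hs : s ∈ Metric.sphere (z i) (r i)) :
    Tendsto (poleSum (fun i => Metric.ball (z i) (r i)) z C x) (𝓝[(Metric.ball (z i) (r i))ᶜ] s)
      (𝓝 (poleSum (fun i => Metric.ball (z i) (r i)) z C x s)) := by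
  refine tendsto_poleSum fun j => ?_
  by_cases hj : j = i
  · subst hj
    exact tendsto_poleReg_outside (hr.1 j) hs
  · have h1 := hr.notMem (Ne.symm hj) (Metric.sphere_subset_closedBall hs)
    exact ((differentiableAt_poleReg (hr.1 j)
      fun h => h1 (Metric.sphere_subset_closedBall h)).continuousAt).mono_left nhdsWithin_le_nhds

lemma tendsto_poleSum_inside (hr : AdmissibleRadii z r) {s : ℂ} {i : Fin n}
    (hs : s ∈ Metric.sphere (z i) (r i)) :
    Tendsto (poleSum (fun i => Metric.closedBall (z i) (r i)) z C x)
      (𝓝[Metric.closedBall (z i) (r i)] s)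
      (𝓝 (poleSum (fun i => Metric.closedBall (z i) (r i)) z C x s)) := by
  refine tendsto_poleSum fun j => ?_
  by_cases hj : j = i
  · subst hj
    exact tendsto_poleReg_inside hs
  · have h1 := hr.notMem (Ne.symm hj) (Metric.sphere_subset_closedBall hs)
    exact (tendsto_poleReg_closedBall hr
      fun h => h1 (Metric.sphere_subset_closedBall h)).mono_left nhdsWithin_le_nhds

lemma poleSum_eq_of_mem_ball (hr : AdmissibleRadii z r) {w : ℂ} {i : Fin n}
    (hw : w ∈ Metric.ball (z i) (r i)) :
    poleSum (fun i => Metric.ball (z i) (r i)) z C x w =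
      poleSum (fun i => Metric.closedBall (z i) (r i)) z C x w := by
  ext k
  refine Finset.sum_congr rfl fun j _ => ?_
  by_cases hj : j = i
  · subst hj
    rw [poleReg_of_mem hw, poleReg_of_mem (Metric.ball_subset_closedBall hw)]
  · have h1 := hr.notMem (Ne.symm hj) (Metric.ball_subset_closedBall hw)
    rw [poleReg_of_notMem h1, poleReg_of_notMem fun h => h1 (Metric.ball_subset_closedBall h)]

lemma differentiableAt_poleSum (hr : AdmissibleRadii z r) {s : ℂ}
    (hs : ∀ i, s ∉ Metric.sphere (z i) (r i)) (k : Fin 2) :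
    DifferentiableAt ℂ (fun w => poleSum (fun i => Metric.ball (z i) (r i)) z C x w k) s := by
  unfold poleSum
  exact DifferentiableAt.fun_sum fun i _ => (differentiableAt_poleReg (hr.1 i) (hs i)).const_mul _

lemma tendsto_mul_poleSum (z : Fin n → ℂ) (r : Fin n → ℝ) (C : Fin n → Fin 2 → ℂ) (x : ℝ) :
    Tendsto (fun w k => w * poleSum (fun i => Metric.ball (z i) (r i)) z C x w k) (cobounded ℂ)
      (𝓝 fun k => ∑ i, C i k * exp (2 * I * z i * x)) := by
  refine tendsto_pi_nhds.2 fun k => ?_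
  simp only [poleSum, Finset.mul_sum]
  refine tendsto_finsetSum _ fun i _ => ?_
  have h := (tendsto_mul_poleOut (z i) x).const_mul (C i k)
  refine h.congr' ?_
  filter_upwards [(isBounded_def.1 (Metric.isBounded_ball (x := z i) (r := r i)))] with w hw
  rw [poleReg_of_notMem hw]
  ring

lemma tendsto_poleSum_cobounded (z : Fin n → ℂ) (r : Fin n → ℝ) (C : Fin n → Fin 2 → ℂ) (x : ℝ) :
    Tendsto (poleSum (fun i => Metric.ball (z i) (r i)) z C x) (cobounded ℂ) (𝓝 0) := by
  refine tendsto_pi_nhds.2 fun k => ?_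
  have h := (tendsto_pi_nhds.1 (tendsto_mul_poleSum z r C x) k)
  have h2 := (tendsto_inv₀_cobounded (α := ℂ)).mul h
  rw [zero_mul] at h2
  refine h2.congr' ?_
  filter_upwards [eventually_ne_cobounded (0 : ℂ)] with w hw
  rw [inv_mul_cancel_left₀ hw]

end poleSum

end

/-! ### The branches of the solution above and below the line -/

section

open scoped Matrix

variable {n : ℕ}

section branches

variable {m : ℕ} {r : Fin m → ℝ → ℂ} {N K : ℂ → Matrix (Fin (m + 1)) (Fin (m + 1)) ℂ}
  {ℓ : Matrix (Fin (m + 1)) (Fin (m + 1)) ℂ} {T : ℂ → Fin m → ℂ} {F : Filter ℂ} {s : ℂ}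

/-- The upper branch `N L(T)`. -/
def upperBranch (N : ℂ → Matrix (Fin (m + 1)) (Fin (m + 1)) ℂ) (T : ℂ → Fin m → ℂ) (w : ℂ) :
    Matrix (Fin (m + 1)) (Fin (m + 1)) ℂ := N w * lowMat (T w)

/-- The inverse `L(-T) K` of the upper branch. -/
def lowerBranch (K : ℂ → Matrix (Fin (m + 1)) (Fin (m + 1)) ℂ) (T : ℂ → Fin m → ℂ) (w : ℂ) :
    Matrix (Fin (m + 1)) (Fin (m + 1)) ℂ := lowMat (-T w) * K w

lemma IsFactor.continuousOn (hF : IsFactor r N K ℓ) : ContinuousOn N {w | 0 ≤ w.im} :=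
  continuousOn_pi.2 fun j => continuousOn_pi.2 fun k => (hF.nice j k).cont

lemma IsFactor.continuousOn_inv (hF : IsFactor r N K ℓ) : ContinuousOn K {w | 0 ≤ w.im} :=
  continuousOn_pi.2 fun j => continuousOn_pi.2 fun k => (hF.nice_inv j k).cont

lemma IsFactor.tendsto_upperBranch (hF : IsFactor r N K ℓ) {t : Fin m → ℂ} (hs : 0 ≤ s.im)
    (hle : F ≤ 𝓝[{w | 0 ≤ w.im}] s) (hT : Tendsto T F (𝓝 t)) :
    Tendsto (upperBranch N T) F (𝓝 (N s * lowMat t)) :=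
  ((hF.continuousOn s hs).mono_left hle).mul ((continuous_lowMat.tendsto _).comp hT)

lemma IsFactor.tendsto_lowerBranch (hF : IsFactor r N K ℓ) {t : Fin m → ℂ} (hs : 0 ≤ s.im)
    (hle : F ≤ 𝓝[{w | 0 ≤ w.im}] s) (hT : Tendsto T F (𝓝 t)) :
    Tendsto (lowerBranch K T) F (𝓝 (lowMat (-t) * K s)) :=
  ((continuous_lowMat.tendsto _).comp hT.neg).mul ((hF.continuousOn_inv s hs).mono_left hle)

lemma IsFactor.tendsto_upperInfty (hF : IsFactor r N K ℓ) : Tendsto N upperInfty (𝓝 1) :=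
  tendsto_pi_nhds.2 fun j => tendsto_pi_nhds.2 fun k => (hF.nice j k).lim

lemma IsFactor.tendsto_inv_upperInfty (hF : IsFactor r N K ℓ) : Tendsto K upperInfty (𝓝 1) :=
  tendsto_pi_nhds.2 fun j => tendsto_pi_nhds.2 fun k => (hF.nice_inv j k).lim

lemma smul_lowMat_sub_one (w : ℂ) (t : Fin m → ℂ) :
    w • (lowMat t - 1) = lowMat (fun k => w * t k) - 1 := by
  rw [← lowMat_zero]
  ext j k
  refine Fin.cases ?_ (fun j => ?_) j <;> refine Fin.cases ?_ (fun k => ?_) k <;> simp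

lemma IsFactor.tendsto_smul_upperBranch (hF : IsFactor r N K ℓ) {κ : ℝ} (hκ : 0 < κ)
    {c : Fin m → ℂ} (hT : Tendsto T (cobounded ℂ) (𝓝 0))
    (hT' : Tendsto (fun w k => w * T w k) (cobounded ℂ) (𝓝 c)) :
    Tendsto (fun w => w • (upperBranch N T w - 1)) (upperCone κ) (𝓝 (ℓ + (lowMat c - 1))) := by
  have hle : upperCone κ ≤ cobounded ℂ := inf_le_left
  have h1 : Tendsto (fun w => w • (N w - 1)) (upperCone κ) (𝓝 ℓ) :=
    tendsto_pi_nhds.2 fun j => tendsto_pi_nhds.2 fun k => (hF.nice j k).cone κ hκ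
  have h2 : Tendsto (fun w => lowMat (T w)) (upperCone κ) (𝓝 1) := by
    have := (continuous_lowMat.tendsto _).comp (hT.mono_left hle)
    rw [lowMat_zero] at this
    exact this
  have h3 : Tendsto (fun w => lowMat (fun k => w * T w k) - 1) (upperCone κ) (𝓝 (lowMat c - 1)) :=
    ((continuous_lowMat.tendsto _).comp (hT'.mono_left hle)).sub_const _
  have h4 := (h1.mul h2).add h3
  rw [mul_one] at h4
  refine h4.congr fun w => ?_
  rw [← smul_lowMat_sub_one, upperBranch, smul_mul_assoc, ← smul_add, sub_mul, one_mul]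
  congr 1
  abel

lemma IsFactor.tendsto_smul_lowerBranch (hF : IsFactor r N K ℓ) {κ : ℝ} (hκ : 0 < κ)
    {c : Fin m → ℂ} (hT : Tendsto T (cobounded ℂ) (𝓝 0))
    (hT' : Tendsto (fun w k => w * T w k) (cobounded ℂ) (𝓝 c)) :
    Tendsto (fun w => w • (lowerBranch K T w - 1)) (upperCone κ) (𝓝 (-ℓ + (lowMat (-c) - 1))) := by
  have hle : upperCone κ ≤ cobounded ℂ := inf_le_left
  have h1 : Tendsto (fun w => w • (K w - 1)) (upperCone κ) (𝓝 (-ℓ)) :=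
    tendsto_pi_nhds.2 fun j => tendsto_pi_nhds.2 fun k => (hF.nice_inv j k).cone κ hκ
  have h2 : Tendsto (fun w => lowMat (-T w)) (upperCone κ) (𝓝 1) := by
    have := (continuous_lowMat.tendsto _).comp (hT.mono_left hle).neg
    rw [neg_zero, lowMat_zero] at this
    exact this
  have h3 : Tendsto (fun w => lowMat (fun k => w * (-T w) k) - 1) (upperCone κ)
      (𝓝 (lowMat (-c) - 1)) := by
    have := ((continuous_lowMat.tendsto _).comp (hT'.mono_left hle).neg).sub_const
      (1 : Matrix (Fin (m + 1)) (Fin (m + 1)) ℂ)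
    refine this.congr fun w => ?_
    simp only [Function.comp_apply]
    congr 2
    ext k
    simp
  have h4 := (h2.mul h1).add h3
  rw [one_mul] at h4
  refine h4.congr fun w => ?_
  rw [← smul_lowMat_sub_one, lowerBranch, mul_smul_comm, ← smul_add, mul_sub, mul_one]
  congr 1
  abel

lemma IsFactor.differentiableAt_upperBranch (hF : IsFactor r N K ℓ) (hs : 0 < s.im)
    (hT : ∀ k, DifferentiableAt ℂ (fun w => T w k) s) (j k : Fin (m + 1)) :
    DifferentiableAt ℂ (fun w => upperBranch N T w j k) s := by
  have hN : ∀ j k, DifferentiableAt ℂ (fun w => N w j k) s := fun j k =>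
    (hF.nice j k).diff.differentiableAt (UpperNice.isOpen_upper.mem_nhds hs)
  refine Fin.cases ?_ (fun k => ?_) k
  · simp only [upperBranch, mul_lowMat_zero]
    exact (hN _ _).add (DifferentiableAt.fun_sum fun k _ => (hN _ _).mul (hT k))
  · simp only [upperBranch, mul_lowMat_succ]
    exact hN _ _

lemma IsFactor.differentiableAt_lowerBranch (hF : IsFactor r N K ℓ) (hs : 0 < s.im)
    (hT : ∀ k, DifferentiableAt ℂ (fun w => T w k) s) (j k : Fin (m + 1)) :
    DifferentiableAt ℂ (fun w => lowerBranch K T w j k) s := by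
  have hK : ∀ j k, DifferentiableAt ℂ (fun w => K w j k) s := fun j k =>
    (hF.nice_inv j k).diff.differentiableAt (UpperNice.isOpen_upper.mem_nhds hs)
  refine Fin.cases ?_ (fun j => ?_) j
  · simp only [lowerBranch, lowMat_mul_zero]
    exact hK _ _
  · simp only [lowerBranch, lowMat_mul_succ, Pi.neg_apply]
    exact ((hT j).neg.mul (hK _ _)).add (hK _ _)

/-- The jump relation on the line. When t is the pole sum, r + t is `ρ e^{2isx}`, so the original
jump matrix reappears. -/
lemma IsFactor.upperBranch_eq (hF : IsFactor r N K ℓ) (s : ℝ) (t : Fin m → ℂ) :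
    N s * lowMat t = (lowMat (-t) * K s)ᴴ *
      ((lowMat ((fun k => r k s) + t))ᴴ * lowMat ((fun k => r k s) + t)) := by
  have h1 : (K s)ᴴ * (N s)ᴴ = 1 := by
    rw [← Matrix.conjTranspose_mul, hF.mul_inv s (by simp), Matrix.conjTranspose_one]
  have h2 : (lowMat (-t))ᴴ * (lowMat ((fun k => r k s) + t))ᴴ = (lowMat fun k => r k s)ᴴ := by
    rw [← Matrix.conjTranspose_mul, lowMat_mul_lowMat, add_neg_cancel_right]
  rw [Matrix.conjTranspose_mul, Matrix.mul_assoc, ← Matrix.mul_assoc (lowMat (-t))ᴴ, h2,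
    ← lowMat_mul_lowMat, ← Matrix.mul_assoc (lowMat _)ᴴ, ← hF.jump s, Matrix.mul_assoc,
    ← Matrix.mul_assoc, h1, Matrix.one_mul]

end branches

/-- For c > 0 the double cone meets the real axis only at 0, so far out it consists of an upper cone
and the conjugate of one. -/
lemma coneAtInfty_eq_sup {c : ℝ} (hc : 0 < c) :
    coneAtInfty c ≤ (upperCone c ⊓ 𝓟 {w | 0 < w.im}) ⊔
      Filter.comap (fun w => conj w) (upperCone c ⊓ 𝓟 {w | 0 < w.im}) := by
  intro S hS
  rw [Filter.mem_sup, Filter.mem_comap] at hS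
  obtain ⟨hS1, t, ht, htS⟩ := hS
  rw [upperCone, mem_inf_principal, mem_inf_principal] at hS1 ht
  have ht' : ∀ᶠ w : ℂ in cobounded ℂ, c * |w.re| ≤ -w.im → w.im < 0 → conj w ∈ t := by
    have : Tendsto (fun w : ℂ => conj w) (cobounded ℂ) (cobounded ℂ) := by
      rw [← tendsto_norm_atTop_iff_cobounded]
      simpa using tendsto_norm_cobounded_atTop
    filter_upwards [this ht] with w hw h1 h2
    exact hw (by simpa using h1) (by simpa using h2)
  rw [coneAtInfty, mem_inf_principal]
  filter_upwards [hS1, ht', eventually_ne_cobounded (0 : ℂ)] with w h1 h2 h0 h3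
  have h3 : c * |w.re| ≤ |w.im| := h3
  rcases lt_trichotomy w.im 0 with h | h | h
  · rw [abs_of_neg h] at h3
    exact htS (h2 h3 h)
  · exfalso
    rw [h, abs_zero] at h3
    have : w.re = 0 := by
      have h4 : |w.re| ≤ 0 := by nlinarith [abs_nonneg w.re]
      simpa using h4
    exact h0 (Complex.ext this h)
  · rw [abs_of_pos h] at h3
    exact h1 h3 h

end

/-! ### Gluing the two half planes -/

section

open scoped Matrix

section solution

variable {n : ℕ} {z : Fin n → ℂ} {r : Fin n → ℝ} {C : Fin n → Fin 2 → ℂ} {x : ℝ}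

lemma continuous_conjTranspose {m : ℕ} :
    Continuous fun A : Matrix (Fin m) (Fin m) ℂ => Aᴴ := continuous_id.matrix_conjTranspose

lemma tendsto_conj_cobounded : Tendsto (fun w : ℂ => conj w) (cobounded ℂ) (cobounded ℂ) := by
  rw [← tendsto_norm_atTop_iff_cobounded]
  simpa using tendsto_norm_cobounded_atTop

/-- The glued function equal to `U` in the closed upper half plane and to `W(conj w)ᴴ` below. -/
def glueHalf (U W : ℂ → Mat3) (w : ℂ) : Mat3 := if 0 ≤ w.im then U w else (W (conj w))ᴴ

/-- The glued function equal to `U` in the open upper half plane and to `W(conj w)ᴴ` below. -/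
def glueHalf' (U W : ℂ → Mat3) (w : ℂ) : Mat3 := if 0 < w.im then U w else (W (conj w))ᴴ

variable {U W : ℂ → Mat3} {F : Filter ℂ} {A : Mat3}

lemma tendsto_conjTranspose (h : Tendsto W (Filter.map (fun w => conj w) F) (𝓝 A)) :
    Tendsto (fun w => (W (conj w))ᴴ) F (𝓝 Aᴴ) :=
  (continuous_conjTranspose.tendsto A).comp (tendsto_map'_iff.1 h)

lemma tendsto_glueHalf_upper (h : ∀ᶠ w in F, 0 ≤ w.im) (hU : Tendsto U F (𝓝 A)) :
    Tendsto (glueHalf U W) F (𝓝 A) :=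
  hU.congr' (h.mono fun _ hw => (if_pos hw).symm)

lemma tendsto_glueHalf_lower (h : ∀ᶠ w in F, w.im < 0)
    (hW : Tendsto W (Filter.map (fun w => conj w) F) (𝓝 A)) :
    Tendsto (glueHalf U W) F (𝓝 Aᴴ) :=
  (tendsto_conjTranspose hW).congr' (h.mono fun _ hw => (if_neg hw.not_ge).symm)

lemma tendsto_glueHalf'_upper (h : ∀ᶠ w in F, 0 < w.im) (hU : Tendsto U F (𝓝 A)) :
    Tendsto (glueHalf' U W) F (𝓝 A) :=
  hU.congr' (h.mono fun _ hw => (if_pos hw).symm)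

lemma tendsto_glueHalf'_lower (h : ∀ᶠ w in F, w.im ≤ 0)
    (hW : Tendsto W (Filter.map (fun w => conj w) F) (𝓝 A)) :
    Tendsto (glueHalf' U W) F (𝓝 Aᴴ) :=
  (tendsto_conjTranspose hW).congr' (h.mono fun _ hw => (if_neg hw.not_gt).symm)

variable {ρ : Fin 2 → ℝ → ℂ} {N K : ℂ → Mat3} {ℓ : Mat3}

lemma IsFactor.differentiableAt_glueHalf {T : ℂ → Fin 2 → ℂ} {rr : Fin 2 → ℝ → ℂ}
    (hF : IsFactor rr N K ℓ) {s : ℂ} (hs : s.im ≠ 0)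
    (hT : 0 < s.im → ∀ k, DifferentiableAt ℂ (fun w => T w k) s)
    (hT' : s.im < 0 → ∀ k, DifferentiableAt ℂ (fun w => T w k) (conj s)) (j k : Fin 3) :
    DifferentiableAt ℂ (fun w => glueHalf (upperBranch N T) (lowerBranch K T) w j k) s := by
  rcases hs.lt_or_gt with hs | hs
  · have h1 := hF.differentiableAt_lowerBranch (s := conj s) (by simpa using hs) (hT' hs) k j
    have h2 := h1.conj_conj
    rw [Complex.conj_conj] at h2
    refine h2.congr_of_eventuallyEq ?_
    filter_upwards [(isOpen_lt continuous_im continuous_const).mem_nhds hs] with w hw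
    have hw : w.im < 0 := hw
    rw [glueHalf, if_neg hw.not_ge]
    rfl
  · refine (hF.differentiableAt_upperBranch hs (hT hs) j k).congr_of_eventuallyEq ?_
    filter_upwards [UpperNice.isOpen_upper.mem_nhds hs] with w hw
    have hw : 0 < w.im := hw
    rw [glueHalf, if_pos hw.le]

lemma IsFactor.tendsto_glueHalf_cobounded {T : ℂ → Fin 2 → ℂ} {rr : Fin 2 → ℝ → ℂ}
    (hF : IsFactor rr N K ℓ) (hT : Tendsto T (cobounded ℂ) (𝓝 0)) :
    Tendsto (glueHalf (upperBranch N T) (lowerBranch K T)) (cobounded ℂ) (𝓝 1) := by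
  have hle : upperInfty ≤ cobounded ℂ := inf_le_left
  have hU : Tendsto (upperBranch N T) upperInfty (𝓝 1) := by
    have h1 := (continuous_lowMat.tendsto _).comp (hT.mono_left hle)
    rw [lowMat_zero] at h1
    have h2 := hF.tendsto_upperInfty.mul h1
    rw [mul_one] at h2
    exact h2
  have hW : Tendsto (lowerBranch K T) upperInfty (𝓝 1) := by
    have h1 := (continuous_lowMat.tendsto _).comp (hT.mono_left hle).neg
    rw [neg_zero, lowMat_zero] at h1
    have h2 := h1.mul hF.tendsto_inv_upperInfty
    rw [mul_one] at h2
    exact h2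
  refine Filter.Tendsto.if hU ?_
  rw [← Matrix.conjTranspose_one]
  refine tendsto_conjTranspose (hW.mono_left ?_)
  refine le_inf ?_ ?_
  · exact (Filter.map_mono inf_le_left).trans tendsto_conj_cobounded
  · rw [le_principal_iff, Filter.mem_map, mem_inf_principal]
    refine Filter.Eventually.of_forall fun w hw => ?_
    have hw : ¬ 0 ≤ w.im := hw
    simp only [Set.mem_preimage, Set.mem_ofPred_eq, conj_im]
    linarith

/-- The lower branch is the adjoint of the inverse of the upper one at the conjugate point, hence
the sign, the transposition and the conjugation in the second limit. -/
lemma IsFactor.tendsto_smul_glueHalf {T : ℂ → Fin 2 → ℂ} {rr : Fin 2 → ℝ → ℂ}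
    (hF : IsFactor rr N K ℓ) {c : Fin 2 → ℂ} (hT : Tendsto T (cobounded ℂ) (𝓝 0))
    (hT' : Tendsto (fun w k => w * T w k) (cobounded ℂ) (𝓝 c)) {κ : ℝ} (hκ : 0 < κ) (j k : Fin 3) :
    Tendsto (fun w => w * (glueHalf (upperBranch N T) (lowerBranch K T) w j k - (1 : Mat3) j k))
      (upperCone κ ⊓ 𝓟 {w | 0 < w.im}) (𝓝 ((ℓ + (lowMat c - 1)) j k)) ∧
    Tendsto (fun w => w * (glueHalf (upperBranch N T) (lowerBranch K T) w j k - (1 : Mat3) j k))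
      (Filter.comap (fun w => conj w) (upperCone κ ⊓ 𝓟 {w | 0 < w.im}))
      (𝓝 (conj ((-ℓ + (lowMat (-c) - 1)) k j))) := by
  have h1 := tendsto_pi_nhds.1 (tendsto_pi_nhds.1 (hF.tendsto_smul_upperBranch hκ hT hT') j) k
  have h2 := tendsto_pi_nhds.1 (tendsto_pi_nhds.1 (hF.tendsto_smul_lowerBranch hκ hT hT') k) j
  constructor
  · refine (h1.mono_left inf_le_left).congr' ?_
    have : ∀ᶠ w in upperCone κ ⊓ 𝓟 {w : ℂ | 0 < w.im}, 0 < w.im :=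
      mem_inf_of_right (mem_principal_self _)
    filter_upwards [this] with w hw
    rw [glueHalf, if_pos hw.le]
    rfl
  · have h3 := (continuous_conj.tendsto _).comp
      ((h2.mono_left inf_le_left).comp
        (tendsto_comap (f := fun w : ℂ => conj w) (x := upperCone κ ⊓ 𝓟 {w : ℂ | 0 < w.im})))
    refine h3.congr' ?_
    have : ∀ᶠ w in Filter.comap (fun w : ℂ => conj w) (upperCone κ ⊓ 𝓟 {w : ℂ | 0 < w.im}),
        w.im < 0 := by
      refine (tendsto_comap.eventually
        (show ∀ᶠ w in upperCone κ ⊓ 𝓟 {w : ℂ | 0 < w.im}, 0 < w.im from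
          mem_inf_of_right (mem_principal_self _))).mono fun w hw => ?_
      simpa using hw
    filter_upwards [this] with w hw
    rw [glueHalf, if_neg hw.not_ge]
    have e : conj ((1 : Mat3) k j) = (1 : Mat3) j k := by
      rw [Matrix.one_apply, Matrix.one_apply]
      by_cases h : k = j
      · simp [h]
      · simp [h, Ne.symm h]
    simp only [Function.comp_apply, Matrix.smul_apply, Matrix.sub_apply, smul_eq_mul, map_mul,
      map_sub, Complex.conj_conj, e, Matrix.conjTranspose_apply, RCLike.star_def]

lemma isBigO_inv_of_tendsto {f : ℂ → ℂ} {F : Filter ℂ} {a : ℂ} (hF : ∀ᶠ w in F, w ≠ 0)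
    (h : Tendsto (fun w => w * f w) F (𝓝 a)) : f =O[F] fun w => w⁻¹ := by
  have h1 := (h.isBigO_one ℂ).mul (Asymptotics.isBigO_refl (fun w : ℂ => w⁻¹) F)
  simp only [one_mul] at h1
  refine h1.congr' ?_ .rfl
  filter_upwards [hF] with w hw
  field_simp

lemma eventually_ne_upperCone (κ : ℝ) : ∀ᶠ w in upperCone κ ⊓ 𝓟 {w : ℂ | 0 < w.im}, w ≠ 0 :=
  (inf_le_left.trans inf_le_left : upperCone κ ⊓ 𝓟 {w : ℂ | 0 < w.im} ≤ cobounded ℂ)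
    (eventually_ne_cobounded (0 : ℂ))

end solution

end

/-! ### From a factorization to a solution -/

section

open scoped Matrix

variable {n : ℕ} {z : Fin n → ℂ} {r : Fin n → ℝ} {C : Fin n → Fin 2 → ℂ} {x : ℝ}
  {ρ : Fin 2 → ℝ → ℂ} {N K : ℂ → Mat3} {ℓ : Mat3}

/-- The pole terms regularized in the open discs. -/
abbrev poleOpen (z : Fin n → ℂ) (r : Fin n → ℝ) (C : Fin n → Fin 2 → ℂ) (x : ℝ) : ℂ → Fin 2 → ℂ :=
  poleSum (fun i => Metric.ball (z i) (r i)) z C x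

/-- The pole terms regularized in the closed discs. -/
abbrev poleClosed (z : Fin n → ℂ) (r : Fin n → ℝ) (C : Fin n → Fin 2 → ℂ) (x : ℝ) : ℂ → Fin 2 → ℂ :=
  poleSum (fun i => Metric.closedBall (z i) (r i)) z C x

/-- The solution of the Riemann-Hilbert problem built from a factorization. -/
def solM (N K : ℂ → Mat3) (z : Fin n → ℂ) (r : Fin n → ℝ) (C : Fin n → Fin 2 → ℂ) (x : ℝ) : ℂ → Mat3 :=
  glueHalf (upperBranch N (poleOpen z r C x)) (lowerBranch K (poleOpen z r C x))

/-- Its boundary values from the plus side. -/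
def solPlus (N K : ℂ → Mat3) (z : Fin n → ℂ) (r : Fin n → ℝ) (C : Fin n → Fin 2 → ℂ) (x : ℝ) : ℂ → Mat3 :=
  glueHalf (upperBranch N (poleOpen z r C x)) (lowerBranch K (poleClosed z r C x))

/-- Its boundary values from the minus side. -/
def solMinus (N K : ℂ → Mat3) (z : Fin n → ℂ) (r : Fin n → ℝ) (C : Fin n → Fin 2 → ℂ) (x : ℝ) : ℂ → Mat3 :=
  glueHalf' (upperBranch N (poleClosed z r C x)) (lowerBranch K (poleOpen z r C x))

lemma AdmissibleRadii.notMem_sphere_of_im_nonpos (hr : AdmissibleRadii z r) {s : ℂ} (hs : s.im ≤ 0) (i : Fin n) :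
    s ∉ Metric.sphere (z i) (r i) := fun h =>
  (hr.im_pos (Metric.sphere_subset_closedBall h)).not_ge hs

section factor

variable {rr : Fin 2 → ℝ → ℂ} {F : Filter ℂ} {s : ℂ}

lemma le_nhdsWithin_upper (hF : F ≤ 𝓝 s) (h : ∀ᶠ w in F, 0 ≤ w.im) : F ≤ 𝓝[{w | 0 ≤ w.im}] s :=
  le_inf hF (le_principal_iff.2 h)

lemma map_conj_le_nhdsWithin_upper (hF : F ≤ 𝓝 s) (h : ∀ᶠ w in F, w.im ≤ 0) :
    Filter.map (fun w => conj w) F ≤ 𝓝[{w | 0 ≤ w.im}] (conj s) := by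
  refine le_inf ((Filter.map_mono hF).trans (continuous_conj.tendsto s)) (le_principal_iff.2 ?_)
  exact mem_map.2 (h.mono fun w hw => by simpa using hw)

lemma IsFactor.tendsto_upper (hFac : IsFactor rr N K ℓ) {T : ℂ → Fin 2 → ℂ} (hF : F ≤ 𝓝 s)
    (h : ∀ᶠ w in F, 0 ≤ w.im) (hs : 0 ≤ s.im) (hT : Tendsto T F (𝓝 (T s))) :
    Tendsto (upperBranch N T) F (𝓝 (upperBranch N T s)) :=
  hFac.tendsto_upperBranch hs (le_nhdsWithin_upper hF h) hT

lemma IsFactor.tendsto_lower (hFac : IsFactor rr N K ℓ) {T : ℂ → Fin 2 → ℂ} (hF : F ≤ 𝓝 s)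
    (h : ∀ᶠ w in F, w.im ≤ 0) (hs : s.im ≤ 0)
    (hT : Tendsto T (Filter.map (fun w => conj w) F) (𝓝 (T (conj s)))) :
    Tendsto (lowerBranch K T) (Filter.map (fun w => conj w) F) (𝓝 (lowerBranch K T (conj s))) :=
  hFac.tendsto_lowerBranch (by simpa using hs) (map_conj_le_nhdsWithin_upper hF h) hT

end factor

lemma map_conj_nhdsWithin_le {A B : Set ℂ} {s : ℂ} (h : ∀ w ∈ A, conj w ∈ B) :
    Filter.map (fun w => conj w) (𝓝[A] s) ≤ 𝓝[B] (conj s) :=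
  continuous_conj.continuousWithinAt.tendsto_nhdsWithin h

/-- The plus side is outside the upper circles and inside the lower ones. This fixes the
regularization: open discs above, where a circle point counts as outside, and closed discs below. -/
lemma IsFactor.continuousOn_solPlus {rr : Fin 2 → ℝ → ℂ} (hF : IsFactor rr N K ℓ) (hr : AdmissibleRadii z r) :
    ContinuousOn (solPlus N K z r C x) (contour z r) := by
  intro s hs
  rcases hs with hs | hs
  · have hs : s.im = 0 := hs
    have e := hr.eventually_contour_real hs
    have := tendsto_glueHalf_upper (W := lowerBranch K (poleClosed z r C x))
      (e.mono fun w hw => hw.ge) (hF.tendsto_upper (T := poleOpen z r C x) nhdsWithin_le_nhds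
        (e.mono fun w hw => hw.ge) hs.ge
        ((tendsto_poleSum_off hr (hr.notMem_sphere_of_im_nonpos hs.le)).mono_left nhdsWithin_le_nhds))
    rw [ContinuousWithinAt, solPlus, glueHalf, if_pos hs.ge]
    exact this
  · obtain ⟨i, hs | hs⟩ := Set.mem_iUnion.1 hs
    · have e := hr.eventually_contour_sphere hs
      have h0 := hr.im_pos (Metric.sphere_subset_closedBall hs)
      have e' : ∀ᶠ w in 𝓝[contour z r] s, 0 ≤ w.im :=
        e.mono fun w hw => (hr.im_pos (Metric.sphere_subset_closedBall hw)).le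
      have hle : 𝓝[contour z r] s ≤ 𝓝[(Metric.ball (z i) (r i))ᶜ] s :=
        le_inf nhdsWithin_le_nhds (le_principal_iff.2 (e.mono fun w hw h =>
          (show dist w (z i) < r i from h).ne hw))
      have := tendsto_glueHalf_upper (W := lowerBranch K (poleClosed z r C x))
        e' (hF.tendsto_upper (T := poleOpen z r C x) nhdsWithin_le_nhds e' h0.le
          ((tendsto_poleSum_outside hr hs).mono_left hle))
      rw [ContinuousWithinAt, solPlus, glueHalf, if_pos h0.le]
      exact this
    · have hs' := conj_mem_sphere.2 hs
      have e := (tendsto_conj_contour s).eventually (hr.eventually_contour_sphere hs')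
      have h0 : s.im < 0 := by simpa using hr.im_pos (Metric.sphere_subset_closedBall hs')
      have e' : ∀ᶠ w in 𝓝[contour z r] s, w.im < 0 := e.mono fun w hw => by
        simpa using hr.im_pos (Metric.sphere_subset_closedBall hw)
      have hle : Filter.map (fun w => conj w) (𝓝[contour z r] s) ≤
          𝓝[Metric.closedBall (z i) (r i)] (conj s) :=
        le_inf ((tendsto_conj_contour s).trans nhdsWithin_le_nhds)
          (le_principal_iff.2 (e.mono fun w hw => Metric.sphere_subset_closedBall hw))
      have := tendsto_glueHalf_lower (U := upperBranch N (poleOpen z r C x)) e'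
        (hF.tendsto_lower (T := poleClosed z r C x) nhdsWithin_le_nhds (e'.mono fun w hw => hw.le) h0.le
          ((tendsto_poleSum_inside hr hs').mono_left hle))
      rw [ContinuousWithinAt, solPlus, glueHalf, if_neg h0.not_ge]
      exact this

lemma IsFactor.continuousOn_solMinus {rr : Fin 2 → ℝ → ℂ} (hF : IsFactor rr N K ℓ) (hr : AdmissibleRadii z r) :
    ContinuousOn (solMinus N K z r C x) (contour z r) := by
  intro s hs
  rcases hs with hs | hs
  · have hs : s.im = 0 := hs
    have e := hr.eventually_contour_real hs
    have hcs : (conj s).im ≤ 0 := by simp [hs]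
    have := tendsto_glueHalf'_lower (U := upperBranch N (poleClosed z r C x))
      (e.mono fun w hw => hw.le) (hF.tendsto_lower (T := poleOpen z r C x) nhdsWithin_le_nhds
        (e.mono fun w hw => hw.le) hs.le
        ((tendsto_poleSum_off hr (hr.notMem_sphere_of_im_nonpos hcs)).mono_left
          ((Filter.map_mono nhdsWithin_le_nhds).trans (continuous_conj.tendsto s))))
    rw [ContinuousWithinAt, solMinus, glueHalf', if_neg hs.le.not_gt]
    exact this
  · obtain ⟨i, hs | hs⟩ := Set.mem_iUnion.1 hs
    · have e := hr.eventually_contour_sphere hs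
      have h0 := hr.im_pos (Metric.sphere_subset_closedBall hs)
      have e' : ∀ᶠ w in 𝓝[contour z r] s, 0 < w.im :=
        e.mono fun w hw => hr.im_pos (Metric.sphere_subset_closedBall hw)
      have hle : 𝓝[contour z r] s ≤ 𝓝[Metric.closedBall (z i) (r i)] s :=
        le_inf nhdsWithin_le_nhds (le_principal_iff.2 (e.mono fun w hw =>
          Metric.sphere_subset_closedBall hw))
      have := tendsto_glueHalf'_upper (W := lowerBranch K (poleOpen z r C x))
        e' (hF.tendsto_upper (T := poleClosed z r C x) nhdsWithin_le_nhds
          (e'.mono fun w hw => hw.le) h0.le ((tendsto_poleSum_inside hr hs).mono_left hle))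
      rw [ContinuousWithinAt, solMinus, glueHalf', if_pos h0]
      exact this
    · have hs' := conj_mem_sphere.2 hs
      have e := (tendsto_conj_contour s).eventually (hr.eventually_contour_sphere hs')
      have h0 : s.im < 0 := by simpa using hr.im_pos (Metric.sphere_subset_closedBall hs')
      have e' : ∀ᶠ w in 𝓝[contour z r] s, w.im ≤ 0 := e.mono fun w hw => by
        simpa using (hr.im_pos (Metric.sphere_subset_closedBall hw)).le
      have hle : Filter.map (fun w => conj w) (𝓝[contour z r] s) ≤
          𝓝[(Metric.ball (z i) (r i))ᶜ] (conj s) :=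
        le_inf ((tendsto_conj_contour s).trans nhdsWithin_le_nhds)
          (le_principal_iff.2 (e.mono fun w hw h => (show dist (conj w) (z i) < r i from h).ne hw))
      have := tendsto_glueHalf'_lower (U := upperBranch N (poleClosed z r C x)) e'
        (hF.tendsto_lower (T := poleOpen z r C x) nhdsWithin_le_nhds e' h0.le
          ((tendsto_poleSum_outside hr hs').mono_left hle))
      rw [ContinuousWithinAt, solMinus, glueHalf', if_neg h0.le.not_gt]
      exact this

lemma IsFactor.jumpAt_real (hF : IsFactor (effReflection ρ z C x) N K ℓ) (hr : AdmissibleRadii z r) (s : ℝ) :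
    JumpAt x (solM N K z r C x) (solPlus N K z r C x) (solMinus N K z r C x) (s : ℂ)
      {w | 0 < w.im} {w | w.im < 0} (jumpReal (ρ 0) (ρ 1) s) := by
  have hT := tendsto_poleSum_off (C := C) (x := x) hr
    (hr.notMem_sphere_of_im_nonpos (s := (s : ℂ)) (by simp))
  have e1 : ∀ᶠ w in 𝓝[{w : ℂ | 0 < w.im}] (s : ℂ), 0 < w.im := self_mem_nhdsWithin
  have e2 : ∀ᶠ w in 𝓝[{w : ℂ | w.im < 0}] (s : ℂ), w.im < 0 := self_mem_nhdsWithin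
  have hp : solPlus N K z r C x s = upperBranch N (poleOpen z r C x) s := if_pos (by simp)
  have hm : solMinus N K z r C x s = (lowerBranch K (poleOpen z r C x) (conj (s : ℂ)))ᴴ :=
    if_neg (by simp)
  refine ⟨?_, ?_, ?_⟩
  · rw [hp]
    exact tendsto_glueHalf_upper (e1.mono fun w hw => hw.le)
      (hF.tendsto_upper nhdsWithin_le_nhds (e1.mono fun w hw => hw.le) (by simp)
        (hT.mono_left nhdsWithin_le_nhds))
  · rw [hm]
    refine tendsto_glueHalf_lower e2
      (hF.tendsto_lower nhdsWithin_le_nhds (e2.mono fun w hw => hw.le) (by simp) ?_)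
    rw [conj_ofReal]
    refine hT.mono_left ((Filter.map_mono nhdsWithin_le_nhds).trans ?_)
    have := continuous_conj.tendsto (s : ℂ)
    rwa [conj_ofReal] at this
  · rw [hp, hm, phaseConj_jumpReal, conj_ofReal, upperBranch, lowerBranch,
      hF.upperBranch_eq s (poleOpen z r C x s)]
    have : (fun k => effReflection ρ z C x k s) + poleOpen z r C x s =
        fun k => ρ k s * exp (2 * I * s * x) := by
      rw [poleOpen, poleSum_real hr (fun i => Metric.ball_subset_closedBall) (by simp)]
      ext k
      simp [effReflection]
    rw [this]

lemma IsFactor.jumpAt_upper {rr : Fin 2 → ℝ → ℂ} (hF : IsFactor rr N K ℓ) (hr : AdmissibleRadii z r)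
    (i : Fin n) {s : ℂ} (hs : s ∈ Metric.sphere (z i) (r i)) :
    JumpAt x (solM N K z r C x) (solPlus N K z r C x) (solMinus N K z r C x) s
      (Metric.closedBall (z i) (r i))ᶜ (Metric.ball (z i) (r i)) (jumpUpper (z i) (C i 0, C i 1) s) := by
  have h0 := hr.im_pos (Metric.sphere_subset_closedBall hs)
  have hp : solPlus N K z r C x s = upperBranch N (poleOpen z r C x) s := if_pos h0.le
  have hm : solMinus N K z r C x s = upperBranch N (poleClosed z r C x) s := if_pos h0
  have e : ∀ᶠ w in 𝓝 s, 0 ≤ w.im :=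
    Filter.Eventually.mono (UpperNice.isOpen_upper.mem_nhds h0) fun w (hw : 0 < w.im) => hw.le
  refine ⟨?_, ?_, ?_⟩
  · rw [hp]
    exact tendsto_glueHalf_upper (nhdsWithin_le_nhds e)
      (hF.tendsto_upper nhdsWithin_le_nhds (nhdsWithin_le_nhds e) h0.le
        ((tendsto_poleSum_outside hr hs).mono_left
          (nhdsWithin_mono _ (Set.compl_subset_compl.2 Metric.ball_subset_closedBall))))
  · rw [hm]
    refine tendsto_glueHalf_upper (nhdsWithin_le_nhds e) ?_
    refine (hF.tendsto_upper (T := poleClosed z r C x) nhdsWithin_le_nhds (nhdsWithin_le_nhds e) h0.le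
        ((tendsto_poleSum_inside hr hs).mono_left (nhdsWithin_mono _ Metric.ball_subset_closedBall))).congr' ?_
    filter_upwards [self_mem_nhdsWithin] with w hw
    rw [upperBranch, upperBranch, poleClosed, poleOpen, poleSum_eq_of_mem_ball hr hw]
  · rw [hp, hm, phaseConj_jumpUpper (C i), upperBranch, upperBranch, Matrix.mul_assoc, lowMat_mul_lowMat,
      ← poleSum_sub hr hs, add_sub_cancel]

lemma IsFactor.jumpAt_lower {rr : Fin 2 → ℝ → ℂ} (hF : IsFactor rr N K ℓ) (hr : AdmissibleRadii z r)
    (i : Fin n) {s : ℂ} (hs : s ∈ Metric.sphere (conj (z i)) (r i)) :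
    JumpAt x (solM N K z r C x) (solPlus N K z r C x) (solMinus N K z r C x) s
      (Metric.ball (conj (z i)) (r i)) (Metric.closedBall (conj (z i)) (r i))ᶜ
      (jumpLower (z i) (C i 0, C i 1) s) := by
  have hs' := conj_mem_sphere.2 hs
  have h0 : s.im < 0 := by simpa using hr.im_pos (Metric.sphere_subset_closedBall hs')
  have hp : solPlus N K z r C x s = (lowerBranch K (poleClosed z r C x) (conj s))ᴴ := if_neg h0.not_ge
  have hm : solMinus N K z r C x s = (lowerBranch K (poleOpen z r C x) (conj s))ᴴ := if_neg h0.le.not_gt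
  have e : ∀ᶠ w in 𝓝 s, w.im < 0 := (isOpen_lt continuous_im continuous_const).mem_nhds h0
  refine ⟨?_, ?_, ?_⟩
  · rw [hp]
    refine tendsto_glueHalf_lower (nhdsWithin_le_nhds e) ?_
    have hle : Filter.map (fun w => conj w) (𝓝[Metric.ball (conj (z i)) (r i)] s) ≤
        𝓝[Metric.ball (z i) (r i)] (conj s) := map_conj_nhdsWithin_le fun w hw => conj_mem_ball.2 hw
    refine (hF.tendsto_lower (T := poleClosed z r C x) nhdsWithin_le_nhds
      (nhdsWithin_le_nhds (e.mono fun w hw => hw.le)) h0.le ((tendsto_poleSum_inside hr hs').mono_left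
        (hle.trans (nhdsWithin_mono _ Metric.ball_subset_closedBall)))).congr' ?_
    filter_upwards [hle self_mem_nhdsWithin] with w hw
    rw [lowerBranch, lowerBranch, poleClosed, poleOpen, poleSum_eq_of_mem_ball hr hw]
  · rw [hm]
    have hle : Filter.map (fun w => conj w) (𝓝[(Metric.closedBall (conj (z i)) (r i))ᶜ] s) ≤
        𝓝[(Metric.ball (z i) (r i))ᶜ] (conj s) := map_conj_nhdsWithin_le fun w hw h =>
      hw (Metric.ball_subset_closedBall (conj_mem_ball.1 h))
    exact tendsto_glueHalf_lower (nhdsWithin_le_nhds e) (hF.tendsto_lower nhdsWithin_le_nhds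
      (nhdsWithin_le_nhds (e.mono fun w hw => hw.le)) h0.le
      ((tendsto_poleSum_outside hr hs').mono_left hle))
  · rw [hp, hm, phaseConj_jumpLower (C i), ← Matrix.conjTranspose_mul, lowerBranch, lowerBranch,
      ← Matrix.mul_assoc, lowMat_mul_lowMat, ← poleSum_sub hr hs']
    congr 3
    abel_nf

/-- `hp` and `hp'` evaluate the coefficient of 1/z in the first column in the upper and in the lower
cone. Their agreement is what gives a limit in the double cone. -/
theorem IsFactor.exists_solution (hF : IsFactor (effReflection ρ z C x) N K ℓ)
    (hr : AdmissibleRadii z r) {p : Fin 2 → ℂ}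
    (hp : ∀ k, ℓ k.succ 0 + ∑ i, C i k * exp (2 * I * z i * x) = p k)
    (hp' : ∀ k, -conj (ℓ 0 k.succ) = p k) :
    ∃ M, IsRHSolution (ρ 0) (ρ 1) z (fun i => (C i 0, C i 1)) r x M ∧
      Reconstructs M (-2 * I * p 0) (-2 * I * p 1) := by
  have hT0 := tendsto_poleSum_cobounded z r C x
  have hT1 := tendsto_mul_poleSum z r C x
  have hlim : ∀ κ : ℝ, 0 < κ → ∀ k : Fin 2,
      Tendsto (fun s => s * solM N K z r C x s k.succ 0) (coneAtInfty κ) (𝓝 (p k)) := by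
    intro κ hκ k
    obtain ⟨h1, h2⟩ := hF.tendsto_smul_glueHalf hT0 hT1 hκ k.succ 0
    have e : (1 : Mat3) k.succ 0 = 0 := Matrix.one_apply_ne (Fin.succ_ne_zero k)
    have e' : (1 : Mat3) 0 k.succ = 0 := Matrix.one_apply_ne (Fin.succ_ne_zero k).symm
    simp only [Matrix.add_apply, Matrix.sub_apply, Matrix.neg_apply, lowMat_succ_zero,
      lowMat_zero_succ, e, e', sub_zero, add_zero, map_neg] at h1 h2
    rw [hp] at h1
    rw [hp'] at h2
    exact (Tendsto.sup h1 h2).mono_left (coneAtInfty_eq_sup hκ)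
  refine ⟨solM N K z r C x, ⟨?_, ?_, ?_, ?_⟩, ?_⟩
  · intro j k s hs
    have h0 : s.im ≠ 0 := fun h => hs (.inl h)
    refine (hF.differentiableAt_glueHalf h0 (fun _ k => ?_) (fun _ k => ?_) j k).differentiableWithinAt
    · exact differentiableAt_poleSum hr (fun i h => hs (.inr (Set.mem_iUnion.2 ⟨i, .inl h⟩))) k
    · exact differentiableAt_poleSum hr
        (fun i h => hs (.inr (Set.mem_iUnion.2 ⟨i, .inr (conj_mem_sphere.1 h)⟩))) k
  · exact (hF.tendsto_glueHalf_cobounded hT0).mono_left inf_le_left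
  · intro κ hκ j k
    obtain ⟨h1, h2⟩ := hF.tendsto_smul_glueHalf hT0 hT1 hκ j k
    refine Asymptotics.IsBigO.mono ?_ (coneAtInfty_eq_sup hκ)
    refine Asymptotics.IsBigO.sup (isBigO_inv_of_tendsto (eventually_ne_upperCone κ) h1)
      (isBigO_inv_of_tendsto ?_ h2)
    refine (tendsto_comap.eventually (eventually_ne_upperCone κ)).mono fun w hw h => hw ?_
    simp [h]
  · exact ⟨solPlus N K z r C x, solMinus N K z r C x, hF.continuousOn_solPlus hr,
      hF.continuousOn_solMinus hr, hF.jumpAt_real hr, fun i s hs => hF.jumpAt_upper hr i hs,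
      fun i s hs => hF.jumpAt_lower hr i hs⟩
  · exact fun κ hκ => ⟨(hlim κ hκ 0).const_mul _, (hlim κ hκ 1).const_mul _⟩

end

/-! ### Factorization for nonnegative x -/

section

/-- The even extension only serves to have an amplitude in `H^{1,1}` of the whole line; the
factorization sees nonnegative arguments only. -/
lemma memH11_exp_abs {a : ℂ} (ha : 0 < a.im) : MemH11 fun t => exp (I * a * (|t| : ℝ)) := by
  -- Chosen so that `c (1 + t) ≤ e^{t Im a / 2}`; squaring gives the quadratic decay.
  set c := min 1 (a.im / 2) with hc
  have hc0 : 0 < c := lt_min one_pos (by positivity)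
  have hn : ∀ t : ℝ, ‖exp (I * a * t)‖ = Real.exp (-(a.im * t)) := norm_exp_I_mul_mul a
  have hdec : ∀ t : ℝ, 0 ≤ t → Real.exp (-(a.im * t)) ≤ (c⁻¹) ^ 2 * ((1 + t)⁻¹) ^ 2 := by
    intro t ht
    have h1 : c * (1 + t) ≤ Real.exp (a.im / 2 * t) := by
      have h2 := Real.add_one_le_exp (a.im / 2 * t)
      have h3 : c ≤ 1 := min_le_left _ _
      have h4 : c * t ≤ a.im / 2 * t := mul_le_mul_of_nonneg_right (min_le_right _ _) ht
      linarith
    rw [← mul_pow, ← mul_inv, inv_pow, Real.exp_neg]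
    refine inv_anti₀ (by positivity) ?_
    calc (c * (1 + t)) ^ 2 ≤ Real.exp (a.im / 2 * t) ^ 2 := by gcongr
      _ = Real.exp (a.im * t) := by rw [← Real.exp_nat_mul]; congr 1; push_cast; ring
  refine memH11_even_of_bounds (w := fun t => exp (I * a * t)) (D := ‖a‖ * (c⁻¹) ^ 2) (E := (c⁻¹) ^ 2)
    (by positivity) (by positivity) (fun t ht => (hn t).trans_le (hdec t ht)) fun s t hs hst => ?_
  have hd : ∀ u ∈ Set.Icc s t, HasDerivWithinAt (fun t : ℝ => exp (I * a * t))
      (exp (I * a * u) * (I * a)) (Set.Icc s t) u := fun u _ => by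
    have h1 : HasDerivAt (fun t : ℝ => I * a * (t : ℂ)) (I * a) u := by
      simpa using (ofRealCLM.hasDerivAt (x := u)).const_mul (I * a)
    exact h1.cexp.hasDerivWithinAt
  have hb : ∀ u ∈ Set.Ico s t, ‖exp (I * a * u) * (I * a)‖ ≤ ‖a‖ * (c⁻¹) ^ 2 * (1 + s)⁻¹ := by
    intro u hu
    have h3 : (1 + u)⁻¹ ≤ (1 + s)⁻¹ := inv_anti₀ (by linarith) (by linarith [hu.1])
    have h4 : (1 + u)⁻¹ ≤ 1 := inv_le_one_of_one_le₀ (by linarith [hu.1])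
    have h5 : 0 ≤ (1 + u)⁻¹ := inv_nonneg.2 (by linarith [hu.1])
    have h6 : ((1 + u)⁻¹) ^ 2 ≤ (1 + s)⁻¹ := by nlinarith
    rw [norm_mul, hn, norm_mul, norm_I, one_mul, mul_comm, mul_assoc]
    gcongr
    exact (hdec u (hs.trans hu.1)).trans (by gcongr)
  have := norm_image_sub_le_of_norm_deriv_le_segment' hd hb t (Set.right_mem_Icc.2 hst)
  exact this.trans (by rw [mul_right_comm])

/-- For τ = 2x and prefactor -iC this is the term -C e^{2iax}/(s - a) of the effective reflection
coefficient. -/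
lemma halfFT_exp {a : ℂ} (ha : 0 < a.im) {τ : ℝ} (hτ : 0 ≤ τ) (s : ℝ) :
    halfFT (fun y => exp (I * a * (|τ + y| : ℝ))) (-s) = -I * exp (I * a * τ) / (s - a) := by
  have h0 : (s : ℂ) - a ≠ 0 := fun h => by
    have := congrArg im h
    simp at this
    exact ha.ne' this
  have e : ∀ y ∈ Set.Ioi (0 : ℝ), exp (I * a * (|τ + y| : ℝ)) * exp (I * -s * y) =
      exp (I * a * τ) * exp (I * (a - s) * y) := by
    intro y hy
    have hy : 0 < y := hy
    rw [abs_of_nonneg (by positivity), ← exp_add, ← exp_add]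
    congr 1
    push_cast
    ring
  rw [halfFT, setIntegral_congr_fun measurableSet_Ioi e, integral_const_mul,
    integral_exp_mul_complex_Ioi (by simpa using ha)]
  have h1 : a - (s : ℂ) ≠ 0 := fun h => h0 (by rw [← neg_sub, h, neg_zero])
  simp only [ofReal_zero, mul_zero, exp_zero]
  field_simp
  rw [I_sq]
  ring

/-- Multiplication by e^{isτ} translates the amplitude, which moves the cut between the two
half-lines from 0 to τ. -/
lemma fourier_amplitude_shift {F : ℝ → ℂ} (hF : MemH11 F) (τ s : ℝ) :
    (halfFT F (-s) + halfFT (fun y => F (-y)) s) * exp (I * s * τ) =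
      halfFT (fun y => F (τ + y)) (-s) + halfFT (fun y => F (τ - y)) s := by
  have h1 := integral_mul_exp_neg_eq hF.integrable s
  have h2 := integral_mul_exp_neg_eq (hF.comp_add_left τ).integrable s
  simp only [← sub_eq_add_neg] at h2
  rw [← h1, ← h2, ← integral_mul_const, ← integral_add_left_eq_self _ τ]
  congr 1
  ext y
  rw [mul_assoc, ← exp_add]
  congr 2
  push_cast
  ring

theorem exists_factor_of_nonneg {n : ℕ} {ρ : Fin 2 → ℝ → ℂ} (hρ : ∀ k, MemH11 (ρ k)) {z : Fin n → ℂ}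
    (hz : ∀ i, 0 < (z i).im) (C : Fin n → Fin 2 → ℂ) :
    ∃ p : Fin 2 → ℝ → ℂ, (∀ k, MemH11 (p k)) ∧ ∀ x : ℝ, 0 ≤ x →
      ∃ N K ℓ, IsFactor (effReflection ρ z C x) N K ℓ ∧
        (∀ k, ℓ k.succ 0 + ∑ i, C i k * exp (2 * I * z i * x) = p k x) ∧
        ∀ k, -conj (ℓ 0 k.succ) = p k x := by
  choose F hF hFρ using fun k => (hρ k).exists_fourier_amplitude
  have hE : ∀ k, MemH11 fun y => ∑ i, (-I * C i k) * exp (I * z i * (|y| : ℝ)) := fun k =>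
    MemH11.sum _ fun i _ => (memH11_exp_abs (hz i)).const_mul _
  -- The pole terms of the effective reflection coefficient continue to the lower half plane, as the
  -- z_i lie in the upper one, so they join the amplitude that enters the Marchenko system.
  set G : Fin 2 → ℝ → ℂ := fun k y => F k y + ∑ i, (-I * C i k) * exp (I * z i * (|y| : ℝ)) with hGdef
  have hG : ∀ k, MemH11 (G k) := fun k => (hF k).add (hE k)
  obtain ⟨D, hfam⟩ := MemH11.hankelFamily hG
  set w : Fin 2 → ℝ → ℂ := fun k => hankelCoeff (fun k t => (hG k).shiftLp t) G k with hw
  refine ⟨fun k x => I * (G k (2 * x) + (-1) * w k |2 * x|), fun k => ?_, fun x hx => ?_⟩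
  · exact (((hG k).comp_mul_left two_ne_zero).add
      (((hfam.memH11_coeff k).comp_mul_left two_ne_zero).const_mul (-1))).const_mul I
  have h2x : 0 ≤ 2 * x := by positivity
  obtain ⟨N, K, ℓ, h, h1, h2⟩ := exists_isFactor hG (gneg := fun k y => F k (2 * x - y))
    (fun k => by
      have := ((hF k).comp_add_left (2 * x)).comp_neg
      simp only [← sub_eq_add_neg] at this
      exact this.halfNice) h2x (r := effReflection ρ z C x) (fun k s => by
      have hs : 0 ≤ (-(s : ℂ)).im := by simp
      have hEi : ∀ i, HalfNice fun y => (-I * C i k) * exp (I * z i * (|2 * x + y| : ℝ)) := fun i =>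
        ((((memH11_exp_abs (hz i)).comp_add_left (2 * x))).const_mul _).halfNice
      have e1 := HalfNice.halfFT_add ((hF k).comp_add_left (2 * x)).halfNice
        (HalfNice.sum Finset.univ fun i _ => hEi i) hs
      rw [hGdef]
      simp only
      rw [e1, halfFT_sum _ (fun i _ => hEi i) hs, add_right_comm, ← fourier_amplitude_shift (hF k),
        ← hFρ, effReflection, sub_eq_add_neg, ← Finset.sum_neg_distrib]
      congr 1
      · congr 2
        push_cast
        ring
      · refine Finset.sum_congr rfl fun i _ => ?_
        rw [halfFT_const_mul, halfFT_exp (hz i) h2x, poleOut]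
        have : I * z i * ((2 * x : ℝ) : ℂ) = 2 * I * z i * x := by push_cast; ring
        rw [this]
        linear_combination (-(C i k) * exp (2 * I * z i * x) / (s - z i)) * I_sq)
  have habs : |2 * x| = 2 * x := abs_of_nonneg h2x
  refine ⟨N, K, ℓ, h, fun k => ?_, fun k => ?_⟩
  · have hGx : I * G k (2 * x) = I * F k (2 * x) + ∑ i, C i k * exp (2 * I * z i * x) := by
      simp only [hGdef, habs]
      rw [mul_add, Finset.mul_sum]
      congr 1
      refine Finset.sum_congr rfl fun i _ => ?_
      have e : I * z i * ((2 * x : ℝ) : ℂ) = 2 * I * z i * x := by push_cast; ring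
      rw [e]
      linear_combination (-(C i k) * exp (2 * I * z i * x)) * I_sq
    simp only
    rw [h1, habs, mul_add, hGx, sub_zero]
    simp only [hw]
    ring
  · simp only
    rw [h2, habs, map_mul, conj_I, Complex.conj_conj]
    ring

end

/-! ### Blaschke factors and outer functions -/

section

lemma sub_ne_zero_of_im {a w : ℂ} (ha : a.im < 0) (hw : 0 ≤ w.im) : w - a ≠ 0 := fun h => by
  have := congrArg im h
  simp only [sub_im, zero_im] at this
  linarith

lemma UpperNice.inv_sub {a : ℂ} (ha : a.im < 0) : UpperNice (fun w => (w - a)⁻¹) 0 1 where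
  diff w hw := ((differentiableAt_id.sub_const a).inv
    (sub_ne_zero_of_im ha (le_of_lt hw))).differentiableWithinAt
  cont := ContinuousOn.inv₀ (by fun_prop) fun w hw => sub_ne_zero_of_im ha hw
  lim := (tendsto_inv₀_cobounded.comp (tendsto_sub_const_cobounded a)).mono_left inf_le_left
  cone κ hκ := by
    have h := (tendsto_mul_poleOut a 0).mono_left (inf_le_left : upperCone κ ≤ cobounded ℂ)
    simp only [poleOut, ofReal_zero, mul_zero, exp_zero, one_div] at h
    simp only [sub_zero]
    exact h
  deriv := hasL2Deriv_inv_sub ha.ne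

/-- A Blaschke factor of the upper half plane. -/
def blaschke (a w : ℂ) : ℂ := (w - a) / (w - conj a)

lemma upperNice_blaschke {a : ℂ} (ha : 0 < a.im) : UpperNice (blaschke a) 1 (conj a - a) := by
  have h := (UpperNice.const 1).add ((UpperNice.inv_sub (a := conj a) (by simpa using ha)).const_mul (conj a - a))
  simp only [mul_zero, add_zero, mul_one, zero_add] at h
  refine h.congr fun w hw => ?_
  have := sub_ne_zero_of_im (a := conj a) (by simpa using ha) hw
  rw [blaschke]
  field_simp
  ring

lemma blaschke_mul_conj {a : ℂ} (ha : 0 < a.im) (s : ℝ) : blaschke a s * conj (blaschke a s) = 1 := by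
  have h1 := sub_ne_zero_of_im (a := conj a) (w := s) (by simpa using ha) (by simp)
  have h2 : (s : ℂ) - a ≠ 0 := fun h => h1 (by simpa using congrArg conj h)
  simp only [blaschke, map_div₀, map_sub, conj_ofReal, Complex.conj_conj]
  field_simp

lemma blaschke_ne_zero {a w : ℂ} (ha : 0 < a.im) (hw : 0 ≤ w.im) (h : w ≠ a) : blaschke a w ≠ 0 :=
  div_ne_zero (sub_ne_zero.2 h) (sub_ne_zero_of_im (by simpa using ha) hw)

/-- Zeros are divided out one at a time. As the z i are distinct, the Blaschke factors already
removed do not vanish at the next point, so the zero there persists in the quotient. -/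
lemma UpperNice.exists_div_blaschke {ι : Type*} {z : ι → ℂ} (hz : ∀ i, 0 < (z i).im)
    (hinj : Function.Injective z) (S : Finset ι) {h : ℂ → ℂ} {c l : ℂ} (hh : UpperNice h c l)
    (h0 : ∀ i ∈ S, h (z i) = 0) :
    ∃ g l', UpperNice g c l' ∧ ∀ w : ℂ, 0 ≤ w.im → g w * ∏ i ∈ S, blaschke (z i) w = h w := by
  classical
  induction S using Finset.induction_on with
  | empty => exact ⟨h, l, hh, fun w _ => by simp⟩
  | insert i S hi ih =>
    obtain ⟨g, l', hg, hgh⟩ := ih fun j hj => h0 j (Finset.mem_insert_of_mem hj)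
    have hgi : g (z i) = 0 := by
      have h1 := hgh (z i) (hz i).le
      rw [h0 i (Finset.mem_insert_self i S)] at h1
      refine (mul_eq_zero.1 h1).resolve_right (Finset.prod_ne_zero_iff.2 fun j hj => ?_)
      exact blaschke_ne_zero (hz j) (hz i).le fun h => hi (by rwa [hinj h])
    -- The inverse Blaschke factor is 1 + (z_i - conj z_i)/(w - z_i).
    have H := hg.add ((hg.dslope (hz i) hgi).const_mul (z i - conj (z i)))
    rw [mul_zero, add_zero] at H
    refine ⟨_, _, H, fun w hw => ?_⟩
    have hne := sub_ne_zero_of_im (a := conj (z i)) (by simpa using hz i) hw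
    have hD : (w - z i) * _root_.dslope g (z i) w = g w := by
      have := sub_smul_dslope g (z i) w
      rwa [hgi, sub_zero, smul_eq_mul] at this
    rw [Finset.prod_insert hi, ← hgh w hw, ← mul_assoc, blaschke]
    congr 1
    field_simp
    linear_combination (z i - conj (z i)) * hD

/-- A real-valued amplitude is the boundary value of the squared modulus of an outer function. -/
lemma exists_outer {d : ℝ → ℝ} (hd : ∀ s, 0 < d s) (hl : MemH11 fun s => (Real.log (d s) : ℂ)) :
    ∃ δ l, UpperNice δ 1 l ∧ (∀ w, δ w ≠ 0) ∧ ∀ s : ℝ, δ s * conj (δ s) = d s := by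
  obtain ⟨F, hF, hs⟩ := hl.exists_fourier_amplitude
  -- The real part of the transform of this amplitude on the line is half of log d. Averaging F(-y)
  -- with conj F(y) builds in that log d is real, so no symmetry of F has to be proved.
  have ha : HalfNice fun y => (1 / 2) * (F (-y) + conj (F y)) :=
    (hF.comp_neg.add hF.star).halfNice.const_mul _
  refine ⟨_, _, ha.upperNice.exp, fun w => exp_ne_zero _, fun s => ?_⟩
  have h1 : 0 ≤ (s : ℂ).im := by simp
  rw [halfFT_const_mul, HalfNice.halfFT_add hF.comp_neg.halfNice hF.star.halfNice h1, ← exp_conj, ← exp_add]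
  have h2 := hs s
  have h3 := congrArg conj h2
  have h4 : conj (halfFT (fun y => conj (F y)) s) = halfFT F (-s) := by
    rw [conj_halfFT]; simp
  have h5 : conj (halfFT F (-s)) = halfFT (fun y => conj (F y)) s := by rw [← h4, Complex.conj_conj]
  rw [map_add, conj_ofReal, h5] at h3
  have h6 : (1 / 2) * (halfFT (fun y => F (-y)) s + halfFT (fun y => conj (F y)) s) +
      conj ((1 / 2) * (halfFT (fun y => F (-y)) s + halfFT (fun y => conj (F y)) s)) =
      (Real.log (d s) : ℂ) := by
    simp only [map_mul, map_add, h4, map_div₀, map_one, map_ofNat]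
    linear_combination (-1 / 2) * h2 + (-1 / 2) * h3
  rw [h6, ← ofReal_exp, Real.exp_log (hd s)]

/-- On the nonnegative reals u ↦ log(1 + u) is 1-Lipschitz and vanishes at 0. -/
lemma memH11_log_one_add {q : ℝ → ℝ} (hq : ∀ s, 0 ≤ q s) (h : MemH11 fun s => (q s : ℂ)) :
    MemH11 fun s => (Real.log (1 + q s) : ℂ) := by
  have key : ∀ a b : ℝ, 0 ≤ a → 0 ≤ b → Real.log (1 + b) - Real.log (1 + a) ≤ |b - a| := by
    intro a b ha hb
    rw [← Real.log_div (by positivity) (by positivity)]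
    refine (Real.log_le_sub_one_of_pos (by positivity)).trans ?_
    have h1 : (1 + b) / (1 + a) - 1 = (b - a) / (1 + a) := by field_simp; ring
    rw [h1]
    refine (div_le_div_of_nonneg_right (le_abs_self _) (by positivity)).trans ?_
    exact div_le_self (abs_nonneg _) (by linarith)
  have key2 : ∀ a b : ℝ, 0 ≤ a → 0 ≤ b → |Real.log (1 + b) - Real.log (1 + a)| ≤ |b - a| := by
    intro a b ha hb
    refine abs_le.2 ⟨?_, key a b ha hb⟩
    have := key b a hb ha
    rw [abs_sub_comm] at this
    linarith
  refine h.of_bound_mul (B := 1) (h.hasL2Deriv.of_le (C := 1) fun a b => ?_) fun t => ?_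
  · rw [← ofReal_sub, ← ofReal_sub, norm_real, norm_real, one_mul]
    exact key2 _ _ (hq a) (hq b)
  · rw [norm_real, norm_real, one_mul]
    simpa using key2 0 (q t) le_rfl (hq t)

end

/-! ### Left factorization of 1 + ρρᴴ without zeros -/

section

open scoped Matrix

variable {n : ℕ}

/-- A factorization `E (1 + ρ ρᴴ) Eᴴ = 1` on the real line by a function holomorphic in the upper half
plane, whose kernel at the points `z i`, `i ∈ S`, contains `C i`, and whose determinant has no other
zeros. -/
structure LeftFactor (ρ : Fin 2 → ℝ → ℂ) (z : Fin n → ℂ) (C : Fin n → Fin 2 → ℂ) (S : Finset (Fin n))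
    (E : ℂ → Matrix (Fin 2) (Fin 2) ℂ) (d : ℂ → ℂ) : Prop where
  nice : ∃ e : Matrix (Fin 2) (Fin 2) ℂ, ∀ j k,
    UpperNice (fun w => E w j k) ((1 : Matrix (Fin 2) (Fin 2) ℂ) j k) (e j k)
  nice_det : ∃ l, UpperNice d 1 l
  det_ne : ∀ w : ℂ, 0 ≤ w.im → d w ≠ 0
  det_eq : ∀ w : ℂ, 0 ≤ w.im → (E w).det = d w * ∏ i ∈ S, blaschke (z i) w
  unit : ∀ s : ℝ, E s * (1 + Matrix.of fun j k => ρ j s * conj (ρ k s)) * (E s)ᴴ = 1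
  ker : ∀ i ∈ S, E (z i) *ᵥ C i = 0

lemma UpperNice.matrix_mulVec {E : ℂ → Matrix (Fin 2) (Fin 2) ℂ} {e : Matrix (Fin 2) (Fin 2) ℂ}
    (hE : ∀ j k, UpperNice (fun w => E w j k) ((1 : Matrix (Fin 2) (Fin 2) ℂ) j k) (e j k))
    (c : Fin 2 → ℂ) (j : Fin 2) : ∃ l, UpperNice (fun w => (E w *ᵥ c) j) (c j) l := by
  have h := UpperNice.sum Finset.univ fun k (_ : k ∈ Finset.univ) => (hE j k).mul (.const (c k))
  have e1 : ∑ k, (1 : Matrix (Fin 2) (Fin 2) ℂ) j k * c k = c j := by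
    have := congrFun (Matrix.one_mulVec c) j
    exact this
  rw [e1] at h
  exact ⟨_, h⟩

section start

lemma lowMat_two (t : Fin 1 → ℂ) : lowMat t = !![1, 0; t 0, 1] := by
  ext j k
  fin_cases j <;> fin_cases k <;> rfl

variable {ρ : Fin 2 → ℝ → ℂ}

lemma MemH11.mul_conj {f g : ℝ → ℂ} (hf : MemH11 f) (hg : MemH11 g) :
    MemH11 fun s => f s * conj (g s) := by
  obtain ⟨B, hB⟩ := hf.exists_bound
  exact hg.star.mul_left hf.hasL2Deriv hB

/-- Take outer functions with |α|² = 1 + |ρ 1|² and |η|² = 1 + |ρ 0|² + |ρ 1|². Scaling 1 + ρρᴴ by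
diag(α/η, 1/α) on the left and its adjoint on the right makes the determinant and the lower right
entry equal to one. The result is the transpose of a 2 × 2 jump matrix with a single reflection
coefficient, to which the factorization theorem applies with m = 1 and τ = 0. -/
lemma exists_leftFactor_empty (hρ : ∀ k, MemH11 (ρ k)) (z : Fin n → ℂ) (C : Fin n → Fin 2 → ℂ) :
    ∃ E d, LeftFactor ρ z C ∅ E d := by
  have hsq : ∀ k, MemH11 fun s => ((‖ρ k s‖ ^ 2 : ℝ) : ℂ) := fun k => by
    have h := (hρ k).mul_conj (hρ k)
    simp only [mul_conj'] at h
    simpa using h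
  obtain ⟨α, lα, hα, hα0, hαe⟩ := exists_outer (d := fun s => 1 + ‖ρ 1 s‖ ^ 2) (fun s => by positivity)
    (memH11_log_one_add (q := fun s => ‖ρ 1 s‖ ^ 2) (fun s => by positivity) (hsq 1))
  obtain ⟨η, lη, hη, hη0, hηe⟩ := exists_outer (d := fun s => 1 + (‖ρ 0 s‖ ^ 2 + ‖ρ 1 s‖ ^ 2))
    (fun s => by positivity)
    (memH11_log_one_add (q := fun s => ‖ρ 0 s‖ ^ 2 + ‖ρ 1 s‖ ^ 2) (fun s => by positivity) (by
      simpa using (hsq 0).add (hsq 1)))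
  have hαi := hα.inv one_ne_zero fun w _ => hα0 w
  have hηi := hη.inv one_ne_zero fun w _ => hη0 w
  have hc : MemH11 fun s : ℝ => (α s * conj (α s)⁻¹ * (η s)⁻¹) * (ρ 0 s * conj (ρ 1 s)) := by
    obtain ⟨B1, h1⟩ := hα.exists_bound_real
    obtain ⟨B2, h2⟩ := hαi.exists_bound_real
    obtain ⟨B3, h3⟩ := hηi.exists_bound_real
    have h4 := hα.deriv.mul hαi.deriv.star h1 (B := B2) fun t => by rw [RCLike.norm_conj]; exact h2 t
    have h5 : ∀ t : ℝ, ‖α t * conj (α t)⁻¹‖ ≤ B1 * B2 := fun t => by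
      rw [norm_mul, RCLike.norm_conj]
      exact mul_le_mul (h1 t) (h2 t) (norm_nonneg _) ((norm_nonneg _).trans (h1 t))
    refine ((hρ 0).mul_conj (hρ 1)).mul_left (B := B1 * B2 * B3) (h4.mul hηi.deriv h5 h3) fun t => ?_
    rw [norm_mul]
    exact mul_le_mul (h5 t) (h3 t) (norm_nonneg _) ((norm_nonneg _).trans (h5 t))
  obtain ⟨F, hF, hFs⟩ := hc.exists_fourier_amplitude
  obtain ⟨N, K, ℓ, h, -, -⟩ := exists_isFactor (m := 1) (G := fun _ => F) (fun _ => hF)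
    (gneg := fun _ y => F (-y)) (fun _ => hF.comp_neg.halfNice) le_rfl
    (r := fun _ s => (α s * conj (α s)⁻¹ * (η s)⁻¹) * (ρ 0 s * conj (ρ 1 s)))
    (fun _ s => by simp only [zero_add]; exact hFs s)
  set D : ℂ → Matrix (Fin 2) (Fin 2) ℂ := fun w => Matrix.diagonal ![α w * (η w)⁻¹, (α w)⁻¹] with hD
  have hDn : ∀ j k, ∃ l, UpperNice (fun w => D w j k) ((1 : Matrix (Fin 2) (Fin 2) ℂ) j k) l := by
    have h0 := hα.mul hηi
    rw [inv_one, mul_one] at h0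
    have h1 := hαi
    rw [inv_one] at h1
    intro j k
    fin_cases j <;> fin_cases k
    · exact ⟨_, h0⟩
    · exact ⟨_, .const 0⟩
    · exact ⟨_, .const 0⟩
    · exact ⟨_, h1⟩
  choose dl hdl using hDn
  have hKt : ∀ j k, UpperNice (fun w => (K w)ᵀ j k) ((1 : Matrix (Fin 2) (Fin 2) ℂ) j k) ((-ℓᵀ) j k) :=
    fun j k => by
      have := h.nice_inv k j
      rw [← Matrix.transpose_apply (1 : Matrix (Fin 2) (Fin 2) ℂ), Matrix.transpose_one] at this
      exact this
  have hdet : ∀ w : ℂ, 0 ≤ w.im → ((K w)ᵀ * D w).det ≠ 0 := fun w hw => by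
    rw [Matrix.det_mul, Matrix.det_transpose, hD, Matrix.det_diagonal]
    refine mul_ne_zero (fun h0 => ?_) (Finset.prod_ne_zero_iff.2 fun i _ => ?_)
    · have := congrArg Matrix.det (h.mul_inv w hw)
      rw [Matrix.det_mul, h0, mul_zero, Matrix.det_one] at this
      exact zero_ne_one this
    · fin_cases i
      · exact mul_ne_zero (hα0 w) (inv_ne_zero (hη0 w))
      · exact inv_ne_zero (hα0 w)
  have hE := UpperNice.matrix_mul hKt hdl
  refine ⟨fun w => (K w)ᵀ * D w, fun w => ((K w)ᵀ * D w).det, ⟨_, hE⟩, ?_, hdet, fun w _ => by simp,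
    fun s => ?_, by simp⟩
  · have := ((hE 0 0).mul (hE 1 1)).sub ((hE 0 1).mul (hE 1 0))
    simp only [Matrix.one_apply_eq, ne_eq, zero_ne_one, one_ne_zero, not_false_eq_true, Matrix.one_apply_ne, mul_zero,
      sub_zero, mul_one] at this
    exact ⟨_, this.congr fun w _ => Matrix.det_fin_two _⟩
  · have hmid : D s * (1 + Matrix.of fun j k => ρ j s * conj (ρ k s)) * (D s)ᴴ = ((N s)ᴴ * N s)ᵀ := by
      rw [h.jump s]
      have e1 : α s * conj (α s) = 1 + ρ 1 s * conj (ρ 1 s) := by rw [hαe, mul_conj']; push_cast; rfl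
      have e2 : η s * conj (η s) = 1 + (ρ 0 s * conj (ρ 0 s) + ρ 1 s * conj (ρ 1 s)) := by
        rw [hηe, mul_conj', mul_conj']; push_cast; rfl
      have n1 : α s ≠ 0 := hα0 s
      have n2 : η s ≠ 0 := hη0 s
      have n3 : conj (α s) ≠ 0 := by simpa using n1
      have n4 : conj (η s) ≠ 0 := by simpa using n2
      rw [lowMat_two]
      ext j k
      fin_cases j <;> fin_cases k <;>
        simp [Matrix.mul_apply, Fin.sum_univ_two, hD, Matrix.one_apply] <;> field_simp
      · linear_combination (1 + ρ 0 s * conj (ρ 0 s)) * e1 - e2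
      · linear_combination -e1
    have hNK : ((N s)ᴴ)ᵀ * ((K s)ᵀ)ᴴ = 1 := by
      have : ((K s)ᵀ)ᴴ = ((K s)ᴴ)ᵀ := rfl
      rw [this, ← Matrix.transpose_mul, ← Matrix.conjTranspose_mul, h.mul_inv s (by simp),
        Matrix.conjTranspose_one, Matrix.transpose_one]
    have hKN : (K s)ᵀ * (N s)ᵀ = 1 := by
      rw [← Matrix.transpose_mul, h.mul_inv s (by simp), Matrix.transpose_one]
    calc _ = (K s)ᵀ * (D s * (1 + Matrix.of fun j k => ρ j s * conj (ρ k s)) * (D s)ᴴ) * ((K s)ᵀ)ᴴ := by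
          rw [Matrix.conjTranspose_mul]; simp only [Matrix.mul_assoc]
      _ = ((K s)ᵀ * (N s)ᵀ) * (((N s)ᴴ)ᵀ * ((K s)ᵀ)ᴴ) := by
          rw [hmid, Matrix.transpose_mul]; simp only [Matrix.mul_assoc]
      _ = 1 := by rw [hKN, hNK, one_mul]

end start

end

/-! ### Prescribed kernels through Blaschke–Potapov factors, and dual vectors -/

section

open scoped Matrix

variable {n : ℕ} {ρ : Fin 2 → ℝ → ℂ} {z : Fin n → ℂ} {C : Fin n → Fin 2 → ℂ}

/-- The orthogonal projection onto the line spanned by `v`. -/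
def lineProj (v : Fin 2 → ℂ) : Matrix (Fin 2) (Fin 2) ℂ :=
  Matrix.of fun j k => v j * conj (v k) / (v 0 * conj (v 0) + v 1 * conj (v 1))

lemma lineProj_conjTranspose (v : Fin 2 → ℂ) : (lineProj v)ᴴ = lineProj v := by
  ext j k
  simp only [lineProj, Matrix.conjTranspose_apply, Matrix.of_apply, RCLike.star_def, map_div₀, map_mul,
    map_add, Complex.conj_conj]
  ring

lemma mul_conj_add_ne_zero {v : Fin 2 → ℂ} (hv : v ≠ 0) :
    v 0 * conj (v 0) + v 1 * conj (v 1) ≠ 0 := by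
  intro h
  rw [mul_conj', mul_conj'] at h
  have h' : ‖v 0‖ ^ 2 + ‖v 1‖ ^ 2 = 0 := by exact_mod_cast h
  have h0 : ‖v 0‖ = 0 := by nlinarith [sq_nonneg ‖v 0‖, sq_nonneg ‖v 1‖]
  have h1 : ‖v 1‖ = 0 := by nlinarith [sq_nonneg ‖v 0‖, sq_nonneg ‖v 1‖]
  refine hv (funext fun k => ?_)
  fin_cases k
  · simpa using h0
  · simpa using h1

lemma lineProj_mul_self {v : Fin 2 → ℂ} (hv : v ≠ 0) : lineProj v * lineProj v = lineProj v := by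
  have := mul_conj_add_ne_zero hv
  ext j k
  simp only [lineProj, Matrix.mul_apply, Matrix.of_apply, Fin.sum_univ_two]
  field_simp

lemma lineProj_mulVec {v : Fin 2 → ℂ} (hv : v ≠ 0) : lineProj v *ᵥ v = v := by
  have := mul_conj_add_ne_zero hv
  ext j
  simp only [lineProj, Matrix.mulVec, dotProduct, Matrix.of_apply, Fin.sum_univ_two]
  rw [div_mul_eq_mul_div, div_mul_eq_mul_div, ← add_div, div_eq_iff this]
  ring

lemma det_one_add_smul_lineProj {v : Fin 2 → ℂ} (hv : v ≠ 0) (b : ℂ) :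
    (1 + (b - 1) • lineProj v).det = b := by
  have := mul_conj_add_ne_zero hv
  rw [Matrix.det_fin_two]
  simp only [lineProj, Matrix.add_apply, Matrix.smul_apply, Matrix.of_apply, Matrix.one_apply_eq, ne_eq,
    zero_ne_one, one_ne_zero, not_false_eq_true, Matrix.one_apply_ne, smul_eq_mul]
  field_simp
  ring

lemma one_add_smul_lineProj_unitary {v : Fin 2 → ℂ} (hv : v ≠ 0) {b : ℂ} (hb : b * conj b = 1) :
    (1 + (b - 1) • lineProj v) * (1 + (b - 1) • lineProj v)ᴴ = 1 := by
  rw [Matrix.conjTranspose_add, Matrix.conjTranspose_one, Matrix.conjTranspose_smul,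
    lineProj_conjTranspose, add_mul, one_mul, mul_add, mul_one, smul_mul_smul_comm, lineProj_mul_self hv,
    add_assoc, ← add_smul, ← add_smul]
  have : star (b - 1) + (b - 1 + (b - 1) * star (b - 1)) = 0 := by
    simp only [RCLike.star_def, map_sub, map_one]
    linear_combination hb
  rw [this, zero_smul, add_zero]

/-- A left factor 1 + (β - 1)P, with β the Blaschke factor at z_i and P the projection onto the line
of E(z_i) C_i, is unitary on the real line and annihilates that vector at z_i. Multiplication from
the left preserves the kernels already arranged. The vector is nonzero because the z_i are distinct,
so det E(z_i) has not yet been made to vanish. -/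
lemma exists_leftFactor (hρ : ∀ k, MemH11 (ρ k)) (hz : ∀ i, 0 < (z i).im) (hinj : Function.Injective z)
    (S : Finset (Fin n)) (hC : ∀ i ∈ S, C i ≠ 0) : ∃ E d, LeftFactor ρ z C S E d := by
  classical
  induction S using Finset.induction_on with
  | empty => exact exists_leftFactor_empty hρ z C
  | insert i S hi ih =>
    obtain ⟨E, d, h⟩ := ih fun j hj => hC j (Finset.mem_insert_of_mem hj)
    obtain ⟨e, he⟩ := h.nice
    have hdet : (E (z i)).det ≠ 0 := by
      rw [h.det_eq _ (hz i).le]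
      refine mul_ne_zero (h.det_ne _ (hz i).le) (Finset.prod_ne_zero_iff.2 fun j hj => ?_)
      exact blaschke_ne_zero (hz j) (hz i).le fun h => hi (by rwa [hinj h])
    set v := E (z i) *ᵥ C i with hv
    have hv0 : v ≠ 0 := fun h0 =>
      hC i (Finset.mem_insert_self i S) (Matrix.eq_zero_of_mulVec_eq_zero hdet h0)
    set B : ℂ → Matrix (Fin 2) (Fin 2) ℂ := fun w => 1 + (blaschke (z i) w - 1) • lineProj v with hB
    have hBn : ∀ j k, UpperNice (fun w => B w j k) ((1 : Matrix (Fin 2) (Fin 2) ℂ) j k)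
        (((conj (z i) - z i) • lineProj v) j k) := fun j k => by
      have h1 := (UpperNice.const ((1 : Matrix (Fin 2) (Fin 2) ℂ) j k)).add
        (((upperNice_blaschke (hz i)).sub (.const 1)).mul (.const (lineProj v j k)))
      simp only [sub_self, zero_mul, add_zero, sub_zero, zero_add] at h1
      exact h1
    have hBz : B (z i) *ᵥ v = 0 := by
      have : blaschke (z i) (z i) = 0 := by simp [blaschke]
      rw [hB]
      simp only [this]
      rw [Matrix.add_mulVec, Matrix.smul_mulVec, lineProj_mulVec hv0, Matrix.one_mulVec]
      simp
    refine ⟨fun w => B w * E w, d, ⟨_, UpperNice.matrix_mul hBn he⟩, h.nice_det, h.det_ne,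
      fun w hw => ?_, fun s => ?_, fun j hj => ?_⟩
    · rw [Matrix.det_mul, h.det_eq w hw, det_one_add_smul_lineProj hv0, Finset.prod_insert hi]
      ring
    · rw [Matrix.conjTranspose_mul]
      calc _ = B s * (E s * (1 + Matrix.of fun j k => ρ j s * conj (ρ k s)) * (E s)ᴴ) * (B s)ᴴ := by
            simp only [Matrix.mul_assoc]
        _ = 1 := by
          rw [h.unit, Matrix.mul_one]
          exact one_add_smul_lineProj_unitary hv0 (blaschke_mul_conj (hz i) s)
    · rw [← Matrix.mulVec_mulVec]
      rcases Finset.mem_insert.1 hj with rfl | hj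
      · exact hBz
      · rw [h.ker j hj, Matrix.mulVec_zero]

namespace LeftFactor

variable {S : Finset (Fin n)} {E : ℂ → Matrix (Fin 2) (Fin 2) ℂ} {d : ℂ → ℂ}

/-- The quotient of the Blaschke product by `w - z i`. -/
def coBlaschke (z : Fin n → ℂ) (S : Finset (Fin n)) (i : Fin n) (w : ℂ) : ℂ :=
  (∏ j ∈ S.erase i, blaschke (z j) w) * (w - conj (z i))⁻¹

lemma mul_coBlaschke (z : Fin n → ℂ) {S : Finset (Fin n)} {i : Fin n} (hi : i ∈ S) (w : ℂ) :
    (w - z i) * coBlaschke z S i w = ∏ j ∈ S, blaschke (z j) w := by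
  rw [← Finset.mul_prod_erase S _ hi, coBlaschke, blaschke, div_eq_mul_inv]
  ring

lemma coBlaschke_ne_zero (hz : ∀ i, 0 < (z i).im) (hinj : Function.Injective z) (i : Fin n) :
    coBlaschke z S i (z i) ≠ 0 := by
  refine mul_ne_zero (Finset.prod_ne_zero_iff.2 fun j hj => ?_)
    (inv_ne_zero (sub_ne_zero_of_im (by simpa using hz i) (hz i).le))
  exact blaschke_ne_zero (hz j) (hz i).le fun h => (Finset.mem_erase.1 hj).1 (hinj h).symm

lemma coBlaschke_eq_zero {i j : Fin n} (hi : i ∈ S) (hij : i ≠ j) : coBlaschke z S j (z i) = 0 := by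
  rw [coBlaschke, Finset.prod_eq_zero (Finset.mem_erase.2 ⟨hij, hi⟩), zero_mul]
  simp [blaschke]

lemma upperNice_coBlaschke (hz : ∀ i, 0 < (z i).im) (i : Fin n) :
    UpperNice (coBlaschke z S i) 0 1 := by
  obtain ⟨l, hl⟩ := UpperNice.prod (S.erase i) fun j _ => ⟨_, upperNice_blaschke (hz j)⟩
  have := hl.mul (UpperNice.inv_sub (a := conj (z i)) (by simpa using hz i))
  simp only [mul_zero, zero_add, mul_one] at this
  exact this

/-- Choose b with det(C_i, b) = 1. Then det(E C_i, E b) = det E, and dividing by w - z_i pairs the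
derivative of E C_i at z_i with E(z_i) b. The covector (E b)_1, -(E b)_0 annihilates E(z_i), and
this pairing shows that it can be normalized. -/
lemma exists_dual (h : LeftFactor ρ z C S E d) (hz : ∀ i, 0 < (z i).im) (hinj : Function.Injective z)
    {i : Fin n} (hi : i ∈ S) (hC : C i ≠ 0) :
    ∃ v : Fin 2 → ℂ, (∀ k, v 0 * E (z i) 0 k + v 1 * E (z i) 1 k = 0) ∧
      d (z i) * coBlaschke z S i (z i) *
        (v 0 * dslope (fun w => (E w *ᵥ C i) 0) (z i) (z i) +
          v 1 * dslope (fun w => (E w *ᵥ C i) 1) (z i) (z i)) = 1 := by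
  obtain ⟨e, he⟩ := h.nice
  obtain ⟨l, hd⟩ := h.nice_det
  obtain ⟨b, hb⟩ : ∃ b : Fin 2 → ℂ, C i 0 * b 1 - C i 1 * b 0 = 1 := by
    by_cases h0 : C i 0 = 0
    · have h1 : C i 1 ≠ 0 := fun h1 => hC (funext fun k => by fin_cases k <;> assumption)
      exact ⟨![-(C i 1)⁻¹, 0], by simp [h1]⟩
    · exact ⟨![0, (C i 0)⁻¹], by simp [h0]⟩
  set φ : Fin 2 → ℂ → ℂ := fun k => dslope (fun w => (E w *ᵥ C i) k) (z i) with hφ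
  have hφw : ∀ k w, (w - z i) * φ k w = (E w *ᵥ C i) k := fun k w => by
    have := sub_smul_dslope (fun w => (E w *ᵥ C i) k) (z i) w
    rw [h.ker i hi, Pi.zero_apply, sub_zero, smul_eq_mul] at this
    exact this
  have hcont : ∀ {f : ℂ → ℂ} {c l : ℂ}, UpperNice f c l → ContinuousAt f (z i) := fun hf =>
    (hf.diff.differentiableAt (UpperNice.isOpen_upper.mem_nhds (hz i))).continuousAt
  have hφc : ∀ k, ContinuousAt (φ k) (z i) := fun k => by
    obtain ⟨l, hl⟩ := UpperNice.matrix_mulVec he (C i) k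
    exact hcont (hl.dslope (hz i) (congrFun (h.ker i hi) k))
  have hEb : ∀ k, ContinuousAt (fun w => (E w *ᵥ b) k) (z i) := fun k => by
    obtain ⟨l, hl⟩ := UpperNice.matrix_mulVec he b k
    exact hcont hl
  have key : φ 0 (z i) * (E (z i) *ᵥ b) 1 - φ 1 (z i) * (E (z i) *ᵥ b) 0 =
      d (z i) * coBlaschke z S i (z i) := by
    have c1 : ContinuousAt (fun w => φ 0 w * (E w *ᵥ b) 1 - φ 1 w * (E w *ᵥ b) 0) (z i) :=
      ((hφc 0).mul (hEb 1)).sub ((hφc 1).mul (hEb 0))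
    have c2 : ContinuousAt (fun w => d w * coBlaschke z S i w) (z i) :=
      (hcont hd).mul (hcont (upperNice_coBlaschke hz i))
    refine tendsto_nhds_unique (c1.mono_left (nhdsWithin_le_nhds (s := {z i}ᶜ)))
      ((c2.mono_left (nhdsWithin_le_nhds (s := {z i}ᶜ))).congr' ?_)
    filter_upwards [self_mem_nhdsWithin, nhdsWithin_le_nhds (UpperNice.isOpen_upper.mem_nhds (hz i))]
      with w hw hw'
    refine mul_left_cancel₀ (sub_ne_zero.2 hw) ?_
    have h1 := h.det_eq w (le_of_lt hw')
    rw [← mul_coBlaschke z hi, Matrix.det_fin_two] at h1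
    have h2 := hφw 0 w
    have h3 := hφw 1 w
    simp only [Matrix.mulVec, dotProduct, Fin.sum_univ_two] at h2 h3 ⊢
    linear_combination (-1 : ℂ) * h1 - (E w 1 0 * b 0 + E w 1 1 * b 1) * h2 +
      (E w 0 0 * b 0 + E w 0 1 * b 1) * h3 - (E w 0 0 * E w 1 1 - E w 0 1 * E w 1 0) * hb
  set t := d (z i) * coBlaschke z S i (z i) with ht
  have ht0 : t ≠ 0 := mul_ne_zero (h.det_ne _ (hz i).le) (coBlaschke_ne_zero hz hinj i)
  have hdet : E (z i) 0 0 * E (z i) 1 1 - E (z i) 0 1 * E (z i) 1 0 = 0 := by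
    rw [← Matrix.det_fin_two, h.det_eq _ (hz i).le, ← mul_coBlaschke z hi, sub_self]
    simp
  -- The unscaled covector pairs to t, while the normalization asks that t times the pairing be one;
  -- hence the square.
  refine ⟨![(E (z i) *ᵥ b) 1 / t ^ 2, -(E (z i) *ᵥ b) 0 / t ^ 2], fun k => ?_, ?_⟩
  · simp only [Matrix.mulVec, dotProduct, Fin.sum_univ_two, Matrix.cons_val_zero, Matrix.cons_val_one]
    fin_cases k
    · simp only [Fin.zero_eta]
      field_simp
      linear_combination b 1 * hdet
    · simp only [Fin.mk_one]
      field_simp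
      linear_combination (-b 0) * hdet
  · simp only [Matrix.cons_val_zero, Matrix.cons_val_one]
    field_simp
    linear_combination key

end LeftFactor

end

/-! ### The block matrix connecting the two problems -/

section

open scoped Matrix

lemma UpperNice.adjugate_three {A : ℂ → Mat3} {q : Mat3}
    (hA : ∀ j k, UpperNice (fun w => A w j k) ((1 : Mat3) j k) (q j k)) :
    ∃ q' : Mat3, ∀ j k, UpperNice (fun w => (A w).adjugate j k) ((1 : Mat3) j k) (q' j k) := by
  have key : ∀ (a b c e f g i j : Fin 3) (L : ℂ) (F : ℂ → ℂ),
      (1 : Mat3) a b * (1 : Mat3) c e - (1 : Mat3) f g * (1 : Mat3) i j = L →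
      (∀ w, F w = A w a b * A w c e - A w f g * A w i j) → ∃ l, UpperNice F L l := by
    rintro a b c e f g i j _ F rfl hF
    exact ⟨_, (((hA a b).mul (hA c e)).sub ((hA f g).mul (hA i j))).congr fun w _ => hF w⟩
  have h : ∀ j k, ∃ l, UpperNice (fun w => (A w).adjugate j k) ((1 : Mat3) j k) l := by
    simp only [Matrix.adjugate_fin_three]
    intro j k
    fin_cases j <;> fin_cases k
    · exact key 1 1 2 2 1 2 2 1 _ _ (by simp) fun w => rfl
    · exact key 0 2 2 1 0 1 2 2 _ _ (by simp) fun w => neg_add_eq_sub _ _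
    · exact key 0 1 1 2 0 2 1 1 _ _ (by simp) fun w => rfl
    · exact key 1 2 2 0 1 0 2 2 _ _ (by simp) fun w => neg_add_eq_sub _ _
    · exact key 0 0 2 2 0 2 2 0 _ _ (by simp) fun w => rfl
    · exact key 0 2 1 0 0 0 1 2 _ _ (by simp) fun w => neg_add_eq_sub _ _
    · exact key 1 0 2 1 1 1 2 0 _ _ (by simp) fun w => rfl
    · exact key 0 1 2 0 0 0 2 1 _ _ (by simp) fun w => neg_add_eq_sub _ _
    · exact key 0 0 1 1 0 1 1 0 _ _ (by simp) fun w => rfl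
  choose q' hq' using h
  exact ⟨q', hq'⟩

lemma eq_of_eq_off_range {n : ℕ} {z : Fin n → ℂ} {f : ℂ → ℂ} {b : ℂ} (hf : ContinuousOn f {w | 0 ≤ w.im})
    (hz : ∀ i, 0 < (z i).im) (h : ∀ w : ℂ, 0 ≤ w.im → w ∉ Set.range z → f w = b) {w : ℂ} (hw : 0 ≤ w.im) :
    f w = b := by
  by_cases hr : w ∈ Set.range z
  · obtain ⟨i, rfl⟩ := hr
    have hU := UpperNice.isOpen_upper.mem_nhds (hz i)
    have hc : ContinuousAt f (z i) :=
      hf.continuousAt (mem_of_superset hU fun w (hw : 0 < w.im) => hw.le)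
    have hfin : (Set.range z \ {z i})ᶜ ∈ 𝓝 (z i) :=
      ((Set.finite_range z).subset Set.sdiff_subset).isClosed.isOpen_compl.mem_nhds (by simp)
    refine tendsto_nhds_unique (hc.mono_left (nhdsWithin_le_nhds (s := {z i}ᶜ)))
      (tendsto_const_nhds.congr' ?_)
    filter_upwards [self_mem_nhdsWithin, nhdsWithin_le_nhds hU, nhdsWithin_le_nhds hfin] with w h1 h2 h3
    exact (h w (le_of_lt h2) fun h4 => h3 ⟨h4, h1⟩).symm
  · exact h w hw hr

lemma lowMat_three (t : Fin 2 → ℂ) : lowMat t = !![1, 0, 0; t 0, 1, 0; t 1, 0, 1] := by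
  ext j k
  fin_cases j <;> fin_cases k <;> rfl

/-- The block matrix with corner `g`, first row `y`, first column `-x` and lower block `E`. -/
def blockMat (g : ℂ) (y x : Fin 2 → ℂ) (E : Matrix (Fin 2) (Fin 2) ℂ) : Mat3 :=
  !![g, y 0, y 1; -x 0, E 0 0, E 0 1; -x 1, E 1 0, E 1 1]

/-- All entries except the corner follow from u uᴴ + E Eᴴ = 1. The corner also needs 1 - |u|² = |det
E|², the determinant of E Eᴴ = 1 - u uᴴ. -/
lemma blockMat_hermitian {E : Matrix (Fin 2) (Fin 2) ℂ} {u τ : Fin 2 → ℂ} {δ i b : ℂ}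
    (hb : b * conj b = 1) (hi : δ * i = 1) (hdet : E.det = δ * b)
    (hu : ∀ j k, u j * conj (u k) + (E j 0 * conj (E k 0) + E j 1 * conj (E k 1)) =
      (1 : Matrix (Fin 2) (Fin 2) ℂ) j k) :
    blockMat (i * conj b - (τ 0 * u 0 + τ 1 * u 1)) (fun k => τ 0 * E 0 k + τ 1 * E 1 k) u E *
      (blockMat (i * conj b - (τ 0 * u 0 + τ 1 * u 1)) (fun k => τ 0 * E 0 k + τ 1 * E 1 k) u E)ᴴ =
      (lowMat fun k => -(u k * b * conj i) + conj (τ k))ᴴ *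
        lowMat fun k => -(u k * b * conj i) + conj (τ k) := by
  have U00 := hu 0 0
  have U01 := hu 0 1
  have U10 := hu 1 0
  have U11 := hu 1 1
  simp only [Matrix.one_apply_eq, ne_eq, zero_ne_one, one_ne_zero, not_false_eq_true,
    Matrix.one_apply_ne] at U00 U01 U10 U11
  have hi' : conj δ * conj i = 1 := by rw [← map_mul, hi, map_one]
  rw [Matrix.det_fin_two] at hdet
  have hdet' : conj (E 0 0) * conj (E 1 1) - conj (E 0 1) * conj (E 1 0) = conj δ * conj b := by
    rw [← map_mul, ← map_mul, ← map_mul, ← map_sub, hdet]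
  have hD : 1 - (u 0 * conj (u 0) + u 1 * conj (u 1)) = δ * b * (conj δ * conj b) := by
    rw [← hdet, ← hdet']
    linear_combination (-(1 - u 1 * conj (u 1))) * U00 - 
      (E 0 0 * conj (E 0 0) + E 0 1 * conj (E 0 1)) * U11 +
      (E 1 0 * conj (E 0 0) + E 1 1 * conj (E 0 1)) * U01 - u 0 * conj (u 1) * U10
  have h3 : i * conj i * (b * conj b) * (1 - (u 0 * conj (u 0) + u 1 * conj (u 1))) = 1 := by
    rw [hD]
    calc _ = (δ * i) * (conj δ * conj i) * (b * conj b) * (b * conj b) := by ring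
      _ = 1 := by rw [hi, hi', hb]; ring
  rw [lowMat_three]
  ext j k
  fin_cases j <;> fin_cases k <;>
    simp [blockMat, Matrix.mul_apply, Fin.sum_univ_three]
  · linear_combination h3 + τ 0 * conj (τ 0) * U00 + τ 0 * conj (τ 1) * U01 + τ 1 * conj (τ 0) * U10 +
      τ 1 * conj (τ 1) * U11
  · linear_combination τ 0 * U00 + τ 1 * U10
  · linear_combination τ 0 * U01 + τ 1 * U11
  · linear_combination conj (τ 0) * U00 + conj (τ 1) * U01
  · linear_combination U00
  · linear_combination U01
  · linear_combination conj (τ 0) * U10 + conj (τ 1) * U11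
  · linear_combination U10
  · linear_combination U11

lemma blockMat_mul_lowMat (g : ℂ) (y x r : Fin 2 → ℂ) (E : Matrix (Fin 2) (Fin 2) ℂ) :
    blockMat g y x E * lowMat r = blockMat (g + (y 0 * r 0 + y 1 * r 1)) y
      (fun k => x k - (E k 0 * r 0 + E k 1 * r 1)) E := by
  rw [lowMat_three]
  ext j k
  fin_cases j <;> fin_cases k <;>
    simp [blockMat, Matrix.mul_apply, Fin.sum_univ_three] <;> ring

lemma det_blockMat (g : ℂ) (t x : Fin 2 → ℂ) (E : Matrix (Fin 2) (Fin 2) ℂ) :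
    (blockMat g (fun k => t 0 * E 0 k + t 1 * E 1 k) x E).det =
      (g + (t 0 * x 0 + t 1 * x 1)) * E.det := by
  rw [Matrix.det_fin_three, Matrix.det_fin_two]
  simp [blockMat]
  ring

lemma UpperNice.exists_blockMat {g : ℂ → ℂ} {y x : ℂ → Fin 2 → ℂ} {E : ℂ → Matrix (Fin 2) (Fin 2) ℂ}
    {lg : ℂ} {ly lx : Fin 2 → ℂ} {e : Matrix (Fin 2) (Fin 2) ℂ} (hg : UpperNice g 1 lg)
    (hy : ∀ k, UpperNice (fun w => y w k) 0 (ly k)) (hx : ∀ k, UpperNice (fun w => x w k) 0 (lx k))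
    (hE : ∀ j k, UpperNice (fun w => E w j k) ((1 : Matrix (Fin 2) (Fin 2) ℂ) j k) (e j k)) (j k : Fin 3) :
    UpperNice (fun w => blockMat (g w) (y w) (x w) (E w) j k) ((1 : Mat3) j k)
      (blockMat lg ly lx e j k) := by
  have hx' : ∀ k, UpperNice (fun w => -x w k) 0 (-lx k) := fun k => by
    have := (hx k).neg
    rwa [neg_zero] at this
  fin_cases j <;> fin_cases k
  exacts [hg, hy 0, hy 1, hx' 0, hE 0 0, hE 0 1, hx' 1, hE 1 0, hE 1 1]

end

/-! ### Reflection coefficient and poles of the reflected problem -/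

section

open scoped Matrix

variable {n : ℕ} {ρ : Fin 2 → ℝ → ℂ} {z : Fin n → ℂ} {C : Fin n → Fin 2 → ℂ} {S : Finset (Fin n)}
  {E : ℂ → Matrix (Fin 2) (Fin 2) ℂ} {d : ℂ → ℂ}

/-- The reflection coefficient of the reflected problem. -/
def leftReflection (ρ : Fin 2 → ℝ → ℂ) (z : Fin n → ℂ) (S : Finset (Fin n))
    (E : ℂ → Matrix (Fin 2) (Fin 2) ℂ) (d : ℂ → ℂ) (k : Fin 2) (s : ℝ) : ℂ :=
  -((E ((-s : ℝ) : ℂ) k 0 * ρ 0 (-s) + E ((-s : ℝ) : ℂ) k 1 * ρ 1 (-s)) *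
    (∏ i ∈ S, blaschke (z i) ((-s : ℝ) : ℂ)) * conj (d ((-s : ℝ) : ℂ))⁻¹)

lemma LeftFactor.memH11_leftReflection (h : LeftFactor ρ z C S E d) (hρ : ∀ k, MemH11 (ρ k))
    (hz : ∀ i, 0 < (z i).im) (k : Fin 2) : MemH11 (leftReflection ρ z S E d k) := by
  obtain ⟨e, he⟩ := h.nice
  obtain ⟨l, hd⟩ := h.nice_det
  obtain ⟨b, hb⟩ := UpperNice.prod S fun j _ => ⟨_, upperNice_blaschke (hz j)⟩
  have hdi := hd.inv one_ne_zero h.det_ne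
  have h1 : ∀ j, MemH11 fun s : ℝ => E s k j * ρ j s := fun j => by
    obtain ⟨B, hB⟩ := (he k j).exists_bound_real
    exact (hρ j).mul_left (he k j).deriv hB
  obtain ⟨B1, hB1⟩ := hb.exists_bound_real
  obtain ⟨B2, hB2⟩ := hdi.exists_bound_real
  have h2 := (((h1 0).add (h1 1)).mul_left hb.deriv hB1).mul_left hdi.deriv.star (B := B2)
    fun t => by rw [RCLike.norm_conj]; exact hB2 t
  have h3 := (h2.const_mul (-1)).comp_neg
  have e : leftReflection ρ z S E d k = fun s => -1 * (conj (d ((-s : ℝ) : ℂ))⁻¹ *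
      ((∏ i ∈ S, blaschke (z i) ((-s : ℝ) : ℂ)) *
      (E ((-s : ℝ) : ℂ) k 0 * ρ 0 (-s) + E ((-s : ℝ) : ℂ) k 1 * ρ 1 (-s)))) := by
    ext s
    rw [leftReflection]
    ring
  rw [e]
  exact h3

lemma poleOut_neg_conj (a : ℂ) (x s : ℝ) :
    poleOut (-conj a) x ((-s : ℝ) : ℂ) = -conj (poleOut a x s) := by
  have e : conj (exp (2 * I * a * x)) = exp (2 * I * (-conj a) * x) := by
    rw [← exp_conj]
    congr 1
    simp [conj_ofNat]
  have e2 : ((-s : ℝ) : ℂ) - -conj a = -((s : ℂ) - conj a) := by push_cast; ring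
  rw [poleOut, poleOut, map_div₀, map_sub, conj_ofReal, e, e2, div_neg]

end

/-! ### Cancellation of poles in the connecting matrix -/

section

open scoped Matrix

variable {n : ℕ} {ρ : Fin 2 → ℝ → ℂ} {z : Fin n → ℂ} {C : Fin n → Fin 2 → ℂ} {S : Finset (Fin n)}
  {E : ℂ → Matrix (Fin 2) (Fin 2) ℂ} {d : ℂ → ℂ} {v : Fin n → Fin 2 → ℂ} {x : ℝ}

/-- Norming constants of the reflected problem. -/
structure DualVectors (z : Fin n → ℂ) (C : Fin n → Fin 2 → ℂ) (S : Finset (Fin n))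
    (E : ℂ → Matrix (Fin 2) (Fin 2) ℂ) (d : ℂ → ℂ) (v : Fin n → Fin 2 → ℂ) : Prop where
  zero : ∀ i ∉ S, v i = 0
  ker : ∀ i ∈ S, ∀ k, v i 0 * E (z i) 0 k + v i 1 * E (z i) 1 k = 0
  norming : ∀ i ∈ S, d (z i) * LeftFactor.coBlaschke z S i (z i) *
    (v i 0 * dslope (fun w => (E w *ᵥ C i) 0) (z i) (z i) +
      v i 1 * dslope (fun w => (E w *ᵥ C i) 1) (z i) (z i)) = 1

lemma LeftFactor.exists_dualVectors (h : LeftFactor ρ z C S E d) (hz : ∀ i, 0 < (z i).im)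
    (hinj : Function.Injective z) (hC : ∀ i ∈ S, C i ≠ 0) : ∃ v, DualVectors z C S E d v := by
  classical
  choose v hv1 hv2 using fun i (hi : i ∈ S) => h.exists_dual hz hinj hi (hC i hi)
  refine ⟨fun i => if hi : i ∈ S then v i hi else 0, fun i hi => dif_neg hi, fun i hi k => ?_,
    fun i hi => ?_⟩
  · simp only [dif_pos hi]
    exact hv1 i hi k
  · simp only [dif_pos hi]
    exact hv2 i hi

/-- The regular function `E R`, with `R` the sum of the pole terms. -/
def colPole (z : Fin n → ℂ) (C : Fin n → Fin 2 → ℂ) (E : ℂ → Matrix (Fin 2) (Fin 2) ℂ) (x : ℝ) (w : ℂ)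
    (k : Fin 2) : ℂ :=
  ∑ i, exp (2 * I * z i * x) * dslope (fun w => (E w *ᵥ C i) k) (z i) w

/-- The regular function `R E`, with `R` the row of the dual pole terms. -/
def rowPole (z : Fin n → ℂ) (v : Fin n → Fin 2 → ℂ) (E : ℂ → Matrix (Fin 2) (Fin 2) ℂ) (x : ℝ) (w : ℂ)
    (k : Fin 2) : ℂ :=
  ∑ i, exp (2 * I * z i * x) * dslope (fun w => v i 0 * E w 0 k + v i 1 * E w 1 k) (z i) w

/-- The sum of the pole terms. -/
def sumPole (z : Fin n → ℂ) (C : Fin n → Fin 2 → ℂ) (x : ℝ) (w : ℂ) (k : Fin 2) : ℂ :=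
  ∑ i, C i k * poleOut (z i) x w

lemma dslope_of_zero {f : ℂ → ℂ} {a w : ℂ} (h0 : f a = 0) (hw : w ≠ a) : dslope f a w = f w / (w - a) := by
  rw [dslope_of_ne _ hw, slope_def_field, h0, sub_zero]

namespace LeftFactor

lemma ker_all (h : LeftFactor ρ z C S E d) (hC : ∀ i ∉ S, C i = 0) (i : Fin n) : E (z i) *ᵥ C i = 0 := by
  by_cases hi : i ∈ S
  · exact h.ker i hi
  · rw [hC i hi, Matrix.mulVec_zero]

lemma upperNice_colPole (h : LeftFactor ρ z C S E d) (hz : ∀ i, 0 < (z i).im) (hC : ∀ i ∉ S, C i = 0)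
    (x : ℝ) (k : Fin 2) : UpperNice (fun w => colPole z C E x w k) 0 (∑ i, C i k * exp (2 * I * z i * x)) := by
  obtain ⟨e, he⟩ := h.nice
  choose l hl using fun i => UpperNice.matrix_mulVec he (C i) k
  have := UpperNice.sum Finset.univ fun i (_ : i ∈ Finset.univ) =>
    ((hl i).dslope (hz i) (congrFun (h.ker_all hC i) k)).const_mul (exp (2 * I * z i * x))
  simp only [mul_zero, Finset.sum_const_zero, mul_comm _ (C _ k)] at this
  exact this

lemma colPole_eq (h : LeftFactor ρ z C S E d) (hC : ∀ i ∉ S, C i = 0) {w : ℂ} (hw : w ∉ Set.range z)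
    (k : Fin 2) : colPole z C E x w k = E w k 0 * sumPole z C x w 0 + E w k 1 * sumPole z C x w 1 := by
  simp only [sumPole, Finset.mul_sum, ← Finset.sum_add_distrib]
  refine Finset.sum_congr rfl fun i _ => ?_
  rw [dslope_of_zero (congrFun (h.ker_all hC i) k) fun h => hw ⟨i, h.symm⟩, poleOut]
  simp only [Matrix.mulVec, dotProduct, Fin.sum_univ_two]
  ring

end LeftFactor

namespace DualVectors

lemma ker_all (hv : DualVectors z C S E d v) (i : Fin n) (k : Fin 2) :
    v i 0 * E (z i) 0 k + v i 1 * E (z i) 1 k = 0 := by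
  by_cases hi : i ∈ S
  · exact hv.ker i hi k
  · simp [hv.zero i hi]

lemma upperNice_rowPole (hv : DualVectors z C S E d v) (h : LeftFactor ρ z C S E d) (hz : ∀ i, 0 < (z i).im)
    (x : ℝ) (k : Fin 2) : UpperNice (fun w => rowPole z v E x w k) 0 (∑ i, v i k * exp (2 * I * z i * x)) := by
  obtain ⟨e, he⟩ := h.nice
  have := UpperNice.sum Finset.univ fun i (_ : i ∈ Finset.univ) =>
    ((((he 0 k).const_mul (v i 0)).add ((he 1 k).const_mul (v i 1))).dslope (hz i)
      (hv.ker_all i k)).const_mul (exp (2 * I * z i * x))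
  have e1 : ∀ (k : Fin 2) i, v i 0 * (1 : Matrix (Fin 2) (Fin 2) ℂ) 0 k +
      v i 1 * (1 : Matrix (Fin 2) (Fin 2) ℂ) 1 k = v i k :=
    Fin.forall_fin_two.2 ⟨fun i => by simp, fun i => by simp⟩
  simp only [mul_zero, Finset.sum_const_zero, e1, mul_comm _ (v _ k)] at this
  exact this

lemma rowPole_eq (hv : DualVectors z C S E d v) {w : ℂ} (hw : w ∉ Set.range z)
    (k : Fin 2) : rowPole z v E x w k = sumPole z v x w 0 * E w 0 k + sumPole z v x w 1 * E w 1 k := by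
  simp only [sumPole, Finset.sum_mul, ← Finset.sum_add_distrib]
  refine Finset.sum_congr rfl fun i _ => ?_
  rw [dslope_of_zero (f := fun w => v i 0 * E w 0 k + v i 1 * E w 1 k) (hv.ker_all i k) fun h => hw ⟨i, h.symm⟩, poleOut]
  ring

/-- The right-hand side is the corner entry that gives the connecting matrix determinant one. After
multiplication by the Blaschke product it is regular in the upper half plane, and it vanishes at
each z_i by the norming condition: the terms with j ≠ i are killed by v_i E(z_i) = 0, and the
exponentials of x and -x cancel, so the condition does not depend on x. The Blaschke product can
then be divided out again. -/
lemma exists_corner (hv : DualVectors z C S E d v) (h : LeftFactor ρ z C S E d) (hz : ∀ i, 0 < (z i).im)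
    (hinj : Function.Injective z) (hC : ∀ i ∉ S, C i = 0) (x : ℝ) :
    ∃ g l, UpperNice g 1 l ∧ ∀ w : ℂ, 0 ≤ w.im → w ∉ Set.range z →
      g w = (d w * ∏ i ∈ S, blaschke (z i) w)⁻¹ -
        (sumPole z v (-x) w 0 * colPole z C E x w 0 + sumPole z v (-x) w 1 * colPole z C E x w 1) := by
  obtain ⟨ld, hd⟩ := h.nice_det
  -- The corner times the Blaschke product, written with `coBlaschke` so that no pole is visible.
  set H : ℂ → ℂ := fun w => (d w)⁻¹ - ∑ i, exp (2 * I * z i * (-x : ℝ)) *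
    (LeftFactor.coBlaschke z S i w * (v i 0 * colPole z C E x w 0 + v i 1 * colPole z C E x w 1)) with hH
  have hX := h.upperNice_colPole hz hC x
  have hHn : ∃ l, UpperNice H 1 l := by
    have h1 := UpperNice.sum Finset.univ fun i (_ : i ∈ Finset.univ) =>
      ((LeftFactor.upperNice_coBlaschke (S := S) hz i).mul
        (((hX 0).const_mul (v i 0)).add ((hX 1).const_mul (v i 1)))).const_mul
          (exp (2 * I * z i * (-x : ℝ)))
    have h2 := (hd.inv one_ne_zero h.det_ne).sub h1
    simp only [mul_zero, add_zero, Finset.sum_const_zero, inv_one, sub_zero] at h2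
    exact ⟨_, h2⟩
  obtain ⟨lH, hHn⟩ := hHn
  have hH0 : ∀ i ∈ S, H (z i) = 0 := by
    intro i hi
    have h1 : v i 0 * colPole z C E x (z i) 0 + v i 1 * colPole z C E x (z i) 1 =
        exp (2 * I * z i * x) * (v i 0 * dslope (fun w => (E w *ᵥ C i) 0) (z i) (z i) +
      v i 1 * dslope (fun w => (E w *ᵥ C i) 1) (z i) (z i)) := by
      simp only [colPole, Finset.mul_sum, ← Finset.sum_add_distrib]
      rw [Finset.sum_eq_single i]
      · ring
      · intro j _ hj
        have hne : z i ≠ z j := fun h => hj (hinj h).symm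
        rw [dslope_of_zero (congrFun (h.ker_all hC j) 0) hne,
          dslope_of_zero (congrFun (h.ker_all hC j) 1) hne]
        simp only [Matrix.mulVec, dotProduct, Fin.sum_univ_two]
        have k0 := hv.ker_all i 0
        have k1 := hv.ker_all i 1
        linear_combination (exp (2 * I * z j * x) / (z i - z j)) * (C j 0 * k0 + C j 1 * k1)
      · simp
    simp only [hH]
    rw [Finset.sum_eq_single i, h1]
    · have h2 := hv.norming i hi
      have h3 : exp (2 * I * z i * (-x : ℝ)) * exp (2 * I * z i * x) = 1 := by
        rw [← exp_add, ← exp_zero]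
        congr 1
        push_cast
        ring
      rw [sub_eq_zero]
      refine inv_eq_of_mul_eq_one_right ?_
      linear_combination h2 + (d (z i) * LeftFactor.coBlaschke z S i (z i) *
        (v i 0 * dslope (fun w => (E w *ᵥ C i) 0) (z i) (z i) +
          v i 1 * dslope (fun w => (E w *ᵥ C i) 1) (z i) (z i))) * h3
    · intro j _ hj
      rw [LeftFactor.coBlaschke_eq_zero hi (Ne.symm hj), zero_mul, mul_zero]
    · simp
  obtain ⟨g, l, hg, hgH⟩ := UpperNice.exists_div_blaschke hz hinj S hHn hH0
  refine ⟨g, l, hg, fun w hw hwr => ?_⟩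
  have hβ : ∏ i ∈ S, blaschke (z i) w ≠ 0 :=
    Finset.prod_ne_zero_iff.2 fun i _ => blaschke_ne_zero (hz i) hw fun h => hwr ⟨i, h.symm⟩
  have hd0 := h.det_ne w hw
  refine mul_right_cancel₀ hβ ?_
  rw [hgH w hw, sub_mul, mul_inv, mul_assoc (d w)⁻¹, inv_mul_cancel₀ hβ, mul_one]
  simp only [hH]
  congr 1
  simp only [sumPole, Finset.sum_mul, ← Finset.sum_add_distrib]
  refine Finset.sum_congr rfl fun i _ => ?_
  by_cases hi : i ∈ S
  · have hwi : w - z i ≠ 0 := sub_ne_zero.2 fun h => hwr ⟨i, h.symm⟩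
    rw [poleOut, ← LeftFactor.mul_coBlaschke z hi w]
    field_simp
  · simp [hv.zero i hi]

end DualVectors

end

/-! ### Transfer of factorizations from the reflected problem -/

section

open scoped Matrix

variable {n : ℕ} {ρ : Fin 2 → ℝ → ℂ} {z : Fin n → ℂ} {C : Fin n → Fin 2 → ℂ} {S : Finset (Fin n)}
  {E : ℂ → Matrix (Fin 2) (Fin 2) ℂ} {d : ℂ → ℂ} {v : Fin n → Fin 2 → ℂ} {x : ℝ}

lemma blockMat_succ_zero (g : ℂ) (y x : Fin 2 → ℂ) (E : Matrix (Fin 2) (Fin 2) ℂ) (k : Fin 2) :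
    blockMat g y x E k.succ 0 = -x k := by fin_cases k <;> rfl

lemma blockMat_zero_succ (g : ℂ) (y x : Fin 2 → ℂ) (E : Matrix (Fin 2) (Fin 2) ℂ) (k : Fin 2) :
    blockMat g y x E 0 k.succ = y k := by fin_cases k <;> rfl

lemma LeftFactor.unit_apply (h : LeftFactor ρ z C S E d) (s : ℝ) {e : ℂ} (he : e * conj e = 1)
    (j k : Fin 2) :
    (E s j 0 * (ρ 0 s * e) + E s j 1 * (ρ 1 s * e)) *
        conj (E s k 0 * (ρ 0 s * e) + E s k 1 * (ρ 1 s * e)) +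
      (E s j 0 * conj (E s k 0) + E s j 1 * conj (E s k 1)) = (1 : Matrix (Fin 2) (Fin 2) ℂ) j k := by
  have h1 := congrFun (congrFun (h.unit s) j) k
  simp only [Matrix.mul_apply, Fin.sum_univ_two, Matrix.add_apply, Matrix.of_apply,
    Matrix.conjTranspose_apply, Matrix.one_apply_eq, ne_eq, zero_ne_one, one_ne_zero, not_false_eq_true,
    Matrix.one_apply_ne, RCLike.star_def] at h1
  rw [← h1]
  simp only [map_add, map_mul]
  linear_combination ((E s j 0 * ρ 0 s + E s j 1 * ρ 1 s) *
    (conj (E s k 0) * conj (ρ 0 s) + conj (E s k 1) * conj (ρ 1 s))) * he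

lemma effReflection_leftReflection (s : ℝ) (k : Fin 2) :
    effReflection (leftReflection ρ z S E d) (fun i => -conj (z i)) (fun i k => conj (v i k)) (-x) k (-s) =
      -((E s k 0 * (ρ 0 s * exp (2 * I * s * x)) + E s k 1 * (ρ 1 s * exp (2 * I * s * x))) *
        (∏ i ∈ S, blaschke (z i) s) * conj (d s)⁻¹) + conj (sumPole z v (-x) s k) := by
  rw [effReflection, sumPole, leftReflection, map_sum, sub_eq_add_neg, ← Finset.sum_neg_distrib]
  congr 1
  · rw [neg_neg]
    have : 2 * I * ((-s : ℝ) : ℂ) * ((-x : ℝ) : ℂ) = 2 * I * s * x := by push_cast; ring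
    rw [this]
    ring
  · refine Finset.sum_congr rfl fun i _ => ?_
    rw [poleOut_neg_conj, map_mul]
    ring

/-- On the line Y = Q L(-r) satisfies Y Yᴴ = N'(-s)ᴴ N'(-s), so K'(-s)ᴴ Y is unitary. Therefore
K'(-s)ᴴ Q, which is this unitary matrix times L(r), factors L(r)ᴴ L(r). The map w ↦ -conj w
preserves the upper half plane, so the product is holomorphic there, and det Q = 1 does the same for
the inverse. -/
theorem LeftFactor.isFactor_of_reflected (h : LeftFactor ρ z C S E d) (hv : DualVectors z C S E d v)
    (hz : ∀ i, 0 < (z i).im) (hinj : Function.Injective z) (hC : ∀ i ∉ S, C i = 0) {N' K' : ℂ → Mat3}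
    {ℓ' : Mat3}
    (hF : IsFactor (effReflection (leftReflection ρ z S E d) (fun i => -conj (z i))
      (fun i k => conj (v i k)) (-x)) N' K' ℓ') :
    ∃ N K ℓ, IsFactor (effReflection ρ z C x) N K ℓ ∧
      (∀ k, ℓ k.succ 0 = conj (ℓ' 0 k.succ) - ∑ i, C i k * exp (2 * I * z i * x)) ∧
      ∀ k, ℓ 0 k.succ = conj (ℓ' k.succ 0) + ∑ i, v i k * exp (2 * I * z i * (-x : ℝ)) := by
  obtain ⟨g, lg, hg, hgeq⟩ := hv.exists_corner h hz hinj hC x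
  obtain ⟨e, he⟩ := h.nice
  set Q : ℂ → Mat3 := fun w => blockMat (g w) (rowPole z v E (-x) w) (colPole z C E x w) (E w) with hQ
  have hQn := UpperNice.exists_blockMat hg (hv.upperNice_rowPole h hz (-x)) (h.upperNice_colPole hz hC x) he
  obtain ⟨q', hadj⟩ := UpperNice.adjugate_three hQn
  have hrow : ∀ {w : ℂ}, w ∉ Set.range z → rowPole z v E (-x) w =
      fun k => sumPole z v (-x) w 0 * E w 0 k + sumPole z v (-x) w 1 * E w 1 k :=
    fun hw => funext fun k => hv.rowPole_eq hw k
  have hdet : ∀ w : ℂ, 0 ≤ w.im → (Q w).det = 1 := by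
    have hcont : ContinuousOn Q {w | 0 ≤ w.im} :=
      continuousOn_pi.2 fun j => continuousOn_pi.2 fun k => (hQn j k).cont
    intro w hw
    refine eq_of_eq_off_range (f := fun w => (Q w).det)
      (continuous_id.matrix_det.comp_continuousOn hcont) hz (fun w hw hwr => ?_) hw
    have hβ : ∏ i ∈ S, blaschke (z i) w ≠ 0 :=
      Finset.prod_ne_zero_iff.2 fun i _ => blaschke_ne_zero (hz i) hw fun h => hwr ⟨i, h.symm⟩
    simp only [hQ]
    rw [hrow hwr, det_blockMat, hgeq w hw hwr, sub_add_cancel, h.det_eq w hw]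
    exact inv_mul_cancel₀ (mul_ne_zero (h.det_ne w hw) hβ)
  have hconj1 : ∀ j k : Fin 3, conj ((1 : Mat3) k j) = (1 : Mat3) j k := fun j k => by
    simp only [Matrix.one_apply, eq_comm (a := k)]
    split_ifs <;> simp
  have hrefl : ∀ {A : ℂ → Mat3} {a : Mat3}, (∀ j k, UpperNice (fun w => A w j k) ((1 : Mat3) j k) (a j k)) →
      ∀ j k, UpperNice (fun w => (A (-conj w))ᴴ j k) ((1 : Mat3) j k) ((-aᴴ) j k) := by
    intro A a hA j k
    have := (hA k j).reflect
    rw [hconj1] at this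
    exact this
  have hNn := UpperNice.matrix_mul (hrefl (a := -ℓ') hF.nice_inv) hQn
  have hKn := UpperNice.matrix_mul hadj (hrefl hF.nice)
  have hmul : ∀ w : ℂ, 0 ≤ w.im →
      ((K' (-conj w))ᴴ * Q w) * ((Q w).adjugate * (N' (-conj w))ᴴ) = 1 := by
    intro w hw
    rw [Matrix.mul_assoc, ← Matrix.mul_assoc (Q w), Matrix.mul_adjugate, hdet w hw, one_smul,
      Matrix.one_mul, ← Matrix.conjTranspose_mul, hF.mul_inv _ (by simpa using hw),
      Matrix.conjTranspose_one]
  refine ⟨fun w => (K' (-conj w))ᴴ * Q w, fun w => (Q w).adjugate * (N' (-conj w))ᴴ, _,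
    ⟨hNn, fun j k => ?_, hmul, fun s => ?_⟩, fun k => ?_, fun k => ?_⟩
  · rw [← UpperNice.eq_neg_of_mul_eq_one hNn hKn hmul j k]
    exact hKn j k
  · have hs : (s : ℂ) ∉ Set.range z := by
      rintro ⟨i, hi⟩
      have := hz i
      rw [hi] at this
      simp at this
    have hs0 : 0 ≤ (s : ℂ).im := by simp
    set r : Fin 2 → ℂ := fun k => effReflection ρ z C x k s with hr
    set b : ℂ := ∏ i ∈ S, blaschke (z i) s with hb
    set τ : Fin 2 → ℂ := sumPole z v (-x) s with hτ
    set ε : ℂ := exp (2 * I * s * x) with hε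
    set u : Fin 2 → ℂ := fun k => E s k 0 * (ρ 0 s * ε) + E s k 1 * (ρ 1 s * ε) with hu
    have hbb : b * conj b = 1 := by
      rw [hb, map_prod, ← Finset.prod_mul_distrib]
      exact Finset.prod_eq_one fun i _ => blaschke_mul_conj (hz i) s
    have hεε : ε * conj ε = 1 := by
      rw [hε, ← exp_conj, ← exp_add, ← exp_zero]
      congr 1
      simp [conj_ofNat]
    have hd0 := h.det_ne s hs0
    have hbinv : b⁻¹ = conj b := inv_eq_of_mul_eq_one_right hbb
    have hrdef : ∀ k, r k = ρ k s * ε - sumPole z C x s k := fun k => rfl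
    have hY : Q s * lowMat (-r) = blockMat ((d s)⁻¹ * conj b - (τ 0 * u 0 + τ 1 * u 1))
        (fun k => τ 0 * E s 0 k + τ 1 * E s 1 k) u (E s) := by
      simp only [hQ]
      rw [blockMat_mul_lowMat, hrow hs, hgeq s hs0 hs]
      have e1 : (fun k => colPole z C E x s k - (E s k 0 * (-r) 0 + E s k 1 * (-r) 1)) = u := by
        ext k
        rw [h.colPole_eq hC hs, Pi.neg_apply, Pi.neg_apply, hrdef, hrdef]
        simp only [hu]
        ring
      rw [e1]
      congr 1
      rw [h.colPole_eq hC hs, h.colPole_eq hC hs, Pi.neg_apply, Pi.neg_apply, hrdef, hrdef, mul_inv, hbinv]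
      simp only [hu]
      ring
    have hYY : (Q s * lowMat (-r)) * (Q s * lowMat (-r))ᴴ =
        (N' ((-s : ℝ) : ℂ))ᴴ * N' ((-s : ℝ) : ℂ) := by
      rw [hF.jump (-s), hY, blockMat_hermitian hbb (mul_inv_cancel₀ hd0)
        (h.det_eq s hs0) (h.unit_apply s hεε)]
      simp only [effReflection_leftReflection]
      rfl
    have hcs : -conj (s : ℂ) = ((-s : ℝ) : ℂ) := by simp
    set Y := Q s * lowMat (-r) with hYdef
    have hQY : Q s = Y * lowMat r := by
      rw [hYdef, Matrix.mul_assoc, lowMat_mul_lowMat, neg_add_cancel, lowMat_zero, Matrix.mul_one]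
    have hNK := hF.mul_inv ((-s : ℝ) : ℂ) (by simp)
    have hXX : ((K' ((-s : ℝ) : ℂ))ᴴ * Y)ᴴ * ((K' ((-s : ℝ) : ℂ))ᴴ * Y) = 1 := by
      refine mul_eq_one_comm.1 ?_
      rw [Matrix.conjTranspose_mul, Matrix.conjTranspose_conjTranspose, Matrix.mul_assoc,
        ← Matrix.mul_assoc Y, hYY, Matrix.mul_assoc, hNK, Matrix.mul_one, ← Matrix.conjTranspose_mul, hNK,
        Matrix.conjTranspose_one]
    rw [hcs, hQY, ← Matrix.mul_assoc (K' ((-s : ℝ) : ℂ))ᴴ Y (lowMat r), Matrix.conjTranspose_mul, Matrix.mul_assoc,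
      ← Matrix.mul_assoc _ _ (lowMat r), hXX, Matrix.one_mul]
  · rw [blockMat_succ_zero]
    simp [sub_eq_add_neg]
  · rw [blockMat_zero_succ]
    simp

end

/-! ### Nonpositive x and gluing at the origin -/

section

open scoped Matrix

variable {n : ℕ} {z : Fin n → ℂ}

/-- At x ≤ 0 the reflected problem sits at -x ≥ 0, where its exponentials decay, so the result for
nonnegative parameters applies to it. -/
theorem exists_factor_of_nonpos {ρ : Fin 2 → ℝ → ℂ} (hρ : ∀ k, MemH11 (ρ k)) (hz : ∀ i, 0 < (z i).im)
    (hinj : Function.Injective z) (C : Fin n → Fin 2 → ℂ) :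
    ∃ p : Fin 2 → ℝ → ℂ, (∀ k, MemH11 (p k)) ∧ ∀ x : ℝ, x ≤ 0 →
      ∃ N K ℓ, IsFactor (effReflection ρ z C x) N K ℓ ∧
        (∀ k, ℓ k.succ 0 + ∑ i, C i k * exp (2 * I * z i * x) = p k x) ∧
        ∀ k, -conj (ℓ 0 k.succ) = p k x := by
  classical
  -- Poles with vanishing constants are left out: the kernel construction needs a nonzero vector at
  -- each point.
  set S : Finset (Fin n) := Finset.univ.filter fun i => C i ≠ 0 with hS
  have hC1 : ∀ i ∈ S, C i ≠ 0 := fun i hi => (Finset.mem_filter.1 hi).2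
  have hC0 : ∀ i ∉ S, C i = 0 := fun i hi => by simpa [hS] using hi
  obtain ⟨E, d, h⟩ := exists_leftFactor hρ hz hinj S hC1
  obtain ⟨v, hv⟩ := h.exists_dualVectors hz hinj hC1
  obtain ⟨p, hp, hfac⟩ := exists_factor_of_nonneg (fun k => h.memH11_leftReflection hρ hz k)
    (z := fun i => -conj (z i)) (fun i => by simpa using hz i) (fun i k => conj (v i k))
  refine ⟨fun k x => -1 * p k (-x), fun k => (hp k).comp_neg.const_mul (-1), fun x hx => ?_⟩
  obtain ⟨N', K', ℓ', hF, h1, h2⟩ := hfac (-x) (by linarith)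
  obtain ⟨N, K, ℓ, hN, h3, h4⟩ := h.isFactor_of_reflected hv hz hinj hC0 hF
  refine ⟨N, K, ℓ, hN, fun k => ?_, fun k => ?_⟩
  · change _ = -1 * p k (-x)
    rw [h3, sub_add_cancel, ← h2]
    ring
  · have e : ∀ i, conj (exp (2 * I * z i * (-x : ℝ))) = exp (2 * I * -conj (z i) * (-x : ℝ)) := fun i => by
      rw [← exp_conj]
      congr 1
      simp [conj_ofNat]
    change _ = -1 * p k (-x)
    rw [h4, map_add, Complex.conj_conj, map_sum, ← h1]
    simp only [map_mul, e]
    ring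

lemma eventually_notMem_contour (z : Fin n → ℂ) (r : Fin n → ℝ) {c : ℝ} (hc : 0 < c) :
    ∀ᶠ s in coneAtInfty c, s ∈ (contour z r)ᶜ := by
  have h1 : ∀ᶠ s : ℂ in cobounded ℂ, ∀ i, s ∉ Metric.sphere (z i) (r i) ∧
      s ∉ Metric.sphere (conj (z i)) (r i) := eventually_all.2 fun i => by
    filter_upwards [isBounded_def.1 (Metric.isBounded_sphere (x := z i) (r := r i)),
      isBounded_def.1 (Metric.isBounded_sphere (x := conj (z i)) (r := r i))] with s h1 h2 using ⟨h1, h2⟩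
  rw [coneAtInfty, eventually_inf_principal]
  filter_upwards [h1, eventually_ne_cobounded (0 : ℂ)] with s hs h0 hcone hmem
  have hcone : c * |s.re| ≤ |s.im| := hcone
  rcases hmem with hm | hm
  · have hm : s.im = 0 := hm
    rw [hm, abs_zero] at hcone
    have h4 : |s.re| ≤ 0 := by nlinarith [abs_nonneg s.re]
    exact h0 (Complex.ext (by simpa using h4) hm)
  · obtain ⟨i, hm | hm⟩ := Set.mem_iUnion.1 hm
    · exact (hs i).1 hm
    · exact (hs i).2 hm

/-- Needed for uniqueness of the limits in the double cone. -/
lemma coneAtInfty_neBot (c : ℝ) : (coneAtInfty c).NeBot := by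
  have := upperCone_neBot c
  exact this.mono (inf_le_inf_left _ (principal_mono.2 fun s (hs : c * |s.re| ≤ s.im) =>
    hs.trans (le_abs_self _)))

lemma Reconstructs.congr {M M' : ℂ → Mat3} {p q : ℂ} {r : Fin n → ℝ} (h : Reconstructs M p q)
    (he : ∀ s ∈ (contour z r)ᶜ, M s = M' s) : Reconstructs M' p q := fun c hc => by
  have e := eventually_notMem_contour z r hc
  exact ⟨(h c hc).1.congr' (e.mono fun s hs => by rw [he s hs]),
    (h c hc).2.congr' (e.mono fun s hs => by rw [he s hs])⟩

lemma Reconstructs.unique {M : ℂ → Mat3} {p q p' q' : ℂ} (h : Reconstructs M p q)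
    (h' : Reconstructs M p' q') : p = p' ∧ q = q' :=
  have := coneAtInfty_neBot 1
  ⟨tendsto_nhds_unique (h 1 one_pos).1 (h' 1 one_pos).1, tendsto_nhds_unique (h 1 one_pos).2 (h' 1 one_pos).2⟩

theorem exists_potential {ρ : Fin 2 → ℝ → ℂ} (hρ : ∀ k, MemH11 (ρ k)) (hz : ∀ i, 0 < (z i).im)
    (hinj : Function.Injective z) (C : Fin n → Fin 2 → ℂ) {r : Fin n → ℝ} (hr : AdmissibleRadii z r) :
    ∃ p : Fin 2 → ℝ → ℂ, (∀ k, MemH11 (p k)) ∧ ∀ x : ℝ, ∃ M,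
      IsRHSolution (ρ 0) (ρ 1) z (fun i => (C i 0, C i 1)) r x M ∧ Reconstructs M (p 0 x) (p 1 x) := by
  obtain ⟨p, hp, hpf⟩ := exists_factor_of_nonneg hρ hz C
  obtain ⟨q, hq, hqf⟩ := exists_factor_of_nonpos hρ hz hinj C
  have hpM : ∀ x : ℝ, 0 ≤ x → ∃ M, IsRHSolution (ρ 0) (ρ 1) z (fun i => (C i 0, C i 1)) r x M ∧
      Reconstructs M (-2 * I * p 0 x) (-2 * I * p 1 x) := fun x hx => by
    obtain ⟨N, K, ℓ, h, h1, h2⟩ := hpf x hx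
    exact h.exists_solution hr h1 h2
  have hqM : ∀ x : ℝ, x ≤ 0 → ∃ M, IsRHSolution (ρ 0) (ρ 1) z (fun i => (C i 0, C i 1)) r x M ∧
      Reconstructs M (-2 * I * q 0 x) (-2 * I * q 1 x) := fun x hx => by
    obtain ⟨N, K, ℓ, h, h1, h2⟩ := hqf x hx
    exact h.exists_solution hr h1 h2
  -- At x = 0 both constructions solve the same problem, so uniqueness identifies their potentials
  -- there. Without this agreement the glued function could jump and have no L² derivative.
  have h0 : ∀ k, -2 * I * p k 0 = -2 * I * q k 0 := by
    obtain ⟨M, hM, hMr⟩ := hpM 0 le_rfl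
    obtain ⟨M', hM', hMr'⟩ := hqM 0 le_rfl
    have := (hMr.congr fun s hs => IsRHSolution.unique hr.1 hM hM' hs).unique hMr'
    exact Fin.forall_fin_two.2 this
  refine ⟨fun k x => if 0 ≤ x then -2 * I * p k x else -2 * I * q k x, fun k => ?_, fun x => ?_⟩
  · refine ((hp k).const_mul (-2 * I)).glue ((hq k).const_mul (-2 * I)) (fun t ht => if_pos ht)
      fun t ht => ?_
    rcases ht.eq_or_lt with rfl | ht
    · exact (if_pos le_rfl).trans (h0 k)
    · exact if_neg ht.not_ge
  · by_cases hx : 0 ≤ x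
    · simp only [if_pos hx]
      exact hpM x hx
    · simp only [if_neg hx]
      exact hqM x (not_le.1 hx).le

end

end AKNS

end

theorem proposition4p4 (n : ℕ) (ρ₁ ρ₂ : ℝ → ℂ) (z : Fin n → ℂ) (C : Fin n → ℂ × ℂ)
    (r : Fin n → ℝ) (hρ₁ : AKNS.MemH11 ρ₁) (hρ₂ : AKNS.MemH11 ρ₂)
    (hz : ∀ i, 0 < (z i).im) (hz_inj : Function.Injective z)
    (hr : AKNS.AdmissibleRadii z r) :
    ∃ u v : ℝ → ℂ,
      (∀ x : ℝ, (∃ M : ℂ → AKNS.Mat3, AKNS.IsRHSolution ρ₁ ρ₂ z C r x M) ∧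
        ∀ M : ℂ → AKNS.Mat3, AKNS.IsRHSolution ρ₁ ρ₂ z C r x M →
          AKNS.Reconstructs M (u x) (v x)) ∧
      AKNS.MemH11 u ∧ AKNS.MemH11 v := by
  obtain ⟨p, hp, hM⟩ := AKNS.exists_potential (ρ := ![ρ₁, ρ₂])
    (Fin.forall_fin_two.2 ⟨hρ₁, hρ₂⟩) hz hz_inj (fun i => ![(C i).1, (C i).2]) hr
  refine ⟨p 0, p 1, fun x => ?_, hp 0, hp 1⟩
  obtain ⟨M, hMs, hMr⟩ := hM x
  refine ⟨⟨M, hMs⟩, fun M' hM' => ?_⟩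
  exact hMr.congr fun s hs => AKNS.IsRHSolution.unique hr.1 hMs hM' hs
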